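/- **Setting.** For each $r\in\mathbb N$, $r\ge 1$, consider a network with $I$ resources and $J$ job types and an incidence matrix $K\in\{0,1\}^{I\times J}$ that does not depend on $r$. On a probability space $(\Omega,\mathcal F,P)$ let $\{u^r_j(l)\}_{l\ge1}$ (interarrival times) and $\{v^r_j(l)\}_{l\ge1}$ (job sizes), $1\le j\le J$, be mutually independent i.i.d. sequences of a.s. positive random variables with means $1/\alpha^r_j$, $1/\beta^r_j$ and standard deviations $\sigma^{u,r}_j,\sigma^{v,r}_j$. Products and quotients of vectors in $\mathbb R^J$ are componentwise; $|\cdot|$ is the Euclidean norm. Assume: 1. There is $\delta_0>0$ with $\sup_{r\ge1}E[e^{yv^r_j(1)}]<\infty$ and $\sup_{r\ge1}E[e^{yu^r_j(1)}]<\infty$ for all $y<\delta_0$ and all $j$. 2. There are $\alpha_j,\beta_j,\bar\alpha_j,\bar\beta_j,\sigma^u_j,\sigma^v_j\in(0,\infty)$ with $r(\alpha^r_j-\alpha_j)\to\bar\alpha_j$, $r(\beta^r_j-\beta_j)\to\bar\beta_j$, $\sigma^{u,r}_j\to\sigma^u_j$, $\sigma^{v,r}_j\to\sigma^v_j$ as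 $r\to\infty$. With $\rho=\alpha/\beta$ and $\eta=\beta^{-2}(\bar\alpha\beta-\alpha\bar\beta)$, the capacity vector is $C=K\rho$, and $(K\eta)_i<0$ for every $i$. 3. For every $i$ there is $j$ with $K_{i,j}=1$ and $K_{l,j}=0$ for all $l\ne i$. **Policy parameters.** Let $h\in\mathbb R^J$, $h>0$, $0<c_1<c_2$, $0<\kappa<\frac14$, $\tilde c_k=c_k\min_j\beta_j$, $\rho^*=\min_j\rho_j$, and $\mathcal C^h_K=\{w\in\ker K:(h\beta)\cdot w=0\}$. If $\dim\mathcal C_K^h=\dim\ker K-1$, let $u_*$ be the unit vector in $\ker K$ that is orthogonal to $\mathcal C^h_K$ and satisfies $(h\beta)\cdot u_*<0$, and let $\mathcal M$ be the set of $z\in\{0,1\}^J$ for which there is $w\in\ker K$ with $w_j\ge0$ whenever $z_j=1$ and $w\cdot u_*>0$. Otherwise $\mathcal C^h_K=\ker K$ and $\mathcal M=\emptyset$. For $z\in\mathcal M$ fix $v^c(z)\in\ker K$ with $v^c_j(z)\ge0$ whenever $z_j=1$, $v^c(z)\cdot u_*>0$, and $\rho_j-v^c_j(z)>\rho^*/2$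 for all $j$. For $z\in\{0,1\}^J$ fix $v^b(z)\in\mathbb R^J$ such that $|v^b_j(z)|\le\rho^*/4$ for all $j$; if $\mathcal M\neq\emptyset$, also $|v^b_j(z)|\le|\tilde\lambda|/(4|\beta||h|)$ for all $j$, where $\tilde\lambda=\max_{z'\in\mathcal M}(h\beta)\cdot v^c(z')$; $(Kv^b(z))_i=0$ for every $i$ for which there is $j$ with $K_{i,j}=1$ and $z_j=0$; and $v^b_j(z)>0$ whenever $z_j=1$. **Processes.** Fix $r$ and an initial state consisting of $q^r\in\mathbb N_0^J$, $\Upsilon^r=(\Upsilon^{A,r},\Upsilon^{S,r})\in\mathbb R_+^{2J}$ and $\tilde{\mathcal E}^r\in\{0,1\}^J$. Put $A^r_j(s)=\max\{n\ge0:\sum_{l=1}^nu^r_j(l)\le s\}$ and $S^r_j(s)=\max\{n\ge0:\sum_{l=1}^nv^r_j(l)\le s\}$. A cumulative allocation process $B^r$ generates the queue lengths $$Q^r_j(t)=q^r_j+A^r_j\big((t-\Upsilon^{A,r}_j)^+\big)+1_{\{t\ge\Upsilon^{A,r}_j>0\}}-S^r_j\big((B^r_j(t)-\Upsilon^{S,r}_j)^+\big)-1_{\{B^r_j(t)\ge\Upsilon^{S,r}_j>0\}}.$$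 Let $\tilde\tau^j_1=\inf\{t\ge0:Q^r_j(t)<\tilde c_1r^\kappa\}$ if $\tilde{\mathcal E}^r_j=0$ and $\tilde\tau^j_1=0$ if $\tilde{\mathcal E}^r_j=1$; for $l\ge1$ let $\tilde\tau^j_{2l}=\inf\{t\ge\tilde\tau^j_{2l-1}:Q^r_j(t)\ge\tilde c_2r^\kappa\}$ and $\tilde\tau^j_{2l+1}=\inf\{t\ge\tilde\tau^j_{2l}:Q^r_j(t)<\tilde c_1r^\kappa\}$. Let $\mathcal E^r_j(t)=1$ if $t\in\bigcup_{l\ge1}[\tilde\tau^j_{2l-1},\tilde\tau^j_{2l})$ and $\mathcal E^r_j(t)=0$ otherwise, and let $\mathcal Z^r_j(t)=1_{\{Q^r_j(t)<\tilde c_2r^\kappa\}}$. The policy is given by the measurable process $B^r$ that satisfies, a.s. for all $t\ge0$ and $j$, $$B^r_j(t)=\int_0^t1_{\{\mathcal E^r_j(s)=0\}}\Big(\rho_j-1_{\{\mathcal Z^r(s)\in\mathcal M\}}v^c_j(\mathcal Z^r(s))-v^b_j(\mathcal Z^r(s))\Big)\,ds .$$ Put $\hat W^r_i(t)=\frac1r\sum_{j}K_{i,j}Q^r_j(r^2t)/\beta^r_j$,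 $\hat q^r=q^r/r$ and $\hat\Upsilon^r=\Upsilon^r/r$. **Proposition 3.4.** There exist constants $\tilde R,\tilde B_1,\tilde B_2,\tilde B_3,\tilde\delta,\delta>0$ such that for all $r\ge\tilde R$ and all initial states $y^r=(\hat q^r,\hat\Upsilon^r,\tilde{\mathcal E}^r)\in(\frac1r\mathbb N_0)^J\times\mathbb R_+^{2J}\times\{0,1\}^J$ a process $B^r$ as above exists, and for every such $B^r$, all $c\in(0,\delta]$ and all $t\ge0$, $$E_{y^r}\big[e^{c|\hat W^r(t)|}\big]\le\tilde B_1e^{-\tilde\delta t+\tilde B_2(|\hat q^r|+|\hat\Upsilon^r|)}+\tilde B_3 .$$ -/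

import Mathlib

open MeasureTheory ProbabilityTheory Filter Topology
open scoped ENNReal NNReal Matrix

noncomputable section

namespace RSN

/-- Euclidean norm of a finite real vector. -/
def norm2 {ι : Type*} [Fintype ι] (x : ι → ℝ) : ℝ := Real.sqrt (∑ i, x i ^ 2)

/-- Data of a sequence (indexed by `r`) of resource sharing networks with `I` resources and `J` job
types: the incidence matrix `K`, the interarrival times `u r j l` and the job sizes `v r j l` (the
index `l = 0, 1, 2, …` stands for the first, second, third, … job), the capacities `C`, and the
limiting parameters of the heavy traffic regime. -/
structure Network (I J : ℕ) (Ω : Type*) where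
  K : Matrix (Fin I) (Fin J) ℝ
  u : ℕ → Fin J → ℕ → Ω → ℝ
  v : ℕ → Fin J → ℕ → Ω → ℝ
  C : Fin I → ℝ
  α : Fin J → ℝ
  β : Fin J → ℝ
  αbar : Fin J → ℝ
  βbar : Fin J → ℝ
  σu : Fin J → ℝ
  σv : Fin J → ℝ

namespace Network

variable {I J : ℕ} {Ω : Type*} [MeasurableSpace Ω]

/-- Arrival rate `α^r_j = 1 / E[u^r_j(1)]`. -/
def rateA (N : Network I J Ω) (P : Measure Ω) (r : ℕ) (j : Fin J) : ℝ := (∫ ω, N.u r j 0 ω ∂P)⁻¹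

/-- Service rate `β^r_j = 1 / E[v^r_j(1)]`. -/
def rateS (N : Network I J Ω) (P : Measure Ω) (r : ℕ) (j : Fin J) : ℝ := (∫ ω, N.v r j 0 ω ∂P)⁻¹

/-- `ρ = α / β`. -/
def ρ (N : Network I J Ω) (j : Fin J) : ℝ := N.α j / N.β j

/-- `ρ^* = min_j ρ_j`. -/
def ρmin (N : Network I J Ω) : ℝ := ⨅ j, N.ρ j

/-- `η = (ᾱ β - α β̄) / β²`, componentwise. -/
def η (N : Network I J Ω) (j : Fin J) : ℝ :=
  (N.αbar j * N.β j - N.α j * N.βbar j) / N.β j ^ 2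

/-- The primitives: `K` has entries `0` and `1`; for every `r ≥ 1` the interarrival times and job
sizes are a.s. positive random variables, identically distributed within each of the `2J`
sequences, and all of them are mutually independent. -/
structure IsPrimitive (N : Network I J Ω) (P : Measure Ω) : Prop where
  K_zero_one : ∀ i j, N.K i j = 0 ∨ N.K i j = 1
  measurable_u : ∀ r j l, 0 < r → Measurable (N.u r j l)
  measurable_v : ∀ r j l, 0 < r → Measurable (N.v r j l)
  pos_u : ∀ r j l, 0 < r → ∀ᵐ ω ∂P, 0 < N.u r j l ω
  pos_v : ∀ r j l, 0 < r → ∀ᵐ ω ∂P, 0 < N.v r j l ω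
  ident_u : ∀ r j l, 0 < r → IdentDistrib (N.u r j l) (N.u r j 0) P P
  ident_v : ∀ r j l, 0 < r → IdentDistrib (N.v r j l) (N.v r j 0) P P
  indep : ∀ r, 0 < r →
    iIndepFun (fun k : (Fin J × ℕ) ⊕ (Fin J × ℕ) =>
      Sum.elim (fun p => N.u r p.1 p.2) (fun p => N.v r p.1 p.2) k) P

/-- Moment generating functions near the origin, uniformly in `r ≥ 1`. -/
def ExpMoments (N : Network I J Ω) (P : Measure Ω) : Prop :=
  ∃ δ : ℝ, 0 < δ ∧ ∀ y : ℝ, y < δ → ∀ j,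
    (⨆ r : ℕ, ⨆ _ : 0 < r, ∫⁻ ω, ENNReal.ofReal (Real.exp (y * N.v r j 0 ω)) ∂P) < ∞ ∧
    (⨆ r : ℕ, ⨆ _ : 0 < r, ∫⁻ ω, ENNReal.ofReal (Real.exp (y * N.u r j 0 ω)) ∂P) < ∞

/-- The heavy traffic condition. -/
structure HeavyTraffic (N : Network I J Ω) (P : Measure Ω) : Prop where
  α_pos : ∀ j, 0 < N.α j
  β_pos : ∀ j, 0 < N.β j
  αbar_pos : ∀ j, 0 < N.αbar j
  βbar_pos : ∀ j, 0 < N.βbar j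
  σu_pos : ∀ j, 0 < N.σu j
  σv_pos : ∀ j, 0 < N.σv j
  lim_rateA : ∀ j, Tendsto (fun r : ℕ => (r : ℝ) * (N.rateA P r j - N.α j)) atTop (𝓝 (N.αbar j))
  lim_rateS : ∀ j, Tendsto (fun r : ℕ => (r : ℝ) * (N.rateS P r j - N.β j)) atTop (𝓝 (N.βbar j))
  lim_σu : ∀ j, Tendsto (fun r : ℕ => Real.sqrt (Var[N.u r j 0; P])) atTop (𝓝 (N.σu j))
  lim_σv : ∀ j, Tendsto (fun r : ℕ => Real.sqrt (Var[N.v r j 0; P])) atTop (𝓝 (N.σv j))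
  capacity : N.C = N.K *ᵥ N.ρ
  drift_neg : ∀ i, (N.K *ᵥ N.η) i < 0

/-- Every resource has a job type that requires this resource only. -/
def LocalTraffic (N : Network I J Ω) : Prop :=
  ∀ i, ∃ j, N.K i j = 1 ∧ ∀ l, l ≠ i → N.K l j = 0

end Network

/-! ### The threshold policy -/

/-- Parameters of the policy. A vector in `χ_J = {0,1}^J` is encoded as a function
`Fin J → Bool`, with `true` for the entry `1`. -/
structure Policy (J : ℕ) where
  h : Fin J → ℝ
  c₁ : ℝ
  c₂ : ℝ
  κ : ℝ
  uStar : Fin J → ℝ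
  vc : (Fin J → Bool) → Fin J → ℝ
  vb : (Fin J → Bool) → Fin J → ℝ

namespace Policy

variable {I J : ℕ} {Ω : Type*}

/-- `ker K`. -/
def kerK (N : Network I J Ω) : Submodule ℝ (Fin J → ℝ) := LinearMap.ker N.K.mulVecLin

/-- The vector `h β` (componentwise product). -/
def hβ (p : Policy J) (N : Network I J Ω) : Fin J → ℝ := fun j => p.h j * N.β j

/-- `C_K^h`: the vectors `w ∈ ker K` with `(h β) · w = 0`. -/
def costKer (p : Policy J) (N : Network I J Ω) : Submodule ℝ (Fin J → ℝ) where
  carrier := {w | N.K *ᵥ w = 0 ∧ p.hβ N ⬝ᵥ w = 0}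
  zero_mem' := by simp
  add_mem' := by
    rintro a b ⟨ha, ha'⟩ ⟨hb, hb'⟩
    simp [Matrix.mulVec_add, dotProduct_add, ha, ha', hb, hb']
  smul_mem' := by
    rintro c a ⟨ha, ha'⟩
    simp [Matrix.mulVec_smul, dotProduct_smul, ha, ha']

/-- The case `dim C_K^h = dim ker K - 1`; the other case is `C_K^h = ker K`. -/
def Nontriv (p : Policy J) (N : Network I J Ω) : Prop :=
  Module.finrank ℝ (p.costKer N) + 1 = Module.finrank ℝ (kerK N)

/-- `A_z`: the resources used by at least one job type `j` with `z_j = 0`. -/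
def activeRes (N : Network I J Ω) (z : Fin J → Bool) : Set (Fin I) :=
  {i | ∃ j, N.K i j = 1 ∧ z j = false}

/-- The set `ℳ ⊆ χ_J`; it is empty when `C_K^h = ker K`. -/
def modes (p : Policy J) (N : Network I J Ω) : Set (Fin J → Bool) :=
  {z | p.Nontriv N ∧ ∃ w ∈ kerK N, (∀ j, z j = true → 0 ≤ w j) ∧ 0 < w ⬝ᵥ p.uStar}

/-- `λ̃ = max {λ_c(z) : z ∈ ℳ}` with `λ_c(z) = (h β) · v^c(z)`. -/
def lamTilde (p : Policy J) (N : Network I J Ω) : ℝ :=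
  sSup ((fun z => p.hβ N ⬝ᵥ p.vc z) '' p.modes N)

/-- The requirements on the policy parameters. The vector `uStar` is the last vector `u_{J-I}` of
the orthonormal basis of `ker K` whose other vectors span `C_K^h`; it plays no role when
`C_K^h = ker K`. In that case `ℳ` is empty and the bound on `v^b` that involves `λ̃` is void. -/
structure IsValid (p : Policy J) (N : Network I J Ω) : Prop where
  h_pos : ∀ j, 0 < p.h j
  c₁_pos : 0 < p.c₁
  c₁_lt_c₂ : p.c₁ < p.c₂
  κ_pos : 0 < p.κ
  κ_lt : p.κ < 1 / 4
  uStar_mem : p.Nontriv N → p.uStar ∈ kerK N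
  uStar_unit : p.Nontriv N → p.uStar ⬝ᵥ p.uStar = 1
  uStar_orth : p.Nontriv N → ∀ w ∈ p.costKer N, w ⬝ᵥ p.uStar = 0
  uStar_cost : p.Nontriv N → p.hβ N ⬝ᵥ p.uStar < 0
  vc_mem : ∀ z ∈ p.modes N, p.vc z ∈ kerK N
  vc_nonneg : ∀ z ∈ p.modes N, ∀ j, z j = true → 0 ≤ p.vc z j
  vc_uStar : ∀ z ∈ p.modes N, 0 < p.vc z ⬝ᵥ p.uStar
  vc_bound : ∀ z ∈ p.modes N, ∀ j, N.ρmin / 2 < N.ρ j - p.vc z j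
  vb_bound : ∀ z j, |p.vb z j| ≤ N.ρmin / 4
  vb_bound' : p.Nontriv N → ∀ z j,
    |p.vb z j| ≤ |p.lamTilde N| / (4 * norm2 N.β * norm2 p.h)
  vb_active : ∀ z, ∀ i ∈ activeRes N z, (N.K *ᵥ p.vb z) i = 0
  vb_pos : ∀ z j, z j = true → 0 < p.vb z j

/-- Lower threshold `c̃₁ r^κ`, `c̃₁ = c₁ min_j β_j`. -/
def lower (p : Policy J) (N : Network I J Ω) (r : ℕ) : ℝ := (⨅ j, N.β j) * p.c₁ * (r : ℝ) ^ p.κ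

/-- Upper threshold `c̃₂ r^κ`, `c̃₂ = c₂ min_j β_j`. -/
def upper (p : Policy J) (N : Network I J Ω) (r : ℕ) : ℝ := (⨅ j, N.β j) * p.c₂ * (r : ℝ) ^ p.κ

end Policy

/-! ### State processes -/

/-- Initial state (unscaled): queue lengths, residual arrival times, residual service times, and
the initial value of the indicators `ℰ_j`. For `r ≥ 1`, dividing the first three by `r` identifies
these states with the elements `(q̂, Υ̂, ℰ̃)` of `𝒴^r = (ℕ₀/r)^J × ℝ₊^{2J} × χ_J`. -/
structure InitState (J : ℕ) where
  q : Fin J → ℕ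
  ΥA : Fin J → ℝ≥0
  ΥS : Fin J → ℝ≥0
  flag : Fin J → Bool

/-- `max {n ≥ 0 : x(1) + ⋯ + x(n) ≤ s}`, the sequence being indexed from `0` here. -/
def renewalCount (x : ℕ → ℝ) (s : ℝ) : ℕ := sSup {n : ℕ | ∑ l ∈ Finset.range n, x l ≤ s}

/-- Number of renewals by time `s` when the sequence `x` starts after the residual time `Υ`, and a
positive `Υ` yields a renewal of its own at time `Υ`. -/
def delayedCount (x : ℕ → ℝ) (Υ : ℝ) (s : ℝ) : ℝ :=
  (renewalCount x (max (s - Υ) 0) : ℝ) + Set.indicator {s' : ℝ | Υ ≤ s' ∧ 0 < Υ} 1 s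

/-- The queue length `Q_j(t)` in terms of the cumulative allocation `b = B_j(t)`. -/
def queue {J : ℕ} (y : InitState J) (u v : Fin J → ℕ → ℝ) (t : ℝ) (b : Fin J → ℝ)
    (j : Fin J) : ℝ :=
  y.q j + delayedCount (u j) (y.ΥA j) t - delayedCount (v j) (y.ΥS j) (b j)

/-- `inf {t ≥ 0 : t ≥ s, A t}`, which is `⊤` if there is no such `t`. -/
def hitAfter (s : EReal) (A : ℝ → Prop) : EReal :=
  ⨅ t ∈ {t : ℝ | 0 ≤ t ∧ s ≤ (t : EReal) ∧ A t}, (t : EReal)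

/-- The switching times of a queue length path `x` for the thresholds `a < b`: `switchTime … n` is
the stopping time `τ̃_{n+1}`, so that even `n` are entrances below `a` and odd `n` are the next
times at or above `b`. If the indicator is initially `1` then `τ̃_1 = 0`. -/
def switchTime (a b : ℝ) (flag : Bool) (x : ℝ → ℝ) : ℕ → EReal
  | 0 => if flag = true then 0 else hitAfter 0 (fun t => x t < a)
  | n + 1 =>
    if Even n then hitAfter (switchTime a b flag x n) (fun t => b ≤ x t)
    else hitAfter (switchTime a b flag x n) (fun t => x t < a)

/-- `ℰ(t) = 1`: the time `t` lies in some interval `[τ̃_{2l-1}, τ̃_{2l})`, `l ≥ 1`. -/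
def Blocked (a b : ℝ) (flag : Bool) (x : ℝ → ℝ) (t : ℝ) : Prop :=
  ∃ k : ℕ, switchTime a b flag x (2 * k) ≤ (t : EReal) ∧
    (t : EReal) < switchTime a b flag x (2 * k + 1)

namespace Policy

variable {I J : ℕ} {Ω : Type*}

open Classical in
/-- The allocation rate `𝔟_j(t)` that the policy prescribes along the queue length path `Q`. -/
def rate (p : Policy J) (N : Network I J Ω) (r : ℕ) (flag : Fin J → Bool)
    (Q : ℝ → Fin J → ℝ) (t : ℝ) (j : Fin J) : ℝ :=
  let z : Fin J → Bool := fun k => decide (Q t k < p.upper N r)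
  if Blocked (p.lower N r) (p.upper N r) (flag j) (fun s => Q s j) t then 0
  else N.ρ j - (if z ∈ p.modes N then p.vc z j else 0) - p.vb z j

/-- The queue length process of the `r`-th system from the initial state `y` under the cumulative
allocation process `B`. -/
def queueProc (N : Network I J Ω) (r : ℕ) (y : InitState J) (B : Ω → ℝ → Fin J → ℝ) (ω : Ω)
    (t : ℝ) : Fin J → ℝ :=
  queue y (fun j l => N.u r j l ω) (fun j l => N.v r j l ω) t (B ω t)

/-- `B` is the allocation process of the policy in the `r`-th system from the initial state `y`:
almost surely, `B(t) = ∫₀ᵗ 𝔟(s) ds` for all `t ≥ 0`, where `𝔟` is prescribed by the policy along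
the queue length path that `B` generates. -/
structure IsAllocation [MeasurableSpace Ω] (p : Policy J) (N : Network I J Ω) (P : Measure Ω)
    (r : ℕ) (y : InitState J) (B : Ω → ℝ → Fin J → ℝ) : Prop where
  measurable : ∀ t j, 0 ≤ t → Measurable (fun ω => B ω t j)
  integral_eq : ∀ᵐ ω ∂P, ∀ t j, 0 ≤ t →
    IntervalIntegrable (fun s => p.rate N r y.flag (queueProc N r y B ω) s j) volume 0 t ∧
    B ω t j = ∫ s in (0 : ℝ)..t, p.rate N r y.flag (queueProc N r y B ω) s j

/-- The diffusion-scaled workload `Ŵ^r(t) = K M^r Q^r(r² t) / r`, `M^r = diag(1 / β^r_j)`. -/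
def workloadHat [MeasurableSpace Ω] (N : Network I J Ω) (P : Measure Ω) (r : ℕ) (y : InitState J)
    (B : Ω → ℝ → Fin J → ℝ) (ω : Ω) (t : ℝ) : Fin I → ℝ :=
  fun i => (N.K *ᵥ fun j => queueProc N r y B ω ((r : ℝ) ^ 2 * t) j / N.rateS P r j) i / r

end Policy

namespace InitState

/-- `|q̂|`, `q̂ = q / r`. -/
def normQ {J : ℕ} (y : InitState J) (r : ℕ) : ℝ := norm2 (fun j => (y.q j : ℝ) / r)

/-- `|Υ̂|`, `Υ̂ = (Υ^A, Υ^S) / r ∈ ℝ^{2J}`. -/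
def normΥ {J : ℕ} (y : InitState J) (r : ℕ) : ℝ :=
  norm2 (Sum.elim (fun j => (y.ΥA j : ℝ) / r) (fun j => (y.ΥS j : ℝ) / r) : Fin J ⊕ Fin J → ℝ)

end InitState

end RSN

end

open MeasureTheory ProbabilityTheory Filter Topology
open scoped ENNReal NNReal Matrix

noncomputable section

namespace RSN

/-! ### The switching times and hysteresis -/

/-! Between two events (arrivals or service completions) all allocation rates are constant. With
residual interarrival and service times and blocking flags added to the state, the queues form a
piecewise deterministic Markov process. The proof reduces every allocation process pathwise to a
chain of events, and then finds a Lyapunov function for that chain.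

Pathwise reduction. `Sys.chain` computes the successive events, updating the blocking flag of a type
by `hyst` whenever its queue changes. `phaseBefore_chain` shows that these flags reproduce the
switching times of the policy, even if several events share an instant. A continuous induction
(`onPath_of_integral`) shows that every solution of the integral equation follows the chain.
Conversely, the allocation of the chain is a solution (`integral_chainAlloc`), since by the law of
large numbers the events do not accumulate (`tendsto_T`). This gives existence, and a single chain
serves for all `B`.

Lyapunov principle. If a function obeys `V' ≤ -δ V + b` along the flow and its mean does not
increase at events, then the mean of `V` at time `t` is at most `exp (-δ t)` times its initial mean
plus `b / δ` (`Sys.lyapunov`, based on `lintegral_pick`). Here `δ` and `b` are both of order `1 / r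
^ 2`, and the workload is read at time `r ^ 2 * t`.

The function for one resource (`WorkConst.lyap`). Let `ℓ` be a small multiple of the scaled
workload, corrected by residual times, less a multiple of the auxiliary variables `D`. The slopes of
the corrections are chosen so that the mean of `exp ℓ` does not increase at events
(`ExpBounds.tilt`). The main part of the function is essentially `exp ℓ - 2 ℓ`. There are three
regimes.

If no type of the resource is blocked or waits for its first arrival, and some queue of the resource
is above the upper threshold, then the capacity is fully used. The workload has drift at most `-θ /
r` by `(K η) i < 0`, which beats the second-order errors if the multiple is small.

If no type is blocked or waiting and all queues are below the threshold, the policy leaves capacity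
unused at a rate bounded away from `0`, and `ℓ` increases at a rate of order `1 / r`, too large for
the additive constant. But `ℓ` is then small, apart from residual service times, and `exp ℓ - 2 ℓ`
has a negative slope near `0`, so the order `1 / r` cancels. Large residual service times are paid
for by `expRes`.

If a type is blocked or waiting, service is lost, but its variable `D` grows and pulls `ℓ` down. The
variables `D` are controlled by `blockPot`. A type below the upper threshold is served more slowly
than its jobs arrive, so falling from the upper to the lower threshold carries a weight
exponentially small in their distance, of order `r ^ κ`. This is negligible against `r ^ 2`, and the
slow decay rate `γ` of order `1 / r` suffices to bring `D` back.

`WorkConst.Ok.drift_le` combines the regimes, `exists_blockConst` and `exists_workConst` supply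
constants that do not depend on `r`, and `WorkConst.Ok.exp_work_le` recovers the exponential of the
workload. The theorem follows by combining the resources. -/

/-- The hysteresis update: below `a` the flag is raised, at or above `b` it is cleared. -/
def hyst (a b q : ℝ) (f : Bool) : Bool := decide (q < a) || (decide (q < b) && f)

theorem hyst_of_lt {a b q : ℝ} (h : q < a) (f : Bool) : hyst a b q f = true := by
  simp [hyst, h]

theorem hyst_of_ge {a b q : ℝ} (hab : a < b) (h : b ≤ q) (f : Bool) : hyst a b q f = false := by
  simp [hyst, not_lt.2 h, not_lt.2 (hab.le.trans h)]

theorem le_of_hyst_false {a b q : ℝ} {f : Bool} (h : hyst a b q f = false) : a ≤ q := by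
  by_contra hq
  rw [hyst_of_lt (not_le.1 hq)] at h
  exact absurd h (by simp)

theorem lt_of_hyst_true {a b q : ℝ} (hab : a < b) {f : Bool} (h : hyst a b q f = true) :
    q < b := by
  by_contra hq
  rw [hyst_of_ge hab (not_lt.1 hq)] at h
  exact absurd h (by simp)

theorem hyst_hyst {a b q : ℝ} (f : Bool) : hyst a b q (hyst a b q f) = hyst a b q f := by
  unfold hyst
  cases f <;> by_cases h₁ : q < a <;> by_cases h₂ : q < b <;> simp [h₁, h₂]

theorem le_hitAfter_self (s : EReal) (A : ℝ → Prop) : s ≤ hitAfter s A :=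
  le_iInf₂ fun _ ht => ht.2.1

theorem hitAfter_le {s : EReal} {A : ℝ → Prop} {t : ℝ} (h₀ : 0 ≤ t) (h₁ : s ≤ (t : EReal))
    (h₂ : A t) : hitAfter s A ≤ t :=
  iInf₂_le (f := fun (t : ℝ) (_ : t ∈ {t : ℝ | 0 ≤ t ∧ s ≤ (t : EReal) ∧ A t}) => (t : EReal))
    t ⟨h₀, h₁, h₂⟩

theorem le_hitAfter {s c : EReal} {A : ℝ → Prop}
    (h : ∀ t : ℝ, 0 ≤ t → s ≤ (t : EReal) → A t → c ≤ (t : EReal)) : c ≤ hitAfter s A :=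
  le_iInf₂ fun t ht => h t ht.1 ht.2.1 ht.2.2

/-- The switching times preceded by the time `0`; phase `n` is the time interval from
`phaseTime n` to `phaseTime (n + 1)`, and the blocked phases are the odd ones. -/
def phaseTime (a b : ℝ) (flag : Bool) (x : ℝ → ℝ) : ℕ → EReal
  | 0 => 0
  | n + 1 => switchTime a b flag x n

/-- The condition that ends phase `n`. -/
def PhaseEnd (a b : ℝ) (n : ℕ) (q : ℝ) : Prop := if Even n then q < a else b ≤ q

theorem phaseTime_succ {a b : ℝ} {flag : Bool} {x : ℝ → ℝ} {n : ℕ}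
    (h : n = 0 → flag = false) :
    phaseTime a b flag x (n + 1) =
      hitAfter (phaseTime a b flag x n) (fun t => PhaseEnd a b n (x t)) := by
  cases n with
  | zero => simp [phaseTime, switchTime, h rfl, PhaseEnd]
  | succ n =>
    by_cases hn : Even n
    · have h' : ¬ Even (n + 1) := by rw [Nat.even_add_one]; simpa using hn
      simp [phaseTime, switchTime, PhaseEnd, hn, h']
    · have h' : Even (n + 1) := by rw [Nat.even_add_one]; simpa using hn
      simp [phaseTime, switchTime, PhaseEnd, hn, h']

theorem phaseTime_mono {a b : ℝ} {flag : Bool} {x : ℝ → ℝ} :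
    Monotone (phaseTime a b flag x) := by
  refine monotone_nat_of_le_succ fun n => ?_
  by_cases h : n = 0 → flag = false
  · rw [phaseTime_succ h]; exact le_hitAfter_self _ _
  · push Not at h
    obtain ⟨rfl, hf⟩ := h
    have hf : flag = true := by simpa using hf
    simp [phaseTime, switchTime, hf]

/-- Phase times increase, so a time in phase `n` can lie in the blocked interval of index `k` only
if `n = 2 * k + 1`. -/
theorem blocked_iff_of_phase {a b : ℝ} {flag : Bool} {x : ℝ → ℝ} {n : ℕ} {t : ℝ}
    (h₁ : phaseTime a b flag x n ≤ t) (h₂ : (t : EReal) < phaseTime a b flag x (n + 1)) :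
    Blocked a b flag x t ↔ Odd n := by
  constructor
  · rintro ⟨k, hk₁, hk₂⟩
    have e₁ : phaseTime a b flag x (2 * k + 1) ≤ t := hk₁
    have e₂ : (t : EReal) < phaseTime a b flag x (2 * k + 1 + 1) := hk₂
    have : n = 2 * k + 1 := by
      apply le_antisymm
      · by_contra hlt
        exact absurd (e₂.trans_le (phaseTime_mono (by omega))) (not_lt.2 h₁)
      · by_contra hlt
        exact absurd (h₂.trans_le (phaseTime_mono (by omega))) (not_lt.2 e₁)
    exact ⟨k, this⟩
  · rintro ⟨k, rfl⟩
    exact ⟨k, h₁, h₂⟩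

/-- At the times before `s` and close to `s` the path is in a phase whose parity is given by `f`;
for `s = 0` the flag `f` is the initial one. -/
def PhaseBefore (a b : ℝ) (flag : Bool) (x : ℝ → ℝ) (f : Bool) (s : ℝ) : Prop :=
  (s = 0 ∧ f = flag) ∨ ∃ (s₀ : ℝ) (n : ℕ), 0 ≤ s₀ ∧ s₀ < s ∧ (Odd n ↔ f = true) ∧
    phaseTime a b flag x n ≤ s₀ ∧ (n = 0 → flag = false) ∧
    ∀ t : ℝ, s₀ ≤ t → t < s → (t : EReal) < phaseTime a b flag x (n + 1)

/-- Since `a < b`, the update toggles the flag precisely at the threshold that ends the current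
phase. This turns the hitting times into a one-step recursion. -/
theorem phaseEnd_iff_hyst {a b q : ℝ} (hab : a < b) {n : ℕ} {f : Bool} (hf : Odd n ↔ f = true) :
    PhaseEnd a b n q ↔ hyst a b q f ≠ f := by
  unfold PhaseEnd hyst
  cases f
  · have hn : Even n := by simpa using hf
    simp [hn]
  · have hn : ¬ Even n := by simpa using hf
    by_cases h : q < b
    · simp [hn, h]
    · have : ¬ q < a := fun h' => h (h'.trans hab)
      simp [hn, h, this, not_lt.1 h]

/-- A constant value `q` on `[s₁, s₂)` can end at most one phase, and only at `s₁` itself. Repeating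
the update with the same `q` changes nothing, so the phase reached then lasts at least until `s₂`.
-/
theorem exists_phase_of_phaseBefore {a b : ℝ} (hab : a < b) {flag f : Bool} {x : ℝ → ℝ}
    {s₁ s₂ q : ℝ} (hs : s₁ < s₂) (h : PhaseBefore a b flag x f s₁)
    (hx : ∀ t, s₁ ≤ t → t < s₂ → x t = q) :
    0 ≤ s₁ ∧ ∃ n : ℕ, (Odd n ↔ hyst a b q f = true) ∧ phaseTime a b flag x n ≤ s₁ ∧
      (n = 0 → flag = false) ∧
      ∀ t : ℝ, s₁ ≤ t → t < s₂ → (t : EReal) < phaseTime a b flag x (n + 1) := by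
  -- it suffices to start from a phase that has not ended before `s₁`
  have key : ∀ n : ℕ, 0 ≤ s₁ → (Odd n ↔ f = true) → (n = 0 → flag = false) →
      phaseTime a b flag x n ≤ s₁ →
      (s₁ : EReal) ≤ phaseTime a b flag x (n + 1) →
      ∃ n : ℕ, (Odd n ↔ hyst a b q f = true) ∧ phaseTime a b flag x n ≤ s₁ ∧
      (n = 0 → flag = false) ∧
      ∀ t : ℝ, s₁ ≤ t → t < s₂ → (t : EReal) < phaseTime a b flag x (n + 1) := by
    intro n h0 hn hfl hle hge
    have late : ∀ m : ℕ, (s₁ : EReal) ≤ phaseTime a b flag x (m + 1) → (m = 0 → flag = false) →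
        ¬ PhaseEnd a b m q → (s₂ : EReal) ≤ phaseTime a b flag x (m + 1) := by
      intro m hm hm0 hend
      rw [phaseTime_succ hm0]
      refine le_hitAfter fun t ht0 ht1 ht2 => ?_
      have h1 : (s₁ : EReal) ≤ t := by
        refine hm.trans ?_
        rw [phaseTime_succ hm0]
        exact hitAfter_le ht0 ht1 ht2
      by_contra hlt
      have h2 : t < s₂ := by exact_mod_cast not_le.1 hlt
      rw [hx t (by exact_mod_cast h1) h2] at ht2
      exact hend ht2
    have fin : ∀ m : ℕ, (s₂ : EReal) ≤ phaseTime a b flag x (m + 1) →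
        ∀ t : ℝ, s₁ ≤ t → t < s₂ → (t : EReal) < phaseTime a b flag x (m + 1) :=
      fun m hm t _ ht => lt_of_lt_of_le (by exact_mod_cast ht) hm
    -- If `q` ends the phase, the next one starts at `s₁`, and `hyst_hyst` prevents `q` from ending
    -- it as well.
    by_cases hE : PhaseEnd a b n q
    · have hne := (phaseEnd_iff_hyst hab hn).1 hE
      have hle' : phaseTime a b flag x (n + 1) ≤ s₁ := by
        rw [phaseTime_succ hfl]
        exact hitAfter_le h0 hle (by simpa [hx s₁ le_rfl hs] using hE)
      have hodd : Odd (n + 1) ↔ hyst a b q f = true := by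
        rw [Nat.odd_add_one, hn]
        revert hne
        cases hyst a b q f <;> cases f <;> simp
      refine ⟨n + 1, hodd, hle', by simp, fin _ (late _ ?_ (by simp) ?_)⟩
      · exact hge.trans (phaseTime_mono (Nat.le_succ _))
      · rw [phaseEnd_iff_hyst hab hodd, hyst_hyst]; simp
    · have heq : hyst a b q f = f := by
        by_contra hne
        exact hE ((phaseEnd_iff_hyst hab hn).2 hne)
      exact ⟨n, by rw [heq]; exact hn, hle, hfl, fin _ (late _ hge hfl hE)⟩
  rcases h with ⟨rfl, rfl⟩ | ⟨s₀, n, h0, hlt, hn, hle, hfl, hph⟩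
  · refine ⟨le_rfl, ?_⟩
    cases f
    · refine key 0 le_rfl (by simp) (by simp) (by simp [phaseTime]) ?_
      have := phaseTime_mono (a := a) (b := b) (flag := false) (x := x) (Nat.zero_le 1)
      simpa [phaseTime] using this
    · refine key 1 le_rfl (by simp) (by simp) (by simp [phaseTime, switchTime]) ?_
      have := phaseTime_mono (a := a) (b := b) (flag := true) (x := x) (Nat.zero_le 2)
      simpa [phaseTime] using this
  · refine ⟨h0.trans hlt.le, key n (h0.trans hlt.le) hn hfl
      (hle.trans (by exact_mod_cast hlt.le)) ?_⟩
    -- An end of the phase before `s₁` would be a real time after `s₀`, and at that time the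
    -- hypothesis makes it smaller than itself.
    by_contra hcon
    have hcon := not_le.1 hcon
    have hlow := hph s₀ le_rfl hlt
    induction hτ : phaseTime a b flag x (n + 1) with
    | bot => rw [hτ] at hlow; exact absurd hlow (by simp)
    | top => rw [hτ] at hcon; exact absurd hcon (by simp)
    | coe t =>
      rw [hτ] at hcon hlow
      have := hph t (by exact_mod_cast hlow.le) (by exact_mod_cast hcon)
      rw [hτ] at this
      exact lt_irrefl _ this

theorem blocked_iff_of_phaseBefore {a b : ℝ} (hab : a < b) {flag f : Bool} {x : ℝ → ℝ}
    {s₁ s₂ q : ℝ} (h : PhaseBefore a b flag x f s₁)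
    (hx : ∀ t, s₁ ≤ t → t < s₂ → x t = q) {t : ℝ} (ht₁ : s₁ ≤ t) (ht₂ : t < s₂) :
    Blocked a b flag x t ↔ hyst a b q f = true := by
  obtain ⟨-, n, hn, hle, -, hlt⟩ := exists_phase_of_phaseBefore hab (ht₁.trans_lt ht₂) h hx
  rw [blocked_iff_of_phase (hle.trans (by exact_mod_cast ht₁)) (hlt t ht₁ ht₂), hn]

theorem phaseBefore_step {a b : ℝ} (hab : a < b) {flag f : Bool} {x : ℝ → ℝ}
    {s₁ s₂ q : ℝ} (hs : s₁ < s₂) (h : PhaseBefore a b flag x f s₁)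
    (hx : ∀ t, s₁ ≤ t → t < s₂ → x t = q) : PhaseBefore a b flag x (hyst a b q f) s₂ := by
  obtain ⟨h0, n, hn, hle, hfl, hlt⟩ := exists_phase_of_phaseBefore hab hs h hx
  exact Or.inr ⟨s₁, n, h0, hs, hn, hle, hfl, hlt⟩

/-! ### Renewal counts -/

theorem renewalCount_eq {x : ℕ → ℝ} (hx : ∀ l, 0 < x l) {n : ℕ} {s : ℝ}
    (h₁ : ∑ l ∈ Finset.range n, x l ≤ s) (h₂ : s < ∑ l ∈ Finset.range (n + 1), x l) :
    renewalCount x s = n := by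
  have hmono : StrictMono fun n => ∑ l ∈ Finset.range n, x l :=
    strictMono_nat_of_lt_succ fun n => by simp [Finset.sum_range_succ, hx n]
  have : {m : ℕ | ∑ l ∈ Finset.range m, x l ≤ s} = Set.Iic n := by
    ext m
    simp only [Set.mem_ofPred_eq, Set.mem_Iic]
    constructor
    · intro hm
      have := hmono.lt_iff_lt.1 (hm.trans_lt h₂)
      omega
    · intro hm
      exact (hmono.monotone hm).trans h₁
  rw [renewalCount, this, csSup_Iic]

theorem delayedCount_eq_zero {x : ℕ → ℝ} (hx : ∀ l, 0 < x l) {Υ s : ℝ} (h : s < Υ) :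
    delayedCount x Υ s = 0 := by
  have h0 : renewalCount x (max (s - Υ) 0) = 0 := by
    rw [max_eq_right (by linarith)]
    exact renewalCount_eq hx (by simp) (by simpa using hx 0)
  simp [delayedCount, h0, not_le.2 h]

theorem delayedCount_eq {x : ℕ → ℝ} (hx : ∀ l, 0 < x l) {Υ s : ℝ} {n : ℕ}
    (h₁ : Υ + ∑ l ∈ Finset.range n, x l ≤ s) (h₂ : s < Υ + ∑ l ∈ Finset.range (n + 1), x l) :
    delayedCount x Υ s = n + if 0 < Υ then 1 else 0 := by
  have hs : Υ ≤ s := le_trans (le_add_of_nonneg_right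
    (Finset.sum_nonneg fun l _ => (hx l).le)) h₁
  have h0 : renewalCount x (max (s - Υ) 0) = n := by
    rw [max_eq_left (by linarith)]
    exact renewalCount_eq hx (by linarith) (by linarith)
  rw [delayedCount, h0]
  by_cases hΥ : 0 < Υ <;> simp [hs, hΥ]

/-! ### The chain of events -/

/-- The clocks: `inl j` for the arrivals and `inr j` for the services of type `j`. -/
abbrev Clk (J : ℕ) := Fin J ⊕ Fin J

/-- Data of one system: initial state, thresholds, the allocation rates `b0 z j` of the types that
are not blocked, and the growth and decay rates `chg`, `γ` of the auxiliary variables `D`. -/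
structure Sys (J : ℕ) where
  q : Fin J → ℕ
  Υ : Clk J → ℝ
  flag : Fin J → Bool
  L : ℝ
  U : ℝ
  b0 : (Fin J → Bool) → Fin J → ℝ
  chg : ℝ
  γ : ℝ

/-- State of the chain: time `T`, cumulative allocation `B`, number `cnt` of the variables used by
each clock, residual times `res`, blocking flags `blk` and an auxiliary variable `D`, which grows
while a type is blocked or waits for its first arrival and decays otherwise. -/
@[ext] structure State (J : ℕ) where
  T : ℝ
  B : Fin J → ℝ
  cnt : Clk J → ℕ
  res : Clk J → ℝ
  blk : Fin J → Bool
  D : Fin J → ℝ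

variable {J : ℕ}

namespace State

/-- A state as a tuple. -/
def toProd (s : State J) :
    ℝ × (Fin J → ℝ) × (Clk J → ℕ) × (Clk J → ℝ) × (Fin J → Bool) × (Fin J → ℝ) :=
  (s.T, s.B, s.cnt, s.res, s.blk, s.D)

instance : MeasurableSpace (State J) := MeasurableSpace.comap toProd inferInstance

theorem measurable_toProd : Measurable (toProd (J := J)) := comap_measurable _

theorem measurable_T : Measurable (State.T (J := J)) := measurable_toProd.fst
theorem measurable_B : Measurable (State.B (J := J)) := measurable_toProd.snd.fst
theorem measurable_cnt : Measurable (State.cnt (J := J)) := measurable_toProd.snd.snd.fst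
theorem measurable_res : Measurable (State.res (J := J)) := measurable_toProd.snd.snd.snd.fst
theorem measurable_blk : Measurable (State.blk (J := J)) := measurable_toProd.snd.snd.snd.snd.fst
theorem measurable_D : Measurable (State.D (J := J)) := measurable_toProd.snd.snd.snd.snd.snd

theorem measurable_B_apply (j : Fin J) : Measurable fun s : State J => s.B j :=
  (measurable_pi_apply j).comp measurable_B
theorem measurable_cnt_apply (k : Clk J) : Measurable fun s : State J => s.cnt k :=
  (measurable_pi_apply k).comp measurable_cnt
theorem measurable_blk_apply (j : Fin J) : Measurable fun s : State J => s.blk j :=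
  (measurable_pi_apply j).comp measurable_blk
theorem measurable_D_apply (j : Fin J) : Measurable fun s : State J => s.D j :=
  (measurable_pi_apply j).comp measurable_D

theorem measurable_of {α : Type*} [MeasurableSpace α] {f : α → State J}
    (hT : Measurable fun a => (f a).T) (hB : ∀ j, Measurable fun a => (f a).B j)
    (hcnt : ∀ k, Measurable fun a => (f a).cnt k) (hres : ∀ k, Measurable fun a => (f a).res k)
    (hblk : ∀ j, Measurable fun a => (f a).blk j) (hD : ∀ j, Measurable fun a => (f a).D j) :
    Measurable f := by
  refine measurable_comap_iff.2 ?_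
  exact hT.prodMk ((measurable_pi_iff.2 hB).prodMk ((measurable_pi_iff.2 hcnt).prodMk
    ((measurable_pi_iff.2 hres).prodMk ((measurable_pi_iff.2 hblk).prodMk
    (measurable_pi_iff.2 hD)))))

end State

/-- The type of job that a clock belongs to. -/
def typ : Clk J → Fin J := Sum.elim id id

@[simp] theorem typ_inl (j : Fin J) : typ (Sum.inl j) = j := rfl
@[simp] theorem typ_inr (j : Fin J) : typ (Sum.inr j) = j := rfl

namespace Sys

variable (S : Sys J)

/-- Number of variables that a clock has used at time `0`. -/
def c0 (k : Clk J) : ℕ := if 0 < S.Υ k then 0 else 1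

/-- Queue lengths. -/
def Q (s : State J) (j : Fin J) : ℝ :=
  S.q j + ((s.cnt (Sum.inl j) : ℝ) - S.c0 (Sum.inl j)) -
    ((s.cnt (Sum.inr j) : ℝ) - S.c0 (Sum.inr j))

/-- Indicators of the queues below the upper threshold. -/
def z (s : State J) (j : Fin J) : Bool := decide (S.Q s j < S.U)

/-- Allocation rates. -/
def alloc (s : State J) (j : Fin J) : ℝ := if s.blk j = true then 0 else S.b0 (S.z s) j

/-- Speeds of the clocks. -/
def speed (s : State J) : Clk J → ℝ := Sum.elim (fun _ => 1) (S.alloc s)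

/-- The types that wait for the first arrival after a positive residual time. -/
def Waiting (s : State J) (j : Fin J) : Prop := 0 < S.Υ (Sum.inl j) ∧ s.cnt (Sum.inl j) = 0

/-- The types whose variable `D` grows. -/
def Charged (s : State J) (j : Fin J) : Prop := s.blk j = true ∨ S.Waiting s j

open Classical in
/-- The state after a time `h` without events. -/
def flow (s : State J) (h : ℝ) : State J where
  T := s.T + h
  B := fun j => s.B j + h * S.alloc s j
  cnt := s.cnt
  res := fun k => s.res k - h * S.speed s k
  blk := s.blk
  D := fun j => if S.Charged s j then s.D j + S.chg * h else max (s.D j - S.γ * h) 0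

/-- Time to the next event of a clock; blocked service clocks get the time of the arrival clock. -/
def ttf (s : State J) : Clk J → ℝ :=
  Sum.elim (fun j => s.res (Sum.inl j))
    (fun j => if s.blk j = true then s.res (Sum.inl j) else s.res (Sum.inr j) / S.b0 (S.z s) j)

/-- Time to the next event. -/
def tau (s : State J) : ℝ := ⨅ k, S.ttf s k

/-- The clock `k` rings at the next event. -/
def Rings (s : State J) (k : Clk J) : Prop :=
  S.ttf s k = S.tau s ∧ ∀ j, k = Sum.inr j → s.blk j = false

end Sys

open Classical in
/-- Selects a clock from a set of clocks, arrival clocks first. -/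
def select [NeZero J] (E : Finset (Clk J)) : Clk J :=
  if h : ∃ j, Sum.inl j ∈ E then Sum.inl h.choose
  else if h : ∃ j, Sum.inr j ∈ E then Sum.inr h.choose else Sum.inl 0

theorem select_mem [NeZero J] {E : Finset (Clk J)} (hE : E.Nonempty) : select E ∈ E := by
  unfold select
  split_ifs with h₁ h₂
  · exact h₁.choose_spec
  · exact h₂.choose_spec
  · obtain ⟨k | k, hk⟩ := hE
    · exact absurd ⟨k, hk⟩ h₁
    · exact absurd ⟨k, hk⟩ h₂

theorem notMem_of_select_inr [NeZero J] {E : Finset (Clk J)} {j : Fin J}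
    (h : select E = Sum.inr j) (i : Fin J) : Sum.inl i ∉ E := by
  intro hi
  unfold select at h
  rw [dif_pos ⟨i, hi⟩] at h
  exact absurd h (by simp)

namespace Sys

variable (S : Sys J)

open Classical in
/-- The clock that is processed at the next event. -/
def pick [NeZero J] (s : State J) : Clk J := select (Finset.univ.filter fun k => S.Rings s k)

/-- The state after the event of clock `k`, the next variable of which is `y`. -/
def jump (s : State J) (k : Clk J) (y : ℝ) : State J :=
  let c := Function.update s.cnt k (s.cnt k + 1)
  { s with
    cnt := c
    res := Function.update s.res k y
    blk := Function.update s.blk (typ k)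
      (hyst S.L S.U (S.Q { s with cnt := c } (typ k)) (s.blk (typ k))) }

/-- One step of the chain. -/
def step [NeZero J] (s : State J) (y : ℝ) : State J := S.jump (S.flow s (S.tau s)) (S.pick s) y

/-- The state at time `0`. -/
def init (x : Clk J → ℕ → ℝ) : State J where
  T := 0
  B := fun _ => 0
  cnt := S.c0
  res := fun k => if 0 < S.Υ k then S.Υ k else x k 0
  blk := fun j => hyst S.L S.U (S.q j) (S.flag j)
  D := fun _ => 0

/-- The chain of the states after the successive events. -/
def chain [NeZero J] (x : Clk J → ℕ → ℝ) : ℕ → State J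
  | 0 => S.init x
  | n + 1 => S.step (chain x n) (x (S.pick (chain x n)) ((chain x n).cnt (S.pick (chain x n))))

/-! #### Measurability -/

theorem measurable_Q (j : Fin J) : Measurable fun s : State J => S.Q s j :=
  (measurable_of_countable fun c : Clk J → ℕ => S.Q ⟨0, 0, c, 0, fun _ => false, 0⟩ j).comp
    State.measurable_cnt

theorem measurable_z : Measurable (S.z) :=
  (measurable_of_countable fun c : Clk J → ℕ => S.z ⟨0, 0, c, 0, fun _ => false, 0⟩).comp
    State.measurable_cnt

theorem measurable_b0 (j : Fin J) : Measurable fun s : State J => S.b0 (S.z s) j :=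
  (measurable_of_countable fun z => S.b0 z j).comp S.measurable_z

theorem measurableSet_blk (j : Fin J) : MeasurableSet {s : State J | s.blk j = true} :=
  ((measurable_pi_apply j).comp State.measurable_blk) (measurableSet_singleton true)

theorem measurable_alloc (j : Fin J) : Measurable fun s : State J => S.alloc s j :=
  Measurable.ite (measurableSet_blk j) measurable_const (S.measurable_b0 j)

theorem measurable_res (k : Clk J) : Measurable fun s : State J => s.res k :=
  (measurable_pi_apply k).comp State.measurable_res

theorem measurable_speed (k : Clk J) : Measurable fun s : State J => S.speed s k := by
  cases k with
  | inl j => exact measurable_const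
  | inr j => exact S.measurable_alloc j

theorem measurableSet_waiting (j : Fin J) : MeasurableSet {s : State J | S.Waiting s j} := by
  have : MeasurableSet {c : Clk J → ℕ | 0 < S.Υ (Sum.inl j) ∧ c (Sum.inl j) = 0} :=
    Set.Countable.measurableSet (Set.to_countable _)
  exact State.measurable_cnt this

theorem measurableSet_charged (j : Fin J) : MeasurableSet {s : State J | S.Charged s j} :=
  (measurableSet_blk j).union (S.measurableSet_waiting j)

theorem measurable_flow : Measurable fun p : State J × ℝ => S.flow p.1 p.2 := by
  refine State.measurable_of ?_ ?_ ?_ ?_ ?_ ?_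
  · exact (State.measurable_T.comp measurable_fst).add measurable_snd
  · exact fun j => ((measurable_pi_apply j).comp (State.measurable_B.comp measurable_fst)).add
      (measurable_snd.mul ((S.measurable_alloc j).comp measurable_fst))
  · exact fun k => ((State.measurable_cnt_apply k).comp (measurable_fst (β := ℝ)) :)
  · exact fun k => ((measurable_res k).comp measurable_fst).sub
      (measurable_snd.mul ((S.measurable_speed k).comp measurable_fst))
  · exact fun j => ((State.measurable_blk_apply j).comp (measurable_fst (β := ℝ)) :)
  · intro j
    have hD : Measurable fun p : State J × ℝ => p.1.D j :=
      (measurable_pi_apply j).comp (State.measurable_D.comp measurable_fst)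
    exact Measurable.ite (measurable_fst (S.measurableSet_charged j))
      (hD.add (measurable_snd.const_mul _))
      ((hD.sub (measurable_snd.const_mul _)).max measurable_const)

theorem measurable_ttf (k : Clk J) : Measurable fun s : State J => S.ttf s k := by
  cases k with
  | inl j => exact measurable_res _
  | inr j =>
    simp only [ttf, Sum.elim_inr]
    exact Measurable.ite (measurableSet_blk j) (measurable_res (Sum.inl j))
      ((measurable_res (Sum.inr j)).div (S.measurable_b0 j))

theorem measurable_tau : Measurable S.tau := Measurable.iInf fun k => S.measurable_ttf k

theorem measurableSet_rings (k : Clk J) : MeasurableSet {s : State J | S.Rings s k} := by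
  have h : MeasurableSet {s : State J | ∀ j, k = Sum.inr j → s.blk j = false} :=
    State.measurable_blk (Set.Countable.measurableSet
      (Set.to_countable {b : Fin J → Bool | ∀ j, k = Sum.inr j → b j = false}))
  exact (measurableSet_eq_fun (S.measurable_ttf k) S.measurable_tau).inter h

/-- The choice in `select` depends only on the set of ringing clocks, which takes finitely many
values, so the choice itself need not be measurable. -/
theorem measurableSet_pick [NeZero J] (k : Clk J) : MeasurableSet {s : State J | S.pick s = k} := by
  classical
  have : {s : State J | S.pick s = k} = ⋃ E ∈ {E : Finset (Clk J) | select E = k},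
      ⋂ l, {s : State J | S.Rings s l ↔ l ∈ E} := by
    ext s
    simp only [Set.mem_ofPred_eq, Set.mem_iUnion, Set.mem_iInter, exists_prop]
    constructor
    · intro h
      refine ⟨_, h, fun l => ?_⟩
      simp
    · rintro ⟨E, hE, hl⟩
      rw [← hE, pick]
      congr 1
      ext l
      simp [hl l]
  rw [this]
  refine MeasurableSet.biUnion (Set.to_countable _) fun E _ => MeasurableSet.iInter fun l => ?_
  by_cases hl : l ∈ E
  · simp only [hl, iff_true]
    exact S.measurableSet_rings l
  · simp only [hl, iff_false]
    exact (S.measurableSet_rings l).compl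

theorem measurable_jump (k : Clk J) : Measurable fun p : State J × ℝ => S.jump p.1 k p.2 := by
  have hc : Measurable fun p : State J × ℝ => p.1.cnt := State.measurable_cnt.comp measurable_fst
  refine State.measurable_of ?_ ?_ ?_ ?_ ?_ ?_
  · exact (State.measurable_T.comp (measurable_fst (β := ℝ)) :)
  · exact fun j => ((State.measurable_B_apply j).comp (measurable_fst (β := ℝ)) :)
  · exact fun l => (measurable_of_countable fun c : Clk J → ℕ =>
      Function.update c k (c k + 1) l).comp hc
  · intro l
    by_cases h : l = k
    · subst h
      simpa [jump] using measurable_snd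
    · have : Measurable fun p : State J × ℝ => p.1.res l :=
        ((measurable_res l).comp measurable_fst :)
      simp only [jump, Function.update_of_ne h]
      exact this
  · intro j
    exact (measurable_of_countable fun p : (Clk J → ℕ) × (Fin J → Bool) =>
      Function.update p.2 (typ k) (hyst S.L S.U (S.Q ⟨0, 0, Function.update p.1 k (p.1 k + 1), 0,
        fun _ => false, 0⟩ (typ k)) (p.2 (typ k))) j).comp
      (hc.prodMk (State.measurable_blk.comp measurable_fst))
  · exact fun j => ((State.measurable_D_apply j).comp (measurable_fst (β := ℝ)) :)

theorem measurable_init {α : Type*} [MeasurableSpace α] {x : α → Clk J → ℕ → ℝ}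
    (hx : ∀ k l, Measurable fun a => x a k l) : Measurable fun a => S.init (x a) := by
  refine State.measurable_of ?_ ?_ ?_ ?_ ?_ ?_
  · exact measurable_const
  · exact fun _ => measurable_const
  · exact fun _ => measurable_const
  · intro k
    by_cases h : 0 < S.Υ k
    · simp [init, h]
    · simpa [init, h] using hx k 0
  · exact fun _ => measurable_const
  · exact fun _ => measurable_const

theorem measurable_chain [NeZero J] {α : Type*} [MeasurableSpace α] {x : α → Clk J → ℕ → ℝ}
    (hx : ∀ k l, Measurable fun a => x a k l) (n : ℕ) : Measurable fun a => S.chain (x a) n := by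
  induction n with
  | zero => exact S.measurable_init hx
  | succ n ih =>
    -- on the set where the clock `k` is picked and has used `m` variables
    have hset : ∀ (k : Clk J) (m : ℕ), MeasurableSet
        {a | S.pick (S.chain (x a) n) = k ∧ (S.chain (x a) n).cnt k = m} := fun k m =>
      (ih (S.measurableSet_pick k)).inter
        ((((measurable_pi_apply k).comp State.measurable_cnt).comp ih) (measurableSet_singleton m))
    have hf : ∀ (p : Clk J × ℕ), Measurable fun a =>
        S.jump (S.flow (S.chain (x a) n) (S.tau (S.chain (x a) n))) p.1 (x a p.1 p.2) := fun p =>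
      (S.measurable_jump p.1).comp ((S.measurable_flow.comp
        (ih.prodMk (S.measurable_tau.comp ih))).prodMk (hx p.1 p.2))
    intro A hA
    have : (fun a => S.chain (x a) (n + 1)) ⁻¹' A = ⋃ p : Clk J × ℕ,
        {a | S.pick (S.chain (x a) n) = p.1 ∧ (S.chain (x a) n).cnt p.1 = p.2} ∩
        (fun a => S.jump (S.flow (S.chain (x a) n) (S.tau (S.chain (x a) n))) p.1
          (x a p.1 p.2)) ⁻¹' A := by
      ext a
      simp only [Set.mem_preimage, Set.mem_iUnion, Set.mem_inter_iff, Set.mem_ofPred_eq, Prod.exists]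
      constructor
      · intro h
        exact ⟨_, _, ⟨rfl, rfl⟩, h⟩
      · rintro ⟨k, m, ⟨rfl, rfl⟩, h⟩
        exact h
    rw [this]
    exact MeasurableSet.iUnion fun p => (hset p.1 p.2).inter (hf p hA)

/-! #### Invariants -/

variable {S} in
/-- The requirements on the data of a system. -/
structure Good (S : Sys J) : Prop where
  Υ_nonneg : ∀ k, 0 ≤ S.Υ k
  one_le_L : 1 ≤ S.L
  L_lt_U : S.L < S.U
  b0_pos : ∀ z j, 0 < S.b0 z j
  chg_nonneg : 0 ≤ S.chg
  γ_nonneg : 0 ≤ S.γ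

/-- The states that the chain can reach. -/
structure Valid (s : State J) : Prop where
  res_nonneg : ∀ k, 0 ≤ s.res k
  D_nonneg : ∀ j, 0 ≤ s.D j
  Q_nonneg : ∀ j, 0 ≤ S.Q s j
  le_Q : ∀ j, s.blk j = false → S.L ≤ S.Q s j
  Q_lt : ∀ j, s.blk j = true → S.Q s j < S.U

variable {S}

@[simp] theorem flow_cnt (s : State J) (h : ℝ) : (S.flow s h).cnt = s.cnt := rfl
@[simp] theorem flow_blk (s : State J) (h : ℝ) : (S.flow s h).blk = s.blk := rfl
@[simp] theorem Q_flow (s : State J) (h : ℝ) (j : Fin J) : S.Q (S.flow s h) j = S.Q s j := rfl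

theorem flow_zero {s : State J} (hD : ∀ j, 0 ≤ s.D j) : S.flow s 0 = s := by
  ext j
  · simp [flow]
  · simp [flow]
  · rfl
  · simp [flow]
  · rfl
  · simp [flow, hD j]

/-- Semigroup property. The cut-off of `D` at `0` respects it because the decay rate is nonnegative:
a variable that has reached `0` stays there. -/
theorem flow_flow (hS : S.Good) (s : State J) {h h' : ℝ} (hh' : 0 ≤ h') : S.flow (S.flow s h) h' = S.flow s (h + h') := by
  classical
  ext j
  · simp [flow, add_assoc]
  · change s.B j + h * S.alloc s j + h' * S.alloc s j = s.B j + (h + h') * S.alloc s j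
    ring
  · rfl
  · change s.res j - h * S.speed s j - h' * S.speed s j = s.res j - (h + h') * S.speed s j
    ring
  · rfl
  · change (if S.Charged s j then (S.flow s h).D j + S.chg * h'
      else max ((S.flow s h).D j - S.γ * h') 0) =
      if S.Charged s j then s.D j + S.chg * (h + h') else max (s.D j - S.γ * (h + h')) 0
    by_cases hc : S.Charged s j
    · simp only [hc, if_true, flow]; ring
    · simp only [hc, if_false, flow]
      have := mul_nonneg hS.γ_nonneg hh'
      rcases le_total (s.D j - S.γ * h) 0 with h0 | h0
      · rw [max_eq_right h0, max_eq_right, max_eq_right] <;> nlinarith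
      · rw [max_eq_left h0]; congr 1; ring

theorem tau_le [NeZero J] (s : State J) (k : Clk J) : S.tau s ≤ S.ttf s k :=
  ciInf_le (Finite.bddBelow_range _) k

/-- A blocked service clock borrows the time of the arrival clock of its type. If it attains the
minimum, so does that arrival clock, and some admissible clock always rings. -/
theorem pick_spec [NeZero J] (s : State J) : S.Rings s (S.pick s) := by
  classical
  have hne : (Finset.univ.filter fun k => S.Rings s k).Nonempty := by
    obtain ⟨k, hk⟩ := exists_eq_ciInf_of_finite (f := fun k => S.ttf s k)
    by_cases hb : ∃ j, k = Sum.inr j ∧ s.blk j = true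
    · obtain ⟨j, rfl, hj⟩ := hb
      refine ⟨Sum.inl j, Finset.mem_filter.2 ⟨Finset.mem_univ _, ?_, by simp⟩⟩
      rw [tau, ← hk]
      simp [ttf, hj]
    · push Not at hb
      exact ⟨k, Finset.mem_filter.2 ⟨Finset.mem_univ _, hk, fun j hj => by simpa using hb j hj⟩⟩
  exact (Finset.mem_filter.1 (select_mem hne)).2

/-- Ties are broken in favour of arrivals: a service is processed only if no arrival is due at the
same instant. `phaseBefore_chain` relies on this. -/
theorem tau_lt_res_inl_of_pick_inr [NeZero J] {s : State J} {j : Fin J}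
    (h : S.pick s = Sum.inr j) (i : Fin J) : S.tau s < s.res (Sum.inl i) := by
  classical
  have h1 := notMem_of_select_inr h i
  refine lt_of_le_of_ne (tau_le s (Sum.inl i)) fun he => h1 ?_
  exact Finset.mem_filter.2 ⟨Finset.mem_univ _, he.symm, by simp⟩

theorem tau_mul_speed_le (hS : S.Good) [NeZero J] {s : State J} (hs : ∀ k, 0 ≤ s.res k)
    (k : Clk J) : S.tau s * S.speed s k ≤ s.res k := by
  have h := tau_le (S := S) s k
  cases k with
  | inl j => simpa [speed, ttf] using h
  | inr j =>
    by_cases hb : s.blk j = true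
    · simpa [speed, alloc, hb] using hs _
    · simp only [ttf, Sum.elim_inr, hb, if_false, Bool.false_eq_true] at h
      simp only [speed, Sum.elim_inr, alloc, hb, Bool.false_eq_true, if_false]
      exact (le_div_iff₀ (hS.b0_pos _ _)).1 h

theorem res_pick [NeZero J] (hS : S.Good) (s : State J) :
    s.res (S.pick s) = S.tau s * S.speed s (S.pick s) := by
  obtain ⟨h1, h2⟩ := pick_spec (S := S) s
  cases hk : S.pick s with
  | inl j => rw [hk] at h1; simpa [ttf, speed] using h1
  | inr j =>
    rw [hk] at h1
    have hb := h2 j hk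
    simp only [ttf, Sum.elim_inr, hb, if_false, Bool.false_eq_true] at h1
    simp only [speed, Sum.elim_inr, alloc, hb, Bool.false_eq_true, if_false]
    rw [← h1, div_mul_cancel₀ _ (hS.b0_pos _ _).ne']

theorem flow_res_pick [NeZero J] (hS : S.Good) (s : State J) :
    (S.flow s (S.tau s)).res (S.pick s) = 0 := by
  simp [flow, res_pick hS s]

theorem blk_of_pick_inr [NeZero J] {s : State J} {j : Fin J} (h : S.pick s = Sum.inr j) :
    s.blk j = false := (pick_spec (S := S) s).2 j h

theorem tau_nonneg [NeZero J] (hS : S.Good) {s : State J} (hs : ∀ k, 0 ≤ s.res k) :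
    0 ≤ S.tau s := by
  refine le_ciInf fun k => ?_
  cases k with
  | inl j => exact hs _
  | inr j =>
    simp only [ttf, Sum.elim_inr]
    split_ifs
    · exact hs _
    · exact div_nonneg (hs _) (hS.b0_pos _ _).le

theorem valid_flow [NeZero J] (hS : S.Good) {s : State J} (hs : S.Valid s) {h : ℝ} (h0 : 0 ≤ h)
    (h1 : h ≤ S.tau s) : S.Valid (S.flow s h) where
  res_nonneg k := by
    have hsp : 0 ≤ S.speed s k := by
      cases k with
      | inl j => simp [speed]
      | inr j =>
        simp only [speed, Sum.elim_inr, alloc]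
        split_ifs
        · exact le_rfl
        · exact (hS.b0_pos _ _).le
    have := tau_mul_speed_le hS hs.res_nonneg k
    have h2 := mul_le_mul_of_nonneg_right h1 hsp
    simp only [flow]
    linarith
  D_nonneg j := by
    simp only [flow]
    split_ifs
    · exact add_nonneg (hs.D_nonneg j) (mul_nonneg hS.chg_nonneg h0)
    · exact le_max_right _ _
  Q_nonneg := hs.Q_nonneg
  le_Q := hs.le_Q
  Q_lt := hs.Q_lt

@[simp] theorem jump_D (s : State J) (k : Clk J) (y : ℝ) : (S.jump s k y).D = s.D := rfl
@[simp] theorem jump_cnt (s : State J) (k : Clk J) (y : ℝ) :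
    (S.jump s k y).cnt = Function.update s.cnt k (s.cnt k + 1) := rfl
@[simp] theorem jump_res (s : State J) (k : Clk J) (y : ℝ) :
    (S.jump s k y).res = Function.update s.res k y := rfl

theorem jump_blk (s : State J) (k : Clk J) (y : ℝ) : (S.jump s k y).blk =
    Function.update s.blk (typ k) (hyst S.L S.U (S.Q (S.jump s k y) (typ k)) (s.blk (typ k))) := rfl

theorem Q_jump_inl (s : State J) (j : Fin J) (y : ℝ) (i : Fin J) :
    S.Q (S.jump s (Sum.inl j) y) i = S.Q s i + if i = j then 1 else 0 := by
  by_cases h : i = j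
  · subst h; simp [Q]; ring
  · simp [Q, h]

theorem Q_jump_inr (s : State J) (j : Fin J) (y : ℝ) (i : Fin J) :
    S.Q (S.jump s (Sum.inr j) y) i = S.Q s i - if i = j then 1 else 0 := by
  by_cases h : i = j
  · subst h; simp [Q]; ring
  · simp [Q, h]

theorem Q_jump_of_ne {s : State J} {k : Clk J} {i : Fin J} (h : i ≠ typ k) (y : ℝ) :
    S.Q (S.jump s k y) i = S.Q s i := by
  cases k with
  | inl j => rw [Q_jump_inl, if_neg (by simpa using h), add_zero]
  | inr j => rw [Q_jump_inr, if_neg (by simpa using h), sub_zero]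

/-- Only an unblocked type is served, and its queue is at least `S.L ≥ 1`, so no queue becomes
negative. The threshold bounds are what a value of `hyst` says about the updated queue. -/
theorem valid_jump (hS : S.Good) {s : State J} (hs : S.Valid s) {k : Clk J}
    (hk : ∀ j, k = Sum.inr j → s.blk j = false) {y : ℝ} (hy : 0 ≤ y) : S.Valid (S.jump s k y) where
  res_nonneg l := by
    by_cases h : l = k
    · subst h; simpa using hy
    · simpa [h] using hs.res_nonneg l
  D_nonneg := hs.D_nonneg
  Q_nonneg j := by
    cases k with
    | inl i =>
      rw [Q_jump_inl]
      have := hs.Q_nonneg j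
      split_ifs <;> linarith
    | inr i =>
      rw [Q_jump_inr]
      have := hs.Q_nonneg j
      split_ifs with h
      · subst h
        have := hs.le_Q j (hk j rfl)
        have := hS.one_le_L
        linarith
      · linarith
  le_Q j hj := by
    by_cases h : j = typ k
    · subst h
      rw [jump_blk, Function.update_self] at hj
      exact le_of_hyst_false hj
    · rw [jump_blk, Function.update_of_ne h] at hj
      rw [Q_jump_of_ne h]
      exact hs.le_Q j hj
  Q_lt j hj := by
    by_cases h : j = typ k
    · subst h
      rw [jump_blk, Function.update_self] at hj
      exact lt_of_hyst_true hS.L_lt_U hj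
    · rw [jump_blk, Function.update_of_ne h] at hj
      rw [Q_jump_of_ne h]
      exact hs.Q_lt j hj

theorem Q_init (x : Clk J → ℕ → ℝ) (j : Fin J) : S.Q (S.init x) j = S.q j := by
  simp [Q, init]

theorem valid_init (hS : S.Good) {x : Clk J → ℕ → ℝ} (hx : ∀ k l, 0 < x k l) :
    S.Valid (S.init x) where
  res_nonneg k := by
    simp only [init]
    split_ifs with h
    · exact h.le
    · exact (hx k 0).le
  D_nonneg _ := le_rfl
  Q_nonneg j := by rw [Q_init]; positivity
  le_Q j hj := by rw [Q_init]; exact le_of_hyst_false hj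
  Q_lt j hj := by rw [Q_init]; exact lt_of_hyst_true hS.L_lt_U hj

theorem valid_step [NeZero J] (hS : S.Good) {s : State J} (hs : S.Valid s) {y : ℝ} (hy : 0 ≤ y) :
    S.Valid (S.step s y) :=
  valid_jump hS (k := S.pick s) (valid_flow hS hs (tau_nonneg hS hs.res_nonneg) le_rfl)
    (fun _ hj => blk_of_pick_inr (S := S) (s := s) hj) hy

theorem valid_chain [NeZero J] (hS : S.Good) {x : Clk J → ℕ → ℝ} (hx : ∀ k l, 0 < x k l) (n : ℕ) :
    S.Valid (S.chain x n) := by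
  induction n with
  | zero => exact valid_init hS hx
  | succ n ih => exact valid_step hS ih (hx _ _).le

theorem chain_succ_T [NeZero J] (x : Clk J → ℕ → ℝ) (n : ℕ) :
    (S.chain x (n + 1)).T = (S.chain x n).T + S.tau (S.chain x n) := rfl

/-- The chain up to event `n` depends only on the variables that it has used. -/
theorem chain_congr [NeZero J] {x x' : Clk J → ℕ → ℝ} (n : ℕ)
    (h : ∀ k l, l < (S.chain x n).cnt k → x k l = x' k l) : S.chain x' n = S.chain x n := by
  induction n with
  | zero =>
    change S.init x' = S.init x
    ext k
    · rfl
    · rfl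
    · rfl
    · simp only [init]
      split_ifs with hk
      · rfl
      · refine (h k 0 ?_).symm
        change 0 < S.c0 k
        simp [c0, hk]
    · rfl
    · rfl
  | succ n ih =>
    have hc : (S.chain x (n + 1)).cnt = Function.update (S.chain x n).cnt (S.pick (S.chain x n))
        ((S.chain x n).cnt (S.pick (S.chain x n)) + 1) := rfl
    have hle : ∀ k, (S.chain x n).cnt k ≤ (S.chain x (n + 1)).cnt k := by
      intro k
      rw [hc]
      by_cases hk : k = S.pick (S.chain x n)
      · subst hk; simp
      · simp [hk]
    have he := ih fun k l hl => h k l (hl.trans_le (hle k))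
    change S.step (S.chain x' n) _ = S.step (S.chain x n) _
    rw [he]
    congr 1
    refine (h _ _ ?_).symm
    rw [hc]
    simp

end Sys

variable {J : ℕ}

namespace Sys

variable {S : Sys J}

/-! ### The chain and the paths of the policy -/

/-- The queue lengths at time `t` if the cumulative allocation is `b`. -/
def pathQueue (S : Sys J) (x : Clk J → ℕ → ℝ) (t : ℝ) (b : Fin J → ℝ) (j : Fin J) : ℝ :=
  S.q j + delayedCount (x (Sum.inl j)) (S.Υ (Sum.inl j)) t -
    delayedCount (x (Sum.inr j)) (S.Υ (Sum.inr j)) (b j)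

open Classical in
/-- The allocation rates along a queue length path. -/
def pathRate (S : Sys J) (Q : ℝ → Fin J → ℝ) (t : ℝ) (j : Fin J) : ℝ :=
  if Blocked S.L S.U (S.flag j) (fun s => Q s j) t then 0
  else S.b0 (fun k => decide (Q t k < S.U)) j

/-- The local times of the clocks. -/
def el (s : State J) : Clk J → ℝ := Sum.elim (fun _ => s.T) s.B

/-- Relation of the local times, the residual times and the variables used so far. -/
def Accounts (S : Sys J) (x : Clk J → ℕ → ℝ) (s : State J) : Prop :=
  ∀ k, el s k + s.res k = S.Υ k + ∑ l ∈ Finset.range (s.cnt k), x k l ∧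
    ((s.cnt k = 0 ∧ 0 < S.Υ k) ∨
      ∃ n, s.cnt k = n + 1 ∧ S.Υ k + ∑ l ∈ Finset.range n, x k l ≤ el s k)

theorem el_flow (s : State J) (h : ℝ) (k : Clk J) :
    el (S.flow s h) k = el s k + h * S.speed s k := by
  cases k <;> simp [el, flow, speed]

theorem speed_nonneg (hS : S.Good) (s : State J) (k : Clk J) : 0 ≤ S.speed s k := by
  cases k with
  | inl j => simp [speed]
  | inr j =>
    simp only [speed, Sum.elim_inr, alloc]
    split_ifs
    · exact le_rfl
    · exact (hS.b0_pos _ _).le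

theorem alloc_nonneg (hS : S.Good) (s : State J) (j : Fin J) : 0 ≤ S.alloc s j :=
  speed_nonneg hS s (Sum.inr j)

variable [NeZero J]

/-- The flow preserves the sum of the local time and the residual time of a clock. At an event of
the clock its residual time is `0`, and the next variable is appended. -/
theorem accounts_chain (hS : S.Good) {x : Clk J → ℕ → ℝ} (hx : ∀ k l, 0 < x k l) (n : ℕ) :
    S.Accounts x (S.chain x n) := by
  induction n with
  | zero =>
    intro k
    have he : el (S.init x) k = 0 := by cases k <;> rfl
    by_cases h : 0 < S.Υ k
    · simp [chain, he]
      simp [init, c0, h]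
    · have h0 : S.Υ k = 0 := le_antisymm (not_lt.1 h) (hS.Υ_nonneg k)
      simp [chain, he]
      simp [init, c0, h0]
  | succ n ih =>
    intro k
    have hv := valid_chain hS hx n
    set s := S.chain x n with hs
    obtain ⟨h1, h2⟩ := ih k
    have hτ := tau_nonneg hS hv.res_nonneg
    have hsp := mul_nonneg hτ (speed_nonneg hS s k)
    have hel : el (S.chain x (n + 1)) k = el s k + S.tau s * S.speed s k := by
      rw [← el_flow]; cases k <;> rfl
    rw [hel]
    by_cases hk : k = S.pick s
    · have hc : (S.chain x (n + 1)).cnt k = s.cnt k + 1 := by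
        change (S.step s _).cnt k = _
        simp [step, hk]
      have hr : (S.chain x (n + 1)).res k = x k (s.cnt k) := by
        change (S.step s _).res k = _
        rw [hk]; simp [step, ← hs]
      have hres : s.res k = S.tau s * S.speed s k := by rw [hk]; exact res_pick hS s
      rw [hc, hr, Finset.sum_range_succ]
      refine ⟨by linarith, Or.inr ⟨_, rfl, by linarith⟩⟩
    · have hc : (S.chain x (n + 1)).cnt k = s.cnt k := by
        change (S.step s _).cnt k = _
        simp [step, hk]
      have hr : (S.chain x (n + 1)).res k = s.res k - S.tau s * S.speed s k := by
        change (S.step s _).res k = _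
        simp [step, hk, flow]
      rw [hc, hr]
      refine ⟨by linarith, h2.imp_right ?_⟩
      rintro ⟨m, hm, hle⟩
      exact ⟨m, hm, by linarith⟩

omit [NeZero J] in
theorem delayedCount_of_accounts {x : Clk J → ℕ → ℝ} (hx : ∀ k l, 0 < x k l)
    {s : State J} (hs : S.Accounts x s) {k : Clk J} {e : ℝ} (h₁ : el s k ≤ e)
    (h₂ : e < el s k + s.res k) :
    delayedCount (x k) (S.Υ k) e = (s.cnt k : ℝ) - S.c0 k := by
  obtain ⟨ha, hb⟩ := hs k
  rw [ha] at h₂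
  rcases hb with ⟨h0, hΥ⟩ | ⟨n, hn, hle⟩
  · rw [h0] at h₂
    rw [delayedCount_eq_zero (hx k) (by simpa using h₂)]
    simp [h0, c0, hΥ]
  · rw [hn] at h₂
    rw [delayedCount_eq (hx k) (hle.trans h₁) h₂, hn]
    by_cases hΥ : 0 < S.Υ k <;> simp [c0, hΥ]

theorem T_mono (hS : S.Good) {x : Clk J → ℕ → ℝ} (hx : ∀ k l, 0 < x k l) :
    Monotone fun n => (S.chain x n).T :=
  monotone_nat_of_le_succ fun n => by
    have := tau_nonneg hS (valid_chain hS hx n).res_nonneg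
    simp only [chain_succ_T]; linarith

theorem T_nonneg (hS : S.Good) {x : Clk J → ℕ → ℝ} (hx : ∀ k l, 0 < x k l) (n : ℕ) :
    0 ≤ (S.chain x n).T := T_mono hS hx (Nat.zero_le n)

/-- The cumulative allocation `b` agrees with the chain up to its event `n`. -/
def OnPath (S : Sys J) (x : Clk J → ℕ → ℝ) (b : ℝ → Fin J → ℝ) (n : ℕ) : Prop :=
  ∀ m < n, ∀ t, (S.chain x m).T ≤ t → t ≤ (S.chain x (m + 1)).T →
    b t = (S.flow (S.chain x m) (t - (S.chain x m).T)).B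

omit [NeZero J] in
theorem pathQueue_eq {x : Clk J → ℕ → ℝ} (hx : ∀ k l, 0 < x k l) {s : State J}
    (hs : S.Accounts x s) {t : ℝ} {b : Fin J → ℝ} {j : Fin J} (h₁ : s.T ≤ t)
    (h₂ : t < s.T + s.res (Sum.inl j)) (h₃ : s.B j ≤ b j)
    (h₄ : b j < s.B j + s.res (Sum.inr j)) : S.pathQueue x t b j = S.Q s j := by
  rw [pathQueue, Q, delayedCount_of_accounts hx hs (k := Sum.inl j) h₁ h₂,
    delayedCount_of_accounts hx hs (k := Sum.inr j) h₃ h₄]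

/-- Within the time to the next event the clocks do not run out. -/
theorem mul_alloc_lt_res (hS : S.Good) {s : State J}
    (hb : ∀ j, s.blk j = true → 0 < s.res (Sum.inr j)) {h : ℝ} (h1 : h < S.tau s) (j : Fin J) :
    h * S.alloc s j < s.res (Sum.inr j) := by
  by_cases hj : s.blk j = true
  · simpa [alloc, hj] using hb j hj
  · have h2 := h1.trans_le (tau_le s (Sum.inr j))
    simp only [ttf, Sum.elim_inr, hj, if_false, Bool.false_eq_true] at h2
    simp only [alloc, hj, Bool.false_eq_true, if_false]
    exact (lt_div_iff₀ (hS.b0_pos _ _)).1 h2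

/-- Here `f j` is the flag just before the present instant, and `blk` the flag after the events
processed so far. Several events may share an instant, while the switching times see only the path
after all of them. The positivity clauses exclude the sequences in which successive updates would
differ from a single update of `f` at the final queue length; they persist because arrivals precede
services. -/
theorem phaseBefore_chain (hS : S.Good) {x : Clk J → ℕ → ℝ} (hx : ∀ k l, 0 < x k l)
    {b : ℝ → Fin J → ℝ} (n : ℕ) (hb : S.OnPath x b n) :
    ∃ f : Fin J → Bool, ∀ j,
      (S.chain x n).blk j = hyst S.L S.U (S.Q (S.chain x n) j) (f j) ∧
      PhaseBefore S.L S.U (S.flag j) (fun t => S.pathQueue x t (b t) j) (f j) (S.chain x n).T ∧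
      (f j = true → 0 < (S.chain x n).res (Sum.inr j)) ∧
      (f j = false → (S.chain x n).blk j = true → 0 < (S.chain x n).res (Sum.inl j)) ∧
      ((S.chain x n).blk j = true → 0 < (S.chain x n).res (Sum.inr j)) := by
  induction n with
  | zero =>
    have hpos : ∀ k, 0 < (S.chain x 0).res k := by
      intro k
      simp only [chain, init]
      split_ifs with h
      · exact h
      · exact hx k 0
    refine ⟨S.flag, fun j => ⟨?_, Or.inl ⟨rfl, rfl⟩, fun _ => hpos _, fun _ _ => hpos _,
      fun _ => hpos _⟩⟩
    rw [chain, Q_init]; rfl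
  | succ n ih =>
    obtain ⟨f, hf⟩ := ih fun m hm => hb m (hm.trans (Nat.lt_succ_self n))
    have hv := valid_chain hS hx n
    have hacc := accounts_chain hS hx n
    have hbn := hb n (Nat.lt_succ_self n)
    have hchain : S.chain x (n + 1) = S.step (S.chain x n)
      (x (S.pick (S.chain x n)) ((S.chain x n).cnt (S.pick (S.chain x n)))) := rfl
    rw [chain_succ_T] at hbn
    set s := S.chain x n with hs
    have hy := hx (S.pick s) (s.cnt (S.pick s))
    set y := x (S.pick s) (s.cnt (S.pick s)) with hy_def
    have hblkres : ∀ j, s.blk j = true → 0 < s.res (Sum.inr j) := fun j => (hf j).2.2.2.2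
    have hτ := tau_nonneg hS hv.res_nonneg
    have hpick := pick_spec (S := S) s
    have hrespick := res_pick hS s
    -- the flags of the preceding times
    obtain ⟨f', hf', hcase⟩ : ∃ f' : Fin J → Bool, (∀ j, PhaseBefore S.L S.U (S.flag j)
        (fun t => S.pathQueue x t (b t) j) (f' j) (s.T + S.tau s)) ∧
        ((S.tau s = 0 ∧ f' = f) ∨ (0 < S.tau s ∧ f' = s.blk)) := by
      rcases hτ.eq_or_lt with h0 | h0
      · exact ⟨f, fun j => by rw [← h0, add_zero]; exact (hf j).2.1, Or.inl ⟨h0.symm, rfl⟩⟩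
      · refine ⟨s.blk, fun j => ?_, Or.inr ⟨h0, rfl⟩⟩
        rw [(hf j).1]
        refine phaseBefore_step hS.L_lt_U (by linarith) (hf j).2.1 fun t ht1 ht2 => ?_
        have h2 : t - s.T < S.tau s := by linarith
        rw [hbn t ht1 ht2.le]
        refine pathQueue_eq hx hacc ht1 ?_ ?_ ?_
        · have := tau_le (S := S) s (Sum.inl j)
          simp only [ttf, Sum.elim_inl] at this
          linarith
        · have := mul_nonneg (sub_nonneg.2 ht1) (alloc_nonneg hS s j)
          simp only [flow]; linarith
        · have := mul_alloc_lt_res hS hblkres h2 j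
          simp only [flow]; linarith
    have hresr : ∀ j, s.blk j = true → s.res (Sum.inr j) - S.tau s * S.speed s (Sum.inr j) =
        s.res (Sum.inr j) := by
      intro j hj
      simp [speed, alloc, hj]
    rw [hchain]
    have hf3 : ∀ j, f' j = true → 0 < s.res (Sum.inr j) - S.tau s * S.speed s (Sum.inr j) := by
      intro j hj
      rcases hcase with ⟨h0, rfl⟩ | ⟨h0, rfl⟩
      · rw [h0, zero_mul, sub_zero]; exact (hf j).2.2.1 hj
      · rw [hresr j hj]; exact hblkres j hj
    refine ⟨f', fun j => ⟨?_, hf' j, ?_⟩⟩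
    · -- the flags satisfy the hysteresis relation
      by_cases hj : j = typ (S.pick s)
      · rw [step, jump_blk, ← hj, Function.update_self, flow_blk]
        -- Without elapsed time `f` is kept, and updating `blk` must give the same as updating `f`.
        -- After a positive time `f` is `blk` itself.
        rcases hcase with ⟨h0, rfl⟩ | ⟨h0, rfl⟩
        · rcases hk : S.pick s with i | i
          · rw [hk, typ_inl] at hj
            subst hj
            rw [Q_jump_inl, Q_flow, if_pos rfl, (hf j).1]
            cases hfj : f' j
            · cases hbj : hyst S.L S.U (S.Q s j) false
              · rfl
              · have h4 := (hf j).2.2.2.1 hfj (by rw [(hf j).1, hfj, hbj])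
                rw [hk, h0, zero_mul] at hrespick
                exact absurd hrespick h4.ne'
            · by_cases hQ : S.U ≤ S.Q s j
              · rw [hyst_of_ge hS.L_lt_U hQ, hyst_of_ge hS.L_lt_U (by linarith),
                  hyst_of_ge hS.L_lt_U (by linarith)]
              · congr 1
                simp [hyst, not_le.1 hQ]
          · rw [hk, typ_inr] at hj
            subst hj
            rw [blk_of_pick_inr hk]
            cases hfj : f' j
            · rfl
            · have h3 := (hf j).2.2.1 hfj
              rw [hk, h0, zero_mul] at hrespick
              exact absurd hrespick h3.ne'
        · rfl
      · rw [step, jump_blk, Function.update_of_ne hj, Q_jump_of_ne hj, flow_blk, Q_flow]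
        rcases hcase with ⟨-, rfl⟩ | ⟨-, rfl⟩
        · exact (hf j).1
        · conv_rhs => rw [(hf j).1, hyst_hyst]
          exact (hf j).1
    · -- positivity of the residual times
      rcases hk : S.pick s with i | i
      · have hr : (S.step s y).res (Sum.inr j) =
            s.res (Sum.inr j) - S.tau s * S.speed s (Sum.inr j) := by
          simp [step, hk, flow]
        -- An arrival cannot start a blocked period: the queue of an unblocked type is already at
        -- least `S.L`.
        have hblk' : (S.step s y).blk j = true → s.blk j = true := by
          intro h
          by_cases hj : j = i
          · subst hj
            by_contra hne
            rw [step, jump_blk, hk, typ_inl, Function.update_self, Q_jump_inl, if_pos rfl, Q_flow,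
              flow_blk, Bool.eq_false_of_not_eq_true hne] at h
            have := hv.le_Q j (Bool.eq_false_of_not_eq_true hne)
            simp [hyst, not_lt.2 (show S.L ≤ S.Q s j + 1 by linarith)] at h
          · rwa [step, jump_blk, hk, typ_inl, Function.update_of_ne hj] at h
        rw [hr]
        refine ⟨hf3 j, fun h1 h2 => ?_, fun h => ?_⟩
        · by_cases hj : j = i
          · subst hj
            simpa [step, hk] using hy
          · have h2 := hblk' h2
            rcases hcase with ⟨h0, rfl⟩ | ⟨h0, rfl⟩
            · have h4 := (hf j).2.2.2.1 h1 h2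
              simpa [step, hk, hj, flow, h0] using h4
            · rw [h1] at h2; exact absurd h2 (by simp)
        · rw [hresr j (hblk' h)]; exact hblkres j (hblk' h)
      · have hl : 0 < (S.step s y).res (Sum.inl j) := by
          have := tau_lt_res_inl_of_pick_inr hk j
          simpa [step, hk, flow, speed] using this
        by_cases hj : j = i
        · subst hj
          have hr : 0 < (S.step s y).res (Sum.inr j) := by
            simpa [step, hk] using hy
          exact ⟨fun _ => hr, fun _ _ => hl, fun _ => hr⟩
        · have hr : (S.step s y).res (Sum.inr j) =
              s.res (Sum.inr j) - S.tau s * S.speed s (Sum.inr j) := by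
            simp [step, hk, flow, hj]
          have hbl : (S.step s y).blk j = s.blk j := by
            rw [step, jump_blk, hk, typ_inr, Function.update_of_ne hj, flow_blk]
          rw [hr, hbl]
          exact ⟨hf3 j, fun _ _ => hl, fun h => by rw [hresr j h]; exact hblkres j h⟩

/-- As long as `b` stays below the level at which a service clock runs out, and time below the next
event, the queue path is constant. The phase recursion then identifies the rate. -/
theorem pathRate_eq (hS : S.Good) {x : Clk J → ℕ → ℝ} (hx : ∀ k l, 0 < x k l)
    {b : ℝ → Fin J → ℝ} {n : ℕ} (hb : S.OnPath x b n) {s₂ : ℝ}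
    (hs₂ : s₂ ≤ (S.chain x (n + 1)).T)
    (hB : ∀ t, (S.chain x n).T ≤ t → t < s₂ → ∀ j, (S.chain x n).B j ≤ b t j ∧
      b t j < (S.chain x n).B j + (S.chain x n).res (Sum.inr j))
    {t : ℝ} (ht₁ : (S.chain x n).T ≤ t) (ht₂ : t < s₂) :
    S.pathQueue x t (b t) = S.Q (S.chain x n) ∧
      ∀ j, S.pathRate (fun t => S.pathQueue x t (b t)) t j = S.alloc (S.chain x n) j := by
  obtain ⟨f, hf⟩ := phaseBefore_chain hS hx n hb
  have hacc := accounts_chain hS hx n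
  rw [chain_succ_T] at hs₂
  set s := S.chain x n
  have hQ : ∀ t, s.T ≤ t → t < s₂ → ∀ j, S.pathQueue x t (b t) j = S.Q s j := by
    intro t h1 h2 j
    refine pathQueue_eq hx hacc h1 ?_ (hB t h1 h2 j).1 (hB t h1 h2 j).2
    have := tau_le (S := S) s (Sum.inl j)
    simp only [ttf, Sum.elim_inl] at this
    linarith
  refine ⟨funext (hQ t ht₁ ht₂), fun j => ?_⟩
  have hbl := blocked_iff_of_phaseBefore hS.L_lt_U (hf j).2.1 (fun t h1 h2 => hQ t h1 h2 j) ht₁ ht₂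
  rw [← (hf j).1] at hbl
  simp only [pathRate, alloc, hbl]
  congr 2
  ext k
  simp only [hQ t ht₁ ht₂ k, z]

omit [NeZero J] in
theorem pathRate_nonneg (hS : S.Good) (Q : ℝ → Fin J → ℝ) (t : ℝ) (j : Fin J) :
    0 ≤ S.pathRate Q t j := by
  unfold pathRate
  split_ifs
  · exact le_rfl
  · exact (hS.b0_pos _ _).le

omit [NeZero J] in
theorem integral_of_eq_const {g : ℝ → ℝ} {s t c : ℝ} (hst : s ≤ t)
    (h : ∀ u, s ≤ u → u < t → g u = c) :
    IntervalIntegrable g volume s t ∧ ∫ u in s..t, g u = (t - s) * c := by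
  have hae : ∀ᵐ u ∂(volume.restrict (Set.uIoc s t)), c = g u := by
    rw [ae_restrict_iff' measurableSet_uIoc]
    filter_upwards [compl_mem_ae_iff.2 (measure_singleton (μ := volume) t)] with u hu hmem
    rw [Set.uIoc_of_le hst] at hmem
    exact (h u hmem.1.le (lt_of_le_of_ne hmem.2 hu)).symm
  refine ⟨(intervalIntegrable_const (c := c)).congr_ae hae, ?_⟩
  rw [← intervalIntegral.integral_congr_ae_restrict hae]
  simp

/-- Uniqueness of the allocation, by induction on the events. While `b` agrees with the flow, no
service clock runs out before the next event. By continuity none runs out slightly later either, so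
the rate there is the constant rate of the chain, and integration extends the agreement. -/
theorem onPath_of_integral (hS : S.Good) {x : Clk J → ℕ → ℝ} (hx : ∀ k l, 0 < x k l)
    {b : ℝ → Fin J → ℝ}
    (hb : ∀ t j, 0 ≤ t →
      IntervalIntegrable (fun s => S.pathRate (fun t => S.pathQueue x t (b t)) s j) volume 0 t ∧
      b t j = ∫ s in (0 : ℝ)..t, S.pathRate (fun t => S.pathQueue x t (b t)) s j) (n : ℕ) :
    S.OnPath x b n := by
  have hsub : ∀ s t j, 0 ≤ s → s ≤ t →
      b t j = b s j + ∫ u in s..t, S.pathRate (fun t => S.pathQueue x t (b t)) u j := by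
    intro s t j h0 hst
    rw [(hb t j (h0.trans hst)).2, (hb s j h0).2,
      intervalIntegral.integral_add_adjacent_intervals (hb s j h0).1
        ((hb s j h0).1.symm.trans (hb t j (h0.trans hst)).1)]
  have hmono : ∀ s t j, 0 ≤ s → s ≤ t → b s j ≤ b t j := by
    intro s t j h0 hst
    rw [hsub s t j h0 hst]
    exact le_add_of_nonneg_right
      (intervalIntegral.integral_nonneg hst fun u _ => pathRate_nonneg hS _ _ _)
  have hcont : ∀ M j, 0 ≤ M → ContinuousOn (fun t => b t j) (Set.Icc 0 M) := by
    intro M j hM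
    have h := intervalIntegral.continuousOn_primitive_interval' (hb M j hM).1 Set.left_mem_uIcc
    rw [Set.uIcc_of_le hM] at h
    exact h.congr fun t ht => (hb t j ht.1).2
  induction n with
  | zero => intro m hm; exact absurd hm (Nat.not_lt_zero m)
  | succ n ih =>
    intro m hm
    rcases Nat.lt_succ_iff_lt_or_eq.1 hm with hlt | rfl
    · exact ih m hlt
    have hv := valid_chain hS hx m
    have hT0 := T_nonneg hS hx m
    have hstart : b (S.chain x m).T = (S.chain x m).B := by
      cases m with
      | zero =>
        funext j
        change b 0 j = 0
        rw [(hb 0 j le_rfl).2, intervalIntegral.integral_same]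
      | succ m =>
        have e : (S.chain x (m + 1)).T - (S.chain x m).T = S.tau (S.chain x m) := by
          rw [chain_succ_T, add_sub_cancel_left]
        rw [ih m (Nat.lt_succ_self m) (S.chain x (m + 1)).T (T_mono hS hx (Nat.le_succ m)) le_rfl,
          e]
        rfl
    obtain ⟨f, hf⟩ := phaseBefore_chain hS hx m ih
    have hblkres : ∀ j, (S.chain x m).blk j = true → 0 < (S.chain x m).res (Sum.inr j) :=
      fun j => (hf j).2.2.2.2
    have hrate := fun s₂ => pathRate_eq hS hx ih (s₂ := s₂)
    rw [chain_succ_T] at *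
    set s := S.chain x m
    have hτ := tau_nonneg hS hv.res_nonneg
    let A : Set ℝ := {t | ∀ t', s.T ≤ t' → t' ≤ t → b t' = (S.flow s (t' - s.T)).B}
    -- Continuous induction: the times of agreement in the interval form a closed set that can be
    -- enlarged to the right.
    have hA : Set.Icc s.T (s.T + S.tau s) ⊆ A := by
      refine IsClosed.Icc_subset_of_forall_exists_gt ?_ ?_ ?_
      · refine IsSeqClosed.isClosed fun u t hu htend => ?_
        have hmem : t ∈ Set.Icc s.T (s.T + S.tau s) :=
          isClosed_Icc.mem_of_tendsto htend (Eventually.of_forall fun k => (hu k).2)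
        refine ⟨fun t' h1 h2 => ?_, hmem⟩
        rcases h2.lt_or_eq with h2 | rfl
        · obtain ⟨k, hk⟩ := (htend.eventually (lt_mem_nhds h2)).exists
          exact (hu k).1 t' h1 hk.le
        · funext j
          have hc := hcont (s.T + S.tau s) j (by linarith) t' ⟨hT0.trans hmem.1, hmem.2⟩
          have ht : Tendsto u atTop (𝓝[Set.Icc 0 (s.T + S.tau s)] t') :=
            tendsto_nhdsWithin_iff.2 ⟨htend, Eventually.of_forall fun k =>
              ⟨hT0.trans (hu k).2.1, (hu k).2.2⟩⟩
          have l1 := hc.tendsto.comp ht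
          have l2 : Tendsto (fun k => (S.flow s (u k - s.T)).B j) atTop
              (𝓝 ((S.flow s (t' - s.T)).B j)) := by
            simp only [flow]
            exact ((htend.sub_const _).mul_const _).const_add _
          refine tendsto_nhds_unique l1 (l2.congr fun k => ?_)
          simp only [Function.comp]
          rw [(hu k).1 (u k) (hu k).2.1 le_rfl]
      · intro t' h1 h2
        have : t' = s.T := le_antisymm h2 h1
        subst this
        rw [hstart, sub_self, flow_zero hv.D_nonneg]
      · rintro t ⟨htA, ht1, ht2⟩ y hy
        have hbt := htA t ht1 le_rfl
        -- Beyond `t` only the continuity of `b` is available. It keeps the service clocks from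
        -- running out for a short time, which suffices to determine the rates.
        have ev : ∀ᶠ u in 𝓝[Set.Icc 0 (s.T + S.tau s)] t, ∀ j, b u j < s.B j + s.res (Sum.inr j) := by
          refine eventually_all.2 fun j => ?_
          refine (hcont _ j (by linarith) t ⟨hT0.trans ht1, ht2.le⟩).tendsto.eventually
            (gt_mem_nhds ?_)
          rw [hbt]
          have := mul_alloc_lt_res hS hblkres (show t - s.T < S.tau s by linarith) j
          simp only [flow]; linarith
        rw [eventually_nhdsWithin_iff, Metric.eventually_nhds_iff] at ev
        obtain ⟨ε, hε, hev⟩ := ev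
        obtain ⟨w, hw1, hw2⟩ : ∃ w, t < w ∧ w < min (min y (s.T + S.tau s)) (t + ε) :=
          exists_between (by simp only [lt_min_iff]; exact ⟨⟨hy, ht2⟩, by linarith⟩)
        simp only [lt_min_iff] at hw2
        have hwb : ∀ u, s.T ≤ u → u < w → ∀ j, s.B j ≤ b u j ∧
            b u j < s.B j + s.res (Sum.inr j) := by
          intro u hu1 hu2 j
          refine ⟨?_, ?_⟩
          · rw [← hstart]; exact hmono _ _ j hT0 hu1
          · rcases le_or_gt t u with h | h
            · refine hev ?_ ⟨hT0.trans hu1, by linarith⟩ j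
              rw [Real.dist_eq, abs_of_nonneg (by linarith)]; linarith
            · exact (hmono u t j (hT0.trans hu1) h.le).trans_lt
                (hev (by simpa using hε) ⟨hT0.trans ht1, ht2.le⟩ j)
        refine ⟨w, fun t' h1 h2 => ?_, hw1, hw2.1.1.le⟩
        funext j
        have hi := (integral_of_eq_const (g := fun u =>
          S.pathRate (fun t => S.pathQueue x t (b t)) u j) (c := S.alloc s j) h1
          fun u hu1 hu2 => (hrate w hw2.1.2.le hwb hu1 (by linarith)).2 j).2
        rw [hsub s.T t' j hT0 h1, hi, hstart]
        rfl
    intro t h1 h2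
    exact hA ⟨h1, h2⟩ t h1 le_rfl

/-! ### The path that the chain generates -/

/-- No explosion: during a bounded time each clock has a bounded local time. Its partial sums
diverge, so it uses boundedly many variables, whereas every event uses one more. -/
theorem tendsto_T (hS : S.Good) {x : Clk J → ℕ → ℝ} (hx : ∀ k l, 0 < x k l)
    (hsum : ∀ k, Tendsto (fun n => ∑ l ∈ Finset.range n, x k l) atTop atTop) :
    Tendsto (fun n => (S.chain x n).T) atTop atTop := by
  refine (tendsto_atTop_atTop_of_monotone (T_mono hS hx)) fun M => ?_
  by_contra hcon
  push Not at hcon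
  have hM : 0 ≤ M := (T_nonneg hS hx 0).trans (hcon 0).le
  set bmax : ℝ := ∑ z, ∑ j, S.b0 z j with hbmax
  have hle : ∀ z j, S.b0 z j ≤ bmax := fun z j =>
    (Finset.single_le_sum (f := S.b0 z) (fun j _ => (hS.b0_pos z j).le) (Finset.mem_univ j)).trans
      (Finset.single_le_sum (f := fun z => ∑ j, S.b0 z j)
        (fun z _ => Finset.sum_nonneg fun j _ => (hS.b0_pos z j).le) (Finset.mem_univ z))
  have hbmax0 : 0 ≤ bmax := Finset.sum_nonneg fun z _ =>
    Finset.sum_nonneg fun j _ => (hS.b0_pos z j).le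
  have hspeed : ∀ s k, S.speed s k ≤ 1 + bmax := by
    intro s k
    cases k with
    | inl j => simp [speed, hbmax0]
    | inr j =>
      simp only [speed, Sum.elim_inr, alloc]
      split_ifs
      · linarith
      · linarith [hle (S.z s) j]
  have hel : ∀ n k, el (S.chain x n) k ≤ (1 + bmax) * (S.chain x n).T := by
    intro n k
    induction n with
    | zero => cases k <;> simp [chain, init, el]
    | succ n ih =>
      have h1 : el (S.chain x (n + 1)) k =
          el (S.chain x n) k + S.tau (S.chain x n) * S.speed (S.chain x n) k := by
        rw [← el_flow]; cases k <;> rfl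
      have h2 := mul_le_mul_of_nonneg_left (hspeed (S.chain x n) k)
        (tau_nonneg hS (valid_chain hS hx n).res_nonneg)
      rw [h1, chain_succ_T]
      nlinarith
  have hcnt : ∀ k, ∃ N, ∀ n, (S.chain x n).cnt k ≤ N := by
    intro k
    obtain ⟨N, hN⟩ := ((hsum k).eventually_gt_atTop ((1 + bmax) * M)).exists_forall_of_atTop
    refine ⟨N + 1, fun n => ?_⟩
    rcases (accounts_chain hS hx n k).2 with ⟨h0, -⟩ | ⟨m, hm, hle⟩
    · omega
    · rw [hm]
      by_contra hlt
      have h1 := hN m (by omega)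
      have h2 := hel n k
      have h3 : (1 + bmax) * (S.chain x n).T ≤ (1 + bmax) * M :=
        mul_le_mul_of_nonneg_left (hcon n).le (by linarith)
      have h4 := hS.Υ_nonneg k
      linarith
  choose N hN using hcnt
  have htot : ∀ n, ∑ k, (S.chain x n).cnt k = ∑ k, S.c0 k + n := by
    intro n
    induction n with
    | zero => rfl
    | succ n ih =>
      have : (S.chain x (n + 1)).cnt = Function.update (S.chain x n).cnt (S.pick (S.chain x n))
        ((S.chain x n).cnt (S.pick (S.chain x n)) + 1) := rfl
      rw [this, Finset.sum_update_of_mem (Finset.mem_univ _), ← add_assoc, ← ih,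
        ← Finset.add_sum_erase Finset.univ _ (Finset.mem_univ (S.pick (S.chain x n))),
        Finset.sdiff_singleton_eq_erase]
      ring
  have h1 := htot (∑ k, N k + 1)
  have h2 : ∑ k, (S.chain x (∑ k, N k + 1)).cnt k ≤ ∑ k, N k := Finset.sum_le_sum fun k _ => hN k _
  omega

theorem exists_interval {x : Clk J → ℕ → ℝ}
    (hT : Tendsto (fun n => (S.chain x n).T) atTop atTop) {t : ℝ} (ht : 0 ≤ t) :
    ∃ m, (S.chain x m).T ≤ t ∧ t < (S.chain x (m + 1)).T := by
  classical
  have hex : ∃ n, t < (S.chain x n).T := (hT.eventually_gt_atTop t).exists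
  have hpos : Nat.find hex ≠ 0 := by
    intro h0
    have := Nat.find_spec hex
    rw [h0] at this
    exact absurd this (not_lt.2 ht)
  obtain ⟨m, hm⟩ := Nat.exists_eq_succ_of_ne_zero hpos
  refine ⟨m, not_lt.1 (Nat.find_min hex (by omega)), ?_⟩
  have := Nat.find_spec hex
  rwa [hm] at this

theorem interval_unique (hS : S.Good) {x : Clk J → ℕ → ℝ} (hx : ∀ k l, 0 < x k l) {t : ℝ}
    {m n : ℕ} (hm₁ : (S.chain x m).T ≤ t) (hm₂ : t < (S.chain x (m + 1)).T)
    (hn₁ : (S.chain x n).T ≤ t) (hn₂ : t < (S.chain x (n + 1)).T) : m = n := by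
  by_contra hne
  rcases lt_or_gt_of_ne hne with h | h
  · exact absurd ((T_mono hS hx (Nat.succ_le_of_lt h)).trans hn₁) (not_le.2 hm₂)
  · exact absurd ((T_mono hS hx (Nat.succ_le_of_lt h)).trans hm₁) (not_le.2 hn₂)

/-- The cumulative allocation of the chain at time `t`. -/
def chainAlloc (S : Sys J) (x : Clk J → ℕ → ℝ) (t : ℝ) (j : Fin J) : ℝ :=
  (∑' m, (Set.Ici (S.chain x m).T ∩ Set.Iio (S.chain x (m + 1)).T).indicator
    (fun t => ENNReal.ofReal ((S.flow (S.chain x m) (t - (S.chain x m).T)).B j)) t).toReal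

theorem measurable_chainAlloc {α : Type*} [MeasurableSpace α] {x : α → Clk J → ℕ → ℝ}
    (hx : ∀ k l, Measurable fun a => x a k l) (t : ℝ) (j : Fin J) :
    Measurable fun a => S.chainAlloc (x a) t j := by
  refine (Measurable.tsum fun m => ?_).ennreal_toReal
  have hm := S.measurable_chain hx m
  have hT := State.measurable_T.comp hm
  have hT' := State.measurable_T.comp (S.measurable_chain hx (m + 1))
  have hset : MeasurableSet {a | (S.chain (x a) m).T ≤ t ∧ t < (S.chain (x a) (m + 1)).T} :=
    (measurableSet_le hT measurable_const).inter (measurableSet_lt measurable_const hT')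
  have hf : Measurable fun a =>
      ENNReal.ofReal ((S.flow (S.chain (x a) m) (t - (S.chain (x a) m).T)).B j) :=
    ((State.measurable_B_apply j).comp (S.measurable_flow.comp
      (hm.prodMk (measurable_const.sub hT)))).ennreal_ofReal
  exact Measurable.ite hset hf measurable_const

theorem B_nonneg (hS : S.Good) {x : Clk J → ℕ → ℝ} (hx : ∀ k l, 0 < x k l) (n : ℕ) (j : Fin J) :
    0 ≤ (S.chain x n).B j := by
  induction n with
  | zero => exact le_rfl
  | succ n ih =>
    exact add_nonneg ih (mul_nonneg (tau_nonneg hS (valid_chain hS hx n).res_nonneg)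
      (alloc_nonneg hS _ j))

theorem chainAlloc_eq (hS : S.Good) {x : Clk J → ℕ → ℝ} (hx : ∀ k l, 0 < x k l) {t : ℝ} {m : ℕ}
    (h₁ : (S.chain x m).T ≤ t) (h₂ : t < (S.chain x (m + 1)).T) :
    S.chainAlloc x t = (S.flow (S.chain x m) (t - (S.chain x m).T)).B := by
  funext j
  rw [chainAlloc, tsum_eq_single m]
  · rw [Set.indicator_of_mem (show t ∈ Set.Ici (S.chain x m).T ∩
      Set.Iio (S.chain x (m + 1)).T from ⟨h₁, h₂⟩), ENNReal.toReal_ofReal]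
    exact add_nonneg (B_nonneg hS hx m j) (mul_nonneg (sub_nonneg.2 h₁) (alloc_nonneg hS _ j))
  · intro n hn
    refine Set.indicator_of_notMem (fun hmem => hn ?_) _
    exact interval_unique hS hx hmem.1 hmem.2 h₁ h₂

/-- Events without elapsed time do not change the cumulative allocation, which makes it well defined
at instants with several events. -/
theorem B_eq_of_T_eq (hS : S.Good) {x : Clk J → ℕ → ℝ} (hx : ∀ k l, 0 < x k l) {m n : ℕ}
    (hmn : m ≤ n) (h : (S.chain x n).T = (S.chain x m).T) :
    (S.chain x n).B = (S.chain x m).B := by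
  induction n, hmn using Nat.le_induction with
  | base => rfl
  | succ n hmn ih =>
    have h1 := T_mono hS hx hmn
    have h2 := tau_nonneg hS (valid_chain hS hx n).res_nonneg
    rw [chain_succ_T] at h
    simp only at h1
    have h3 : S.tau (S.chain x n) = 0 := by linarith
    rw [← ih (by linarith)]
    funext j
    change (S.chain x n).B j + S.tau (S.chain x n) * _ = _
    rw [h3, zero_mul, add_zero]

theorem onPath_chainAlloc (hS : S.Good) {x : Clk J → ℕ → ℝ} (hx : ∀ k l, 0 < x k l)
    (hT : Tendsto (fun n => (S.chain x n).T) atTop atTop) (n : ℕ) :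
    S.OnPath x (S.chainAlloc x) n := by
  intro m _ t h1 h2
  rcases h2.lt_or_eq with h2 | h2
  · exact chainAlloc_eq hS hx h1 h2
  -- At the right endpoint the path is read off from the last event `m'` of that instant, which may
  -- come after `m + 1`.
  · obtain ⟨m', hm1, hm2⟩ := exists_interval hT ((T_nonneg hS hx m).trans h1)
    rw [chainAlloc_eq hS hx hm1 hm2]
    have hle : m + 1 ≤ m' := by
      by_contra hlt
      have h3 : (S.chain x (m' + 1)).T ≤ (S.chain x (m + 1)).T :=
        T_mono hS hx (show m' + 1 ≤ m + 1 by omega)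
      linarith
    have he : (S.chain x m').T = (S.chain x (m + 1)).T :=
      le_antisymm (by rw [← h2]; exact hm1) (T_mono hS hx hle)
    have hB := B_eq_of_T_eq hS hx hle he
    have e1 : t - (S.chain x m').T = 0 := by rw [he, h2, sub_self]
    have e2 : t - (S.chain x m).T = S.tau (S.chain x m) := by
      rw [h2, chain_succ_T, add_sub_cancel_left]
    rw [e1, e2, flow_zero (valid_chain hS hx m').D_nonneg, hB]
    rfl

/-- Existence of the allocation: between events the chain uses exactly the rate that the policy
prescribes along the path generated by the chain, and the integrals over the intervals add up. -/
theorem integral_chainAlloc (hS : S.Good) {x : Clk J → ℕ → ℝ} (hx : ∀ k l, 0 < x k l)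
    (hT : Tendsto (fun n => (S.chain x n).T) atTop atTop) {t : ℝ} (j : Fin J) (ht : 0 ≤ t) :
    IntervalIntegrable (fun s => S.pathRate (fun t => S.pathQueue x t (S.chainAlloc x t)) s j)
      volume 0 t ∧
    S.chainAlloc x t j =
      ∫ s in (0 : ℝ)..t, S.pathRate (fun t => S.pathQueue x t (S.chainAlloc x t)) s j := by
  set g := fun s => S.pathRate (fun t => S.pathQueue x t (S.chainAlloc x t)) s j with hg
  have hpath := onPath_chainAlloc hS hx hT
  have seg : ∀ n t, (S.chain x n).T ≤ t → t ≤ (S.chain x (n + 1)).T →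
      IntervalIntegrable g volume (S.chain x n).T t ∧
      ∫ u in (S.chain x n).T..t, g u = (t - (S.chain x n).T) * S.alloc (S.chain x n) j := by
    intro n t h1 h2
    refine integral_of_eq_const h1 fun u hu1 hu2 => ?_
    obtain ⟨f, hf⟩ := phaseBefore_chain hS hx n (hpath n)
    refine (pathRate_eq hS hx (hpath n) le_rfl (fun v hv1 hv2 i => ?_) hu1
      (hu2.trans_le h2)).2 j
    rw [chainAlloc_eq hS hx hv1 hv2]
    rw [chain_succ_T] at hv2
    have := mul_nonneg (sub_nonneg.2 hv1) (alloc_nonneg hS (S.chain x n) i)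
    have := mul_alloc_lt_res hS (s := S.chain x n) (fun i => (hf i).2.2.2.2)
      (show v - (S.chain x n).T < S.tau (S.chain x n) by linarith) i
    constructor <;> simp only [flow] <;> linarith
  have main : ∀ n, IntervalIntegrable g volume 0 (S.chain x n).T ∧
      ∫ u in (0 : ℝ)..(S.chain x n).T, g u = (S.chain x n).B j := by
    intro n
    induction n with
    | zero =>
      change IntervalIntegrable g volume 0 0 ∧ ∫ u in (0 : ℝ)..0, g u = 0
      simp
    | succ n ih =>
      obtain ⟨s1, s2⟩ := seg n (S.chain x (n + 1)).T (T_mono hS hx (Nat.le_succ n)) le_rfl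
      refine ⟨ih.1.trans s1, ?_⟩
      rw [← intervalIntegral.integral_add_adjacent_intervals ih.1 s1, ih.2, s2, chain_succ_T,
        add_sub_cancel_left]
      rfl
  obtain ⟨m, hm1, hm2⟩ := exists_interval hT ht
  obtain ⟨s1, s2⟩ := seg m t hm1 hm2.le
  refine ⟨(main m).1.trans s1, ?_⟩
  rw [← intervalIntegral.integral_add_adjacent_intervals (main m).1 s1, (main m).2, s2,
    chainAlloc_eq hS hx hm1 hm2]
  rfl

/-- The queue lengths under an allocation that follows the chain. -/
theorem pathQueue_of_integral (hS : S.Good) {x : Clk J → ℕ → ℝ} (hx : ∀ k l, 0 < x k l)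
    {b : ℝ → Fin J → ℝ}
    (hb : ∀ t j, 0 ≤ t →
      IntervalIntegrable (fun s => S.pathRate (fun t => S.pathQueue x t (b t)) s j) volume 0 t ∧
      b t j = ∫ s in (0 : ℝ)..t, S.pathRate (fun t => S.pathQueue x t (b t)) s j)
    {t : ℝ} {m : ℕ} (h₁ : (S.chain x m).T ≤ t) (h₂ : t < (S.chain x (m + 1)).T) :
    S.pathQueue x t (b t) = S.Q (S.chain x m) := by
  have hpath := onPath_of_integral hS hx hb
  obtain ⟨f, hf⟩ := phaseBefore_chain hS hx m (hpath m)
  refine (pathRate_eq hS hx (hpath m) le_rfl (fun v hv1 hv2 i => ?_) h₁ h₂).1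
  rw [hpath (m + 1) m (Nat.lt_succ_self m) v hv1 hv2.le]
  rw [chain_succ_T] at hv2
  have := mul_nonneg (sub_nonneg.2 hv1) (alloc_nonneg hS (S.chain x m) i)
  have := mul_alloc_lt_res hS (s := S.chain x m) (fun i => (hf i).2.2.2.2)
    (show v - (S.chain x m).T < S.tau (S.chain x m) by linarith) i
  constructor <;> simp only [flow] <;> linarith

end Sys
variable {J : ℕ}

namespace Sys

variable {S : Sys J} [NeZero J]

/-! ### The chain driven by independent variables -/

theorem measurable_step : Measurable fun p : State J × ℝ => S.step p.1 p.2 := by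
  intro A hA
  have : (fun p : State J × ℝ => S.step p.1 p.2) ⁻¹' A = ⋃ k : Clk J,
      {p : State J × ℝ | S.pick p.1 = k} ∩
        (fun p : State J × ℝ => S.jump (S.flow p.1 (S.tau p.1)) k p.2) ⁻¹' A := by
    ext p
    simp [step]
  rw [this]
  refine MeasurableSet.iUnion fun k => (measurable_fst (S.measurableSet_pick k)).inter ?_
  exact ((S.measurable_jump k).comp (((S.measurable_flow.comp (measurable_id.prodMk
    S.measurable_tau)).comp measurable_fst).prodMk measurable_snd)) hA

section Engine

variable {Ω : Type*} [MeasurableSpace Ω] {P : Measure Ω} [IsProbabilityMeasure P]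
  {X : Clk J → ℕ → Ω → ℝ} {μ : Clk J → Measure ℝ}

/-- The next variable of the clock that is picked is independent of the past. -/
theorem lintegral_pick (hX : ∀ k l, Measurable (X k l))
    (hind : iIndepFun (fun p : Clk J × ℕ => X p.1 p.2) P) (hμ : ∀ k l, P.map (X k l) = μ k)
    (n : ℕ) {F : State J × ℝ → ℝ≥0∞} (hF : Measurable F) :
    ∫⁻ ω, F (S.chain (fun k l => X k l ω) n,
        X (S.pick (S.chain (fun k l => X k l ω) n))
          ((S.chain (fun k l => X k l ω) n).cnt (S.pick (S.chain (fun k l => X k l ω) n))) ω) ∂P =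
      ∫⁻ ω, ∫⁻ y, F (S.chain (fun k l => X k l ω) n, y)
        ∂μ (S.pick (S.chain (fun k l => X k l ω) n)) ∂P := by
  classical
  have hprob : ∀ k, IsProbabilityMeasure (μ k) := fun k => by
    rw [← hμ k 0]; exact Measure.isProbabilityMeasure_map (hX k 0).aemeasurable
  have hchain : Measurable fun ω => S.chain (fun k l => X k l ω) n :=
    S.measurable_chain (x := fun ω k l => X k l ω) hX n
  let E : (Clk J → ℕ) × Clk J → Set (State J) := fun p => {s | s.cnt = p.1 ∧ S.pick s = p.2}
  have hE : ∀ p, MeasurableSet (E p) := fun p =>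
    (State.measurable_cnt (Set.to_countable {p.1}).measurableSet).inter (S.measurableSet_pick p.2)
  let E' : (Clk J → ℕ) × Clk J → Set Ω := fun p =>
    (fun ω => S.chain (fun k l => X k l ω) n) ⁻¹' E p
  have hE' : ∀ p, MeasurableSet (E' p) := fun p => hchain (hE p)
  have hdisj : Pairwise (Function.onFun Disjoint E') := by
    intro p p' hne
    refine Set.disjoint_left.2 fun ω h1 h2 => hne ?_
    exact Prod.ext (h1.1.symm.trans h2.1) (h1.2.symm.trans h2.2)
  have hunion : ⋃ p, E' p = Set.univ :=
    Set.eq_univ_of_forall fun ω => Set.mem_iUnion.2 ⟨(_, _), rfl, rfl⟩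
  -- Partition by the counts and the picked clock. On each of these countably many pieces the index
  -- of the next variable is deterministic.
  rw [← setLIntegral_univ, ← setLIntegral_univ (μ := P) (fun ω => ∫⁻ y, _ ∂_), ← hunion,
    lintegral_iUnion hE' hdisj, lintegral_iUnion hE' hdisj]
  refine tsum_congr fun p => ?_
  obtain ⟨c, k⟩ := p
  -- the variables used before the event
  let I : Finset (Clk J × ℕ) :=
    (Finset.univ ×ˢ Finset.range (∑ k, c k + 1)).filter fun p => p.2 < c p.1
  have hI : ∀ p, p ∈ I ↔ p.2 < c p.1 := by
    intro p
    simp only [I, Finset.mem_filter, Finset.mem_product, Finset.mem_univ, true_and,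
      Finset.mem_range, and_iff_right_iff_imp]
    intro h
    have := Finset.single_le_sum (f := c) (fun _ _ => Nat.zero_le _) (Finset.mem_univ p.1)
    omega
  -- The value `1` stands in for the variables that have not been used; any other would do.
  let ext : (I → ℝ) → Clk J → ℕ → ℝ := fun w k l => if h : (k, l) ∈ I then w ⟨(k, l), h⟩ else 1
  have hext : ∀ k l, Measurable fun w => ext w k l := by
    intro k l
    by_cases h : (k, l) ∈ I
    · simpa [ext, h] using measurable_pi_apply (⟨(k, l), h⟩ : I)
    · simp [ext, h]
  let past : Ω → State J := fun ω => S.chain (ext fun p => X p.1.1 p.1.2 ω) n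
  have hpast : Measurable past :=
    (S.measurable_chain (x := ext) hext n).comp
      (measurable_pi_iff.2 fun p : I => hX p.1.1 p.1.2)
  have hagree : ∀ ω l m, m < c l → ext (fun p => X p.1.1 p.1.2 ω) l m = X l m ω := by
    intro ω l m h
    have : (l, m) ∈ I := (hI _).2 h
    simp [ext, this]
  have h1 : ∀ ω, ω ∈ E' (c, k) → S.chain (fun k l => X k l ω) n = past ω := by
    intro ω hω
    refine (chain_congr n fun l m hm => ?_).symm
    have hc : (S.chain (fun k l => X k l ω) n).cnt = c := hω.1
    rw [hc] at hm
    exact (hagree ω l m hm).symm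
  -- The piece itself is an event of the past: by `chain_congr` in either direction, the true and
  -- the truncated variables lead to the same state.
  have h2 : ∀ ω, ω ∈ E' (c, k) ↔ past ω ∈ E (c, k) := by
    intro ω
    constructor
    · intro hω
      rw [← h1 ω hω]; exact hω
    · intro hω
      have : S.chain (fun k l => X k l ω) n = past ω := by
        refine chain_congr n fun l m hm => ?_
        have hc : (past ω).cnt = c := hω.1
        change m < (past ω).cnt l at hm
        rw [hc] at hm
        exact hagree ω l m hm
      change S.chain (fun k l => X k l ω) n ∈ E (c, k)
      rw [this]; exact hω
  have hindep : IndepFun past (X k (c k)) P := by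
    have := hind.indepFun_finset I {(k, c k)} (by
      rw [Finset.disjoint_singleton_right, hI]; simp) (fun p => hX p.1 p.2)
    exact this.comp (φ := fun w => S.chain (ext w) n)
      (ψ := fun w : ({(k, c k)} : Finset (Clk J × ℕ)) → ℝ => w ⟨(k, c k), by simp⟩)
      (S.measurable_chain (x := ext) hext n) (measurable_pi_apply _)
  let G : State J × ℝ → ℝ≥0∞ := (E (c, k) ×ˢ Set.univ).indicator F
  have hG : Measurable G := hF.indicator ((hE _).prod MeasurableSet.univ)
  have hGE : ∀ s ∈ E (c, k), ∀ y, G (s, y) = F (s, y) := fun s hs y =>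
    Set.indicator_of_mem (show (s, y) ∈ E (c, k) ×ˢ Set.univ from ⟨hs, Set.mem_univ _⟩) _
  have hGE' : ∀ s, s ∉ E (c, k) → ∀ y, G (s, y) = 0 := fun s hs y =>
    Set.indicator_of_notMem (fun h : (s, y) ∈ E (c, k) ×ˢ Set.univ => hs h.1) _
  have e1 : ∫⁻ ω in E' (c, k), F (S.chain (fun k l => X k l ω) n,
        X (S.pick (S.chain (fun k l => X k l ω) n))
          ((S.chain (fun k l => X k l ω) n).cnt (S.pick (S.chain (fun k l => X k l ω) n))) ω) ∂P =
      ∫⁻ ω, G (past ω, X k (c k) ω) ∂P := by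
    rw [← lintegral_indicator (hE' _)]
    refine lintegral_congr fun ω => ?_
    by_cases hω : ω ∈ E' (c, k)
    · rw [Set.indicator_of_mem hω, hGE _ ((h2 ω).1 hω), h1 ω hω]
      have h3 := (h2 ω).1 hω
      have h4 : (past ω).cnt = c := h3.1
      have h5 : S.pick (past ω) = k := h3.2
      rw [h5, h4]
    · rw [Set.indicator_of_notMem hω, hGE' _ fun h => hω ((h2 ω).2 h)]
  have e2 : ∫⁻ ω in E' (c, k), ∫⁻ y, F (S.chain (fun k l => X k l ω) n, y)
        ∂μ (S.pick (S.chain (fun k l => X k l ω) n)) ∂P =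
      ∫⁻ ω, ∫⁻ y, G (past ω, y) ∂μ k ∂P := by
    rw [← lintegral_indicator (hE' _)]
    refine lintegral_congr fun ω => ?_
    by_cases hω : ω ∈ E' (c, k)
    · rw [Set.indicator_of_mem hω, h1 ω hω]
      have h5 : S.pick (past ω) = k := ((h2 ω).1 hω).2
      rw [h5]
      exact lintegral_congr fun y => (hGE _ ((h2 ω).1 hω) y).symm
    · rw [Set.indicator_of_notMem hω]
      simp [hGE' _ fun h => hω ((h2 ω).2 h)]
  rw [e1, e2]
  have hmap := (indepFun_iff_map_prod_eq_prod_map_map hpast.aemeasurable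
    (hX k (c k)).aemeasurable).1 hindep
  have : IsProbabilityMeasure (P.map past) :=
    Measure.isProbabilityMeasure_map hpast.aemeasurable
  rw [← lintegral_map (f := G) (g := fun ω => (past ω, X k (c k) ω)) hG
    (hpast.prodMk (hX k (c k))), hmap, hμ, lintegral_prod _ hG.aemeasurable,
    lintegral_map hG.lintegral_prod_right' hpast]

/-- Exponential decay of the mean of a Lyapunov function. -/
theorem lyapunov (hS : S.Good) (hX : ∀ k l, Measurable (X k l))
    (hind : iIndepFun (fun p : Clk J × ℕ => X p.1 p.2) P) (hμ : ∀ k l, P.map (X k l) = μ k)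
    (hpos : ∀ᵐ ω ∂P, ∀ k l, 0 < X k l ω)
    {V : State J → ℝ≥0∞} (hV : Measurable V) {δ b : ℝ} (hδ : 0 < δ) (hb : 0 ≤ b)
    (hflow : ∀ s, S.Valid s → ∀ h, 0 ≤ h → h ≤ S.tau s → V (S.flow s h) ≤
      ENNReal.ofReal (Real.exp (-δ * h)) * V s +
        ENNReal.ofReal (b / δ * (1 - Real.exp (-δ * h))))
    (hjump : ∀ s, S.Valid s →
      ∫⁻ y, V (S.step s y) ∂μ (S.pick s) ≤ V (S.flow s (S.tau s))) {t : ℝ} (ht : 0 ≤ t) :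
    ∑' m, ∫⁻ ω, ({ω | (S.chain (fun k l => X k l ω) m).T ≤ t ∧
        t < (S.chain (fun k l => X k l ω) (m + 1)).T}).indicator
      (fun ω => V (S.flow (S.chain (fun k l => X k l ω) m)
        (t - (S.chain (fun k l => X k l ω) m).T))) ω ∂P ≤
      ENNReal.ofReal (Real.exp (-δ * t)) * ∫⁻ ω, V (S.init fun k l => X k l ω) ∂P +
        ENNReal.ofReal (b / δ) := by
  have hprob : ∀ k, IsProbabilityMeasure (μ k) := fun k => by
    rw [← hμ k 0]; exact Measure.isProbabilityMeasure_map (hX k 0).aemeasurable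
  set s : ℕ → Ω → State J := fun n ω => S.chain (fun k l => X k l ω) n with hs
  have hsm : ∀ n, Measurable (s n) := fun n =>
    S.measurable_chain (x := fun ω k l => X k l ω) hX n
  have hvalid : ∀ᵐ ω ∂P, ∀ n, S.Valid (s n ω) := by
    filter_upwards [hpos] with ω hω n using valid_chain hS hω n
  -- `v s h` is the value at time `h` of the solution of `v' = -δ v + b` that starts from `V s`.
  set v : State J → ℝ → ℝ≥0∞ := fun s h => ENNReal.ofReal (Real.exp (-δ * h)) * V s +
    ENNReal.ofReal (b / δ * (1 - Real.exp (-δ * h))) with hv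
  have hbδ : 0 ≤ b / δ := div_nonneg hb hδ.le
  have hexp : ∀ h, 0 ≤ h → 0 ≤ 1 - Real.exp (-δ * h) := fun h hh => by
    rw [sub_nonneg]; exact Real.exp_le_one_iff.2 (by nlinarith)
  have hvm : Measurable fun p : State J × ℝ => v p.1 p.2 := by
    have he : Measurable fun p : State J × ℝ => Real.exp (-δ * p.2) :=
      Real.measurable_exp.comp (measurable_snd.const_mul _)
    exact (he.ennreal_ofReal.mul (hV.comp measurable_fst)).add
      ((he.const_sub 1).const_mul _).ennreal_ofReal
  -- semigroup property of the bound
  have hvv : ∀ W h h', 0 ≤ h → 0 ≤ h' → ENNReal.ofReal (Real.exp (-δ * h')) *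
      (ENNReal.ofReal (Real.exp (-δ * h)) * W + ENNReal.ofReal (b / δ * (1 - Real.exp (-δ * h)))) +
      ENNReal.ofReal (b / δ * (1 - Real.exp (-δ * h'))) =
      ENNReal.ofReal (Real.exp (-δ * (h + h'))) * W +
      ENNReal.ofReal (b / δ * (1 - Real.exp (-δ * (h + h')))) := by
    intro W h h' hh hh'
    rw [mul_add, ← mul_assoc, ← ENNReal.ofReal_mul (Real.exp_pos _).le, add_assoc,
      ← ENNReal.ofReal_mul (Real.exp_pos _).le, ← ENNReal.ofReal_add
        (mul_nonneg (Real.exp_pos _).le (mul_nonneg hbδ (hexp h hh)))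
        (mul_nonneg hbδ (hexp h' hh')), ← Real.exp_add]
    have e : -δ * h' + -δ * h = -δ * (h + h') := by ring
    have e' : Real.exp (-δ * (h + h')) = Real.exp (-δ * h') * Real.exp (-δ * h) := by
      rw [← Real.exp_add, e]
    rw [e]
    congr 2
    rw [e']; ring
  -- `a m` collects the paths for which `t` lies between the events `m` and `m + 1`. `R m` bounds
  -- what is still open after event `m`. One step of the chain gives `a m + R (m + 1) ≤ R m`, and
  -- the sum telescopes.
  set a : ℕ → ℝ≥0∞ := fun m => ∫⁻ ω, ({ω | (s m ω).T ≤ t ∧ t < (s (m + 1) ω).T}).indicator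
      (fun ω => V (S.flow (s m ω) (t - (s m ω).T))) ω ∂P with ha
  set R : ℕ → ℝ≥0∞ := fun m => ∫⁻ ω, ({ω | (s m ω).T ≤ t}).indicator
      (fun ω => v (s m ω) (t - (s m ω).T)) ω ∂P with hR
  have hmT : ∀ m, Measurable fun ω => (s m ω).T := fun m => State.measurable_T.comp (hsm m)
  have ham : ∀ m, Measurable (({ω | (s m ω).T ≤ t ∧ t < (s (m + 1) ω).T}).indicator
      (fun ω => V (S.flow (s m ω) (t - (s m ω).T)))) := fun m =>
    (hV.comp (S.measurable_flow.comp ((hsm m).prodMk (measurable_const.sub (hmT m))))).indicator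
      ((measurableSet_le (hmT m) measurable_const).inter
        (measurableSet_lt measurable_const (hmT (m + 1))))
  have hstep : ∀ n, a n + R (n + 1) ≤ R n := by
    intro n
    let F : State J × ℝ → ℝ≥0∞ := ({p | p.1.T + S.tau p.1 ≤ t}).indicator
      (fun p => v (S.step p.1 p.2) (t - (p.1.T + S.tau p.1)))
    have hTτ : Measurable fun p : State J × ℝ => p.1.T + S.tau p.1 :=
      ((State.measurable_T.add S.measurable_tau).comp measurable_fst :)
    have hF : Measurable F :=
      (hvm.comp (measurable_step.prodMk (measurable_const.sub hTτ))).indicator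
        (measurableSet_le hTτ measurable_const)
    have hR1 : R (n + 1) = ∫⁻ ω, ∫⁻ y, F (s n ω, y) ∂μ (S.pick (s n ω)) ∂P := by
      rw [← lintegral_pick hX hind hμ n hF]
      rfl
    rw [hR1, ha, ← lintegral_add_left (ham n)]
    refine lintegral_mono_ae ?_
    filter_upwards [hvalid] with ω hω
    have hval := hω n
    have hτ := tau_nonneg hS hval.res_nonneg
    have hT1 : (s (n + 1) ω).T = (s n ω).T + S.tau (s n ω) := rfl
    by_cases h1 : (s n ω).T + S.tau (s n ω) ≤ t
    · have n1 : ω ∉ {ω | (s n ω).T ≤ t ∧ t < (s (n + 1) ω).T} := by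
        intro hmem
        have := hmem.2
        rw [hT1] at this
        exact absurd h1 (not_le.2 this)
      have m1 : ω ∈ {ω | (s n ω).T ≤ t} := by
        change (s n ω).T ≤ t; linarith
      rw [Set.indicator_of_notMem n1, zero_add, Set.indicator_of_mem m1]
      have hFy : ∀ y, F (s n ω, y) = v (S.step (s n ω) y) (t - ((s n ω).T + S.tau (s n ω))) :=
        fun y => Set.indicator_of_mem
          (show (s n ω, y) ∈ {p : State J × ℝ | p.1.T + S.tau p.1 ≤ t} from h1) _
      simp only [hFy, hv]
      have hVm : Measurable fun y => V (S.step (s n ω) y) :=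
        hV.comp (measurable_step.comp (measurable_const.prodMk measurable_id))
      rw [lintegral_add_right _ measurable_const, lintegral_const_mul _ hVm, lintegral_const,
        measure_univ, mul_one]
      have e : t - (s n ω).T = S.tau (s n ω) + (t - ((s n ω).T + S.tau (s n ω))) := by ring
      rw [e, ← hvv _ _ _ hτ (by linarith)]
      gcongr
      exact (hjump _ hval).trans (hflow _ hval _ hτ le_rfl)
    · have hFy : ∀ y, F (s n ω, y) = 0 :=
        fun y => Set.indicator_of_notMem
          (show (s n ω, y) ∉ {p : State J × ℝ | p.1.T + S.tau p.1 ≤ t} from h1) _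
      simp only [hFy, lintegral_zero, add_zero]
      by_cases h2 : (s n ω).T ≤ t
      · rw [Set.indicator_of_mem (show ω ∈ {ω | (s n ω).T ≤ t ∧ t < (s (n + 1) ω).T} from
          ⟨h2, by rw [hT1]; exact not_le.1 h1⟩), Set.indicator_of_mem (show ω ∈ {ω | (s n ω).T ≤ t}
            from h2)]
        exact hflow _ hval _ (by linarith) (by linarith)
      · rw [Set.indicator_of_notMem (show ω ∉ {ω | (s n ω).T ≤ t ∧ t < (s (n + 1) ω).T} from
          fun hmem => h2 hmem.1)]
        exact zero_le
  have hsum : ∀ n, ∑ m ∈ Finset.range n, a m + R n ≤ R 0 := by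
    intro n
    induction n with
    | zero => simp
    | succ n ih =>
      rw [Finset.sum_range_succ, add_assoc]
      exact (add_le_add le_rfl (hstep n)).trans ih
  have hR0 : R 0 ≤ ENNReal.ofReal (Real.exp (-δ * t)) * ∫⁻ ω, V (S.init fun k l => X k l ω) ∂P +
        ENNReal.ofReal (b / δ) := by
    have hm0 : Measurable fun ω => V (S.init fun k l => X k l ω) := hV.comp (hsm 0)
    have : R 0 = ∫⁻ ω, (ENNReal.ofReal (Real.exp (-δ * t)) * V (S.init fun k l => X k l ω) +
        ENNReal.ofReal (b / δ * (1 - Real.exp (-δ * t)))) ∂P := by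
      refine lintegral_congr fun ω => ?_
      have h0 : (s 0 ω).T = 0 := rfl
      rw [Set.indicator_of_mem (show ω ∈ {ω | (s 0 ω).T ≤ t} from ht)]
      simp only [hv, h0, sub_zero]
      rfl
    rw [this, lintegral_add_right _ measurable_const, lintegral_const_mul _ hm0, lintegral_const,
      measure_univ, mul_one]
    gcongr
    have := (Real.exp_pos (-δ * t)).le
    nlinarith
  refine le_trans ?_ hR0
  exact ENNReal.tsum_le_of_sum_range_le fun n => le_self_add.trans (hsum n)

end Engine

end Sys
/-! ### Laws with exponential moments -/

/-- Laws of positive random variables with a bound `M` on the moment generating function at `y₀`. -/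
structure Tame (ν : Measure ℝ) (y₀ M : ℝ) : Prop where
  prob : IsProbabilityMeasure ν
  pos : ∀ᵐ y ∂ν, 0 < y
  mgf_le : ∫⁻ y, ENNReal.ofReal (Real.exp (y₀ * y)) ∂ν ≤ ENNReal.ofReal M

/-- Taylor's formula with a remainder for both signs of `x`, since arrivals and services need tilts
in opposite directions. -/
theorem exp_le_quadratic (x : ℝ) : Real.exp x ≤ 1 + x + x ^ 2 * Real.exp |x| := by
  have h := Complex.norm_exp_sub_sum_le_norm_mul_exp (x : ℂ) 2
  have e : Complex.exp x - ∑ m ∈ Finset.range 2, (x : ℂ) ^ m / m.factorial =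
      ((Real.exp x - (1 + x) : ℝ) : ℂ) := by
    simp [Finset.sum_range_succ]
  rw [e, Complex.norm_real, Complex.norm_real, Real.norm_eq_abs, Real.norm_eq_abs, sq_abs] at h
  linarith [(abs_le.1 h).2]

namespace Tame

variable {ν : Measure ℝ} {y₀ M : ℝ}

theorem integrable_exp (h : Tame ν y₀ M) {θ : ℝ} (hθ : θ ≤ y₀) :
    Integrable (fun y => Real.exp (θ * y)) ν := by
  have h0 : Integrable (fun y => Real.exp (y₀ * y)) ν := by
    refine ⟨by fun_prop, ?_⟩
    rw [hasFiniteIntegral_iff_ofReal (Eventually.of_forall fun y => (Real.exp_pos _).le)]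
    exact h.mgf_le.trans_lt ENNReal.ofReal_lt_top
  refine h0.mono' (by fun_prop) ?_
  filter_upwards [h.pos] with y hy
  rw [Real.norm_eq_abs, abs_of_pos (Real.exp_pos _)]
  exact Real.exp_le_exp.2 (mul_le_mul_of_nonneg_right hθ hy.le)

theorem integral_exp_le (h : Tame ν y₀ M) (hM : 0 ≤ M) :
    ∫ y, Real.exp (y₀ * y) ∂ν ≤ M := by
  rw [integral_eq_lintegral_of_nonneg_ae (Eventually.of_forall fun y => (Real.exp_pos _).le)
    (by fun_prop)]
  exact ENNReal.toReal_le_of_le_ofReal hM h.mgf_le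

theorem integrable_id (h : Tame ν y₀ M) (hy₀ : 0 < y₀) : Integrable (fun y : ℝ => y) ν := by
  refine ((h.integrable_exp le_rfl).const_mul (1 / y₀)).mono' (by fun_prop) ?_
  filter_upwards [h.pos] with y hy
  rw [Real.norm_eq_abs, abs_of_pos hy]
  have := Real.add_one_le_exp (y₀ * y)
  rw [div_mul_eq_mul_div, le_div_iff₀ hy₀]
  linarith

/-- One half of the exponent `y₀` controls `exp |θ * y|`, the other half absorbs `y ^ 2`; hence the
restriction to `|θ| ≤ y₀ / 2`. -/
theorem mgf_le_quadratic (h : Tame ν y₀ M) (hy₀ : 0 < y₀) (hM : 0 ≤ M) {θ : ℝ}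
    (hθ : |θ| ≤ y₀ / 2) :
    ∫ y, Real.exp (θ * y) ∂ν ≤ 1 + θ * ∫ y, y ∂ν + 8 / y₀ ^ 2 * M * θ ^ 2 := by
  have := h.prob
  have hle : θ ≤ y₀ := (le_abs_self θ).trans (by linarith)
  have hi1 : Integrable (fun y : ℝ => 1 + θ * y) ν :=
    (integrable_const 1).add ((h.integrable_id hy₀).const_mul θ)
  have hi2 : Integrable (fun y => 8 / y₀ ^ 2 * θ ^ 2 * Real.exp (y₀ * y)) ν :=
    (h.integrable_exp le_rfl).const_mul _
  have key : ∀ᵐ y ∂ν, Real.exp (θ * y) ≤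
      1 + θ * y + 8 / y₀ ^ 2 * θ ^ 2 * Real.exp (y₀ * y) := by
    filter_upwards [h.pos] with y hy
    refine (exp_le_quadratic (θ * y)).trans (add_le_add le_rfl ?_)
    have e1 : Real.exp |θ * y| ≤ Real.exp (y₀ / 2 * y) := by
      rw [abs_mul, abs_of_pos hy]
      exact Real.exp_le_exp.2 (mul_le_mul_of_nonneg_right hθ hy.le)
    -- The inequality `u ^ 2 / 2 ≤ exp u` at `u = y₀ / 2 * y` gives the factor `8 / y₀ ^ 2`.
    have e2 : y ^ 2 ≤ 8 / y₀ ^ 2 * Real.exp (y₀ / 2 * y) := by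
      have := Real.quadratic_le_exp_of_nonneg (show 0 ≤ y₀ / 2 * y by positivity)
      rw [div_mul_eq_mul_div, le_div_iff₀ (by positivity)]
      nlinarith [mul_pos hy₀ hy]
    have e3 : Real.exp (y₀ * y) = Real.exp (y₀ / 2 * y) * Real.exp (y₀ / 2 * y) := by
      rw [← Real.exp_add]; ring_nf
    calc (θ * y) ^ 2 * Real.exp |θ * y| ≤ (θ * y) ^ 2 * Real.exp (y₀ / 2 * y) := by gcongr
      _ = θ ^ 2 * y ^ 2 * Real.exp (y₀ / 2 * y) := by ring
      _ ≤ θ ^ 2 * (8 / y₀ ^ 2 * Real.exp (y₀ / 2 * y)) * Real.exp (y₀ / 2 * y) := by gcongr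
      _ = _ := by rw [e3]; ring
  calc ∫ y, Real.exp (θ * y) ∂ν
      ≤ ∫ y, (1 + θ * y + 8 / y₀ ^ 2 * θ ^ 2 * Real.exp (y₀ * y)) ∂ν :=
        integral_mono_ae (h.integrable_exp hle) (hi1.add hi2) key
    _ = 1 + θ * ∫ y, y ∂ν + 8 / y₀ ^ 2 * θ ^ 2 * ∫ y, Real.exp (y₀ * y) ∂ν := by
        rw [integral_add hi1 hi2, integral_add (integrable_const 1)
          ((h.integrable_id hy₀).const_mul θ), integral_const_mul, integral_const_mul]
        simp
    _ ≤ 1 + θ * ∫ y, y ∂ν + 8 / y₀ ^ 2 * θ ^ 2 * M := by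
        gcongr
        exact h.integral_exp_le hM
    _ = _ := by ring

end Tame

/-- Estimates for the moment generating functions of the variables of the clocks, whose means are
the inverses of the rates `rt k`. -/
structure ExpBounds {ι : Type*} (μ : ι → Measure ℝ) (rt : ι → ℝ) (k₀ θ₁ : ℝ) : Prop where
  prob : ∀ k, IsProbabilityMeasure (μ k)
  pos : ∀ k, ∀ᵐ y ∂μ k, 0 < y
  rt_pos : ∀ k, 0 < rt k
  k₀_nonneg : 0 ≤ k₀
  θ₁_pos : 0 < θ₁
  small : k₀ * θ₁ ≤ 1 / 2
  integrable_id : ∀ k, Integrable (fun y : ℝ => y) (μ k)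
  mean : ∀ k, ∫ y, y ∂μ k = (rt k)⁻¹
  integrable_exp : ∀ k θ, θ ≤ θ₁ → Integrable (fun y : ℝ => Real.exp (θ * y)) (μ k)
  mgf : ∀ k θ, |θ| ≤ θ₁ → ∫ y, Real.exp (θ * y) ∂μ k ≤ 1 + θ / rt k + k₀ * θ ^ 2
  integrable_tilt : ∀ k θ, |θ| ≤ θ₁ →
    Integrable (fun y : ℝ => Real.exp (θ * (1 - rt k * (1 + k₀ * θ) * y))) (μ k)
  tilt : ∀ k θ, |θ| ≤ θ₁ → ∫ y, Real.exp (θ * (1 - rt k * (1 + k₀ * θ) * y)) ∂μ k ≤ 1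

/-- With the slope `rt` the mean of `exp (θ * (1 - rt * y))` may exceed `1` by a multiple of `θ ^
2`. Changing the slope to `rt * (1 + k₀ * θ)` pays for this excess. The constants depend only on the
moment bound and a bound for the rates, hence not on `r`. -/
theorem exists_expBounds (y₀ M amax : ℝ) (hy₀ : 0 < y₀) (hM : 0 ≤ M) (hamax : 0 < amax) :
    ∃ k₀ θ₁, 0 ≤ k₀ ∧ 0 < θ₁ ∧ ∀ {ι : Type} (μ : ι → Measure ℝ) (rt : ι → ℝ),
      (∀ k, Tame (μ k) y₀ M) → (∀ k, 0 < rt k) → (∀ k, rt k ≤ amax) →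
      (∀ k, ∫ y, y ∂μ k = (rt k)⁻¹) → ExpBounds μ rt k₀ θ₁ := by
  set K := 8 / y₀ ^ 2 * M with hK
  have hK0 : 0 ≤ K := by positivity
  -- `K` is the second-order coefficient of the moment generating functions. A tilted exponent has
  -- size at most `2 * amax * |θ|`, which costs `4 * K * amax ^ 2 * θ ^ 2`.
  set k₀ := K + 4 * K * amax ^ 2 with hk₀
  have hk₀' : 0 ≤ k₀ := by positivity
  set θ₁ := min (min (y₀ / 2) (y₀ / (4 * amax))) (1 / (2 * (k₀ + 1))) with hθ₁
  have hθ1 : θ₁ ≤ y₀ / 2 := (min_le_left _ _).trans (min_le_left _ _)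
  have hθ2 : θ₁ ≤ y₀ / (4 * amax) := (min_le_left _ _).trans (min_le_right _ _)
  have hθ3 : θ₁ ≤ 1 / (2 * (k₀ + 1)) := min_le_right _ _
  have hθpos : 0 < θ₁ := by positivity
  have hsmall : k₀ * θ₁ ≤ 1 / 2 := by
    rw [le_div_iff₀ (by positivity)] at hθ3
    nlinarith
  refine ⟨k₀, θ₁, hk₀', hθpos, fun μ rt hT h0 h1 hm => ?_⟩
  -- the exponent of the tilted variables
  have hφ : ∀ k θ, |θ| ≤ θ₁ → |θ * rt k * (1 + k₀ * θ)| ≤ y₀ / 2 ∧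
      (θ * rt k * (1 + k₀ * θ)) ^ 2 ≤ 4 * amax ^ 2 * θ ^ 2 := by
    intro k θ hθ
    have hkθ : |k₀ * θ| ≤ 1 / 2 := by
      rw [abs_mul, abs_of_nonneg hk₀']
      exact (mul_le_mul_of_nonneg_left hθ hk₀').trans hsmall
    have h2 : |1 + k₀ * θ| ≤ 2 := by
      have := abs_le.1 hkθ
      exact abs_le.2 ⟨by linarith, by linarith⟩
    have h3 : |θ * rt k * (1 + k₀ * θ)| ≤ |θ| * amax * 2 := by
      rw [abs_mul, abs_mul, abs_of_pos (h0 k)]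
      gcongr
      exact h1 k
    constructor
    · refine h3.trans ?_
      have : |θ| * (4 * amax) ≤ y₀ := (le_div_iff₀ (by positivity)).1 (hθ.trans hθ2)
      linarith
    · rw [← sq_abs]
      calc |θ * rt k * (1 + k₀ * θ)| ^ 2 ≤ (|θ| * amax * 2) ^ 2 := by gcongr
        _ = _ := by rw [mul_pow, mul_pow, sq_abs]; ring
  have hsplit : ∀ k θ (y : ℝ), Real.exp (θ * (1 - rt k * (1 + k₀ * θ) * y)) =
      Real.exp θ * Real.exp (-(θ * rt k * (1 + k₀ * θ)) * y) := by
    intro k θ y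
    rw [← Real.exp_add]; ring_nf
  refine ⟨fun k => (hT k).prob, fun k => (hT k).pos, h0, hk₀', hθpos, hsmall,
    fun k => (hT k).integrable_id hy₀, hm, fun k θ hθ => (hT k).integrable_exp (by linarith),
    fun k θ hθ => ?_, fun k θ hθ => ?_, fun k θ hθ => ?_⟩
  · refine ((hT k).mgf_le_quadratic hy₀ hM (hθ.trans hθ1)).trans ?_
    rw [hm, ← div_eq_mul_inv]
    gcongr
    rw [hk₀]
    have : 0 ≤ 4 * K * amax ^ 2 := by positivity
    linarith
  · simp only [hsplit]
    refine ((hT k).integrable_exp ?_).const_mul _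
    refine (le_abs_self _).trans ?_
    rw [abs_neg]
    linarith [(hφ k θ hθ).1]
  · simp only [hsplit]
    rw [integral_const_mul]
    have h4 := (hT k).mgf_le_quadratic hy₀ hM (θ := -(θ * rt k * (1 + k₀ * θ)))
      (by rw [abs_neg]; exact (hφ k θ hθ).1)
    rw [hm, ← hK] at h4
    have h5 : -(θ * rt k * (1 + k₀ * θ)) * (rt k)⁻¹ = -(θ * (1 + k₀ * θ)) := by
      field_simp [(h0 k).ne']
    rw [h5] at h4
    have h6 : K * (-(θ * rt k * (1 + k₀ * θ))) ^ 2 ≤ K * (4 * amax ^ 2 * θ ^ 2) := by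
      rw [neg_sq]
      exact mul_le_mul_of_nonneg_left (hφ k θ hθ).2 hK0
    -- Of the second-order terms only `-K * θ ^ 2` is left, so the mean is at most `1 - θ`.
    have h7 : ∫ y, Real.exp (-(θ * rt k * (1 + k₀ * θ)) * y) ∂μ k ≤ Real.exp (-θ) := by
      refine h4.trans (le_trans ?_ (Real.add_one_le_exp (-θ)))
      have : 0 ≤ K * θ ^ 2 := by positivity
      rw [hk₀]
      nlinarith
    calc Real.exp θ * ∫ y, Real.exp (-(θ * rt k * (1 + k₀ * θ)) * y) ∂μ k
        ≤ Real.exp θ * Real.exp (-θ) := by gcongr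
      _ = 1 := by rw [← Real.exp_add]; simp

/-! ### Functions of the state -/

variable {J : ℕ} {S : Sys J}

/-- `df` is the derivative of `f` along the flow. -/
structure HasDrift (S : Sys J) (f df : State J → ℝ) : Prop where
  cont : ∀ s, Continuous fun h => f (S.flow s h)
  deriv : ∀ s, (∀ j, 0 ≤ s.D j) → HasDerivWithinAt (fun h => f (S.flow s h)) (df s) (Set.Ici 0) 0

namespace HasDrift

variable {f g df dg : State J → ℝ}

theorem congr (hf : HasDrift S f df) (h : ∀ s, (∀ j, 0 ≤ s.D j) → dg s = df s) :
    HasDrift S f dg :=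
  ⟨hf.cont, fun s hs => by rw [h s hs]; exact hf.deriv s hs⟩

theorem const (c : ℝ) : HasDrift S (fun _ => c) (fun _ => 0) :=
  ⟨fun _ => continuous_const, fun _ _ => hasDerivWithinAt_const _ _ _⟩

theorem add (hf : HasDrift S f df) (hg : HasDrift S g dg) :
    HasDrift S (fun s => f s + g s) (fun s => df s + dg s) :=
  ⟨fun s => (hf.cont s).add (hg.cont s), fun s hs => (hf.deriv s hs).add (hg.deriv s hs)⟩

theorem const_mul (c : ℝ) (hf : HasDrift S f df) :
    HasDrift S (fun s => c * f s) (fun s => c * df s) :=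
  ⟨fun s => (hf.cont s).const_mul c, fun s hs => (hf.deriv s hs).const_mul c⟩

theorem sub (hf : HasDrift S f df) (hg : HasDrift S g dg) :
    HasDrift S (fun s => f s - g s) (fun s => df s - dg s) :=
  ⟨fun s => (hf.cont s).sub (hg.cont s), fun s hs => (hf.deriv s hs).sub (hg.deriv s hs)⟩

theorem mul (hf : HasDrift S f df) (hg : HasDrift S g dg) :
    HasDrift S (fun s => f s * g s) (fun s => df s * g s + f s * dg s) :=
  ⟨fun s => (hf.cont s).mul (hg.cont s), fun s hs => by
    have := (hf.deriv s hs).fun_mul (hg.deriv s hs)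
    simpa only [Sys.flow_zero hs] using this⟩

theorem exp (hf : HasDrift S f df) :
    HasDrift S (fun s => Real.exp (f s)) (fun s => Real.exp (f s) * df s) :=
  ⟨fun s => Real.continuous_exp.comp (hf.cont s), fun s hs => by
    have := (hf.deriv s hs).exp
    simpa only [Sys.flow_zero hs] using this⟩

theorem sum {ι : Type*} {t : Finset ι} {f df : ι → State J → ℝ}
    (h : ∀ i ∈ t, HasDrift S (f i) (df i)) :
    HasDrift S (fun s => ∑ i ∈ t, f i s) (fun s => ∑ i ∈ t, df i s) :=
  ⟨fun s => continuous_finsetSum _ fun i hi => (h i hi).cont s,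
    fun s hs => HasDerivWithinAt.fun_sum fun i hi => (h i hi).deriv s hs⟩

theorem ite {p : State J → Prop} [DecidablePred p] (hp : ∀ s h, p (S.flow s h) ↔ p s) (hf : HasDrift S f df)
    (hg : HasDrift S g dg) :
    HasDrift S (fun s => if p s then f s else g s) (fun s => if p s then df s else dg s) := by
  constructor
  · intro s
    by_cases h : p s
    · simpa [hp, h] using hf.cont s
    · simpa [hp, h] using hg.cont s
  · intro s hs
    by_cases h : p s
    · simpa [hp, h] using hf.deriv s hs
    · simpa [hp, h] using hg.deriv s hs

theorem Q (j : Fin J) : HasDrift S (fun s => S.Q s j) (fun _ => 0) :=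
  ⟨fun s => by simpa using continuous_const, fun s _ => by
    simpa using hasDerivWithinAt_const _ _ _⟩

theorem res (k : Clk J) : HasDrift S (fun s => s.res k) (fun s => -S.speed s k) := by
  constructor
  · intro s
    simp only [Sys.flow]
    fun_prop
  · intro s _
    simp only [Sys.flow]
    have := ((hasDerivAt_id (0 : ℝ)).mul_const (S.speed s k)).const_sub (s.res k)
    simpa using this.hasDerivWithinAt

-- At `D = 0` the cut-off has in general only a right derivative, which is why `HasDrift` uses
-- one-sided derivatives.
open Classical in
theorem D (hγ : 0 ≤ S.γ) (j : Fin J) : HasDrift S (fun s => s.D j)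
    (fun s => if S.Charged s j then S.chg else if 0 < s.D j then -S.γ else 0) := by
  constructor
  · intro s
    simp only [Sys.flow]
    by_cases h : S.Charged s j <;> simp only [h, if_true, if_false] <;> fun_prop
  · intro s hs
    simp only [Sys.flow]
    have hd : HasDerivAt (fun h : ℝ => s.D j - S.γ * h) (-S.γ) 0 := by
      simpa using ((hasDerivAt_id (0 : ℝ)).const_mul S.γ).const_sub (s.D j)
    by_cases h : S.Charged s j
    · simp only [h, if_true]
      have := ((hasDerivAt_id (0 : ℝ)).const_mul S.chg).const_add (s.D j)
      simpa using this.hasDerivWithinAt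
    · simp only [h, if_false]
      by_cases hD : 0 < s.D j
      · simp only [hD, if_true]
        refine (hd.congr_of_eventuallyEq ?_).hasDerivWithinAt
        have hc : Tendsto (fun h : ℝ => s.D j - S.γ * h) (𝓝 0) (𝓝 (s.D j - S.γ * 0)) :=
          hd.continuousAt.tendsto
        rw [mul_zero, sub_zero] at hc
        filter_upwards [hc.eventually (lt_mem_nhds hD)] with u hu
        rw [max_eq_left hu.le]
      · have h0 : s.D j = 0 := le_antisymm (not_lt.1 hD) (hs j)
        simp only [hD, if_false]
        refine (hasDerivWithinAt_const 0 _ (0 : ℝ)).congr (fun u hu => ?_) (by simp [h0])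
        rw [max_eq_right]
        rw [h0]
        nlinarith [show (0 : ℝ) ≤ u from hu]

variable [NeZero J]

/-- A drift inequality yields an exponential bound along the flow. -/
theorem le_of_drift_le (hS : S.Good) (hf : HasDrift S f df) {δ b : ℝ} (hδ : 0 < δ)
    (hdf : ∀ s, S.Valid s → df s ≤ -δ * f s + b) {s : State J} (hs : S.Valid s) {h : ℝ}
    (h0 : 0 ≤ h) (h1 : h ≤ S.tau s) :
    f (S.flow s h) ≤ Real.exp (-δ * h) * f s + b / δ * (1 - Real.exp (-δ * h)) := by
  have hmain := le_gronwallBound_of_liminf_deriv_right_le (f := fun h => f (S.flow s h))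
    (f' := fun h => df (S.flow s h)) (δ := f s) (K := -δ) (ε := b) (a := 0) (b := S.tau s)
    (hf.cont s).continuousOn ?_ (by simp [Sys.flow_zero hs.D_nonneg]) ?_ h ⟨h0, h1⟩
  · rw [gronwallBound_of_K_ne_0 (by linarith : -δ ≠ 0), sub_zero] at hmain
    refine hmain.trans (le_of_eq ?_)
    have : b / -δ = -(b / δ) := by rw [div_neg]
    rw [this]; ring
  · intro u hu r hr
    have hv := Sys.valid_flow hS hs hu.1 hu.2.le
    have hd := hf.deriv (S.flow s u) hv.D_nonneg
    -- By the semigroup property, the right derivative at `u` is the derivative at `0` of the flow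
    -- started from the state at `u`.
    have hd' : HasDerivWithinAt (fun h => f (S.flow s h)) (df (S.flow s u)) (Set.Ici u) u := by
      have hsub : HasDerivWithinAt (fun h : ℝ => h - u) 1 (Set.Ici u) u :=
        ((hasDerivAt_id u).sub_const u).hasDerivWithinAt
      have hd0 : HasDerivWithinAt (fun h => f (S.flow (S.flow s u) h)) (df (S.flow s u))
        (Set.Ici 0) (u - u) := by rw [sub_self]; exact hd
      have hcomp := HasDerivWithinAt.scomp (h := fun h : ℝ => h - u) u hd0 hsub
        (fun v (hv : u ≤ v) => show (0 : ℝ) ≤ v - u from sub_nonneg.2 hv)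
      rw [one_smul] at hcomp
      refine hcomp.congr (fun v hv => ?_) ?_
      · simp only [Function.comp]
        rw [Sys.flow_flow hS s (sub_nonneg.2 hv)]
        ring_nf
      · simp only [Function.comp]
        rw [Sys.flow_flow hS s (sub_nonneg.2 le_rfl)]
        ring_nf
    exact hd'.liminf_right_slope_le hr
  · intro u hu
    exact hdf _ (Sys.valid_flow hS hs hu.1 hu.2.le)

end HasDrift

/-- The mean of `f` does not increase at an event of a clock. -/
def SuperJump (S : Sys J) (μ : Clk J → Measure ℝ) (f : State J → ℝ) : Prop :=
  ∀ s, S.Valid s → ∀ k, s.res k = 0 → (∀ j, k = Sum.inr j → s.blk j = false) →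
    Integrable (fun y => f (S.jump s k y)) (μ k) ∧ ∫ y, f (S.jump s k y) ∂μ k ≤ f s

namespace SuperJump

variable {μ : Clk J → Measure ℝ} {f g : State J → ℝ}

theorem const (hμ : ∀ k, IsProbabilityMeasure (μ k)) (c : ℝ) : SuperJump S μ fun _ => c := by
  intro s _ k _ _
  have := hμ k
  exact ⟨integrable_const _, by simp⟩

theorem add (hf : SuperJump S μ f) (hg : SuperJump S μ g) :
    SuperJump S μ fun s => f s + g s := by
  intro s hs k hk hb
  obtain ⟨f1, f2⟩ := hf s hs k hk hb
  obtain ⟨g1, g2⟩ := hg s hs k hk hb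
  exact ⟨f1.add g1, by rw [integral_add f1 g1]; exact add_le_add f2 g2⟩

theorem const_mul (hf : SuperJump S μ f) {c : ℝ} (hc : 0 ≤ c) :
    SuperJump S μ fun s => c * f s := by
  intro s hs k hk hb
  obtain ⟨f1, f2⟩ := hf s hs k hk hb
  exact ⟨f1.const_mul c, by rw [integral_const_mul]; exact mul_le_mul_of_nonneg_left f2 hc⟩

theorem sum {ι : Type*} {t : Finset ι} {f : ι → State J → ℝ}
    (h : ∀ i ∈ t, SuperJump S μ (f i)) : SuperJump S μ fun s => ∑ i ∈ t, f i s := by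
  intro s hs k hk hb
  refine ⟨integrable_finsetSum _ fun i hi => (h i hi s hs k hk hb).1, ?_⟩
  rw [integral_finsetSum _ fun i hi => (h i hi s hs k hk hb).1]
  exact Finset.sum_le_sum fun i hi => (h i hi s hs k hk hb).2

end SuperJump

variable {J : ℕ} {S : Sys J} {μ : Clk J → Measure ℝ} {rt : Clk J → ℝ} {k₀ θ₁ : ℝ}

/-! ### Exponential and linear functions of the workload -/

open Classical in
/-- Derivative of `D` along the flow. -/
def dD (S : Sys J) (s : State J) (j : Fin J) : ℝ :=
  if S.Charged s j then S.chg else if 0 < s.D j then -S.γ else 0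

theorem hasDrift_D (hS : S.Good) (j : Fin J) : HasDrift S (fun s => s.D j) (fun s => dD S s j) :=
  HasDrift.D hS.γ_nonneg j

theorem dD_of_charged {s : State J} {j : Fin J} (h : S.Charged s j) : dD S s j = S.chg := by
  simp [dD, h]

theorem neg_γ_le_dD (hS : S.Good) (s : State J) (j : Fin J) : -S.γ ≤ dD S s j := by
  have h1 := hS.γ_nonneg
  have h2 := hS.chg_nonneg
  unfold dD
  split_ifs <;> linarith

theorem dD_nonpos_of_not_charged (hS : S.Good) {s : State J} {j : Fin J} (h : ¬ S.Charged s j) :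
    dD S s j ≤ 0 := by
  have h1 := hS.γ_nonneg
  unfold dD
  rw [if_neg h]
  split_ifs <;> linarith

/-- A weighted sum of the queue lengths, corrected by the residual times with factors `p`. -/
def corrected (S : Sys J) (w : Fin J → ℝ) (p : Clk J → ℝ) (s : State J) : ℝ :=
  ∑ j, w j * (S.Q s j - p (Sum.inl j) * s.res (Sum.inl j) + p (Sum.inr j) * s.res (Sum.inr j))

theorem hasDrift_corrected (w : Fin J → ℝ) (p : Clk J → ℝ) :
    HasDrift S (corrected S w p)
      (fun s => ∑ j, w j * (p (Sum.inl j) - p (Sum.inr j) * S.alloc s j)) := by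
  refine (HasDrift.sum fun j _ => (((HasDrift.Q j).sub ((HasDrift.res (Sum.inl j)).const_mul
    (p (Sum.inl j)))).add ((HasDrift.res (Sum.inr j)).const_mul (p (Sum.inr j)))).const_mul
    (w j)).congr fun s _ => Finset.sum_congr rfl fun j _ => ?_
  simp only [Sys.speed, Sum.elim_inl, Sum.elim_inr]
  ring

/-- At the event the residual time jumps from `0` to `y`, so the unit change of the queue is
accompanied by the compensator `p * y`, and nothing else changes. -/
theorem corrected_jump_inl (w : Fin J → ℝ) (p : Clk J → ℝ) {s : State J} {i : Fin J}
    (h : s.res (Sum.inl i) = 0) (y : ℝ) :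
    corrected S w p (S.jump s (Sum.inl i) y) =
      corrected S w p s + w i * (1 - p (Sum.inl i) * y) := by
  rw [← sub_eq_iff_eq_add', corrected, corrected, ← Finset.sum_sub_distrib,
    Finset.sum_eq_single i]
  · rw [Sys.Q_jump_inl]; simp [h]; ring
  · intro j _ hj
    rw [Sys.Q_jump_inl]; simp [hj]
  · simp

theorem corrected_jump_inr (w : Fin J → ℝ) (p : Clk J → ℝ) {s : State J} {i : Fin J}
    (h : s.res (Sum.inr i) = 0) (y : ℝ) :
    corrected S w p (S.jump s (Sum.inr i) y) =
      corrected S w p s + -w i * (1 - p (Sum.inr i) * y) := by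
  rw [← sub_eq_iff_eq_add', corrected, corrected, ← Finset.sum_sub_distrib,
    Finset.sum_eq_single i]
  · rw [Sys.Q_jump_inr]; simp [h]; ring
  · intro j _ hj
    rw [Sys.Q_jump_inr]; simp [hj]
  · simp

/-- The factors that make `exp (corrected …)` a supermartingale at the events. -/
def tiltFactor (rt : Clk J → ℝ) (k₀ : ℝ) (w : Fin J → ℝ) : Clk J → ℝ :=
  Sum.elim (fun j => rt (Sum.inl j) * (1 + k₀ * w j)) (fun j => rt (Sum.inr j) * (1 - k₀ * w j))

/-- The exponential of the corrected workload less a multiple of the variables `D`. -/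
def expWork (S : Sys J) (rt : Clk J → ℝ) (k₀ : ℝ) (w v : Fin J → ℝ) (s : State J) : ℝ :=
  Real.exp (corrected S w (tiltFactor rt k₀ w) s - ∑ j, v j * s.D j)

/-- An arrival multiplies the exponential by the tilt factor with `θ = w i`, a service by the one
with `θ = -w i`; `ExpBounds.tilt` covers both. -/
theorem superJump_expWork (hE : ExpBounds μ rt k₀ θ₁) {w v : Fin J → ℝ} (hw : ∀ j, |w j| ≤ θ₁) :
    SuperJump S μ (expWork S rt k₀ w v) := by
  intro s _ k hk _
  have key : ∃ θ, |θ| ≤ θ₁ ∧ ∀ y, expWork S rt k₀ w v (S.jump s k y) =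
      expWork S rt k₀ w v s * Real.exp (θ * (1 - rt k * (1 + k₀ * θ) * y)) := by
    cases k with
    | inl i =>
      refine ⟨w i, hw i, fun y => ?_⟩
      rw [expWork, expWork, corrected_jump_inl _ _ hk, ← Real.exp_add, Sys.jump_D,
        show tiltFactor rt k₀ w (Sum.inl i) = rt (Sum.inl i) * (1 + k₀ * w i) from rfl]
      congr 1
      ring
    | inr i =>
      refine ⟨-w i, by rw [abs_neg]; exact hw i, fun y => ?_⟩
      rw [expWork, expWork, corrected_jump_inr _ _ hk, ← Real.exp_add, Sys.jump_D,
        show tiltFactor rt k₀ w (Sum.inr i) = rt (Sum.inr i) * (1 - k₀ * w i) from rfl]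
      congr 1
      ring
  obtain ⟨θ, hθ, hy⟩ := key
  simp only [hy]
  refine ⟨(hE.integrable_tilt k θ hθ).const_mul _, ?_⟩
  rw [integral_const_mul]
  exact mul_le_of_le_one_right (Real.exp_pos _).le (hE.tilt k θ hθ)

theorem hasDrift_expWork (hS : S.Good) (w v : Fin J → ℝ) :
    HasDrift S (expWork S rt k₀ w v) (fun s => expWork S rt k₀ w v s *
      (∑ j, w j * (rt (Sum.inl j) * (1 + k₀ * w j) -
        rt (Sum.inr j) * (1 - k₀ * w j) * S.alloc s j) - ∑ j, v j * dD S s j)) :=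
  ((hasDrift_corrected w (tiltFactor rt k₀ w)).sub
    (HasDrift.sum fun j _ => (hasDrift_D hS j).const_mul (v j))).exp

/-- With the slopes `rt` the increments have mean `0`, so there is equality at the events whatever
the signs of the weights. The Lyapunov function uses nonpositive ones. -/
theorem superJump_corrected (hE : ExpBounds μ rt k₀ θ₁) (w : Fin J → ℝ) :
    SuperJump S μ (corrected S w rt) := by
  intro s _ k hk _
  have := hE.prob
  have key : ∃ θ, ∀ y, corrected S w rt (S.jump s k y) =
      corrected S w rt s + θ * (1 - rt k * y) := by
    cases k with
    | inl i => exact ⟨w i, fun y => corrected_jump_inl _ _ hk y⟩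
    | inr i => exact ⟨-w i, fun y => corrected_jump_inr _ _ hk y⟩
  obtain ⟨θ, hy⟩ := key
  simp only [hy]
  have hi : Integrable (fun y => θ * (1 - rt k * y)) (μ k) :=
    ((integrable_const 1).sub ((hE.integrable_id k).const_mul _)).const_mul _
  refine ⟨(integrable_const _).add hi, le_of_eq ?_⟩
  rw [integral_add (integrable_const _) hi, integral_const_mul, integral_sub (integrable_const _)
    ((hE.integrable_id k).const_mul _), integral_const_mul, hE.mean,
    mul_inv_cancel₀ (hE.rt_pos k).ne']
  simp

/-! ### Exponential functions of the residual times -/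

/-- The slope for which `exp (η R) - κ R` is a supermartingale at the events. -/
def resSlope (rt : Clk J → ℝ) (k₀ η : ℝ) (k : Clk J) : ℝ := η + rt k * k₀ * η ^ 2

/-- An exponential function of a residual time, damped by `D`. -/
def expRes (rt : Clk J → ℝ) (k₀ η ζ : ℝ) (k : Clk J) (s : State J) : ℝ :=
  Real.exp (-ζ * s.D (typ k)) * (Real.exp (η * s.res k) - resSlope rt k₀ η k * s.res k)

/-- A fresh variable has mean `1 / rt k`, so the linear term with slope `resSlope` removes exactly
the bound for the excess of the mean of `exp (η * y)` over `1`, the value at residual time `0`. -/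
theorem superJump_expRes (hE : ExpBounds μ rt k₀ θ₁) {η : ℝ} (hη₀ : 0 ≤ η) (hη : η ≤ θ₁) (ζ : ℝ)
    (k : Clk J) : SuperJump S μ (expRes rt k₀ η ζ k) := by
  intro s _ l hl _
  have hprob := hE.prob
  by_cases hkl : k = l
  · subst hkl
    have hi := ((hE.integrable_exp k η hη).sub
      ((hE.integrable_id k).const_mul (resSlope rt k₀ η k))).const_mul
      (Real.exp (-ζ * s.D (typ k)))
    simp only [expRes, Sys.jump_D, Sys.jump_res, Function.update_self]
    refine ⟨hi, ?_⟩
    rw [integral_const_mul, hl]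
    refine mul_le_mul_of_nonneg_left ?_ (Real.exp_pos _).le
    rw [integral_sub (hE.integrable_exp k η hη) ((hE.integrable_id k).const_mul _),
      integral_const_mul, hE.mean]
    have h1 := hE.mgf k η (by rwa [abs_of_nonneg hη₀])
    have h2 : resSlope rt k₀ η k * (rt k)⁻¹ = η / rt k + k₀ * η ^ 2 := by
      unfold resSlope
      field_simp [(hE.rt_pos k).ne']
    rw [h2]
    simp
    linarith
  · simp only [expRes, Sys.jump_D, Sys.jump_res, Function.update_of_ne hkl]
    exact ⟨integrable_const _, by simp⟩

theorem hasDrift_expRes (hS : S.Good) (η ζ : ℝ) (k : Clk J) :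
    HasDrift S (expRes rt k₀ η ζ k) (fun s => -ζ * dD S s (typ k) * expRes rt k₀ η ζ k s -
      Real.exp (-ζ * s.D (typ k)) * S.speed s k *
        (η * Real.exp (η * s.res k) - resSlope rt k₀ η k)) := by
  refine ((((hasDrift_D hS (typ k)).const_mul (-ζ)).exp).mul
    ((((HasDrift.res k).const_mul η).exp).sub ((HasDrift.res k).const_mul _))).congr fun s _ => ?_
  simp only [expRes]
  ring

variable {J : ℕ} {S : Sys J} {μ : Clk J → Measure ℝ} {rt : Clk J → ℝ} {k₀ θ₁ : ℝ}

/-! ### A potential for the blocked time of a type -/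

/-- Constants of the potential for the blocked time. -/
structure BlockConst where
  lam : ℝ
  e₁ : ℝ
  a₂ : ℝ
  A : ℝ
  M : ℝ
  G : ℝ

/-- The potential of an unblocked type without its factor `exp (ζ D)`. -/
def openPot (S : Sys J) (rt : Clk J → ℝ) (k₀ : ℝ) (c : BlockConst) (j : Fin J) (s : State J) : ℝ :=
  1 + c.A * Real.exp (-c.lam * (S.Q s j - S.L - rt (Sum.inl j) * (1 - k₀ * c.lam) * s.res (Sum.inl j)
      + rt (Sum.inr j) * (1 + k₀ * c.lam) * s.res (Sum.inr j))) +
    c.A * c.M * Real.exp (-c.lam * (S.U - S.L)) *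
      (Real.exp (c.lam * (rt (Sum.inl j) * (1 - k₀ * c.lam)) * s.res (Sum.inl j)) -
        rt (Sum.inl j) * (Real.exp c.lam - 1) * s.res (Sum.inl j))

/-- The potential of a blocked type. -/
def closedPot (S : Sys J) (c : BlockConst) (j : Fin J) (s : State J) : ℝ :=
  2 * Real.exp (c.e₁ * (s.res (Sum.inl j) + c.a₂ * (S.U + 1 - S.Q s j)))

/-- The potential of a type that waits for its first arrival. -/
def waitPot (c : BlockConst) (j : Fin J) (s : State J) : ℝ :=
  c.G * Real.exp (c.e₁ * s.res (Sum.inl j))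

open Classical in
/-- The potential of a type. -/
def pot (S : Sys J) (rt : Clk J → ℝ) (k₀ : ℝ) (c : BlockConst) (j : Fin J) (s : State J) : ℝ :=
  if S.Waiting s j then waitPot c j s
  else if s.blk j = true then closedPot S c j s else openPot S rt k₀ c j s

/-- The potential with the factor `exp (ζ D)`. -/
def blockPot (S : Sys J) (rt : Clk J → ℝ) (k₀ : ℝ) (c : BlockConst) (ζ : ℝ) (j : Fin J)
    (s : State J) : ℝ := Real.exp (ζ * s.D j) * pot S rt k₀ c j s

/-- Requirements on the constants of the potential. -/
structure BlockConst.Ok (c : BlockConst) (S : Sys J) (rt : Clk J → ℝ) (k₀ θ₁ ζ d₁ b₁ : ℝ) :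
    Prop where
  lam_pos : 0 < c.lam
  lam_le : c.lam ≤ θ₁
  lam_small : k₀ * c.lam ≤ 1 / 4
  exp_lam : Real.exp c.lam - 1 ≤ 3 / 2 * c.lam
  e₁_pos : 0 < c.e₁
  e₁_le : c.e₁ ≤ θ₁
  e₁_le' : ∀ j, c.e₁ ≤ c.lam * (rt (Sum.inl j) * (1 - k₀ * c.lam))
  a₂_ge : ∀ k, (rt k)⁻¹ + k₀ * θ₁ ≤ c.a₂
  a₂_le : Real.exp (c.e₁ * (c.a₂ * (S.U + 2))) ≤ 2
  A_ge : 4 * Real.exp c.lam ≤ c.A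
  M_ge : ∀ j, 2 * (b₁ + d₁) ≤ c.M * (rt (Sum.inl j) * (1 - k₀ * c.lam))
  G_ge : 9 + c.A * (1 + c.M) * Real.exp c.lam ≤ c.G
  exit : c.A * (1 + c.M) * Real.exp (-c.lam * (S.U - S.L)) * Real.exp c.lam ≤ 1
  M_nonneg : 0 ≤ c.M
  ζ_nonneg : 0 ≤ ζ
  e₁_ge : ζ * (S.chg + 1) ≤ c.e₁
  rate_band : ∀ z j, z j = true → rt (Sum.inr j) * (1 + k₀ * c.lam) * S.b0 z j ≤
    rt (Sum.inl j) * (1 - k₀ * c.lam) - d₁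
  rate_top : ∀ z j, rt (Sum.inr j) * (1 + k₀ * c.lam) * S.b0 z j ≤ b₁

namespace BlockConst.Ok

variable {c : BlockConst} {ζ d₁ b₁ : ℝ}

theorem A_pos (h : c.Ok S rt k₀ θ₁ ζ d₁ b₁) : 0 < c.A :=
  lt_of_lt_of_le (by positivity) h.A_ge

theorem a₂_nonneg (h : c.Ok S rt k₀ θ₁ ζ d₁ b₁) (hE : ExpBounds μ rt k₀ θ₁) (j : Fin J) :
    0 ≤ c.a₂ := by
  have h1 := h.a₂_ge (Sum.inl j)
  have h2 := inv_nonneg.2 (hE.rt_pos (Sum.inl j)).le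
  have h3 := mul_nonneg hE.k₀_nonneg hE.θ₁_pos.le
  linarith

theorem alpha_pos (h : c.Ok S rt k₀ θ₁ ζ d₁ b₁) (hE : ExpBounds μ rt k₀ θ₁) (j : Fin J) :
    0 < rt (Sum.inl j) * (1 - k₀ * c.lam) :=
  mul_pos (hE.rt_pos _) (by linarith [h.lam_small])

theorem beta_nonneg (h : c.Ok S rt k₀ θ₁ ζ d₁ b₁) (hE : ExpBounds μ rt k₀ θ₁) (j : Fin J) :
    0 ≤ rt (Sum.inr j) * (1 + k₀ * c.lam) :=
  mul_nonneg (hE.rt_pos _).le (by have := mul_nonneg hE.k₀_nonneg h.lam_pos.le; linarith)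

/-- The linear term in the potential is dominated by the exponential one. -/
theorem linear_le (h : c.Ok S rt k₀ θ₁ ζ d₁ b₁) (hE : ExpBounds μ rt k₀ θ₁) (j : Fin J) {x : ℝ}
    (hx : 0 ≤ x) : rt (Sum.inl j) * (Real.exp c.lam - 1) * x ≤
      Real.exp (c.lam * (rt (Sum.inl j) * (1 - k₀ * c.lam)) * x) := by
  have h1 : rt (Sum.inl j) * (Real.exp c.lam - 1) * x ≤
      2 * (c.lam * (rt (Sum.inl j) * (1 - k₀ * c.lam)) * x) := by
    have h2 : Real.exp c.lam - 1 ≤ 2 * (c.lam * (1 - k₀ * c.lam)) := by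
      nlinarith [h.exp_lam, h.lam_small, h.lam_pos]
    have h3 := mul_le_mul_of_nonneg_left h2 (mul_nonneg (hE.rt_pos (Sum.inl j)).le hx)
    nlinarith
  set u := c.lam * (rt (Sum.inl j) * (1 - k₀ * c.lam)) * x with hu
  have hu0 : 0 ≤ u := mul_nonneg (mul_nonneg h.lam_pos.le (h.alpha_pos hE j).le) hx
  have h4 := Real.quadratic_le_exp_of_nonneg hu0
  nlinarith [sq_nonneg (u - 1)]

theorem integrable_lam (h : c.Ok S rt k₀ θ₁ ζ d₁ b₁) (hE : ExpBounds μ rt k₀ θ₁) (j : Fin J) :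
    Integrable (fun y => Real.exp (c.lam * (rt (Sum.inl j) * (1 - k₀ * c.lam)) * y))
      (μ (Sum.inl j)) ∧
    ∫ y, Real.exp (c.lam * (rt (Sum.inl j) * (1 - k₀ * c.lam)) * y) ∂μ (Sum.inl j) ≤
      Real.exp c.lam := by
  have hθ : |(-c.lam)| ≤ θ₁ := by rw [abs_neg, abs_of_pos h.lam_pos]; exact h.lam_le
  have e : ∀ y, Real.exp (c.lam * (rt (Sum.inl j) * (1 - k₀ * c.lam)) * y) =
      Real.exp c.lam *
        Real.exp (-c.lam * (1 - rt (Sum.inl j) * (1 + k₀ * -c.lam) * y)) := by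
    intro y; rw [← Real.exp_add]; ring_nf
  simp only [e]
  refine ⟨(hE.integrable_tilt _ _ hθ).const_mul _, ?_⟩
  rw [integral_const_mul]
  exact mul_le_of_le_one_right (Real.exp_pos _).le (hE.tilt _ _ hθ)

theorem integrable_lam' (h : c.Ok S rt k₀ θ₁ ζ d₁ b₁) (hE : ExpBounds μ rt k₀ θ₁) (j : Fin J) :
    Integrable (fun y => Real.exp (-c.lam * (rt (Sum.inr j) * (1 + k₀ * c.lam)) * y))
      (μ (Sum.inr j)) ∧
    ∫ y, Real.exp (-c.lam * (rt (Sum.inr j) * (1 + k₀ * c.lam)) * y) ∂μ (Sum.inr j) ≤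
      Real.exp (-c.lam) := by
  have hθ : |c.lam| ≤ θ₁ := by rw [abs_of_pos h.lam_pos]; exact h.lam_le
  have e : ∀ y, Real.exp (-c.lam * (rt (Sum.inr j) * (1 + k₀ * c.lam)) * y) =
      Real.exp (-c.lam) *
        Real.exp (c.lam * (1 - rt (Sum.inr j) * (1 + k₀ * c.lam) * y)) := by
    intro y; rw [← Real.exp_add]; ring_nf
  simp only [e]
  refine ⟨(hE.integrable_tilt _ _ hθ).const_mul _, ?_⟩
  rw [integral_const_mul]
  exact mul_le_of_le_one_right (Real.exp_pos _).le (hE.tilt _ _ hθ)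

theorem mgf_e₁ (h : c.Ok S rt k₀ θ₁ ζ d₁ b₁) (hE : ExpBounds μ rt k₀ θ₁) (k : Clk J) :
    ∫ y, Real.exp (c.e₁ * y) ∂μ k ≤ Real.exp (c.e₁ * c.a₂) := by
  refine (hE.mgf k c.e₁ (by rw [abs_of_pos h.e₁_pos]; exact h.e₁_le)).trans ?_
  have h1 := Real.add_one_le_exp (c.e₁ * c.a₂)
  have h2 := mul_le_mul_of_nonneg_left (h.a₂_ge k) h.e₁_pos.le
  have h3 : k₀ * c.e₁ * c.e₁ ≤ k₀ * θ₁ * c.e₁ :=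
    mul_le_mul_of_nonneg_right (mul_le_mul_of_nonneg_left h.e₁_le hE.k₀_nonneg) h.e₁_pos.le
  rw [div_eq_mul_inv]
  nlinarith

end BlockConst.Ok

variable {c : BlockConst} {ζ d₁ b₁ : ℝ}

theorem one_le_openPot (h : c.Ok S rt k₀ θ₁ ζ d₁ b₁) (hE : ExpBounds μ rt k₀ θ₁) {s : State J}
    (hs : S.Valid s) (j : Fin J) : 1 + c.A * Real.exp (-c.lam * (S.Q s j - S.L -
      rt (Sum.inl j) * (1 - k₀ * c.lam) * s.res (Sum.inl j)
      + rt (Sum.inr j) * (1 + k₀ * c.lam) * s.res (Sum.inr j))) ≤ openPot S rt k₀ c j s := by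
  unfold openPot
  have := h.linear_le hE j (hs.res_nonneg (Sum.inl j))
  have h1 := h.A_pos.le
  have h2 := h.M_nonneg
  refine le_add_of_nonneg_right (mul_nonneg (by positivity) (by linarith))

theorem one_le_pot (h : c.Ok S rt k₀ θ₁ ζ d₁ b₁) (hE : ExpBounds μ rt k₀ θ₁)
    {s : State J} (hs : S.Valid s) (j : Fin J) : 1 ≤ pot S rt k₀ c j s := by
  have hA := h.A_pos.le
  have hM := h.M_nonneg
  have hres := hs.res_nonneg (Sum.inl j)
  have he := h.e₁_pos.le
  unfold pot
  split_ifs with h1 h2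
  · have h3 : 1 ≤ Real.exp (c.e₁ * s.res (Sum.inl j)) := Real.one_le_exp (by positivity)
    have h4 : 1 ≤ c.G := by
      have : 0 ≤ c.A * (1 + c.M) * Real.exp c.lam := by positivity
      linarith [h.G_ge]
    unfold waitPot
    nlinarith
  · have hQ := hs.Q_lt j h2
    have ha := h.a₂_nonneg hE j
    have h3 : 1 ≤ Real.exp (c.e₁ * (s.res (Sum.inl j) + c.a₂ * (S.U + 1 - S.Q s j))) :=
      Real.one_le_exp (mul_nonneg he (add_nonneg hres (mul_nonneg ha (by linarith))))
    unfold closedPot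
    linarith
  · refine le_trans ?_ (one_le_openPot h hE hs j)
    exact le_add_of_nonneg_right (by positivity)

/-- Functions of a type are not affected by the events of other types. -/
theorem pot_jump_of_ne {s : State J} {k : Clk J} {j : Fin J} (h : j ≠ typ k) (y : ℝ) :
    pot S rt k₀ c j (S.jump s k y) = pot S rt k₀ c j s := by
  have h1 : Sum.inl j ≠ k := by rintro rfl; exact h rfl
  have h2 : Sum.inr j ≠ k := by rintro rfl; exact h rfl
  have hw : S.Waiting (S.jump s k y) j ↔ S.Waiting s j := by
    simp [Sys.Waiting, Function.update_of_ne h1]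
  have hb : (S.jump s k y).blk j = s.blk j := by
    rw [Sys.jump_blk, Function.update_of_ne h]
  by_cases hW : S.Waiting s j
  · simp only [pot, hw.2 hW, hW, if_true, waitPot, Sys.jump_res, Function.update_of_ne h1]
  · simp only [pot, mt hw.1 hW, hW, if_false, hb, closedPot, openPot, Sys.Q_jump_of_ne h,
      Sys.jump_res, Function.update_of_ne h1, Function.update_of_ne h2]

theorem openPot_jump_inl (s : State J) (j : Fin J) (y : ℝ) :
    openPot S rt k₀ c j (S.jump s (Sum.inl j) y) =
      (1 + c.A * Real.exp (-c.lam * (S.Q s j + 1 - S.L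
        + rt (Sum.inr j) * (1 + k₀ * c.lam) * s.res (Sum.inr j))) *
          Real.exp (c.lam * (rt (Sum.inl j) * (1 - k₀ * c.lam)) * y)) +
      c.A * c.M * Real.exp (-c.lam * (S.U - S.L)) *
      (Real.exp (c.lam * (rt (Sum.inl j) * (1 - k₀ * c.lam)) * y) -
        rt (Sum.inl j) * (Real.exp c.lam - 1) * y) := by
  rw [openPot, Sys.Q_jump_inl, if_pos rfl, mul_assoc c.A (Real.exp _) (Real.exp _), ← Real.exp_add]
  simp only [Sys.jump_res, Function.update_self, ne_eq, reduceCtorEq, not_false_eq_true,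
    Function.update_of_ne]
  ring_nf

/-- The arrival gains a factor `exp (-lam)`, which offsets the mean of the exponential of the new
interarrival time. In the last summand the linear correction brings the mean down to the value at
residual time `0`. -/
theorem integrable_openPot_jump_inl (h : c.Ok S rt k₀ θ₁ ζ d₁ b₁) (hE : ExpBounds μ rt k₀ θ₁)
    (s : State J) (j : Fin J) :
    Integrable (fun y => openPot S rt k₀ c j (S.jump s (Sum.inl j) y)) (μ (Sum.inl j)) ∧
    ∫ y, openPot S rt k₀ c j (S.jump s (Sum.inl j) y) ∂μ (Sum.inl j) ≤
      1 + c.A * Real.exp (-c.lam * (S.Q s j - S.L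
        + rt (Sum.inr j) * (1 + k₀ * c.lam) * s.res (Sum.inr j))) +
      c.A * c.M * Real.exp (-c.lam * (S.U - S.L)) := by
  have hprob := hE.prob
  simp only [openPot_jump_inl]
  obtain ⟨i1, i2⟩ := h.integrable_lam hE j
  set E := Real.exp (-c.lam * (S.Q s j + 1 - S.L
        + rt (Sum.inr j) * (1 + k₀ * c.lam) * s.res (Sum.inr j))) with hE'
  set E₂ := Real.exp (-c.lam * (S.U - S.L)) with hE₂
  have i3 : Integrable (fun y : ℝ => 1 + c.A * E *
      Real.exp (c.lam * (rt (Sum.inl j) * (1 - k₀ * c.lam)) * y)) (μ (Sum.inl j)) :=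
    (integrable_const _).add (i1.const_mul _)
  have i4 := (hE.integrable_id (Sum.inl j)).const_mul (rt (Sum.inl j) * (Real.exp c.lam - 1))
  have i45 : Integrable (fun y : ℝ =>
      Real.exp (c.lam * (rt (Sum.inl j) * (1 - k₀ * c.lam)) * y) -
        rt (Sum.inl j) * (Real.exp c.lam - 1) * y) (μ (Sum.inl j)) := i1.sub i4
  have i5 : Integrable (fun y : ℝ => c.A * c.M * E₂ *
      (Real.exp (c.lam * (rt (Sum.inl j) * (1 - k₀ * c.lam)) * y) -
        rt (Sum.inl j) * (Real.exp c.lam - 1) * y)) (μ (Sum.inl j)) := i45.const_mul _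
  refine ⟨i3.add i5, ?_⟩
  have hA := h.A_pos.le
  have hM := h.M_nonneg
  have hE0 : 0 ≤ E := (Real.exp_pos _).le
  have hE₂0 : 0 ≤ E₂ := (Real.exp_pos _).le
  rw [integral_add i3 i5, integral_add (integrable_const _) (i1.const_mul _), integral_const_mul,
    integral_const_mul, integral_sub i1 i4, integral_const_mul, hE.mean]
  have e1 : rt (Sum.inl j) * (Real.exp c.lam - 1) * (rt (Sum.inl j))⁻¹ = Real.exp c.lam - 1 := by
    field_simp [(hE.rt_pos (Sum.inl j)).ne']
  have e2 : E * Real.exp c.lam = Real.exp (-c.lam * (S.Q s j - S.L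
        + rt (Sum.inr j) * (1 + k₀ * c.lam) * s.res (Sum.inr j))) := by
    rw [hE', ← Real.exp_add]; ring_nf
  rw [e1, ← e2]
  simp only [integral_const, probReal_univ, smul_eq_mul, mul_one]
  have h1 := mul_le_mul_of_nonneg_left i2 (mul_nonneg hA hE0)
  have h2 := mul_le_mul_of_nonneg_left i2 (mul_nonneg (mul_nonneg hA hM) hE₂0)
  linarith

/-- Within a regime each summand is built as a supermartingale, so only the changes of regime need
slack. The constant `G` dominates everything that can follow the first arrival. The size of `A`
covers the entry into a blocked period. At the exit, the factor `exp (-lam * (U - L))` makes the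
open potential at most `2`, the minimum of the closed one. -/
theorem superJump_pot (hS : S.Good) (h : c.Ok S rt k₀ θ₁ ζ d₁ b₁) (hE : ExpBounds μ rt k₀ θ₁)
    (j : Fin J) : SuperJump S μ (pot S rt k₀ c j) := by
  classical
  intro s hs k hk hb
  have hprob := hE.prob
  have hA := h.A_pos.le
  have hM := h.M_nonneg
  have he := h.e₁_pos.le
  have ha := h.a₂_nonneg hE j
  by_cases hkj : j = typ k
  swap
  · simp only [pot_jump_of_ne hkj]
    exact ⟨integrable_const _, by simp⟩
  cases k with
  | inl i =>
    rw [typ_inl] at hkj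
    subst hkj
    have hw' : ∀ y, ¬ S.Waiting (S.jump s (Sum.inl j) y) j := by
      intro y hw
      have := hw.2
      simp at this
    have hbl : ∀ y, (S.jump s (Sum.inl j) y).blk j = hyst S.L S.U (S.Q s j + 1) (s.blk j) := by
      intro y
      rw [Sys.jump_blk, typ_inl, Function.update_self, Sys.Q_jump_inl, if_pos rfl]
    obtain ⟨o1, o2⟩ := integrable_openPot_jump_inl h hE s j
    have hclosed : ∀ y, closedPot S c j (S.jump s (Sum.inl j) y) =
        2 * Real.exp (c.e₁ * (c.a₂ * (S.U - S.Q s j))) * Real.exp (c.e₁ * y) := by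
      intro y
      rw [closedPot, Sys.Q_jump_inl, if_pos rfl, mul_assoc, ← Real.exp_add]
      simp only [Sys.jump_res, Function.update_self]
      ring_nf
    have hci : Integrable (fun y => closedPot S c j (S.jump s (Sum.inl j) y)) (μ (Sum.inl j)) := by
      simp only [hclosed]
      exact (hE.integrable_exp _ _ h.e₁_le).const_mul _
    have hcl : ∫ y, closedPot S c j (S.jump s (Sum.inl j) y) ∂μ (Sum.inl j) ≤
        2 * Real.exp (c.e₁ * (c.a₂ * (S.U + 1 - S.Q s j))) := by
      simp only [hclosed]
      rw [integral_const_mul, mul_assoc]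
      refine mul_le_mul_of_nonneg_left ?_ zero_le_two
      calc _ ≤ Real.exp (c.e₁ * (c.a₂ * (S.U - S.Q s j))) * Real.exp (c.e₁ * c.a₂) := by
            gcongr; exact h.mgf_e₁ hE _
        _ = _ := by rw [← Real.exp_add]; ring_nf
    have hUL := Real.exp_pos (-c.lam * (S.U - S.L))
    have hbound : ∀ q, S.L ≤ q → Real.exp (-c.lam * (q - S.L
        + rt (Sum.inr j) * (1 + k₀ * c.lam) * s.res (Sum.inr j))) ≤ 1 := by
      intro q hq
      refine Real.exp_le_one_iff.2 ?_
      have := mul_nonneg (h.beta_nonneg hE j) (hs.res_nonneg (Sum.inr j))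
      nlinarith [h.lam_pos]
    by_cases hw : S.Waiting s j
    · -- the first arrival
      have hpre : pot S rt k₀ c j s = c.G := by simp [pot, hw, waitPot, hk]
      rw [hpre]
      have hG := h.G_ge
      by_cases hq : hyst S.L S.U (S.Q s j + 1) (s.blk j) = true
      · simp only [pot, hw', hbl, hq, if_true, if_false]
        refine ⟨hci, hcl.trans ?_⟩
        have h1 : Real.exp (c.e₁ * (c.a₂ * (S.U + 1 - S.Q s j))) ≤ 2 := by
          refine le_trans (Real.exp_le_exp.2 ?_) h.a₂_le
          have := hs.Q_nonneg j
          gcongr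
          linarith
        have h2 : 0 ≤ c.A * (1 + c.M) * Real.exp c.lam := by positivity
        linarith
      · simp only [pot, hw', hbl, hq, if_false]
        refine ⟨o1, o2.trans ?_⟩
        have hq' := le_of_hyst_false (Bool.eq_false_of_not_eq_true hq)
        have h1 : Real.exp (-c.lam * (S.Q s j - S.L
            + rt (Sum.inr j) * (1 + k₀ * c.lam) * s.res (Sum.inr j))) ≤ Real.exp c.lam := by
          refine Real.exp_le_exp.2 ?_
          have := mul_nonneg (h.beta_nonneg hE j) (hs.res_nonneg (Sum.inr j))
          nlinarith [h.lam_pos]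
        have h2 : Real.exp (-c.lam * (S.U - S.L)) ≤ Real.exp c.lam := by
          refine Real.exp_le_exp.2 ?_
          nlinarith [h.lam_pos, hS.L_lt_U]
        have h3 := mul_le_mul_of_nonneg_left h1 hA
        have h4 := mul_le_mul_of_nonneg_left h2 (mul_nonneg hA hM)
        linarith
    · by_cases hblk : s.blk j = true
      · have hpre : pot S rt k₀ c j s =
            2 * Real.exp (c.e₁ * (c.a₂ * (S.U + 1 - S.Q s j))) := by
          simp [pot, hw, hblk, closedPot, hk]
        rw [hpre]
        by_cases hq : hyst S.L S.U (S.Q s j + 1) (s.blk j) = true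
        · simp only [pot, hw', hbl, hq, if_true, if_false]
          exact ⟨hci, hcl⟩
        · -- the end of a blocked period
          simp only [pot, hw', hbl, hq, if_false]
          refine ⟨o1, o2.trans ?_⟩
          -- The block ends with the queue at or above `S.U`. There `exit` bounds the open potential
          -- by `2`.
          have hq' : S.U ≤ S.Q s j + 1 := by
            by_contra hlt
            rw [hblk] at hq
            exact hq (by simp [hyst, not_le.1 hlt])
          have h1 : Real.exp (-c.lam * (S.Q s j - S.L
              + rt (Sum.inr j) * (1 + k₀ * c.lam) * s.res (Sum.inr j))) ≤
              Real.exp (-c.lam * (S.U - S.L)) * Real.exp c.lam := by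
            rw [← Real.exp_add]
            refine Real.exp_le_exp.2 ?_
            have := mul_nonneg (h.beta_nonneg hE j) (hs.res_nonneg (Sum.inr j))
            nlinarith [h.lam_pos]
          have h2 : Real.exp (-c.lam * (S.U - S.L)) ≤
              Real.exp (-c.lam * (S.U - S.L)) * Real.exp c.lam :=
            le_mul_of_one_le_right hUL.le (Real.one_le_exp h.lam_pos.le)
          have h3 := mul_le_mul_of_nonneg_left h1 hA
          have h4 := mul_le_mul_of_nonneg_left h2 (mul_nonneg hA hM)
          have h5 := h.exit
          have h6 : 1 ≤ Real.exp (c.e₁ * (c.a₂ * (S.U + 1 - S.Q s j))) :=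
            Real.one_le_exp (mul_nonneg he (mul_nonneg ha (by linarith [hs.Q_lt j hblk])))
          linarith
      -- For an unblocked type the bound for the mean is exactly the open potential at residual time
      -- `0`.
      · have hLQ := hs.le_Q j (Bool.eq_false_of_not_eq_true hblk)
        have hq : ¬ hyst S.L S.U (S.Q s j + 1) false = true := by
          simp [hyst, show S.L ≤ S.Q s j + 1 by linarith]
        rw [Bool.eq_false_of_not_eq_true hblk] at hbl
        simp only [pot, hw', hbl, hq, if_false, hw, hblk]
        refine ⟨o1, o2.trans (le_of_eq ?_)⟩
        simp [openPot, hk]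
  | inr i =>
    rw [typ_inr] at hkj
    subst hkj
    have hblk := hb j rfl
    have hLQ := hs.le_Q j hblk
    have hw' : ∀ y, S.Waiting (S.jump s (Sum.inr j) y) j ↔ S.Waiting s j := by
      intro y
      simp [Sys.Waiting]
    have hbl : ∀ y, (S.jump s (Sum.inr j) y).blk j = hyst S.L S.U (S.Q s j - 1) (s.blk j) := by
      intro y
      rw [Sys.jump_blk, typ_inr, Function.update_self, Sys.Q_jump_inr, if_pos rfl]
    rw [hblk] at hbl
    by_cases hw : S.Waiting s j
    · simp only [pot, hw', hw, if_true, waitPot, Sys.jump_res, ne_eq, reduceCtorEq,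
        not_false_eq_true, Function.update_of_ne]
      exact ⟨integrable_const _, by simp⟩
    by_cases hq : hyst S.L S.U (S.Q s j - 1) false = true
    · -- the start of a blocked period
      simp only [pot, hw', hw, hbl, hq, if_true, if_false, hblk, Bool.false_eq_true]
      have hQL : S.Q s j - 1 < S.L := by
        by_contra hge
        simp [hyst] at hq
        exact hge hq
      have hclosed : ∀ y, closedPot S c j (S.jump s (Sum.inr j) y) =
          2 * Real.exp (c.e₁ * (s.res (Sum.inl j) + c.a₂ * (S.U + 2 - S.Q s j))) := by
        intro y
        rw [closedPot, Sys.Q_jump_inr, if_pos rfl]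
        simp only [Sys.jump_res, ne_eq, reduceCtorEq, not_false_eq_true, Function.update_of_ne]
        ring_nf
      simp only [hclosed]
      refine ⟨integrable_const _, ?_⟩
      simp only [integral_const, probReal_univ, smul_eq_mul, one_mul]
      refine le_trans ?_ (one_le_openPot h hE hs j)
      have hres := hs.res_nonneg (Sum.inl j)
      rw [hk]
      -- One factor `2` comes from `closedPot`, another from the threshold term. Together they are
      -- matched by `c.A * exp (-lam) ≥ 4`, because the queue before the service was below `S.L +
      -- 1`.
      have h1 : Real.exp (c.e₁ * (s.res (Sum.inl j) + c.a₂ * (S.U + 2 - S.Q s j))) ≤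
          2 * Real.exp (c.lam * (rt (Sum.inl j) * (1 - k₀ * c.lam)) * s.res (Sum.inl j)) := by
        have e1 : Real.exp (c.e₁ * (c.a₂ * (S.U + 2 - S.Q s j))) ≤ 2 := by
          refine le_trans (Real.exp_le_exp.2 ?_) h.a₂_le
          have := hs.Q_nonneg j
          gcongr
          linarith
        rw [mul_add, Real.exp_add, mul_comm]
        gcongr
        exact h.e₁_le' j
      have h2 : Real.exp (-c.lam) *
          Real.exp (c.lam * (rt (Sum.inl j) * (1 - k₀ * c.lam)) * s.res (Sum.inl j)) ≤
          Real.exp (-c.lam * (S.Q s j - S.L -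
            rt (Sum.inl j) * (1 - k₀ * c.lam) * s.res (Sum.inl j)
            + rt (Sum.inr j) * (1 + k₀ * c.lam) * 0)) := by
        rw [← Real.exp_add]
        refine Real.exp_le_exp.2 ?_
        nlinarith [h.lam_pos]
      have h3 := mul_le_mul_of_nonneg_left h2 hA
      have h4 : 4 ≤ c.A * Real.exp (-c.lam) := by
        have := mul_le_mul_of_nonneg_right h.A_ge (Real.exp_pos (-c.lam)).le
        rw [mul_assoc, ← Real.exp_add] at this
        simpa using this
      have h5 := mul_le_mul_of_nonneg_right h4 (Real.exp_pos
        (c.lam * (rt (Sum.inl j) * (1 - k₀ * c.lam)) * s.res (Sum.inl j))).le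
      linarith
    · simp only [pot, hw', hw, hbl, hq, if_false, hblk, Bool.false_eq_true]
      obtain ⟨i1, i2⟩ := h.integrable_lam' hE j
      set E := Real.exp (-c.lam * (S.Q s j - 1 - S.L -
          rt (Sum.inl j) * (1 - k₀ * c.lam) * s.res (Sum.inl j))) with hEdef
      set F := c.A * c.M * Real.exp (-c.lam * (S.U - S.L)) *
          (Real.exp (c.lam * (rt (Sum.inl j) * (1 - k₀ * c.lam)) * s.res (Sum.inl j)) -
            rt (Sum.inl j) * (Real.exp c.lam - 1) * s.res (Sum.inl j)) with hF
      have hopen : ∀ y, openPot S rt k₀ c j (S.jump s (Sum.inr j) y) = (1 + F) +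
          c.A * E * Real.exp (-c.lam * (rt (Sum.inr j) * (1 + k₀ * c.lam)) * y) := by
        intro y
        rw [openPot, Sys.Q_jump_inr, if_pos rfl, mul_assoc c.A E, hEdef, ← Real.exp_add, hF]
        simp only [Sys.jump_res, Function.update_self, ne_eq, reduceCtorEq, not_false_eq_true,
          Function.update_of_ne]
        ring_nf
      simp only [hopen]
      refine ⟨(integrable_const _).add (i1.const_mul _), ?_⟩
      rw [integral_add (integrable_const _) (i1.const_mul _), integral_const_mul]
      have h1 := mul_le_mul_of_nonneg_left i2 (mul_nonneg hA (Real.exp_pos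
        (-c.lam * (S.Q s j - 1 - S.L -
          rt (Sum.inl j) * (1 - k₀ * c.lam) * s.res (Sum.inl j)))).le)
      have h2 : E * Real.exp (-c.lam) = Real.exp (-c.lam * (S.Q s j - S.L -
          rt (Sum.inl j) * (1 - k₀ * c.lam) * s.res (Sum.inl j) +
          rt (Sum.inr j) * (1 + k₀ * c.lam) * 0)) := by
        rw [hEdef, ← Real.exp_add]; ring_nf
      rw [openPot, hk, ← hF, ← h2]
      simp only [integral_const, probReal_univ, smul_eq_mul, one_mul]
      linarith

theorem superJump_blockPot (hS : S.Good) (h : c.Ok S rt k₀ θ₁ ζ d₁ b₁)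
    (hE : ExpBounds μ rt k₀ θ₁) (j : Fin J) : SuperJump S μ (blockPot S rt k₀ c ζ j) := by
  intro s hs k hk hb
  obtain ⟨h1, h2⟩ := superJump_pot hS h hE j s hs k hk hb
  simp only [blockPot, Sys.jump_D]
  refine ⟨h1.const_mul _, ?_⟩
  rw [integral_const_mul]
  exact mul_le_mul_of_nonneg_left h2 (Real.exp_pos _).le

variable {J : ℕ} {S : Sys J} {μ : Clk J → Measure ℝ} {rt : Clk J → ℝ} {k₀ θ₁ : ℝ}
variable {c : BlockConst} {ζ d₁ b₁ : ℝ}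

/-! ### The drift of the potential -/

/-- The rate with which `openPot` changes along the flow. -/
def dOpenPot (S : Sys J) (rt : Clk J → ℝ) (k₀ : ℝ) (c : BlockConst) (j : Fin J)
    (s : State J) : ℝ :=
  c.A * (Real.exp (-c.lam * (S.Q s j - S.L - rt (Sum.inl j) * (1 - k₀ * c.lam) * s.res (Sum.inl j)
      + rt (Sum.inr j) * (1 + k₀ * c.lam) * s.res (Sum.inr j))) *
    (-c.lam * (rt (Sum.inl j) * (1 - k₀ * c.lam) -
      rt (Sum.inr j) * (1 + k₀ * c.lam) * S.alloc s j))) +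
  c.A * c.M * Real.exp (-c.lam * (S.U - S.L)) *
    (rt (Sum.inl j) * (Real.exp c.lam - 1) - c.lam * (rt (Sum.inl j) * (1 - k₀ * c.lam)) *
      Real.exp (c.lam * (rt (Sum.inl j) * (1 - k₀ * c.lam)) * s.res (Sum.inl j)))

theorem hasDrift_openPot (j : Fin J) :
    HasDrift S (openPot S rt k₀ c j) (dOpenPot S rt k₀ c j) := by
  have hA := HasDrift.res (S := S) (Sum.inl j)
  have hB := HasDrift.res (S := S) (Sum.inr j)
  have h1 := ((((((HasDrift.Q (S := S) j).sub (HasDrift.const S.L)).sub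
    (hA.const_mul (rt (Sum.inl j) * (1 - k₀ * c.lam)))).add
    (hB.const_mul (rt (Sum.inr j) * (1 + k₀ * c.lam)))).const_mul (-c.lam)).exp).const_mul c.A
  have h2 := (((hA.const_mul (c.lam * (rt (Sum.inl j) * (1 - k₀ * c.lam)))).exp).sub
    (hA.const_mul (rt (Sum.inl j) * (Real.exp c.lam - 1)))).const_mul
    (c.A * c.M * Real.exp (-c.lam * (S.U - S.L)))
  refine ((((HasDrift.const 1).add h1).add h2)).congr fun s _ => ?_
  simp only [dOpenPot, Sys.speed, Sum.elim_inl, Sum.elim_inr]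
  ring

open Classical in
theorem hasDrift_pot (j : Fin J) : HasDrift S (pot S rt k₀ c j)
    (fun s => if S.Waiting s j then -c.e₁ * waitPot c j s
      else if s.blk j = true then -c.e₁ * closedPot S c j s else dOpenPot S rt k₀ c j s) := by
  have hA := HasDrift.res (S := S) (Sum.inl j)
  have h1 := ((hA.const_mul c.e₁).exp).const_mul c.G
  have h2 := (((hA.add (((HasDrift.const (S.U + 1)).sub
    (HasDrift.Q (S := S) j)).const_mul c.a₂)).const_mul c.e₁).exp).const_mul 2
  refine HasDrift.ite (fun s h => Iff.rfl) (h1.congr fun s _ => ?_)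
    (HasDrift.ite (fun s h => Iff.rfl) (h2.congr fun s _ => ?_) (hasDrift_openPot j))
  · simp only [waitPot, Sys.speed, Sum.elim_inl]; ring
  · simp only [closedPot, Sys.speed, Sum.elim_inl]; ring

open Classical in
/-- The rate with which `blockPot` changes along the flow. -/
def dBlockPot (S : Sys J) (rt : Clk J → ℝ) (k₀ : ℝ) (c : BlockConst) (ζ : ℝ) (j : Fin J)
    (s : State J) : ℝ :=
  Real.exp (ζ * s.D j) * (ζ * dD S s j) * pot S rt k₀ c j s + Real.exp (ζ * s.D j) *
    (if S.Waiting s j then -c.e₁ * waitPot c j s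
      else if s.blk j = true then -c.e₁ * closedPot S c j s else dOpenPot S rt k₀ c j s)

theorem hasDrift_blockPot (hS : S.Good) (j : Fin J) :
    HasDrift S (blockPot S rt k₀ c ζ j) (dBlockPot S rt k₀ c ζ j) :=
  (((hasDrift_D hS j).const_mul ζ).exp).mul (hasDrift_pot j)

/-- While a type is charged, its potential decays at rate `e₁` as the residual interarrival time
shrinks. By `e₁_ge` this exceeds the growth rate `ζ * chg` of `exp (ζ * D)` by at least `ζ`. -/
theorem dBlockPot_le_of_charged (h : c.Ok S rt k₀ θ₁ ζ d₁ b₁) (hE : ExpBounds μ rt k₀ θ₁)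
    {s : State J} (hs : S.Valid s) {j : Fin J} (hc : S.Charged s j) :
    dBlockPot S rt k₀ c ζ j s ≤ -ζ * blockPot S rt k₀ c ζ j s := by
  have h1 := one_le_pot h hE hs j
  have h2 : dBlockPot S rt k₀ c ζ j s =
      (ζ * S.chg - c.e₁) * (Real.exp (ζ * s.D j) * pot S rt k₀ c j s) := by
    rw [dBlockPot, dD_of_charged hc, pot]
    by_cases hw : S.Waiting s j
    · simp only [hw, if_true]; ring
    · have hb : s.blk j = true := hc.resolve_right hw
      simp only [hw, hb, if_true, if_false]; ring
  rw [h2, blockPot]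
  refine mul_le_mul_of_nonneg_right ?_ (mul_nonneg (Real.exp_pos _).le (by linarith))
  linarith [h.e₁_ge]

/-- Below the upper threshold the tilted arrival rate exceeds the service rate by `d₁`, so the
middle exponential decays. Above it this may fail, but there that exponential is at most `exp (-lam
* (U - L))` times the exponential of the residual interarrival time, and half of the decay of the
last summand pays for it. The remaining constant comes from the linear correction. -/
theorem dOpenPot_le (h : c.Ok S rt k₀ θ₁ ζ d₁ b₁) (hE : ExpBounds μ rt k₀ θ₁)
    {s : State J} (hs : S.Valid s) {j : Fin J} (hb : s.blk j = false) {c₃ : ℝ} (hc₃ : 0 ≤ c₃)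
    (h1 : c₃ ≤ c.lam * d₁) (h2 : c₃ ≤ c.lam * (rt (Sum.inl j) * (1 - k₀ * c.lam)) / 2) :
    dOpenPot S rt k₀ c j s ≤ -c₃ * (openPot S rt k₀ c j s - 1) +
      c.A * c.M * Real.exp (-c.lam * (S.U - S.L)) *
        (rt (Sum.inl j) * (Real.exp c.lam - 1)) := by
  have hα := h.alpha_pos hE j
  have hβ := h.beta_nonneg hE j
  have hRA := hs.res_nonneg (Sum.inl j)
  have hRS := hs.res_nonneg (Sum.inr j)
  have hal : S.alloc s j = S.b0 (S.z s) j := by simp [Sys.alloc, hb]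
  have hκ : 0 ≤ rt (Sum.inl j) * (Real.exp c.lam - 1) * s.res (Sum.inl j) := by
    have := Real.one_le_exp h.lam_pos.le
    exact mul_nonneg (mul_nonneg (hE.rt_pos _).le (by linarith)) hRA
  have hlam := h.lam_pos
  unfold dOpenPot openPot
  rw [hal]
  set α' := rt (Sum.inl j) * (1 - k₀ * c.lam)
  set β' := rt (Sum.inr j) * (1 + k₀ * c.lam)
  set E := Real.exp (-c.lam * (S.Q s j - S.L - α' * s.res (Sum.inl j) +
    β' * s.res (Sum.inr j))) with hEdef
  set F := Real.exp (c.lam * α' * s.res (Sum.inl j)) with hF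
  set W := Real.exp (-c.lam * (S.U - S.L)) with hW
  set κ := rt (Sum.inl j) * (Real.exp c.lam - 1)
  have hE0 : 0 < E := Real.exp_pos _
  have hF0 : 0 < F := Real.exp_pos _
  have hW0 : 0 < W := Real.exp_pos _
  have hA := h.A_pos
  have hM := h.M_nonneg
  have hAMW : 0 ≤ c.A * c.M * W := by positivity
  have hkey : c.A * (E * (-c.lam * (α' - β' * S.b0 (S.z s) j))) ≤
      -c₃ * (c.A * E) + c.A * c.M * W * (c.lam * α' / 2 * F) := by
    by_cases hz : S.z s j = true
    · have h3 := h.rate_band (S.z s) j hz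
      have h4 : c.lam * d₁ ≤ c.lam * (α' - β' * S.b0 (S.z s) j) :=
        mul_le_mul_of_nonneg_left (by linarith) hlam.le
      have h5 : (c₃ - c.lam * (α' - β' * S.b0 (S.z s) j)) * (c.A * E) ≤ 0 :=
        mul_nonpos_of_nonpos_of_nonneg (by linarith) (by positivity)
      have h6 : 0 ≤ c.A * c.M * W * (c.lam * α' / 2 * F) := by positivity
      linarith
    · have h3 := h.rate_top (S.z s) j
      have hQU : S.U ≤ S.Q s j := by
        have : ¬ S.Q s j < S.U := by simpa [Sys.z] using hz
        linarith
      have h4 : E ≤ W * F := by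
        rw [hEdef, hW, hF, ← Real.exp_add]
        refine Real.exp_le_exp.2 ?_
        have := mul_nonneg hlam.le (mul_nonneg hβ hRS)
        have := mul_le_mul_of_nonneg_left hQU hlam.le
        linarith
      have h5 : c₃ - c.lam * (α' - β' * S.b0 (S.z s) j) ≤ c.lam * (b₁ + d₁) := by
        have h6 := mul_le_mul_of_nonneg_left h3 hlam.le
        have h7 := mul_nonneg hlam.le hα.le
        linarith
      have h6 : c.lam * (b₁ + d₁) ≤ c.M * (c.lam * α' / 2) := by
        have := mul_le_mul_of_nonneg_left (h.M_ge j) hlam.le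
        linarith
      calc _ = (c₃ - c.lam * (α' - β' * S.b0 (S.z s) j)) * (c.A * E) - c₃ * (c.A * E) := by ring
        _ ≤ c.M * (c.lam * α' / 2) * (c.A * E) - c₃ * (c.A * E) := by
          gcongr; exact h5.trans h6
        _ ≤ c.M * (c.lam * α' / 2) * (c.A * (W * F)) - c₃ * (c.A * E) := by gcongr
        _ = _ := by ring
  -- The other half of the decay of the last summand provides its own rate `c₃`.
  have h7 : c₃ * (c.A * c.M * W * (F - κ * s.res (Sum.inl j))) ≤
      c.A * c.M * W * (c.lam * α' / 2 * F) := by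
    calc _ ≤ c₃ * (c.A * c.M * W * F) := by
          gcongr
          linarith
      _ ≤ c.lam * α' / 2 * (c.A * c.M * W * F) := by gcongr
      _ = _ := by ring
  linarith

/-- The drift of `blockPot` is negative except near its minimum. -/
theorem dBlockPot_le (h : c.Ok S rt k₀ θ₁ ζ d₁ b₁) (hE : ExpBounds μ rt k₀ θ₁) (hS : S.Good)
    {s : State J} (hs : S.Valid s) {j : Fin J} (hγ : S.γ ≤ 2)
    (h1 : ζ * S.γ / 2 ≤ c.lam * d₁)
    (h2 : ζ * S.γ / 2 ≤ c.lam * (rt (Sum.inl j) * (1 - k₀ * c.lam)) / 2)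
    (h3 : c.A * c.M * Real.exp (-c.lam * (S.U - S.L)) *
        (rt (Sum.inl j) * (Real.exp c.lam - 1)) ≤ ζ * S.γ / 2) :
    dBlockPot S rt k₀ c ζ j s ≤ -(ζ * S.γ / 2) * blockPot S rt k₀ c ζ j s + ζ * S.γ := by
  have hp := one_le_pot h hE hs j
  have hζγ : 0 ≤ ζ * S.γ := mul_nonneg h.ζ_nonneg hS.γ_nonneg
  have hV : 0 ≤ blockPot S rt k₀ c ζ j s := mul_nonneg (Real.exp_pos _).le (by linarith)
  by_cases hc : S.Charged s j
  · have h4 := dBlockPot_le_of_charged h hE hs hc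
    have h5 : ζ * S.γ / 2 ≤ ζ := by nlinarith [h.ζ_nonneg]
    have := mul_le_mul_of_nonneg_right h5 hV
    linarith
  · have hb : s.blk j = false := by
      by_contra hb
      exact hc (Or.inl (by simpa using hb))
    have hw : ¬ S.Waiting s j := fun hw => hc (Or.inr hw)
    have h4 := dOpenPot_le h hE hs hb (by linarith) h1 h2
    have hpot : pot S rt k₀ c j s = openPot S rt k₀ c j s := by simp [pot, hw, hb]
    rw [hpot] at hp
    rw [blockPot, dBlockPot, hpot]
    simp only [hw, hb, if_false, Bool.false_eq_true]
    set g := openPot S rt k₀ c j s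
    -- For `D > 0` the decay `ζ * γ` of `exp (ζ * D)` outweighs the constant `ζ * γ / 2`, since the
    -- potential is at least `1`. For `D = 0` there is no such decay, and the constant enters the
    -- bound.
    by_cases hD : 0 < s.D j
    · have h5 : dD S s j = -S.γ := by simp [dD, hc, hD]
      have h6 : 0 ≤ ζ * S.γ / 2 * (g - 1) := mul_nonneg (by linarith) (by linarith)
      have h7 : ζ * -S.γ * g + dOpenPot S rt k₀ c j s ≤ -(ζ * S.γ / 2) * g := by linarith
      have h8 := mul_le_mul_of_nonneg_left h7 (Real.exp_pos (ζ * s.D j)).le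
      rw [h5]
      linarith
    · have h5 : dD S s j = 0 := by simp [dD, hc, hD]
      have h6 : s.D j = 0 := le_antisymm (not_lt.1 hD) (hs.D_nonneg j)
      rw [h5, h6]
      simp only [mul_zero, Real.exp_zero, one_mul, zero_mul, zero_add]
      linarith

theorem exp_le_blockPot (h : c.Ok S rt k₀ θ₁ ζ d₁ b₁) (hE : ExpBounds μ rt k₀ θ₁)
    {s : State J} (hs : S.Valid s) (j : Fin J) :
    Real.exp (ζ * s.D j) ≤ blockPot S rt k₀ c ζ j s :=
  le_mul_of_one_le_right (Real.exp_pos _).le (one_le_pot h hE hs j)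

theorem measurable_blockPot (j : Fin J) : Measurable (blockPot S rt k₀ c ζ j) := by
  have hQ := S.measurable_Q j
  have hA := Sys.measurable_res (J := J) (Sum.inl j)
  have hB := Sys.measurable_res (J := J) (Sum.inr j)
  have hD := State.measurable_D_apply j
  refine (Real.measurable_exp.comp (hD.const_mul ζ)).mul (Measurable.ite (S.measurableSet_waiting j)
    ?_ (Measurable.ite (Sys.measurableSet_blk j) ?_ ?_))
  · unfold waitPot; fun_prop
  · unfold closedPot; fun_prop
  · unfold openPot; fun_prop

variable {J : ℕ} {S : Sys J} {μ : Clk J → Measure ℝ} {rt : Clk J → ℝ} {k₀ θ₁ : ℝ}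

/-! ### Elementary inequalities -/

/-- The sum is at most `n` times its largest term, so one summand on the right suffices. This
replaces products of dependent exponentials by sums. -/
theorem exp_sum_le {ι : Type*} (t : Finset ι) (f : ι → ℝ) {n : ℝ} (hf : ∀ i ∈ t, 0 ≤ f i)
    (hn : (t.card : ℝ) ≤ n) :
    Real.exp (∑ i ∈ t, f i) ≤ 1 + ∑ i ∈ t, (Real.exp (n * f i) - 1) := by
  have hn0 : 0 ≤ n := (Nat.cast_nonneg _).trans hn
  have h0 : ∀ i ∈ t, 0 ≤ Real.exp (n * f i) - 1 := fun i hi => by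
    rw [sub_nonneg]; exact Real.one_le_exp (mul_nonneg hn0 (hf i hi))
  rcases t.eq_empty_or_nonempty with rfl | hne
  · simp
  obtain ⟨m, hm, hmax⟩ := t.exists_max_image f hne
  have h1 : ∑ i ∈ t, f i ≤ n * f m := by
    refine (Finset.sum_le_card_nsmul t f (f m) hmax).trans ?_
    rw [nsmul_eq_mul]
    exact mul_le_mul_of_nonneg_right hn (hf m hm)
  have h2 := Finset.single_le_sum h0 hm
  have h3 := Real.exp_le_exp.2 h1
  linarith

/-- From `exp 1 * x ≤ exp x`. The constant is twice the factor `5 / 4` that bounds `resSlope` in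
`le_expRes`. -/
theorem mul_five_halves_le_exp (x : ℝ) : 5 / 2 * x ≤ Real.exp x := by
  rcases le_or_gt x 0 with hx | hx
  · have := Real.exp_pos x; linarith
  · have h1 := Real.add_one_le_exp (x - 1)
    have h2 : Real.exp x = Real.exp 1 * Real.exp (x - 1) := by rw [← Real.exp_add]; ring_nf
    have h3 := Real.exp_one_gt_d9
    rw [h2]
    nlinarith

/-- Equivalently `exp x - 2 * x + 2 ≥ exp x / 2`: subtracting twice the exponent leaves half of the
exponential, which explains the constant `2` in `WorkConst.lyap`. -/
theorem four_mul_le_exp (x : ℝ) : 4 * x ≤ Real.exp x + 4 := by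
  rcases le_or_gt x 0 with hx | hx
  · have := Real.exp_pos x; linarith
  · have := Real.quadratic_le_exp_of_nonneg hx.le
    nlinarith [sq_nonneg (x - 3)]

/-! ### Bounds for the functions of the residual times -/

theorem resSlope_nonneg (hE : ExpBounds μ rt k₀ θ₁) {η : ℝ} (hη : 0 ≤ η) (k : Clk J) :
    0 ≤ resSlope rt k₀ η k :=
  add_nonneg hη (mul_nonneg (mul_nonneg (hE.rt_pos k).le hE.k₀_nonneg) (sq_nonneg η))

theorem expRes_le (hE : ExpBounds μ rt k₀ θ₁) {η ζ : ℝ} (hη : 0 ≤ η) {s : State J}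
    (hs : S.Valid s) (k : Clk J) :
    expRes rt k₀ η ζ k s ≤ Real.exp (-ζ * s.D (typ k)) * Real.exp (η * s.res k) :=
  mul_le_mul_of_nonneg_left (sub_le_self _ (mul_nonneg (resSlope_nonneg hE hη k)
    (hs.res_nonneg k))) (Real.exp_pos _).le

theorem le_expRes {η ζ : ℝ} (hη : 0 ≤ η) {k : Clk J}
    (h : rt k * k₀ * η ≤ 1 / 4) {s : State J} (hs : S.Valid s) :
    1 / 2 * (Real.exp (-ζ * s.D (typ k)) * Real.exp (η * s.res k)) ≤ expRes rt k₀ η ζ k s := by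
  have h1 := mul_five_halves_le_exp (η * s.res k)
  have h2 : resSlope rt k₀ η k * s.res k ≤ 5 / 4 * (η * s.res k) := by
    have := mul_le_mul_of_nonneg_right h (mul_nonneg hη (hs.res_nonneg k))
    unfold resSlope
    nlinarith
  have h3 : 1 / 2 * Real.exp (η * s.res k) ≤
      Real.exp (η * s.res k) - resSlope rt k₀ η k * s.res k := by linarith
  have := mul_le_mul_of_nonneg_left h3 (Real.exp_pos (-ζ * s.D (typ k))).le
  unfold expRes
  linarith

/-- Drift of the function of the residual service time of a type that is charged. -/
theorem drift_expRes_charged (hS : S.Good) (hE : ExpBounds μ rt k₀ θ₁) {η : ℝ} (hη : 0 ≤ η)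
    {s : State J} (hs : S.Valid s) {j : Fin J} (hc : S.Charged s j) {b₁ σ : ℝ}
    (hb₁ : ∀ z, S.b0 z j ≤ b₁) (hσ : b₁ * (rt (Sum.inr j) * k₀ * η ^ 2) ≤ σ) :
    -η * dD S s j * expRes rt k₀ η η (Sum.inr j) s -
      Real.exp (-η * s.D j) * S.alloc s j *
        (η * Real.exp (η * s.res (Sum.inr j)) - resSlope rt k₀ η (Sum.inr j)) ≤
    -(η * S.chg) * expRes rt k₀ η η (Sum.inr j) s + σ := by
  rw [dD_of_charged hc]
  have h1 : 0 ≤ S.alloc s j := by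
    unfold Sys.alloc; split_ifs
    · exact le_rfl
    · exact (hS.b0_pos _ _).le
  have h2 : S.alloc s j ≤ b₁ := by
    unfold Sys.alloc; split_ifs
    · exact (hS.b0_pos (S.z s) j).le.trans (hb₁ _)
    · exact hb₁ _
  have h3 : Real.exp (-η * s.D j) ≤ 1 := Real.exp_le_one_iff.2 (by
    have := mul_nonneg hη (hs.D_nonneg j); linarith)
  have h4 : 1 ≤ Real.exp (η * s.res (Sum.inr j)) :=
    Real.one_le_exp (mul_nonneg hη (hs.res_nonneg _))
  have h5 : 0 ≤ rt (Sum.inr j) * k₀ * η ^ 2 :=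
    mul_nonneg (mul_nonneg (hE.rt_pos _).le hE.k₀_nonneg) (sq_nonneg η)
  have h6 : -(rt (Sum.inr j) * k₀ * η ^ 2) ≤
      η * Real.exp (η * s.res (Sum.inr j)) - resSlope rt k₀ η (Sum.inr j) := by
    unfold resSlope
    nlinarith
  have h7 : 0 ≤ Real.exp (-η * s.D j) * S.alloc s j := mul_nonneg (Real.exp_pos _).le h1
  have h8 : Real.exp (-η * s.D j) * S.alloc s j ≤ b₁ :=
    (mul_le_of_le_one_left h1 h3).trans h2
  have h9 := mul_le_mul_of_nonneg_left h6 h7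
  have h10 := mul_le_mul_of_nonneg_right h8 h5
  linarith

/-- Drift of the function of the residual service time of a type that is not charged. -/
theorem drift_expRes_not_charged (hS : S.Good) (hE : ExpBounds μ rt k₀ θ₁) {η : ℝ} (hη : 0 ≤ η)
    {s : State J} (hs : S.Valid s) {j : Fin J} (hc : ¬ S.Charged s j) {b₀ b₁ σ : ℝ}
    (hb₀ : ∀ z, b₀ ≤ S.b0 z j) (hb₀' : 0 ≤ b₀) (hγ : S.γ ≤ b₀ / 2)
    (hb₁ : ∀ z, S.b0 z j ≤ b₁) (hσ : b₁ * (rt (Sum.inr j) * k₀ * η ^ 2) ≤ σ) :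
    -η * dD S s j * expRes rt k₀ η η (Sum.inr j) s -
      Real.exp (-η * s.D j) * S.alloc s j *
        (η * Real.exp (η * s.res (Sum.inr j)) - resSlope rt k₀ η (Sum.inr j)) ≤
    -(η * b₀ / 2) * (Real.exp (η * max (s.res (Sum.inr j) - s.D j) 0) - 1) + (S.γ * η + σ) := by
  have hb : ¬ s.blk j = true := fun hb => hc (Or.inl hb)
  have hal : S.alloc s j = S.b0 (S.z s) j := by simp [Sys.alloc, hb]
  rw [hal]
  set E := Real.exp (-η * s.D j) with hEd
  set R := Real.exp (η * s.res (Sum.inr j)) with hR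
  set p := Real.exp (η * max (s.res (Sum.inr j) - s.D j) 0) with hp
  set b := S.b0 (S.z s) j with hbd
  have hE0 : 0 < E := Real.exp_pos _
  have hE1 : E ≤ 1 := Real.exp_le_one_iff.2 (by
    have := mul_nonneg hη (hs.D_nonneg j); linarith)
  have hR1 : 1 ≤ R := Real.one_le_exp (mul_nonneg hη (hs.res_nonneg _))
  have hp1 : 1 ≤ p := Real.one_le_exp (mul_nonneg hη (le_max_right _ _))
  have hER : E * R = Real.exp (η * (s.res (Sum.inr j) - s.D j)) := by
    rw [hEd, hR, ← Real.exp_add]; ring_nf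
  have hERp : E * R ≤ p := by
    rw [hER]
    exact Real.exp_le_exp.2 (mul_le_mul_of_nonneg_left (le_max_left _ _) hη)
  have hpE : p - 1 ≤ E * (R - 1) := by
    rcases le_total (s.res (Sum.inr j) - s.D j) 0 with h | h
    · rw [hp, max_eq_right h, mul_zero, Real.exp_zero, sub_self]
      exact mul_nonneg hE0.le (by linarith)
    · rw [hp, max_eq_left h, ← hER]
      linarith
  have hσ0 : 0 ≤ rt (Sum.inr j) * k₀ * η ^ 2 :=
    mul_nonneg (mul_nonneg (hE.rt_pos _).le hE.k₀_nonneg) (sq_nonneg η)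
  have hb0 : b₀ ≤ b := hb₀ _
  have hb1 : b ≤ b₁ := hb₁ _
  -- the service term
  have h1 : -(E * b * (η * R - resSlope rt k₀ η (Sum.inr j))) ≤ -(η * b₀) * (p - 1) + σ := by
    have e : -(E * b * (η * R - resSlope rt k₀ η (Sum.inr j))) =
        -(b * η * (E * (R - 1))) + E * b * (rt (Sum.inr j) * k₀ * η ^ 2) := by
      unfold resSlope; ring
    rw [e]
    have h2 : b₀ * η * (p - 1) ≤ b * η * (E * (R - 1)) :=
      mul_le_mul (mul_le_mul_of_nonneg_right hb0 hη) hpE (by linarith)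
        (mul_nonneg (hb₀'.trans hb0) hη)
    have h3 : E * b ≤ b₁ := (mul_le_of_le_one_left (hb₀'.trans hb0) hE1).trans hb1
    have h4 := mul_le_mul_of_nonneg_right h3 hσ0
    linarith
  -- the damping term
  have h5 : -η * dD S s j * expRes rt k₀ η η (Sum.inr j) s ≤ S.γ * η * p := by
    have hd1 := neg_γ_le_dD hS s j
    have hd2 := dD_nonpos_of_not_charged hS hc
    have h6 : expRes rt k₀ η η (Sum.inr j) s ≤ p := (expRes_le hE hη hs _).trans hERp
    have hγ0 := hS.γ_nonneg
    have h7 : 0 ≤ -η * dD S s j := by nlinarith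
    have h8 : -η * dD S s j ≤ S.γ * η := by nlinarith
    calc _ ≤ -η * dD S s j * p := mul_le_mul_of_nonneg_left h6 h7
      _ ≤ _ := mul_le_mul_of_nonneg_right h8 (by linarith)
  have h9 : S.γ * η * (p - 1) ≤ η * b₀ / 2 * (p - 1) := by
    refine mul_le_mul_of_nonneg_right ?_ (by linarith)
    nlinarith
  linarith

/-- Drift of the function of a residual interarrival time. -/
theorem drift_expRes_inl (hE : ExpBounds μ rt k₀ θ₁) {η ε σ : ℝ} (hη : 0 ≤ η) (hε₀ : 0 ≤ ε)
    (hε : ε ≤ η) {s : State J} (hs : S.Valid s) {j : Fin J}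
    (hσ : rt (Sum.inl j) * k₀ * η ^ 2 ≤ σ) :
    -0 * dD S s j * expRes rt k₀ η 0 (Sum.inl j) s -
      Real.exp (-0 * s.D j) * 1 *
        (η * Real.exp (η * s.res (Sum.inl j)) - resSlope rt k₀ η (Sum.inl j)) ≤
    -ε * expRes rt k₀ η 0 (Sum.inl j) s + (ε + σ) := by
  have h1 := expRes_le hE hη hs (Sum.inl j) (ζ := 0)
  have h2 : 1 ≤ Real.exp (η * s.res (Sum.inl j)) :=
    Real.one_le_exp (mul_nonneg hη (hs.res_nonneg _))
  simp only [neg_zero, zero_mul, Real.exp_zero, one_mul, zero_sub] at h1 ⊢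
  have h3 := mul_le_mul_of_nonneg_left h1 hε₀
  have h4 : ε * (Real.exp (η * s.res (Sum.inl j)) - 1) ≤
      η * (Real.exp (η * s.res (Sum.inl j)) - 1) :=
    mul_le_mul_of_nonneg_right hε (by linarith)
  unfold resSlope
  linarith

variable {J : ℕ} {S : Sys J} {μ : Clk J → Measure ℝ} {rt : Clk J → ℝ} {k₀ θ₁ : ℝ}

/-! ### The Lyapunov function of a resource -/

/-- Constants of the Lyapunov function of a resource with incidence vector `K`. -/
structure WorkConst (J : ℕ) where
  K : Fin J → ℝ
  x : ℝ
  ζ : ℝ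
  ε : ℝ
  M : ℝ
  A : ℝ
  N : ℝ

namespace WorkConst

/-- The exponent for the residual times. -/
def η (w : WorkConst J) : ℝ := J * w.x

/-- The weights of the queues. -/
def wt (w : WorkConst J) (rt : Clk J → ℝ) (j : Fin J) : ℝ := w.x * w.K j / rt (Sum.inr j)

/-- The Lyapunov function. -/
def lyap (w : WorkConst J) (S : Sys J) (rt : Clk J → ℝ) (k₀ : ℝ) (c : BlockConst)
    (s : State J) : ℝ :=
  expWork S rt k₀ (w.wt rt) (fun j => w.x * w.K j) s +
    corrected S (fun j => -2 * w.wt rt j) rt s +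
    w.M * ∑ j, expRes rt k₀ w.η w.η (Sum.inr j) s +
    w.A * ∑ j, expRes rt k₀ w.η 0 (Sum.inl j) s +
    w.N * ∑ j, blockPot S rt k₀ c w.ζ j s + 2

/-- Requirements on the constants of the Lyapunov function. -/
structure Ok (w : WorkConst J) (S : Sys J) (rt : Clk J → ℝ) (k₀ θ₁ : ℝ)
    (bmin bmax q τ τ₂ dlo dhi σ b : ℝ) : Prop where
  K_zero_one : ∀ j, w.K j = 0 ∨ w.K j = 1
  x_pos : 0 < w.x
  ζ_nonneg : 0 ≤ w.ζ
  ε_nonneg : 0 ≤ w.ε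
  M_nonneg : 0 ≤ w.M
  A_nonneg : 0 ≤ w.A
  N_nonneg : 0 ≤ w.N
  η_le : w.η ≤ θ₁
  wt_le : ∀ j, w.wt rt j ≤ θ₁
  bmin_pos : 0 < bmin
  bmin_le : ∀ z j, bmin ≤ S.b0 z j
  le_bmax : ∀ z j, S.b0 z j ≤ bmax
  quad : ∑ j, w.wt rt j ^ 2 * k₀ * (rt (Sum.inl j) + rt (Sum.inr j) * bmax) ≤ q
  charged : w.x * ∑ j, w.K j * (rt (Sum.inl j) / rt (Sum.inr j)) + q + w.x * J * S.γ + w.ε ≤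
    w.x * S.chg
  active : ∀ z : Fin J → Bool, (∃ j, w.K j = 1 ∧ z j = false) →
    -τ₂ ≤ ∑ j, w.K j * (rt (Sum.inl j) / rt (Sum.inr j) - S.b0 z j) ∧
    ∑ j, w.K j * (rt (Sum.inl j) / rt (Sum.inr j) - S.b0 z j) ≤ -τ
  inactive : ∀ z : Fin J → Bool, (∀ j, w.K j = 1 → z j = true) → ∃ d, dlo ≤ d ∧ d ≤ dhi ∧
    d - τ₂ ≤ ∑ j, w.K j * (rt (Sum.inl j) / rt (Sum.inr j) - S.b0 z j) ∧
    ∑ j, w.K j * (rt (Sum.inl j) / rt (Sum.inr j) - S.b0 z j) ≤ d - τ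
  damp : q + w.x * J * S.γ + w.ε ≤ w.x * τ
  τ₂_nonneg : 0 ≤ τ₂
  ε_le_dlo : w.ε ≤ w.x * dlo
  expU : Real.exp (∑ j, w.wt rt j * S.U) ≤ 2
  M_ge : 4 * w.x * dhi ≤ w.M * (w.η * bmin / 4)
  γ_le : S.γ ≤ bmin / 2
  ε_chg : 2 * w.ε ≤ w.η * S.chg
  ε_bmin : 2 * w.ε ≤ w.η * bmin / 4
  ε_η : 2 * w.ε ≤ w.η
  ε_γ : 2 * w.ε ≤ w.ζ * S.γ / 2
  ε_ζ : 2 * w.ε ≤ w.ζ / 2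
  N_ge : 2 * w.x * (J * bmax) ≤ w.N * (w.ζ / 2)
  N_ge' : 6 * w.x ≤ w.N * w.ζ
  A_ge : ∀ j, 4 * (w.wt rt j * rt (Sum.inl j)) ≤ w.A * w.η
  slope : ∀ k, rt k * k₀ * w.η ≤ 1 / 4
  quad_A : ∀ j, 2 * (w.wt rt j ^ 2 * k₀ * rt (Sum.inl j)) ≤ w.A / 4 * w.η
  quad_M : ∀ j, 2 * (w.wt rt j ^ 2 * k₀ * rt (Sum.inr j)) ≤ w.M / 2 * w.η
  quad_x : ∀ j, 2 * (w.wt rt j ^ 2 * k₀ * rt (Sum.inr j)) ≤ w.x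
  σ_inr : ∀ j, bmax * (rt (Sum.inr j) * k₀ * w.η ^ 2) ≤ σ
  σ_inl : ∀ j, rt (Sum.inl j) * k₀ * w.η ^ 2 ≤ σ
  b_ge : 2 * w.x * τ₂ + 4 * w.ε + w.M * (J * (S.γ * w.η + σ + 2 * w.ε)) +
    w.A * (J * (2 * w.ε + σ)) + w.N * (J * (w.ζ * S.γ)) ≤ b

/-- The part of the drift of `expWork` and of the linear term. -/
def dLyap (w : WorkConst J) (S : Sys J) (rt : Clk J → ℝ) (k₀ : ℝ) (c : BlockConst)
    (s : State J) : ℝ :=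
  expWork S rt k₀ (w.wt rt) (fun j => w.x * w.K j) s *
      (∑ j, w.wt rt j * (rt (Sum.inl j) * (1 + k₀ * w.wt rt j) -
        rt (Sum.inr j) * (1 - k₀ * w.wt rt j) * S.alloc s j) - ∑ j, w.x * w.K j * dD S s j) +
    ∑ j, -2 * w.wt rt j * (rt (Sum.inl j) - rt (Sum.inr j) * S.alloc s j) +
    w.M * ∑ j, (-w.η * dD S s j * expRes rt k₀ w.η w.η (Sum.inr j) s -
      Real.exp (-w.η * s.D j) * S.alloc s j *
        (w.η * Real.exp (w.η * s.res (Sum.inr j)) - resSlope rt k₀ w.η (Sum.inr j))) +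
    w.A * ∑ j, (-0 * dD S s j * expRes rt k₀ w.η 0 (Sum.inl j) s -
      Real.exp (-0 * s.D j) * 1 *
        (w.η * Real.exp (w.η * s.res (Sum.inl j)) - resSlope rt k₀ w.η (Sum.inl j))) +
    w.N * ∑ j, dBlockPot S rt k₀ c w.ζ j s

theorem hasDrift_lyap (w : WorkConst J) (hS : S.Good) (c : BlockConst) :
    HasDrift S (w.lyap S rt k₀ c) (w.dLyap S rt k₀ c) := by
  refine ((((((hasDrift_expWork hS (w.wt rt) (fun j => w.x * w.K j)).add
    (hasDrift_corrected (fun j => -2 * w.wt rt j) rt)).add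
    ((HasDrift.sum fun j _ => hasDrift_expRes hS w.η w.η (Sum.inr j)).const_mul w.M)).add
    ((HasDrift.sum fun j _ => hasDrift_expRes hS w.η 0 (Sum.inl j)).const_mul w.A)).add
    ((HasDrift.sum fun j _ => hasDrift_blockPot hS j).const_mul w.N)).add
    (HasDrift.const 2)).congr fun s _ => ?_
  simp only [dLyap, add_zero, Sys.speed, Sum.elim_inl, Sum.elim_inr, typ_inl, typ_inr]

theorem superJump_lyap (w : WorkConst J) (hE : ExpBounds μ rt k₀ θ₁)
    {c : BlockConst} {d₁ b₁ : ℝ} (hc : c.Ok S rt k₀ θ₁ w.ζ d₁ b₁) (hS : S.Good)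
    (hw : ∀ j, |w.wt rt j| ≤ θ₁) (hη : 0 ≤ w.η) (hη' : w.η ≤ θ₁) (hM : 0 ≤ w.M) (hA : 0 ≤ w.A)
    (hN : 0 ≤ w.N) : SuperJump S μ (w.lyap S rt k₀ c) :=
  ((((((superJump_expWork hE hw).add (superJump_corrected hE _)).add
    ((SuperJump.sum fun j _ => superJump_expRes hE hη hη' w.η (Sum.inr j)).const_mul hM)).add
    ((SuperJump.sum fun j _ => superJump_expRes hE hη hη' 0 (Sum.inl j)).const_mul hA)).add
    ((SuperJump.sum fun j _ => superJump_blockPot hS hc hE j).const_mul hN)).add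
    (SuperJump.const hE.prob 2))

theorem measurable_lyap (w : WorkConst J) (S : Sys J) (rt : Clk J → ℝ) (k₀ : ℝ) (c : BlockConst) :
    Measurable (w.lyap S rt k₀ c) := by
  have hQ := fun j => S.measurable_Q j
  have hR := fun k => Sys.measurable_res (J := J) k
  have hD := fun j => State.measurable_D_apply (J := J) j
  have hB := fun j => measurable_blockPot (S := S) (rt := rt) (k₀ := k₀) (c := c) (ζ := w.ζ) j
  unfold lyap expWork corrected expRes
  simp only [typ_inl, typ_inr]
  fun_prop

namespace Ok

variable {w : WorkConst J} {c : BlockConst} {d₁ b₁ bmin bmax q τ τ₂ dlo dhi σ b : ℝ}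

theorem K_nonneg (h : w.Ok S rt k₀ θ₁ bmin bmax q τ τ₂ dlo dhi σ b) (j : Fin J) :
    0 ≤ w.K j := by rcases h.K_zero_one j with h | h <;> simp [h]

theorem K_le_one (h : w.Ok S rt k₀ θ₁ bmin bmax q τ τ₂ dlo dhi σ b) (j : Fin J) :
    w.K j ≤ 1 := by rcases h.K_zero_one j with h | h <;> simp [h]

theorem sum_K_le (h : w.Ok S rt k₀ θ₁ bmin bmax q τ τ₂ dlo dhi σ b) :
    ∑ j, w.K j ≤ J := by
  refine (Finset.sum_le_sum fun j _ => h.K_le_one j).trans ?_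
  simp

theorem wt_nonneg (h : w.Ok S rt k₀ θ₁ bmin bmax q τ τ₂ dlo dhi σ b)
    (hE : ExpBounds μ rt k₀ θ₁) (j : Fin J) : 0 ≤ w.wt rt j :=
  div_nonneg (mul_nonneg h.x_pos.le (h.K_nonneg j)) (hE.rt_pos _).le

theorem wt_mul (hE : ExpBounds μ rt k₀ θ₁) (j : Fin J) :
    w.wt rt j * rt (Sum.inr j) = w.x * w.K j := by
  unfold wt
  rw [div_mul_cancel₀ _ (hE.rt_pos _).ne']

theorem η_nonneg (h : w.Ok S rt k₀ θ₁ bmin bmax q τ τ₂ dlo dhi σ b) : 0 ≤ w.η :=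
  mul_nonneg (Nat.cast_nonneg _) h.x_pos.le

theorem alloc_nonneg (h : w.Ok S rt k₀ θ₁ bmin bmax q τ τ₂ dlo dhi σ b)
    (s : State J) (j : Fin J) : 0 ≤ S.alloc s j := by
  unfold Sys.alloc; split_ifs
  · exact le_rfl
  · exact h.bmin_pos.le.trans (h.bmin_le _ _)

theorem alloc_le (h : w.Ok S rt k₀ θ₁ bmin bmax q τ τ₂ dlo dhi σ b)
    (s : State J) (j : Fin J) : S.alloc s j ≤ bmax := by
  unfold Sys.alloc; split_ifs
  · exact h.bmin_pos.le.trans ((h.bmin_le (S.z s) j).trans (h.le_bmax _ _))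
  · exact h.le_bmax _ _

/-- The drift of the exponent of `expWork`. -/
theorem exponent_le (h : w.Ok S rt k₀ θ₁ bmin bmax q τ τ₂ dlo dhi σ b)
    (hE : ExpBounds μ rt k₀ θ₁) (s : State J) :
    ∑ j, w.wt rt j * (rt (Sum.inl j) * (1 + k₀ * w.wt rt j) -
        rt (Sum.inr j) * (1 - k₀ * w.wt rt j) * S.alloc s j) ≤
      w.x * ∑ j, w.K j * (rt (Sum.inl j) / rt (Sum.inr j) - S.alloc s j) + q := by
  refine le_trans ?_ (add_le_add le_rfl h.quad)
  rw [Finset.mul_sum, ← Finset.sum_add_distrib]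
  refine Finset.sum_le_sum fun j _ => ?_
  have h1 : 0 ≤ w.wt rt j ^ 2 * k₀ * rt (Sum.inr j) :=
    mul_nonneg (mul_nonneg (sq_nonneg _) hE.k₀_nonneg) (hE.rt_pos _).le
  have h2 := mul_le_mul_of_nonneg_left (h.alloc_le s j) h1
  have h3 : w.x * (w.K j * (rt (Sum.inl j) / rt (Sum.inr j) - S.alloc s j)) =
      w.wt rt j * rt (Sum.inl j) - w.wt rt j * rt (Sum.inr j) * S.alloc s j := by
    rw [wt_mul hE]; unfold wt; ring
  rw [h3]
  linarith

theorem linear_drift (hE : ExpBounds μ rt k₀ θ₁) (s : State J) :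
    ∑ j, -2 * w.wt rt j * (rt (Sum.inl j) - rt (Sum.inr j) * S.alloc s j) =
      -2 * (w.x * ∑ j, w.K j * (rt (Sum.inl j) / rt (Sum.inr j) - S.alloc s j)) := by
  rw [Finset.mul_sum, Finset.mul_sum]
  refine Finset.sum_congr rfl fun j _ => ?_
  have h3 : w.x * (w.K j * (rt (Sum.inl j) / rt (Sum.inr j) - S.alloc s j)) =
      w.wt rt j * rt (Sum.inl j) - w.wt rt j * rt (Sum.inr j) * S.alloc s j := by
    rw [wt_mul hE]; unfold wt; ring
  rw [h3]; ring

theorem neg_sum_D_le (h : w.Ok S rt k₀ θ₁ bmin bmax q τ τ₂ dlo dhi σ b) (hS : S.Good)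
    (s : State J) : -(w.x * J * S.γ) ≤ ∑ j, w.x * w.K j * dD S s j := by
  calc -(w.x * J * S.γ) ≤ -(w.x * (∑ j, w.K j) * S.γ) := by
        have h1 := h.x_pos.le
        have h2 := hS.γ_nonneg
        have h3 := h.sum_K_le
        gcongr
    _ = ∑ j, w.x * w.K j * -S.γ := by
        rw [← Finset.sum_mul, ← Finset.mul_sum]; ring
    _ ≤ _ := by
        refine Finset.sum_le_sum fun j _ => ?_
        exact mul_le_mul_of_nonneg_left (neg_γ_le_dD hS s j)
          (mul_nonneg h.x_pos.le (h.K_nonneg j))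

/-- `expWork` is bounded by the residual service times when all queues of the resource are small. -/
theorem expWork_le (h : w.Ok S rt k₀ θ₁ bmin bmax q τ τ₂ dlo dhi σ b)
    (hE : ExpBounds μ rt k₀ θ₁) {s : State J} (hs : S.Valid s)
    (hz : ∀ j, w.K j = 1 → S.z s j = true) :
    expWork S rt k₀ (w.wt rt) (fun j => w.x * w.K j) s ≤
      2 * (1 + ∑ j, w.K j * (Real.exp (w.η * max (s.res (Sum.inr j) - s.D j) 0) - 1)) := by
  have hx := h.x_pos.le
  have h1 : corrected S (w.wt rt) (tiltFactor rt k₀ (w.wt rt)) s - ∑ j, w.x * w.K j * s.D j ≤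
      ∑ j, w.wt rt j * S.U + ∑ j, w.x * w.K j * max (s.res (Sum.inr j) - s.D j) 0 := by
    rw [corrected, ← Finset.sum_sub_distrib, ← Finset.sum_add_distrib]
    refine Finset.sum_le_sum fun j _ => ?_
    have hwt := h.wt_nonneg hE j
    have hk := mul_nonneg hE.k₀_nonneg hwt
    have e1 : w.wt rt j * S.Q s j ≤ w.wt rt j * S.U := by
      rcases h.K_zero_one j with h0 | h0
      · simp [wt, h0]
      · have : S.Q s j < S.U := by simpa [Sys.z] using hz j h0
        exact mul_le_mul_of_nonneg_left this.le hwt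
    have e2 : 0 ≤ w.wt rt j * (tiltFactor rt k₀ (w.wt rt) (Sum.inl j) * s.res (Sum.inl j)) := by
      refine mul_nonneg hwt (mul_nonneg (mul_nonneg (hE.rt_pos _).le ?_) (hs.res_nonneg _))
      linarith
    have e3 : w.wt rt j * (tiltFactor rt k₀ (w.wt rt) (Sum.inr j) * s.res (Sum.inr j)) ≤
        w.x * w.K j * s.res (Sum.inr j) := by
      rw [← wt_mul hE]
      have := mul_nonneg (mul_nonneg (mul_nonneg hwt (hE.rt_pos (Sum.inr j)).le) hk)
        (hs.res_nonneg (Sum.inr j))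
      change w.wt rt j * (rt (Sum.inr j) * (1 - k₀ * w.wt rt j) * s.res (Sum.inr j)) ≤ _
      linarith
    have e4 := mul_le_mul_of_nonneg_left (le_max_left (s.res (Sum.inr j) - s.D j) 0)
      (mul_nonneg hx (h.K_nonneg j))
    linarith
  have h2 := exp_sum_le Finset.univ
    (fun j => w.x * w.K j * max (s.res (Sum.inr j) - s.D j) 0) (n := J)
    (fun j _ => mul_nonneg (mul_nonneg hx (h.K_nonneg j)) (le_max_right _ _)) (by simp)
  have h3 : ∀ j, Real.exp (J * (w.x * w.K j * max (s.res (Sum.inr j) - s.D j) 0)) - 1 =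
      w.K j * (Real.exp (w.η * max (s.res (Sum.inr j) - s.D j) 0) - 1) := by
    intro j
    rcases h.K_zero_one j with h0 | h0
    · simp [h0]
    · rw [h0, mul_one, one_mul, η, mul_assoc]
  simp only [h3] at h2
  unfold expWork
  refine (Real.exp_le_exp.2 h1).trans ?_
  rw [Real.exp_add]
  exact mul_le_mul h.expU h2 (Real.exp_pos _).le zero_le_two

end Ok

end WorkConst

/-! ### Size and drift of the Lyapunov function. -/

namespace WorkConst.Ok

variable {J : ℕ} {S : Sys J} {μ : Clk J → Measure ℝ} {rt : Clk J → ℝ} {k₀ θ₁ : ℝ}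
variable {w : WorkConst J} {c : BlockConst} {d₁ b₁ bmin bmax q τ τ₂ dlo dhi σ b : ℝ}

theorem sum_le_sub_of_single {f g : Fin J → ℝ} (hfg : ∀ j, f j ≤ g j) (i : Fin J) {a : ℝ}
    (hi : f i ≤ g i - a) : ∑ j, f j ≤ ∑ j, g j - a := by
  classical
  rw [← Finset.add_sum_erase _ _ (Finset.mem_univ i), ← Finset.add_sum_erase _ g (Finset.mem_univ i)]
  have := Finset.sum_le_sum fun j (_ : j ∈ Finset.univ.erase i) => hfg j
  linarith

/-- With nonpositive weights only the residual interarrival times contribute positively, and their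
exponentials dominate them. -/
theorem corrected_ge (h : w.Ok S rt k₀ θ₁ bmin bmax q τ τ₂ dlo dhi σ b)
    (hE : ExpBounds μ rt k₀ θ₁) {s : State J} (hs : S.Valid s) :
    corrected S (fun j => -2 * w.wt rt j) rt s ≤
      w.A * ∑ j, expRes rt k₀ w.η 0 (Sum.inl j) s := by
  rw [corrected, Finset.mul_sum]
  refine Finset.sum_le_sum fun j _ => ?_
  have hwt := h.wt_nonneg hE j
  have h1 := le_expRes (ζ := 0) h.η_nonneg (h.slope (Sum.inl j)) hs
  simp only [neg_zero, zero_mul, Real.exp_zero, one_mul] at h1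
  have h2 := mul_le_mul_of_nonneg_right (h.A_ge j) (hs.res_nonneg (Sum.inl j))
  have h3 := Real.add_one_le_exp (w.η * s.res (Sum.inl j))
  have h4 := mul_nonneg hwt (hs.Q_nonneg j)
  have h5 := mul_nonneg hwt (mul_nonneg (hE.rt_pos (Sum.inr j)).le (hs.res_nonneg (Sum.inr j)))
  have h6 : w.A * (1 / 2 * (w.η * s.res (Sum.inl j))) ≤
      w.A * expRes rt k₀ w.η 0 (Sum.inl j) s :=
    mul_le_mul_of_nonneg_left (by linarith) h.A_nonneg
  linarith

theorem expRes_nonneg (h : w.Ok S rt k₀ θ₁ bmin bmax q τ τ₂ dlo dhi σ b)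
    {s : State J} (hs : S.Valid s) (ζ : ℝ) (k : Clk J) : 0 ≤ expRes rt k₀ w.η ζ k s :=
  le_trans (by positivity) (le_expRes h.η_nonneg (h.slope k) hs)

theorem lyap_le (h : w.Ok S rt k₀ θ₁ bmin bmax q τ τ₂ dlo dhi σ b)
    (hE : ExpBounds μ rt k₀ θ₁) {s : State J} (hs : S.Valid s) :
    w.lyap S rt k₀ c s ≤ expWork S rt k₀ (w.wt rt) (fun j => w.x * w.K j) s +
      w.M * ∑ j, expRes rt k₀ w.η w.η (Sum.inr j) s +
      2 * (w.A * ∑ j, expRes rt k₀ w.η 0 (Sum.inl j) s) +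
      w.N * ∑ j, blockPot S rt k₀ c w.ζ j s + 2 := by
  have := h.corrected_ge hE hs
  unfold lyap
  linarith

/-- The Lyapunov function bounds its main parts. -/
theorem le_lyap (h : w.Ok S rt k₀ θ₁ bmin bmax q τ τ₂ dlo dhi σ b)
    (hE : ExpBounds μ rt k₀ θ₁) (hc : c.Ok S rt k₀ θ₁ w.ζ d₁ b₁) {s : State J} (hs : S.Valid s) :
    1 / 2 * expWork S rt k₀ (w.wt rt) (fun j => w.x * w.K j) s +
      w.A / 4 * ∑ j, Real.exp (w.η * s.res (Sum.inl j)) +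
      w.N / 2 * ∑ j, Real.exp (w.ζ * s.D j) ≤ w.lyap S rt k₀ c s := by
  set ℓ := corrected S (w.wt rt) (tiltFactor rt k₀ (w.wt rt)) s - ∑ j, w.x * w.K j * s.D j with hℓ
  have h1 := four_mul_le_exp ℓ
  have hx := h.x_pos.le
  -- The linear term is `-2 * ℓ` up to the variables `D` and the second-order differences of the
  -- slopes; the other summands absorb these.
  have h2 : corrected S (fun j => -2 * w.wt rt j) rt s = -2 * ℓ - ∑ j, (2 * (w.x * w.K j * s.D j) +
      2 * (w.wt rt j ^ 2 * k₀ * rt (Sum.inl j)) * s.res (Sum.inl j) +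
      2 * (w.wt rt j ^ 2 * k₀ * rt (Sum.inr j)) * s.res (Sum.inr j)) := by
    rw [hℓ, corrected, corrected, ← Finset.sum_sub_distrib, Finset.mul_sum,
      ← Finset.sum_sub_distrib]
    refine Finset.sum_congr rfl fun j _ => ?_
    change _ = -2 * (w.wt rt j * (S.Q s j - rt (Sum.inl j) * (1 + k₀ * w.wt rt j) *
      s.res (Sum.inl j) + rt (Sum.inr j) * (1 - k₀ * w.wt rt j) * s.res (Sum.inr j)) -
      w.x * w.K j * s.D j) - _
    ring
  have h3 : ∑ j, (2 * (w.x * w.K j * s.D j) +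
      2 * (w.wt rt j ^ 2 * k₀ * rt (Sum.inl j)) * s.res (Sum.inl j) +
      2 * (w.wt rt j ^ 2 * k₀ * rt (Sum.inr j)) * s.res (Sum.inr j)) ≤
      ∑ j, (w.N * blockPot S rt k₀ c w.ζ j s - w.N / 2 * Real.exp (w.ζ * s.D j) +
        (w.A * expRes rt k₀ w.η 0 (Sum.inl j) s -
          w.A / 4 * Real.exp (w.η * s.res (Sum.inl j))) +
        w.M * expRes rt k₀ w.η w.η (Sum.inr j) s) := by
    refine Finset.sum_le_sum fun j _ => ?_
    have hD := hs.D_nonneg j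
    have hA := hs.res_nonneg (Sum.inl j)
    have a1 := le_expRes (ζ := 0) h.η_nonneg (h.slope (Sum.inl j)) hs
    simp only [neg_zero, zero_mul, Real.exp_zero, one_mul] at a1
    have a2 := mul_le_mul_of_nonneg_left a1 h.A_nonneg
    have a3 := mul_le_mul_of_nonneg_right (h.quad_A j) hA
    have a4 : w.A * (w.η * s.res (Sum.inl j)) ≤ w.A * Real.exp (w.η * s.res (Sum.inl j)) :=
      mul_le_mul_of_nonneg_left (by have := Real.add_one_le_exp (w.η * s.res (Sum.inl j)); linarith)
        h.A_nonneg
    have n1 := mul_le_mul_of_nonneg_left (exp_le_blockPot hc hE hs j) h.N_nonneg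
    have n2 := mul_le_mul_of_nonneg_right h.N_ge' hD
    have n3 : w.N * (w.ζ * s.D j) ≤ w.N * Real.exp (w.ζ * s.D j) :=
      mul_le_mul_of_nonneg_left (by have := Real.add_one_le_exp (w.ζ * s.D j); linarith)
        h.N_nonneg
    have n4 : w.x * w.K j * s.D j ≤ w.x * s.D j :=
      mul_le_mul_of_nonneg_right (mul_le_of_le_one_right hx (h.K_le_one j)) hD
    have m1 := le_expRes (ζ := w.η) h.η_nonneg (h.slope (Sum.inr j)) hs
    rw [typ_inr, ← Real.exp_add] at m1
    have m2 := mul_le_mul_of_nonneg_left m1 h.M_nonneg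
    have m3 := mul_le_mul_of_nonneg_right (h.quad_x j) hD
    have hw0 : 0 ≤ 2 * (w.wt rt j ^ 2 * k₀ * rt (Sum.inr j)) :=
      mul_nonneg zero_le_two (mul_nonneg (mul_nonneg (sq_nonneg _) hE.k₀_nonneg) (hE.rt_pos _).le)
    -- The residual service time is split into `D` and the excess over `D`. The damped exponential
    -- controls only the excess; the part `D` goes to the blocking potential.
    have m4 : 2 * (w.wt rt j ^ 2 * k₀ * rt (Sum.inr j)) * (s.res (Sum.inr j) - s.D j) ≤
        w.M / 2 * Real.exp (-w.η * s.D j + w.η * s.res (Sum.inr j)) := by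
      rcases le_total (s.res (Sum.inr j) - s.D j) 0 with h0 | h0
      · refine (mul_nonpos_of_nonneg_of_nonpos hw0 h0).trans ?_
        have := h.M_nonneg
        positivity
      · refine (mul_le_mul_of_nonneg_right (h.quad_M j) h0).trans ?_
        rw [mul_assoc]
        refine mul_le_mul_of_nonneg_left ?_ (by have := h.M_nonneg; positivity)
        have := Real.add_one_le_exp (-w.η * s.D j + w.η * s.res (Sum.inr j))
        linarith
    linarith
  simp only [Finset.sum_add_distrib, Finset.sum_sub_distrib, ← Finset.mul_sum] at h2 h3
  unfold lyap
  rw [h2]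
  simp only [expWork, ← hℓ]
  linarith

/-- Three regimes. If a type of the resource is charged, `D` lowers the exponent. If none is charged
and some queue is above the threshold, full use of the capacity yields the drift `-τ`. If none is
charged and all queues are below it, the linear term cancels the growth of the exponential to
leading order. The residual and blocking functions provide decay at twice the rate `ε`, which leaves
room for the factor `2` in `lyap_le`. -/
theorem drift_le (h : w.Ok S rt k₀ θ₁ bmin bmax q τ τ₂ dlo dhi σ b)
    (hE : ExpBounds μ rt k₀ θ₁) (hc : c.Ok S rt k₀ θ₁ w.ζ d₁ b₁) (hS : S.Good)
    (hV : ∀ s, S.Valid s → ∀ j,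
      dBlockPot S rt k₀ c w.ζ j s ≤ -(w.ζ * S.γ / 2) * blockPot S rt k₀ c w.ζ j s + w.ζ * S.γ)
    {s : State J} (hs : S.Valid s) :
    w.dLyap S rt k₀ c s ≤ -w.ε * w.lyap S rt k₀ c s + b := by
  have hε := h.ε_nonneg
  have hx := h.x_pos.le
  have hη := h.η_nonneg
  have hγ0 := hS.γ_nonneg
  have hLle := mul_le_mul_of_nonneg_left (h.lyap_le (c := c) hE hs) hε
  have hbge := h.b_ge
  unfold dLyap
  set P := expWork S rt k₀ (w.wt rt) (fun j => w.x * w.K j) s with hP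
  have hP0 : 0 < P := Real.exp_pos _
  set E₁ := ∑ j, w.wt rt j * (rt (Sum.inl j) * (1 + k₀ * w.wt rt j) -
        rt (Sum.inr j) * (1 - k₀ * w.wt rt j) * S.alloc s j) with hE₁
  have hexp := h.exponent_le hE s
  rw [← hE₁] at hexp
  rw [linear_drift hE]
  set G₁ := ∑ j, w.K j * (rt (Sum.inl j) / rt (Sum.inr j) - S.alloc s j) with hG₁
  have hnegD := h.neg_sum_D_le hS s
  set D₁ := ∑ j, w.x * w.K j * dD S s j with hD₁
  -- interarrival times
  have hFA : ∑ j, (-0 * dD S s j * expRes rt k₀ w.η 0 (Sum.inl j) s -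
      Real.exp (-0 * s.D j) * 1 *
        (w.η * Real.exp (w.η * s.res (Sum.inl j)) - resSlope rt k₀ w.η (Sum.inl j))) ≤
      -(2 * w.ε) * ∑ j, expRes rt k₀ w.η 0 (Sum.inl j) s + J * (2 * w.ε + σ) := by
    refine (Finset.sum_le_sum fun j _ => drift_expRes_inl hE hη (by linarith : 0 ≤ 2 * w.ε)
      h.ε_η hs (h.σ_inl j)).trans (le_of_eq ?_)
    rw [Finset.sum_add_distrib, ← Finset.mul_sum]
    simp only [Finset.sum_const, Finset.card_univ, Fintype.card_fin, nsmul_eq_mul]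
  have hFA' := mul_le_mul_of_nonneg_left hFA h.A_nonneg
  set FA := ∑ j, expRes rt k₀ w.η 0 (Sum.inl j) s
  -- service times
  set p : Fin J → ℝ := fun j => Real.exp (w.η * max (s.res (Sum.inr j) - s.D j) 0) - 1 with hp
  have hp0 : ∀ j, 0 ≤ p j := fun j => by
    rw [hp, sub_nonneg]; exact Real.one_le_exp (mul_nonneg hη (le_max_right _ _))
  have hFSu : ∀ j, ¬ S.Charged s j → -w.η * dD S s j * expRes rt k₀ w.η w.η (Sum.inr j) s -
      Real.exp (-w.η * s.D j) * S.alloc s j *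
        (w.η * Real.exp (w.η * s.res (Sum.inr j)) - resSlope rt k₀ w.η (Sum.inr j)) ≤
      -(2 * w.ε) * expRes rt k₀ w.η w.η (Sum.inr j) s + (S.γ * w.η + σ + 2 * w.ε) -
        w.η * bmin / 4 * p j := by
    intro j hj
    refine (drift_expRes_not_charged hS hE hη hs hj (fun z => h.bmin_le z j) h.bmin_pos.le h.γ_le
      (fun z => h.le_bmax z j) (h.σ_inr j)).trans ?_
    have h1 : expRes rt k₀ w.η w.η (Sum.inr j) s ≤ p j + 1 := by
      refine (expRes_le hE hη hs _).trans ?_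
      rw [hp, sub_add_cancel, ← Real.exp_add, typ_inr]
      refine Real.exp_le_exp.2 ?_
      have := mul_le_mul_of_nonneg_left (le_max_left (s.res (Sum.inr j) - s.D j) 0) hη
      linarith
    have h2 := mul_le_mul_of_nonneg_left h1 (by linarith : 0 ≤ 2 * w.ε)
    have h3 := mul_le_mul_of_nonneg_right h.ε_bmin (hp0 j)
    change -(w.η * bmin / 2) * p j + _ ≤ _
    linarith
  have hFS : ∀ j, -w.η * dD S s j * expRes rt k₀ w.η w.η (Sum.inr j) s -
      Real.exp (-w.η * s.D j) * S.alloc s j *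
        (w.η * Real.exp (w.η * s.res (Sum.inr j)) - resSlope rt k₀ w.η (Sum.inr j)) ≤
      -(2 * w.ε) * expRes rt k₀ w.η w.η (Sum.inr j) s + (S.γ * w.η + σ + 2 * w.ε) := by
    intro j
    by_cases hj : S.Charged s j
    · refine (drift_expRes_charged hS hE hη hs hj (fun z => h.le_bmax z j) (h.σ_inr j)).trans ?_
      have h1 := mul_le_mul_of_nonneg_right h.ε_chg (h.expRes_nonneg hs w.η (Sum.inr j))
      have h2 := mul_nonneg hγ0 hη
      linarith
    · refine (hFSu j hj).trans (sub_le_self _ (mul_nonneg ?_ (hp0 j)))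
      have := h.bmin_pos.le
      positivity
  have hFSsum : ∑ j, (-w.η * dD S s j * expRes rt k₀ w.η w.η (Sum.inr j) s -
      Real.exp (-w.η * s.D j) * S.alloc s j *
        (w.η * Real.exp (w.η * s.res (Sum.inr j)) - resSlope rt k₀ w.η (Sum.inr j))) ≤
      -(2 * w.ε) * ∑ j, expRes rt k₀ w.η w.η (Sum.inr j) s +
        J * (S.γ * w.η + σ + 2 * w.ε) := by
    refine (Finset.sum_le_sum fun j _ => hFS j).trans (le_of_eq ?_)
    rw [Finset.sum_add_distrib, ← Finset.mul_sum]
    simp only [Finset.sum_const, Finset.card_univ, Fintype.card_fin, nsmul_eq_mul]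
  have hFSsum' : (∀ j, w.K j = 1 → ¬ S.Charged s j) →
      ∑ j, (-w.η * dD S s j * expRes rt k₀ w.η w.η (Sum.inr j) s -
      Real.exp (-w.η * s.D j) * S.alloc s j *
        (w.η * Real.exp (w.η * s.res (Sum.inr j)) - resSlope rt k₀ w.η (Sum.inr j))) ≤
      -(2 * w.ε) * ∑ j, expRes rt k₀ w.η w.η (Sum.inr j) s +
        J * (S.γ * w.η + σ + 2 * w.ε) - w.η * bmin / 4 * ∑ j, w.K j * p j := by
    intro hK
    have : ∑ j, (-w.η * dD S s j * expRes rt k₀ w.η w.η (Sum.inr j) s -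
        Real.exp (-w.η * s.D j) * S.alloc s j *
        (w.η * Real.exp (w.η * s.res (Sum.inr j)) - resSlope rt k₀ w.η (Sum.inr j))) ≤
        ∑ j, (-(2 * w.ε) * expRes rt k₀ w.η w.η (Sum.inr j) s + (S.γ * w.η + σ + 2 * w.ε) -
          w.η * bmin / 4 * (w.K j * p j)) := by
      refine Finset.sum_le_sum fun j _ => ?_
      rcases h.K_zero_one j with h0 | h0
      · rw [h0]; simpa using hFS j
      · rw [h0, one_mul]; exact hFSu j (hK j h0)
    refine this.trans (le_of_eq ?_)
    rw [Finset.sum_sub_distrib, Finset.sum_add_distrib, ← Finset.mul_sum, ← Finset.mul_sum]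
    simp only [Finset.sum_const, Finset.card_univ, Fintype.card_fin, nsmul_eq_mul]
  set dFS := ∑ j, (-w.η * dD S s j * expRes rt k₀ w.η w.η (Sum.inr j) s -
      Real.exp (-w.η * s.D j) * S.alloc s j *
        (w.η * Real.exp (w.η * s.res (Sum.inr j)) - resSlope rt k₀ w.η (Sum.inr j))) with hdFS
  have hFS0 : 0 ≤ ∑ j, expRes rt k₀ w.η w.η (Sum.inr j) s :=
    Finset.sum_nonneg fun j _ => h.expRes_nonneg hs _ _
  set FS := ∑ j, expRes rt k₀ w.η w.η (Sum.inr j) s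
  have hFS1 := mul_le_mul_of_nonneg_left hFSsum h.M_nonneg
  -- blocked times
  have hVD1 : ∀ j, 1 ≤ blockPot S rt k₀ c w.ζ j s := fun j =>
    (Real.one_le_exp (mul_nonneg h.ζ_nonneg (hs.D_nonneg j))).trans (exp_le_blockPot hc hE hs j)
  have hVD : ∀ j, dBlockPot S rt k₀ c w.ζ j s ≤
      -(2 * w.ε) * blockPot S rt k₀ c w.ζ j s + w.ζ * S.γ := by
    intro j
    refine (hV s hs j).trans ?_
    have := mul_le_mul_of_nonneg_right h.ε_γ (zero_le_one.trans (hVD1 j))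
    linarith
  have hVDsum : ∑ j, (-(2 * w.ε) * blockPot S rt k₀ c w.ζ j s + w.ζ * S.γ) =
      -(2 * w.ε) * ∑ j, blockPot S rt k₀ c w.ζ j s + J * (w.ζ * S.γ) := by
    rw [Finset.sum_add_distrib, ← Finset.mul_sum]
    simp only [Finset.sum_const, Finset.card_univ, Fintype.card_fin, nsmul_eq_mul]
  have hVD2 := Finset.sum_le_sum fun j (_ : j ∈ Finset.univ) => hVD j
  rw [hVDsum] at hVD2
  have hVD3 := mul_le_mul_of_nonneg_left hVD2 h.N_nonneg
  have hVD0 : 0 ≤ ∑ j, blockPot S rt k₀ c w.ζ j s :=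
    Finset.sum_nonneg fun j _ => zero_le_one.trans (hVD1 j)
  have hεM : 0 ≤ w.ε * (w.M * FS) := mul_nonneg hε (mul_nonneg h.M_nonneg hFS0)
  have hεN : 0 ≤ w.ε * (w.N * ∑ j, blockPot S rt k₀ c w.ζ j s) :=
    mul_nonneg hε (mul_nonneg h.N_nonneg hVD0)
  have hxτ₂ : 0 ≤ w.x * τ₂ := mul_nonneg hx h.τ₂_nonneg
  by_cases hch : ∃ i, w.K i = 1 ∧ S.Charged s i
  · -- some type of the resource is charged
    obtain ⟨i, hi, hci⟩ := hch
    have hD2 : w.x * S.chg - w.x * J * S.γ ≤ D₁ := by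
      have h1 : -D₁ ≤ ∑ j, w.x * w.K j * S.γ - w.x * (S.chg + S.γ) := by
        rw [hD₁, ← Finset.sum_neg_distrib]
        refine sum_le_sub_of_single (fun j => ?_) i ?_
        · have := mul_le_mul_of_nonneg_left (neg_γ_le_dD hS s j)
            (mul_nonneg hx (h.K_nonneg j))
          linarith
        · rw [dD_of_charged hci, hi]; linarith
      have h2 : ∑ j, w.x * w.K j * S.γ ≤ w.x * J * S.γ := by
        rw [← Finset.sum_mul, ← Finset.mul_sum]
        have := h.sum_K_le
        gcongr
      have := mul_nonneg hx hγ0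
      linarith
    have hGa : G₁ ≤ ∑ j, w.K j * (rt (Sum.inl j) / rt (Sum.inr j)) := by
      refine Finset.sum_le_sum fun j _ => mul_le_mul_of_nonneg_left ?_ (h.K_nonneg j)
      linarith [h.alloc_nonneg s j]
    -- Because of the factor `-2` the linear term grows when the resource is served faster than load
    -- arrives. By `N_ge` the extra decay `ζ / 2` of the blocking potential of type `i` pays for
    -- this.
    have hGb : -(J * bmax) ≤ G₁ := by
      have : ∑ _j : Fin J, -bmax ≤ G₁ := by
        refine Finset.sum_le_sum fun j _ => ?_
        have h1 := div_nonneg (hE.rt_pos (Sum.inl j)).le (hE.rt_pos (Sum.inr j)).le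
        have h2 := h.alloc_le s j
        have h3 := h.alloc_nonneg s j
        rcases h.K_zero_one j with h0 | h0 <;> rw [h0] <;> linarith
      simpa using this
    have h1 := mul_le_mul_of_nonneg_left hGa hx
    have h2 : E₁ - D₁ ≤ -w.ε := by linarith [h.charged]
    have h3 := mul_le_mul_of_nonneg_left h2 hP0.le
    have h4 := mul_le_mul_of_nonneg_left hGb (by linarith : 0 ≤ 2 * w.x)
    have h5 : ∑ j, dBlockPot S rt k₀ c w.ζ j s ≤
        -(2 * w.ε) * ∑ j, blockPot S rt k₀ c w.ζ j s + J * (w.ζ * S.γ) - w.ζ / 2 := by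
      rw [← hVDsum]
      refine sum_le_sub_of_single hVD i ?_
      have h6 := dBlockPot_le_of_charged hc hE hs hci
      have h7 := mul_le_mul_of_nonneg_right h.ε_ζ (zero_le_one.trans (hVD1 i))
      have h8 := mul_le_mul_of_nonneg_left (hVD1 i) (by linarith [h.ζ_nonneg] : 0 ≤ w.ζ / 2)
      have h9 := mul_nonneg h.ζ_nonneg hγ0
      linarith
    have h6 := mul_le_mul_of_nonneg_left h5 h.N_nonneg
    have h7 := h.N_ge
    linarith
  · have hK : ∀ j, w.K j = 1 → ¬ S.Charged s j := fun j hj hcj => hch ⟨j, hj, hcj⟩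
    have hG : G₁ = ∑ j, w.K j * (rt (Sum.inl j) / rt (Sum.inr j) - S.b0 (S.z s) j) := by
      refine Finset.sum_congr rfl fun j _ => ?_
      rcases h.K_zero_one j with h0 | h0
      · simp [h0]
      · have hb : ¬ s.blk j = true := fun hb => hK j h0 (Or.inl hb)
        simp [Sys.alloc, hb]
    by_cases hz : ∃ j, w.K j = 1 ∧ S.z s j = false
    -- The capacity is fully used, and `damp` leaves a margin `ε` after the second-order terms and
    -- the decay of `D`.
    · obtain ⟨h1, h2⟩ := h.active (S.z s) hz
      rw [← hG] at h1 h2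
      have h3 := mul_le_mul_of_nonneg_left h1 hx
      have h4 := mul_le_mul_of_nonneg_left h2 hx
      have h5 : E₁ - D₁ ≤ -w.ε := by linarith [h.damp]
      have h6 := mul_le_mul_of_nonneg_left h5 hP0.le
      linarith
    · have hz' : ∀ j, w.K j = 1 → S.z s j = true := fun j hj => by
        by_contra hne
        exact hz ⟨j, hj, by simpa using hne⟩
      obtain ⟨d, hd1, hd2, h1, h2⟩ := h.inactive (S.z s) hz'
      rw [← hG] at h1 h2
      have hXle := h.expWork_le hE hs hz'
      rw [← hP] at hXle
      change P ≤ 2 * (1 + ∑ j, w.K j * p j) at hXle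
      have hKp : 0 ≤ ∑ j, w.K j * p j :=
        Finset.sum_nonneg fun j _ => mul_nonneg (h.K_nonneg j) (hp0 j)
      set Kp := ∑ j, w.K j * p j with hKpdef
      have h3 := mul_le_mul_of_nonneg_left h1 hx
      have h4 := mul_le_mul_of_nonneg_left h2 hx
      have hd1' := mul_le_mul_of_nonneg_left hd1 hx
      have hd2' := mul_le_mul_of_nonneg_left hd2 hx
      -- The exponent may increase here. Since `P ≤ 2 * (1 + Kp)`, the growth `P * (x * d)` is at
      -- most `2 * x * d + 2 * x * d * Kp`. The linear term cancels the first part up to `2 * x *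
      -- τ₂`, and by `M_ge` the residual service times pay for the second.
      have h5 : E₁ - D₁ ≤ w.x * d - w.ε := by linarith [h.damp]
      have h6 := mul_le_mul_of_nonneg_left h5 hP0.le
      have hxd : 0 ≤ w.x * d := by linarith [h.ε_le_dlo]
      have h7 := mul_le_mul_of_nonneg_left hXle hxd
      have h8 : 2 * (w.x * d) * Kp ≤ 4 * w.x * dhi * Kp := by
        refine mul_le_mul_of_nonneg_right ?_ hKp
        linarith
      have h9 := mul_le_mul_of_nonneg_right h.M_ge hKp
      have h10 := mul_le_mul_of_nonneg_left (hFSsum' hK) h.M_nonneg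
      linarith

end WorkConst.Ok

/-! ### Means -/

section MeanLE

variable {Ω : Type*} [MeasurableSpace Ω] {P : Measure Ω}

/-- `f` is integrable and its mean is at most `C`. -/
def MeanLE (P : Measure Ω) (f : Ω → ℝ) (C : ℝ) : Prop := Integrable f P ∧ ∫ ω, f ω ∂P ≤ C

namespace MeanLE

variable {f g : Ω → ℝ} {C C' : ℝ}

theorem const [IsProbabilityMeasure P] (c : ℝ) : MeanLE P (fun _ => c) c :=
  ⟨integrable_const _, by simp⟩

theorem add (hf : MeanLE P f C) (hg : MeanLE P g C') :
    MeanLE P (fun ω => f ω + g ω) (C + C') :=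
  ⟨hf.1.add hg.1, by rw [integral_add hf.1 hg.1]; exact add_le_add hf.2 hg.2⟩

theorem const_mul (hf : MeanLE P f C) {c : ℝ} (hc : 0 ≤ c) :
    MeanLE P (fun ω => c * f ω) (c * C) :=
  ⟨hf.1.const_mul c, by rw [integral_const_mul]; exact mul_le_mul_of_nonneg_left hf.2 hc⟩

theorem sum {ι : Type*} {t : Finset ι} {f : ι → Ω → ℝ} {C : ι → ℝ}
    (h : ∀ i ∈ t, MeanLE P (f i) (C i)) : MeanLE P (fun ω => ∑ i ∈ t, f i ω) (∑ i ∈ t, C i) :=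
  ⟨integrable_finsetSum _ fun i hi => (h i hi).1, by
    rw [integral_finsetSum _ fun i hi => (h i hi).1]
    exact Finset.sum_le_sum fun i hi => (h i hi).2⟩

theorem mono (hf : MeanLE P f C) (hC : C ≤ C') : MeanLE P f C' := ⟨hf.1, hf.2.trans hC⟩

theorem lintegral_le (hf : MeanLE P f C) (hgf : ∀ᵐ ω ∂P, g ω ≤ f ω) (h0 : ∀ᵐ ω ∂P, 0 ≤ f ω) :
    ∫⁻ ω, ENNReal.ofReal (g ω) ∂P ≤ ENNReal.ofReal C := by
  refine (lintegral_mono_ae (hgf.mono fun ω h => ENNReal.ofReal_le_ofReal h)).trans ?_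
  rw [← ofReal_integral_eq_lintegral_ofReal hf.1 h0]
  exact ENNReal.ofReal_le_ofReal hf.2

end MeanLE

end MeanLE

variable {J : ℕ} {S : Sys J} {μ : Clk J → Measure ℝ} {rt : Clk J → ℝ} {k₀ θ₁ : ℝ}

/-! ### Workload moments and the initial value of the Lyapunov function. -/

namespace WorkConst.Ok

variable {w : WorkConst J} {c : BlockConst} {d₁ b₁ bmin bmax q τ τ₂ dlo dhi σ b : ℝ}

theorem lyap_nonneg (h : w.Ok S rt k₀ θ₁ bmin bmax q τ τ₂ dlo dhi σ b)
    (hE : ExpBounds μ rt k₀ θ₁) (hc : c.Ok S rt k₀ θ₁ w.ζ d₁ b₁) {s : State J} (hs : S.Valid s) :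
    0 ≤ w.lyap S rt k₀ c s := by
  refine le_trans ?_ (h.le_lyap hE hc hs)
  have h1 := h.A_nonneg
  have h2 := h.N_nonneg
  unfold expWork
  positivity

/-- The exponential of the workload is bounded by the Lyapunov function. -/
theorem exp_work_le (h : w.Ok S rt k₀ θ₁ bmin bmax q τ τ₂ dlo dhi σ b)
    (hE : ExpBounds μ rt k₀ θ₁) (hc : c.Ok S rt k₀ θ₁ w.ζ d₁ b₁) {s : State J} (hs : S.Valid s)
    {κ : ℝ} (hκ₀ : 0 ≤ κ) (hκ : κ ≤ 1 / 3) (hκN : κ * J * w.N ≤ 2) (hκA : 3 * κ * J * w.A ≤ 2)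
    (hA : 2 ≤ w.A) (hN : 1 ≤ w.N) :
    Real.exp (κ * ∑ j, w.wt rt j * S.Q s j) ≤ 3 + 2 * w.lyap S rt k₀ c s := by
  have hx := h.x_pos.le
  have hη := h.η_nonneg
  have hA0 := h.A_nonneg
  have hN0 := h.N_nonneg
  set ℓ := corrected S (w.wt rt) (tiltFactor rt k₀ (w.wt rt)) s - ∑ j, w.x * w.K j * s.D j with hℓ
  -- To undo the corrections only `D` and the residual interarrival times have to be added back; the
  -- residual service times have the favourable sign.
  have h1 : ∑ j, w.wt rt j * S.Q s j ≤ ℓ + ∑ j, w.N / 6 * (w.ζ * s.D j) +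
      ∑ j, w.A / 2 * (w.η * s.res (Sum.inl j)) := by
    rw [hℓ, corrected, ← Finset.sum_sub_distrib, ← Finset.sum_add_distrib,
      ← Finset.sum_add_distrib]
    refine Finset.sum_le_sum fun j _ => ?_
    change _ ≤ w.wt rt j * (S.Q s j - rt (Sum.inl j) * (1 + k₀ * w.wt rt j) *
      s.res (Sum.inl j) + rt (Sum.inr j) * (1 - k₀ * w.wt rt j) * s.res (Sum.inr j)) -
      w.x * w.K j * s.D j + _ + _
    have hwt := h.wt_nonneg hE j
    have hk : k₀ * w.wt rt j ≤ 1 / 2 :=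
      (mul_le_mul_of_nonneg_left (h.wt_le j) hE.k₀_nonneg).trans hE.small
    have e1 : 0 ≤ w.wt rt j * (rt (Sum.inr j) * (1 - k₀ * w.wt rt j) * s.res (Sum.inr j)) :=
      mul_nonneg hwt (mul_nonneg (mul_nonneg (hE.rt_pos _).le (by linarith)) (hs.res_nonneg _))
    have e2 : w.wt rt j * (rt (Sum.inl j) * (1 + k₀ * w.wt rt j) * s.res (Sum.inl j)) ≤
        w.A / 2 * (w.η * s.res (Sum.inl j)) := by
      have a1 := mul_le_mul_of_nonneg_right (h.A_ge j) (hs.res_nonneg (Sum.inl j))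
      have a2 : 0 ≤ w.wt rt j * rt (Sum.inl j) * s.res (Sum.inl j) :=
        mul_nonneg (mul_nonneg hwt (hE.rt_pos _).le) (hs.res_nonneg _)
      have a3 := mul_le_mul_of_nonneg_right hk a2
      linarith
    have e3 : w.x * w.K j * s.D j ≤ w.N / 6 * (w.ζ * s.D j) := by
      have a1 : w.x * w.K j * s.D j ≤ w.x * s.D j :=
        mul_le_mul_of_nonneg_right (mul_le_of_le_one_right hx (h.K_le_one j)) (hs.D_nonneg j)
      have a2 := mul_le_mul_of_nonneg_right h.N_ge' (hs.D_nonneg j)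
      linarith
    linarith
  have h2 : Real.exp (3 * (κ * ℓ)) ≤ 1 + Real.exp ℓ := by
    rcases le_total ℓ 0 with h0 | h0
    · have : Real.exp (3 * (κ * ℓ)) ≤ 1 := Real.exp_le_one_iff.2 (by nlinarith)
      have := Real.exp_pos ℓ
      linarith
    · have : Real.exp (3 * (κ * ℓ)) ≤ Real.exp ℓ := Real.exp_le_exp.2 (by nlinarith)
      linarith
  have hgen : ∀ (f : Fin J → ℝ) (a : ℝ), (∀ j, 0 ≤ f j) → 0 ≤ a → J * (3 * (κ * a)) ≤ 1 →
      Real.exp (3 * (κ * ∑ j, a * f j)) ≤ 1 + ∑ j, Real.exp (f j) := by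
    intro f a hf ha hle
    have e : 3 * (κ * ∑ j, a * f j) = ∑ j, 3 * (κ * a) * f j := by
      rw [Finset.mul_sum, Finset.mul_sum]
      exact Finset.sum_congr rfl fun j _ => by ring
    rw [e]
    refine (exp_sum_le Finset.univ _ (n := J)
      (fun j _ => mul_nonneg (by positivity) (hf j)) (by simp)).trans ?_
    gcongr with j
    have : Real.exp (J * (3 * (κ * a) * f j)) ≤ Real.exp (f j) := by
      refine Real.exp_le_exp.2 ?_
      have := mul_le_mul_of_nonneg_right hle (hf j)
      linarith
    linarith
  have h3 := hgen (fun j => w.ζ * s.D j) (w.N / 6)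
    (fun j => mul_nonneg h.ζ_nonneg (hs.D_nonneg j)) (by positivity) (by linarith)
  have h4 := hgen (fun j => w.η * s.res (Sum.inl j)) (w.A / 2)
    (fun j => mul_nonneg hη (hs.res_nonneg _)) (by positivity) (by linarith)
  -- The largest of three exponents is at least their average; this takes the place of Hölder's
  -- inequality.
  have h5 : ∀ a b c : ℝ, Real.exp (a + b + c) ≤
      Real.exp (3 * a) + Real.exp (3 * b) + Real.exp (3 * c) := by
    intro a b c
    have ha := Real.exp_pos (3 * a)
    have hb := Real.exp_pos (3 * b)
    have hc := Real.exp_pos (3 * c)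
    rcases le_total a b with hab | hab <;> rcases le_total b c with hbc | hbc <;>
      rcases le_total a c with hac | hac
    all_goals first
      | (have := Real.exp_le_exp.2 (by linarith : a + b + c ≤ 3 * c); linarith)
      | (have := Real.exp_le_exp.2 (by linarith : a + b + c ≤ 3 * b); linarith)
      | (have := Real.exp_le_exp.2 (by linarith : a + b + c ≤ 3 * a); linarith)
  have h6 := h.le_lyap hE hc hs
  simp only [expWork, ← hℓ] at h6
  have h7 : 0 ≤ ∑ j, Real.exp (w.η * s.res (Sum.inl j)) :=
    Finset.sum_nonneg fun j _ => (Real.exp_pos _).le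
  have h8 : 0 ≤ ∑ j, Real.exp (w.ζ * s.D j) := Finset.sum_nonneg fun j _ => (Real.exp_pos _).le
  have h9 := mul_le_mul_of_nonneg_right hA h7
  have h10 := mul_le_mul_of_nonneg_right hN h8
  calc Real.exp (κ * ∑ j, w.wt rt j * S.Q s j)
      ≤ Real.exp (κ * ℓ + κ * ∑ j, w.N / 6 * (w.ζ * s.D j) +
          κ * ∑ j, w.A / 2 * (w.η * s.res (Sum.inl j))) := by
        refine Real.exp_le_exp.2 ?_
        have := mul_le_mul_of_nonneg_left h1 hκ₀
        linarith
    _ ≤ _ := h5 _ _ _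
    _ ≤ _ := by linarith

variable {Ω : Type*} [MeasurableSpace Ω] {P : Measure Ω} [IsProbabilityMeasure P]
  {X : Clk J → ℕ → Ω → ℝ}

/-- The exponent `lam` is not scaled with `r`, so it must not meet an initial residual time of order
`r`. A type with `Υ > 0` starts as waiting and uses only the small exponent `e₁`. An open type that
does not wait has `Υ = 0`, and its residual interarrival time is a fresh variable. -/
theorem blockPot_init_le (hE : ExpBounds μ rt k₀ θ₁) (hc : c.Ok S rt k₀ θ₁ w.ζ d₁ b₁) (hS : S.Good)
    {x : Clk J → ℕ → ℝ} (hs : S.Valid (S.init x)) (j : Fin J) :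
    blockPot S rt k₀ c w.ζ j (S.init x) ≤ c.G * Real.exp (c.e₁ * (S.init x).res (Sum.inl j)) +
      c.G * (if 0 < S.Υ (Sum.inl j) then 0 else Real.exp
        (c.lam * (rt (Sum.inl j) * (1 - k₀ * c.lam)) * (S.init x).res (Sum.inl j))) := by
  have hprob := hE.prob
  have hA := hc.A_pos.le
  have hM := hc.M_nonneg
  have he := hc.e₁_pos.le
  have hlam := hc.lam_pos
  have hα := hc.alpha_pos hE j
  have hres := hs.res_nonneg (Sum.inl j)
  have hAM : 0 ≤ c.A * (1 + c.M) := by positivity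
  have hexp : 1 ≤ Real.exp c.lam := Real.one_le_exp hlam.le
  have hG : 9 + c.A * (1 + c.M) ≤ c.G := by
    have := mul_le_mul_of_nonneg_left hexp hAM
    linarith [hc.G_ge]
  have hG0 : 0 ≤ c.G := by linarith
  have h0 : blockPot S rt k₀ c w.ζ j (S.init x) = pot S rt k₀ c j (S.init x) := by
    change Real.exp (w.ζ * 0) * _ = _
    rw [mul_zero, Real.exp_zero, one_mul]
  rw [h0]
  have hif : 0 ≤ c.G * (if 0 < S.Υ (Sum.inl j) then 0 else Real.exp
      (c.lam * (rt (Sum.inl j) * (1 - k₀ * c.lam)) * (S.init x).res (Sum.inl j))) := by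
    split_ifs
    · simp
    · positivity
  by_cases hw : S.Waiting (S.init x) j
  · simp only [pot, hw, if_true, waitPot]
    linarith
  by_cases hb : (S.init x).blk j = true
  · simp only [pot, hw, hb, if_true, if_false, closedPot]
    have hQ := hs.Q_nonneg j
    have h1 : Real.exp (c.e₁ * ((S.init x).res (Sum.inl j) +
        c.a₂ * (S.U + 1 - S.Q (S.init x) j))) ≤
        Real.exp (c.e₁ * (S.init x).res (Sum.inl j)) * 2 := by
      rw [mul_add, Real.exp_add]
      refine mul_le_mul_of_nonneg_left (le_trans (Real.exp_le_exp.2 ?_) hc.a₂_le)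
        (Real.exp_pos _).le
      have := hc.a₂_nonneg hE j
      gcongr
      linarith
    have h2 : 4 * Real.exp (c.e₁ * (S.init x).res (Sum.inl j)) ≤
        c.G * Real.exp (c.e₁ * (S.init x).res (Sum.inl j)) :=
      mul_le_mul_of_nonneg_right (by linarith) (Real.exp_pos _).le
    linarith
  · have hΥ : ¬ 0 < S.Υ (Sum.inl j) := by
      intro hΥ
      refine hw ⟨hΥ, ?_⟩
      change S.c0 (Sum.inl j) = 0
      simp [Sys.c0, hΥ]
    simp only [pot, hw, hb, hΥ, if_false, openPot, Bool.false_eq_true]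
    have hL := hs.le_Q j (Bool.eq_false_of_not_eq_true hb)
    set F := Real.exp (c.lam * (rt (Sum.inl j) * (1 - k₀ * c.lam)) *
      (S.init x).res (Sum.inl j)) with hF
    have hF1 : 1 ≤ F := Real.one_le_exp (mul_nonneg (mul_nonneg hlam.le hα.le) hres)
    have h1 : Real.exp (-c.lam * (S.Q (S.init x) j - S.L -
        rt (Sum.inl j) * (1 - k₀ * c.lam) * (S.init x).res (Sum.inl j) +
        rt (Sum.inr j) * (1 + k₀ * c.lam) * (S.init x).res (Sum.inr j))) ≤ F := by
      refine Real.exp_le_exp.2 ?_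
      have := mul_nonneg hlam.le (mul_nonneg (hc.beta_nonneg hE j) (hs.res_nonneg (Sum.inr j)))
      have := mul_le_mul_of_nonneg_left hL hlam.le
      linarith
    have h2 : Real.exp (-c.lam * (S.U - S.L)) ≤ 1 :=
      Real.exp_le_one_iff.2 (by nlinarith [hS.L_lt_U])
    have h3 : 0 ≤ rt (Sum.inl j) * (Real.exp c.lam - 1) * (S.init x).res (Sum.inl j) :=
      mul_nonneg (mul_nonneg (hE.rt_pos _).le (by linarith)) hres
    have h4 : c.A * c.M * Real.exp (-c.lam * (S.U - S.L)) * (F -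
        rt (Sum.inl j) * (Real.exp c.lam - 1) * (S.init x).res (Sum.inl j)) ≤
        c.A * c.M * 1 * F := by
      have : F - rt (Sum.inl j) * (Real.exp c.lam - 1) * (S.init x).res (Sum.inl j) ≤ F := by
        linarith
      calc _ ≤ c.A * c.M * Real.exp (-c.lam * (S.U - S.L)) * F :=
            mul_le_mul_of_nonneg_left this (by positivity)
        _ ≤ _ := by gcongr
    have h5 := mul_le_mul_of_nonneg_left h1 hA
    have h6 := mul_le_mul_of_nonneg_right hG (zero_le_one.trans hF1)
    have h7 : 0 ≤ c.G * Real.exp (c.e₁ * (S.init x).res (Sum.inl j)) := by positivity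
    linarith

/-- The residual time is either the given `Υ k > 0` or a fresh variable. In the second case `B₀`
bounds the exponential moment. -/
theorem meanLE_init_res (hE : ExpBounds μ rt k₀ θ₁) (hX : ∀ k l, Measurable (X k l))
    (hμ : ∀ k l, P.map (X k l) = μ k) (hΥ : ∀ k, 0 ≤ S.Υ k) {B₀ : ℝ} (hB₀ : 1 ≤ B₀)
    (hB : ∀ k, 1 + θ₁ / rt k + k₀ * θ₁ ^ 2 ≤ B₀) (k : Clk J) {θ : ℝ} (hθ₀ : 0 ≤ θ) (hθ : θ ≤ θ₁) :
    MeanLE P (fun ω => Real.exp (θ * (S.init fun k l => X k l ω).res k))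
      (B₀ * Real.exp (θ * S.Υ k)) := by
  simp only [Sys.init]
  by_cases hk : 0 < S.Υ k
  · simp only [hk, if_true]
    exact (MeanLE.const _).mono (le_mul_of_one_le_left (Real.exp_pos _).le hB₀)
  · simp only [hk, if_false]
    have h0 : S.Υ k = 0 := le_antisymm (not_lt.1 hk) (hΥ k)
    have hm := (hX k 0).aemeasurable (μ := P)
    have hi := hE.integrable_exp k θ hθ
    rw [← hμ k 0] at hi
    refine ⟨hi.comp_measurable (hX k 0), ?_⟩
    rw [← integral_map (f := fun y => Real.exp (θ * y)) hm hi.aestronglyMeasurable, hμ]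
    refine (hE.mgf k θ (by rwa [abs_of_nonneg hθ₀])).trans ?_
    rw [h0, mul_zero, Real.exp_zero, mul_one]
    refine le_trans ?_ (hB k)
    have h1 := hE.k₀_nonneg
    have h2 := hE.rt_pos k
    gcongr

variable [NeZero J]

/-- The bound of the Lyapunov theorem for the exponential of the workload. -/
theorem lintegral_exp_work_le (h : w.Ok S rt k₀ θ₁ bmin bmax q τ τ₂ dlo dhi σ b)
    (hE : ExpBounds μ rt k₀ θ₁) (hc : c.Ok S rt k₀ θ₁ w.ζ d₁ b₁) (hS : S.Good)
    (hV : ∀ s, S.Valid s → ∀ j,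
      dBlockPot S rt k₀ c w.ζ j s ≤ -(w.ζ * S.γ / 2) * blockPot S rt k₀ c w.ζ j s + w.ζ * S.γ)
    (hε : 0 < w.ε) (hb : 0 ≤ b)
    (hX : ∀ k l, Measurable (X k l))
    (hind : iIndepFun (fun p : Clk J × ℕ => X p.1 p.2) P) (hμ : ∀ k l, P.map (X k l) = μ k)
    (hpos : ∀ᵐ ω ∂P, ∀ k l, 0 < X k l ω)
    {κ : ℝ} (hκ₀ : 0 ≤ κ) (hκ : κ ≤ 1 / 3) (hκN : κ * J * w.N ≤ 2) (hκA : 3 * κ * J * w.A ≤ 2)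
    (hA : 2 ≤ w.A) (hN : 1 ≤ w.N) {t : ℝ} (ht : 0 ≤ t) {W : Ω → ℝ}
    (hW : ∀ᵐ ω ∂P, ∃ m, (S.chain (fun k l => X k l ω) m).T ≤ t ∧
      t < (S.chain (fun k l => X k l ω) (m + 1)).T ∧
      W ω = ∑ j, w.wt rt j * S.Q (S.chain (fun k l => X k l ω) m) j) :
    ∫⁻ ω, ENNReal.ofReal (Real.exp (κ * W ω)) ∂P ≤ 3 + 2 *
      (ENNReal.ofReal (Real.exp (-w.ε * t)) *
        ∫⁻ ω, ENNReal.ofReal (w.lyap S rt k₀ c (S.init fun k l => X k l ω)) ∂P +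
        ENNReal.ofReal (b / w.ε)) := by
  have hVm : Measurable fun s => ENNReal.ofReal (w.lyap S rt k₀ c s) :=
    (measurable_lyap w S rt k₀ c).ennreal_ofReal
  have hexp : ∀ h, 0 ≤ h → 0 ≤ 1 - Real.exp (-w.ε * h) := fun h hh => by
    rw [sub_nonneg]; exact Real.exp_le_one_iff.2 (by nlinarith)
  have hbε : 0 ≤ b / w.ε := div_nonneg hb hε.le
  have key := Sys.lyapunov hS hX hind hμ hpos hVm hε hb ?_ ?_ ht
  rotate_left
  · intro s hs u h0 h1
    have h2 := (hasDrift_lyap w hS c).le_of_drift_le hS hε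
      (fun s hs => h.drift_le hE hc hS hV hs) hs h0 h1
    rw [← ENNReal.ofReal_mul (Real.exp_pos _).le, ← ENNReal.ofReal_add
      (mul_nonneg (Real.exp_pos _).le (h.lyap_nonneg hE hc hs)) (mul_nonneg hbε (hexp u h0))]
    exact ENNReal.ofReal_le_ofReal h2
  · intro s hs
    have hs' := Sys.valid_flow hS hs (Sys.tau_nonneg hS hs.res_nonneg) le_rfl
    have hblk : ∀ j, S.pick s = Sum.inr j → (S.flow s (S.tau s)).blk j = false :=
      fun _ hj => Sys.blk_of_pick_inr (S := S) (s := s) hj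
    obtain ⟨i1, i2⟩ := superJump_lyap w hE hc hS
      (fun j => by rw [abs_of_nonneg (h.wt_nonneg hE j)]; exact h.wt_le j) h.η_nonneg h.η_le
      h.M_nonneg h.A_nonneg h.N_nonneg _ hs' (S.pick s) (Sys.flow_res_pick hS s) hblk
    unfold Sys.step
    rw [← ofReal_integral_eq_lintegral_ofReal i1]
    · exact ENNReal.ofReal_le_ofReal i2
    · filter_upwards [hE.pos (S.pick s)] with y hy
      exact h.lyap_nonneg hE hc (Sys.valid_jump hS hs' hblk hy.le)
  refine le_trans ?_ (add_le_add_right (mul_le_mul_right key 2) 3)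
  set g : ℕ → Ω → ℝ≥0∞ := fun m => ({ω | (S.chain (fun k l => X k l ω) m).T ≤ t ∧
      t < (S.chain (fun k l => X k l ω) (m + 1)).T}).indicator
      (fun ω => ENNReal.ofReal (w.lyap S rt k₀ c (S.flow (S.chain (fun k l => X k l ω) m)
        (t - (S.chain (fun k l => X k l ω) m).T)))) with hg
  have hchain : ∀ m, Measurable fun ω => S.chain (fun k l => X k l ω) m := fun m =>
    S.measurable_chain (x := fun ω k l => X k l ω) hX m
  have hT : ∀ m, Measurable fun ω => (S.chain (fun k l => X k l ω) m).T := fun m =>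
    State.measurable_T.comp (hchain m)
  have hgm : ∀ m, Measurable (g m) := by
    intro m
    refine Measurable.indicator ?_ ((measurableSet_le (hT m) measurable_const).inter
      (measurableSet_lt measurable_const (hT (m + 1))))
    exact hVm.comp (S.measurable_flow.comp ((hchain m).prodMk ((hT m).const_sub t)))
  change _ ≤ 3 + 2 * ∑' m, ∫⁻ ω, g m ω ∂P
  rw [← lintegral_tsum fun m => (hgm m).aemeasurable, ← lintegral_const_mul' _ _ (by simp)]
  have h3 : (3 : ℝ≥0∞) = ∫⁻ _ω, 3 ∂P := by simp
  rw [h3, ← lintegral_add_left measurable_const]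
  refine lintegral_mono_ae ?_
  filter_upwards [hW, hpos] with ω ⟨m, h1, h2, hWω⟩ hω
  have hval := Sys.valid_chain hS hω m
  rw [Sys.chain_succ_T] at h2
  have hfl := Sys.valid_flow hS hval (sub_nonneg.2 h1)
    (by linarith : t - (S.chain (fun k l => X k l ω) m).T ≤ _)
  have h4 := h.exp_work_le hE hc hfl hκ₀ hκ hκN hκA hA hN
  simp only [Sys.Q_flow] at h4
  rw [← hWω] at h4
  have h5 : g m ω = ENNReal.ofReal (w.lyap S rt k₀ c (S.flow (S.chain (fun k l => X k l ω) m)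
        (t - (S.chain (fun k l => X k l ω) m).T))) :=
    Set.indicator_of_mem (show ω ∈ {ω | (S.chain (fun k l => X k l ω) m).T ≤ t ∧
      t < (S.chain (fun k l => X k l ω) (m + 1)).T} from
        ⟨h1, by rw [Sys.chain_succ_T]; exact h2⟩) _
  refine (ENNReal.ofReal_le_ofReal h4).trans ?_
  rw [ENNReal.ofReal_add (by norm_num) (mul_nonneg zero_le_two (h.lyap_nonneg hE hc hfl)),
    ENNReal.ofReal_mul zero_le_two, ← h5]
  have e3 : ENNReal.ofReal 3 = 3 := by simp
  have e2 : ENNReal.ofReal 2 = 2 := by simp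
  rw [e3, e2]
  gcongr
  exact ENNReal.le_tsum m

/-- The mean of the Lyapunov function at time `0`. -/
theorem lintegral_lyap_init_le (h : w.Ok S rt k₀ θ₁ bmin bmax q τ τ₂ dlo dhi σ b)
    (hE : ExpBounds μ rt k₀ θ₁) (hc : c.Ok S rt k₀ θ₁ w.ζ d₁ b₁) (hS : S.Good)
    (hX : ∀ k l, Measurable (X k l)) (hμ : ∀ k l, P.map (X k l) = μ k)
    (hpos : ∀ᵐ ω ∂P, ∀ k l, 0 < X k l ω) {B₀ : ℝ} (hB₀ : 1 ≤ B₀)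
    (hB : ∀ k, 1 + θ₁ / rt k + k₀ * θ₁ ^ 2 ≤ B₀) {H : ℝ} (hH : 0 ≤ H)
    (hq : ∀ j, ∑ i, w.wt rt i * S.q i + w.η * S.Υ (Sum.inr j) ≤ H)
    (hA : ∀ j, w.η * S.Υ (Sum.inl j) ≤ H) (he : ∀ j, c.e₁ * S.Υ (Sum.inl j) ≤ H) :
    ∫⁻ ω, ENNReal.ofReal (w.lyap S rt k₀ c (S.init fun k l => X k l ω)) ∂P ≤
      ENNReal.ofReal ((3 + J * B₀ + w.M * (J * B₀) + 2 * (w.A * (J * B₀)) +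
        w.N * (J * (c.G * B₀ + c.G * Real.exp c.lam))) * Real.exp H) := by
  have hprob := hE.prob
  set R : Clk J → Ω → ℝ := fun k ω => (S.init fun k l => X k l ω).res k with hR
  set Z := Real.exp (∑ i, w.wt rt i * S.q i) with hZ
  have hη := h.η_nonneg
  have hG0 : 0 ≤ c.G := by
    have h1 := h.A_nonneg
    have h2 := hc.A_pos.le
    have h3 := hc.M_nonneg
    have h4 : 0 ≤ c.A * (1 + c.M) * Real.exp c.lam := by positivity
    linarith [hc.G_ge]
  have hΥ := hS.Υ_nonneg
  have hq0 : ∑ i, w.wt rt i * S.q i ≤ H := by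
    have := hq 0
    have := mul_nonneg hη (hΥ (Sum.inr 0))
    linarith
  have hZq : 1 ≤ Z := Real.one_le_exp (Finset.sum_nonneg fun i _ =>
    mul_nonneg (h.wt_nonneg hE i) (Nat.cast_nonneg _))
  -- the terms of the bound
  have mS : ∀ j, MeanLE P (fun ω => Real.exp (w.η * R (Sum.inr j) ω))
      (B₀ * Real.exp (w.η * S.Υ (Sum.inr j))) := fun j =>
    meanLE_init_res hE hX hμ hΥ hB₀ hB _ hη h.η_le
  have mA : ∀ j, MeanLE P (fun ω => Real.exp (w.η * R (Sum.inl j) ω))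
      (B₀ * Real.exp (w.η * S.Υ (Sum.inl j))) := fun j =>
    meanLE_init_res hE hX hμ hΥ hB₀ hB _ hη h.η_le
  have mE : ∀ j, MeanLE P (fun ω => Real.exp (c.e₁ * R (Sum.inl j) ω))
      (B₀ * Real.exp (c.e₁ * S.Υ (Sum.inl j))) := fun j =>
    meanLE_init_res hE hX hμ hΥ hB₀ hB _ hc.e₁_pos.le hc.e₁_le
  have mL : ∀ j, MeanLE P (fun ω => if 0 < S.Υ (Sum.inl j) then 0 else
      Real.exp (c.lam * (rt (Sum.inl j) * (1 - k₀ * c.lam)) * R (Sum.inl j) ω))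
      (Real.exp c.lam) := by
    intro j
    simp only [hR, Sys.init]
    by_cases hj : 0 < S.Υ (Sum.inl j)
    · simp only [hj, if_true]
      exact (MeanLE.const 0).mono (Real.exp_pos _).le
    · simp only [hj, if_false]
      obtain ⟨i1, i2⟩ := hc.integrable_lam hE j
      rw [← hμ (Sum.inl j) 0] at i1 i2
      refine ⟨i1.comp_measurable (hX _ 0), ?_⟩
      rwa [integral_map (hX _ 0).aemeasurable i1.aestronglyMeasurable] at i2
  -- The workload contributes the deterministic factor `Z` times a sum over single residual times,
  -- so no joint moments are needed.
  have hbound := (((((MeanLE.const (P := P) 1).add (MeanLE.sum fun j (_ : j ∈ Finset.univ) =>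
    mS j)).const_mul (zero_le_one.trans hZq)).add
    ((MeanLE.sum fun j (_ : j ∈ Finset.univ) => mS j).const_mul h.M_nonneg)).add
    (((MeanLE.sum fun j (_ : j ∈ Finset.univ) => mA j).const_mul h.A_nonneg).const_mul
      zero_le_two)).add ((MeanLE.sum fun j (_ : j ∈ Finset.univ) =>
        ((mE j).const_mul hG0).add ((mL j).const_mul hG0)).const_mul h.N_nonneg)
  have hbound' := hbound.add (MeanLE.const (P := P) 2)
  have hnn : ∀ ω, 0 ≤ Z * (1 + ∑ j, Real.exp (w.η * R (Sum.inr j) ω)) := fun ω =>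
    mul_nonneg (zero_le_one.trans hZq) (by positivity)
  refine (hbound'.lintegral_le ?_ (Eventually.of_forall fun ω => ?_)).trans
    (ENNReal.ofReal_le_ofReal ?_)
  · filter_upwards [hpos] with ω hω
    have hs := Sys.valid_init (S := S) hS hω
    refine (h.lyap_le hE hs).trans (add_le_add (add_le_add (add_le_add (add_le_add ?_ ?_) ?_) ?_)
      le_rfl)
    · -- the exponential of the workload
      have e1 : corrected S (w.wt rt) (tiltFactor rt k₀ (w.wt rt)) (S.init fun k l => X k l ω) -
          ∑ j, w.x * w.K j * (S.init fun k l => X k l ω).D j ≤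
          ∑ i, w.wt rt i * S.q i + ∑ j, w.x * R (Sum.inr j) ω := by
        rw [corrected, ← Finset.sum_sub_distrib, ← Finset.sum_add_distrib]
        refine Finset.sum_le_sum fun j _ => ?_
        rw [Sys.Q_init]
        change w.wt rt j * (S.q j - rt (Sum.inl j) * (1 + k₀ * w.wt rt j) * R (Sum.inl j) ω +
          rt (Sum.inr j) * (1 - k₀ * w.wt rt j) * R (Sum.inr j) ω) - w.x * w.K j * 0 ≤ _
        have hwt := h.wt_nonneg hE j
        have hk := mul_nonneg hE.k₀_nonneg hwt
        have e2 : 0 ≤ w.wt rt j * (rt (Sum.inl j) * (1 + k₀ * w.wt rt j) * R (Sum.inl j) ω) :=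
          mul_nonneg hwt (mul_nonneg (mul_nonneg (hE.rt_pos _).le (by linarith))
            (hs.res_nonneg _))
        have e3 : w.wt rt j * rt (Sum.inr j) * R (Sum.inr j) ω ≤ w.x * R (Sum.inr j) ω := by
          rw [wt_mul hE]
          exact mul_le_mul_of_nonneg_right (mul_le_of_le_one_right h.x_pos.le (h.K_le_one j))
            (hs.res_nonneg _)
        have e4 : 0 ≤ w.wt rt j * rt (Sum.inr j) * R (Sum.inr j) ω * (k₀ * w.wt rt j) :=
          mul_nonneg (mul_nonneg (mul_nonneg hwt (hE.rt_pos _).le) (hs.res_nonneg _)) hk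
        linarith
      unfold expWork
      refine (Real.exp_le_exp.2 e1).trans ?_
      rw [Real.exp_add]
      refine mul_le_mul_of_nonneg_left ?_ (Real.exp_pos _).le
      refine (exp_sum_le Finset.univ (fun j => w.x * R (Sum.inr j) ω) (n := J)
        (fun j _ => mul_nonneg h.x_pos.le (hs.res_nonneg _)) (by simp)).trans ?_
      gcongr with j
      rw [← mul_assoc]
      exact sub_le_self _ zero_le_one
    · refine mul_le_mul_of_nonneg_left (Finset.sum_le_sum fun j _ => ?_) h.M_nonneg
      refine (expRes_le hE hη hs _).trans (le_of_eq ?_)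
      change Real.exp (-w.η * 0) * _ = _
      rw [mul_zero, Real.exp_zero, one_mul]
    · refine mul_le_mul_of_nonneg_left (mul_le_mul_of_nonneg_left
        (Finset.sum_le_sum fun j _ => ?_) h.A_nonneg) zero_le_two
      refine (expRes_le hE hη hs _).trans (le_of_eq ?_)
      rw [neg_zero, zero_mul, Real.exp_zero, one_mul]
    · refine mul_le_mul_of_nonneg_left (Finset.sum_le_sum fun j _ => ?_) h.N_nonneg
      exact blockPot_init_le hE hc hS hs j
  · have h1 := h.M_nonneg
    have h2 := h.A_nonneg
    have h3 := h.N_nonneg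
    have h4 : ∀ j, 0 ≤ (if 0 < S.Υ (Sum.inl j) then 0 else
      Real.exp (c.lam * (rt (Sum.inl j) * (1 - k₀ * c.lam)) * R (Sum.inl j) ω)) := fun j => by
      split_ifs
      · exact le_rfl
      · exact (Real.exp_pos _).le
    have h5 : ∀ j, 0 ≤ c.G * (if 0 < S.Υ (Sum.inl j) then 0 else
      Real.exp (c.lam * (rt (Sum.inl j) * (1 - k₀ * c.lam)) * R (Sum.inl j) ω)) := fun j =>
      mul_nonneg hG0 (h4 j)
    have h6 : 0 ≤ ∑ j, (c.G * Real.exp (c.e₁ * R (Sum.inl j) ω) +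
      c.G * (if 0 < S.Υ (Sum.inl j) then 0 else
      Real.exp (c.lam * (rt (Sum.inl j) * (1 - k₀ * c.lam)) * R (Sum.inl j) ω))) :=
      Finset.sum_nonneg fun j _ => add_nonneg (by positivity) (h5 j)
    have h7 := hnn ω
    positivity
  · set T := Real.exp H with hT
    have hT1 : 1 ≤ T := Real.one_le_exp hH
    have hM := h.M_nonneg
    have hA' := h.A_nonneg
    have hN := h.N_nonneg
    have hZT : Z ≤ T := Real.exp_le_exp.2 hq0
    have hZS : ∀ j, Z * Real.exp (w.η * S.Υ (Sum.inr j)) ≤ T := fun j => by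
      rw [hZ, ← Real.exp_add]; exact Real.exp_le_exp.2 (hq j)
    have hS1 : ∀ j, Real.exp (w.η * S.Υ (Sum.inr j)) ≤ T := fun j =>
      (le_mul_of_one_le_left (Real.exp_pos _).le hZq).trans (hZS j)
    have hA1 : ∀ j, Real.exp (w.η * S.Υ (Sum.inl j)) ≤ T := fun j => Real.exp_le_exp.2 (hA j)
    have he1 : ∀ j, Real.exp (c.e₁ * S.Υ (Sum.inl j)) ≤ T := fun j => Real.exp_le_exp.2 (he j)
    have hsum : ∀ (f : Fin J → ℝ) (C : ℝ), (∀ j, f j ≤ C) → ∑ j, f j ≤ J * C := by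
      intro f C hf
      refine (Finset.sum_le_sum fun j _ => hf j).trans ?_
      simp
    have hB0 : 0 ≤ B₀ := zero_le_one.trans hB₀
    have t1 : Z * (1 + ∑ j, B₀ * Real.exp (w.η * S.Υ (Sum.inr j))) ≤ T + J * (B₀ * T) := by
      rw [mul_add, mul_one, Finset.mul_sum]
      refine add_le_add hZT (hsum _ _ fun j => ?_)
      have := mul_le_mul_of_nonneg_left (hZS j) hB0
      linarith
    have t2 := mul_le_mul_of_nonneg_left (hsum (fun j => B₀ * Real.exp (w.η * S.Υ (Sum.inr j)))
      (B₀ * T) fun j => mul_le_mul_of_nonneg_left (hS1 j) hB0) hM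
    have t3 := mul_le_mul_of_nonneg_left (hsum (fun j => B₀ * Real.exp (w.η * S.Υ (Sum.inl j)))
      (B₀ * T) fun j => mul_le_mul_of_nonneg_left (hA1 j) hB0) hA'
    have t4 := mul_le_mul_of_nonneg_left (hsum (fun j => c.G * (B₀ *
      Real.exp (c.e₁ * S.Υ (Sum.inl j))) + c.G * Real.exp c.lam)
      ((c.G * B₀ + c.G * Real.exp c.lam) * T) fun j => by
        have h1 := mul_le_mul_of_nonneg_left (he1 j) (mul_nonneg hG0 hB0)
        have h2 := mul_le_mul_of_nonneg_left hT1 (mul_nonneg hG0 (Real.exp_pos c.lam).le)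
        linarith) hN
    linarith

end WorkConst.Ok

/-! ### Constants for large `r` -/

theorem exists_pos_le {ι : Type*} [Finite ι] (f : ι → ℝ) (hf : ∀ i, 0 < f i) :
    ∃ a, 0 < a ∧ ∀ i, a ≤ f i := by
  rcases isEmpty_or_nonempty ι with h | h
  · exact ⟨1, one_pos, fun i => h.elim i⟩
  · obtain ⟨i, hi⟩ := Finite.exists_min f
    exact ⟨f i, hf i, hi⟩

theorem exists_pos_ge {ι : Type*} [Finite ι] (f : ι → ℝ) : ∃ a, 0 < a ∧ ∀ i, f i ≤ a := by
  obtain ⟨M, hM⟩ := Set.finite_range f |>.bddAbove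
  exact ⟨max M 1, lt_max_of_lt_right one_pos, fun i => (hM ⟨i, rfl⟩).trans (le_max_left _ _)⟩

theorem eventually_le_mul (X : ℝ) {Y : ℝ} (hY : 0 < Y) :
    ∀ᶠ r : ℕ in atTop, X ≤ Y * r := by
  filter_upwards [tendsto_natCast_atTop_atTop.eventually_ge_atTop (X / Y)] with r hr
  rwa [div_le_iff₀' hY] at hr

theorem div_le_of_le_mul {X Y r : ℝ} (hr : 0 < r) (h : X ≤ Y * r) : X / r ≤ Y :=
  (div_le_iff₀ hr).2 h

theorem div_sq_le_of_le_mul {X Y r : ℝ} (hr : 0 < r) (h : X ≤ Y * r) : X / r ^ 2 ≤ Y / r := by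
  rw [div_le_div_iff₀ (by positivity) hr]
  nlinarith

variable {J : ℕ} {k₀ θ₁ : ℝ}

set_option maxHeartbeats 1000000 in
/-- Constants for the potential of the blocked times. -/
theorem exists_blockConst {rt : ℕ → Clk J → ℝ} {lim : Clk J → ℝ} (hlim : ∀ k, 0 < lim k)
    (hrt : ∀ k, Tendsto (fun r => rt r k) atTop (𝓝 (lim k)))
    {rlo rhi : ℝ} (hrlo : 0 < rlo) (hlo : ∀ᶠ r in atTop, ∀ k, rlo ≤ rt r k)
    (hhi : ∀ᶠ r in atTop, ∀ k, rt r k ≤ rhi) (hk₀ : 0 ≤ k₀) (hθ₁ : 0 < θ₁)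
    {chg θ₀ vmin bmax : ℝ} (hchg : 0 ≤ chg) (hθ₀ : 0 < θ₀) (hvmin : 0 < vmin)
    {b0 : (Fin J → Bool) → Fin J → ℝ} (hb0 : ∀ z j, 0 < b0 z j) (hbmax : ∀ z j, b0 z j ≤ bmax)
    (hbmax₀ : 0 ≤ bmax)
    (hband : ∀ z j, z j = true → b0 z j ≤ lim (Sum.inl j) / lim (Sum.inr j) - vmin)
    {L U : ℕ → ℝ} (hLU : ∀ᶠ r in atTop, L r < U r)
    (hU : Tendsto (fun r : ℕ => U r / r) atTop (𝓝 0))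
    (hexp : ∀ a > 0, Tendsto (fun r : ℕ => (r : ℝ) ^ 2 * Real.exp (-a * (U r - L r)))
      atTop (𝓝 0)) :
    ∃ lam a₂ A M G d₁ b₁ : ℝ, ∀ᶠ r : ℕ in atTop, ∀ S : Sys J, S.L = L r → S.U = U r →
      S.b0 = b0 → S.chg = chg → S.γ = θ₀ / r →
      BlockConst.Ok ⟨lam, (chg + 1) / r, a₂, A, M, G⟩ S (rt r) k₀ θ₁ (1 / r) d₁ b₁ ∧
      ∀ μ, ExpBounds μ (rt r) k₀ θ₁ → S.Good → ∀ s, S.Valid s → ∀ j,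
        dBlockPot S (rt r) k₀ ⟨lam, (chg + 1) / r, a₂, A, M, G⟩ (1 / r) j s ≤
          -((1 / r) * S.γ / 2) *
            blockPot S (rt r) k₀ ⟨lam, (chg + 1) / r, a₂, A, M, G⟩ (1 / r) j s +
          (1 / r) * S.γ := by
  obtain ⟨βlo, hβlo, hβ⟩ := exists_pos_le (fun j : Fin J => lim (Sum.inr j)) fun j => hlim _
  obtain ⟨αhi, hαhi, hα⟩ := exists_pos_ge (fun j : Fin J => lim (Sum.inl j))
  have hrhi : 0 ≤ |rhi| := abs_nonneg _
  -- the exponent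
  set lam := min (min θ₁ (1 / 2)) (min (1 / (4 * (k₀ + 1))) (βlo * vmin / (8 * (k₀ + 1) * αhi)))
    with hlam
  have hlam0 : 0 < lam := by positivity
  have hlam1 : lam ≤ θ₁ := (min_le_left _ _).trans (min_le_left _ _)
  have hlam2 : lam ≤ 1 / 2 := (min_le_left _ _).trans (min_le_right _ _)
  have hlam3 : k₀ * lam ≤ 1 / 4 := by
    have : lam ≤ 1 / (4 * (k₀ + 1)) := (min_le_right _ _).trans (min_le_left _ _)
    rw [le_div_iff₀ (by positivity)] at this
    linarith
  have hlam4 : k₀ * lam * (2 * αhi) ≤ βlo * vmin / 4 := by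
    have : lam ≤ βlo * vmin / (8 * (k₀ + 1) * αhi) := (min_le_right _ _).trans (min_le_right _ _)
    rw [le_div_iff₀ (by positivity)] at this
    have h0 : 0 ≤ lam * αhi := by positivity
    linarith
  clear_value lam
  -- The rates differ by at least `βlo * vmin` below the threshold. By `hlam4` the tilts use at most
  -- a quarter of this, and `d₁` takes another quarter.
  set d₁ := βlo * vmin / 4 with hd₁
  set b₁ := 2 * |rhi| * bmax with hb₁
  set a₂ := rlo⁻¹ + k₀ * θ₁ with ha₂
  set A := 4 * Real.exp lam with hA
  -- As `1 - k₀ * lam ≥ 3 / 4`, this is the size required by `M_ge`.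
  set M := 8 * (b₁ + d₁) / (3 * rlo) with hM
  set G := 9 + A * (1 + M) * Real.exp lam with hG
  have hd₁0 : 0 < d₁ := by positivity
  have hb₁0 : 0 ≤ b₁ := by positivity
  have ha₂0 : 0 < a₂ := by positivity
  have hA0 : 0 < A := by positivity
  have hM0 : 0 < M := by positivity
  have helam : Real.exp lam - 1 ≤ 3 / 2 * lam := by
    have h1 := Real.abs_exp_sub_one_sub_id_le (x := lam) (by rw [abs_of_pos hlam0]; linarith)
    have h2 := (abs_le.1 h1).2
    have h3 := mul_le_mul_of_nonneg_left hlam2 hlam0.le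
    linarith
  refine ⟨lam, a₂, A, M, G, d₁, b₁, ?_⟩
  -- rates
  have hband' : ∀ᶠ r in atTop, ∀ z : Fin J → Bool, ∀ j, z j = true →
      rt r (Sum.inr j) * (1 + k₀ * lam) * b0 z j ≤ rt r (Sum.inl j) * (1 - k₀ * lam) - d₁ := by
    rw [eventually_all]; intro z
    rw [eventually_all]; intro j
    by_cases hz : z j = true
    swap
    · exact Eventually.of_forall fun r h => absurd h hz
    have hl : lim (Sum.inr j) * (1 + k₀ * lam) * b0 z j <
        lim (Sum.inl j) * (1 - k₀ * lam) - d₁ := by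
      have h1 := mul_le_mul_of_nonneg_left (hband z j hz) (hlim (Sum.inr j)).le
      rw [mul_sub, mul_div_cancel₀ _ (hlim (Sum.inr j)).ne'] at h1
      have h2 : βlo * vmin ≤ lim (Sum.inr j) * vmin :=
        mul_le_mul_of_nonneg_right (hβ j) hvmin.le
      have h3 : 0 < βlo * vmin := by positivity
      have h4 := mul_nonneg hk₀ hlam0.le
      have h5 := mul_le_mul_of_nonneg_left (hα j) h4
      have h6 : k₀ * lam * (lim (Sum.inr j) * b0 z j) ≤ k₀ * lam * lim (Sum.inl j) :=
        mul_le_mul_of_nonneg_left (by linarith) h4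
      have h7 : d₁ = βlo * vmin / 4 := hd₁
      linarith
    have ht : Tendsto (fun r => rt r (Sum.inr j) * (1 + k₀ * lam) * b0 z j) atTop
        (𝓝 (lim (Sum.inr j) * (1 + k₀ * lam) * b0 z j)) :=
      ((hrt (Sum.inr j)).mul_const _).mul_const _
    have ht' : Tendsto (fun r => rt r (Sum.inl j) * (1 - k₀ * lam) - d₁) atTop
        (𝓝 (lim (Sum.inl j) * (1 - k₀ * lam) - d₁)) :=
      ((hrt (Sum.inl j)).mul_const _).sub_const _
    filter_upwards [ht.eventually_lt ht' hl] with r hr _ using hr.le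
  -- thresholds
  have hU' : ∀ᶠ r : ℕ in atTop, Real.exp ((chg + 1) / r * (a₂ * (U r + 2))) ≤ 2 := by
    have h1 : Tendsto (fun r : ℕ => (chg + 1) / r * (a₂ * (U r + 2))) atTop (𝓝 0) := by
      have h2 : Tendsto (fun r : ℕ => (2 : ℝ) / r) atTop (𝓝 0) :=
        tendsto_const_div_atTop_nhds_zero_nat 2
      have h3 := (hU.add h2).const_mul ((chg + 1) * a₂)
      rw [add_zero, mul_zero] at h3
      refine h3.congr fun r => ?_
      ring
    have h4 : Tendsto (fun r : ℕ => Real.exp ((chg + 1) / r * (a₂ * (U r + 2)))) atTop (𝓝 1) := by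
      have h5 := (Real.continuous_exp.tendsto 0).comp h1
      rwa [Real.exp_zero] at h5
    exact (h4.eventually_lt_const one_lt_two).mono fun r hr => hr.le
  -- The weight `exp (-lam * (U - L))` beats the factor `r ^ 2` of the time scale. This serves both
  -- the exit condition and the constant in the drift of `openPot`.
  have hexit : ∀ C > 0, ∀ᶠ r : ℕ in atTop,
      (r : ℝ) ^ 2 * Real.exp (-lam * (U r - L r)) ≤ C := fun C hC =>
    ((hexp lam hlam0).eventually_lt_const hC).mono fun r hr => hr.le
  set C₁ := A * (1 + M) * Real.exp lam with hC₁
  set C₂ := A * M * (|rhi| * (Real.exp lam - 1)) + 1 with hC₂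
  have hC₁0 : 0 < C₁ := by positivity
  have helam0 : 0 ≤ Real.exp lam - 1 := by linarith [Real.one_le_exp hlam0.le]
  have hC₂0 : 0 < C₂ := by positivity
  filter_upwards [hlo, hhi, hband', hU', hLU, hexit (1 / C₁) (by positivity),
    hexit (θ₀ / (2 * C₂)) (by positivity), eventually_ge_atTop 1, eventually_le_mul (chg + 1) hθ₁,
    eventually_le_mul (chg + 1) (show 0 < lam * (rlo * (3 / 4)) by positivity),
    eventually_le_mul θ₀ two_pos, eventually_le_mul θ₀ (show 0 < lam * d₁ by positivity),
    eventually_le_mul θ₀ (show 0 < lam * (rlo * (3 / 4)) by positivity)]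
    with r h1 h2 h3 h4 h5 h6 h7 h8 h9 h10 h11 h12 h13 S hSL hSU hSb hSchg hSγ
  have hr1 : (1 : ℝ) ≤ r := by exact_mod_cast h8
  have hr : (0 : ℝ) < r := by linarith
  have hrt0 : ∀ k, 0 < rt r k := fun k => hrlo.trans_le (h1 k)
  have hα' : ∀ j, rlo * (3 / 4) ≤ rt r (Sum.inl j) * (1 - k₀ * lam) := fun j =>
    mul_le_mul (h1 _) (by linarith) (by norm_num) (hrt0 _).le
  have hkl := mul_nonneg hk₀ hlam0.le
  have hEpos := Real.exp_pos (-lam * (U r - L r))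
  have hE1 : Real.exp (-lam * (U r - L r)) ≤ (r : ℝ) ^ 2 * Real.exp (-lam * (U r - L r)) :=
    le_mul_of_one_le_left hEpos.le (one_le_pow₀ hr1)
  have hok : BlockConst.Ok ⟨lam, (chg + 1) / r, a₂, A, M, G⟩ S (rt r) k₀ θ₁ (1 / r) d₁ b₁ := by
    refine ⟨hlam0, hlam1, hlam3, helam, by positivity, div_le_of_le_mul hr h9, fun j => ?_,
      fun k => ?_, ?_, le_rfl, fun j => ?_, le_rfl, ?_, hM0.le, by positivity, ?_,
      ?_, ?_⟩
    · exact (div_le_of_le_mul hr h10).trans (mul_le_mul_of_nonneg_left (hα' j) hlam0.le)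
    · have := inv_anti₀ hrlo (h1 k)
      simp only [ha₂]
      linarith
    · simpa only [hSU] using h4
    · have h14 := mul_le_mul_of_nonneg_left (hα' j) hM0.le
      have h15 : M * (rlo * (3 / 4)) = 2 * (b₁ + d₁) := by
        rw [hM]; field_simp; ring
      simp only
      linarith
    · simp only [hSU, hSL]
      have h14 := mul_le_mul_of_nonneg_left (hE1.trans h6) hC₁0.le
      rw [mul_one_div_cancel hC₁0.ne'] at h14
      rw [hC₁] at h14
      linarith
    · rw [hSchg]
      simp only
      rw [one_div, div_eq_inv_mul]
    · simpa only [hSb] using h3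
    · intro z j
      simp only [hSb, hb₁]
      have h14 : rt r (Sum.inr j) * (1 + k₀ * lam) ≤ |rhi| * 2 :=
        mul_le_mul ((h2 _).trans (le_abs_self _)) (by linarith) (by linarith) hrhi
      calc _ ≤ |rhi| * 2 * bmax := mul_le_mul h14 (hbmax z j) (hb0 z j).le (by positivity)
        _ = _ := by ring
  refine ⟨hok, fun μ hE hG s hs j => dBlockPot_le hok hE hG hs ?_ ?_ ?_ ?_⟩
  · rw [hSγ]; exact div_le_of_le_mul hr h11
  all_goals
    have hγ : 1 / (r : ℝ) * S.γ / 2 = θ₀ / 2 / (r : ℝ) ^ 2 := by rw [hSγ]; field_simp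
    have hγ' : θ₀ / 2 / (r : ℝ) ^ 2 ≤ θ₀ / 2 / r :=
      div_le_div_of_nonneg_left (by positivity) hr (le_self_pow₀ hr1 two_ne_zero)
    rw [hγ]
  · refine hγ'.trans (div_le_of_le_mul hr ?_)
    simp only
    linarith
  · refine hγ'.trans ((div_le_of_le_mul hr (Y := lam * (rlo * (3 / 4)) / 2) (by linarith)).trans ?_)
    have := mul_le_mul_of_nonneg_left (hα' j) hlam0.le
    simp only
    linarith
  · simp only [hSU, hSL]
    rw [le_div_iff₀ (by positivity)]
    have h14 : A * M * (rt r (Sum.inl j) * (Real.exp lam - 1)) ≤ C₂ := by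
      have : A * M * (rt r (Sum.inl j) * (Real.exp lam - 1)) ≤
          A * M * (|rhi| * (Real.exp lam - 1)) := by
        have := (h2 (Sum.inl j)).trans (le_abs_self _)
        gcongr
      linarith
    have h15 := mul_le_mul h14 h7 (by positivity) hC₂0.le
    have h16 : C₂ * (θ₀ / (2 * C₂)) = θ₀ / 2 := by field_simp
    linarith

variable {J : ℕ} {k₀ θ₁ : ℝ}

set_option maxHeartbeats 2000000 in
/-- Constants for the Lyapunov function of a resource. -/
theorem exists_workConst [NeZero J] {I : ℕ} {K : Fin I → Fin J → ℝ}
    (hK : ∀ i j, K i j = 0 ∨ K i j = 1) (hloc : ∀ i, ∃ j, K i j = 1) {rt : ℕ → Clk J → ℝ}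
    {rlo rhi : ℝ} (hrlo : 0 < rlo) (hlo : ∀ᶠ r in atTop, ∀ k, rlo ≤ rt r k)
    (hhi : ∀ᶠ r in atTop, ∀ k, rt r k ≤ rhi) (hk₀ : 0 ≤ k₀) (hθ₁ : 0 < θ₁)
    {chg θ₀ θ θ₂ vmin bmin bmax vmax : ℝ} (hchg : J * (rhi / rlo) + 1 ≤ chg) (hθ : 0 < θ)
    (hθ₀ : 0 < θ₀) (hθ₀' : J * θ₀ ≤ θ / 4) (hθ₂ : 0 ≤ θ₂)
    (hvmin : 0 < vmin) (hbmin : 0 < bmin) (hvmax : 0 ≤ vmax)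
    {b0 : (Fin J → Bool) → Fin J → ℝ} (hbmin' : ∀ z j, bmin ≤ b0 z j)
    (hbmax : ∀ z j, b0 z j ≤ bmax)
    {ρ : Fin J → ℝ} {vb : (Fin J → Bool) → Fin J → ℝ}
    (hload : ∀ z i, ∑ j, K i j * (ρ j - b0 z j) = ∑ j, K i j * vb z j)
    (hvb : ∀ z i, (∃ j, K i j = 1 ∧ z j = false) → ∑ j, K i j * vb z j = 0)
    (hvb' : ∀ z j, z j = true → vmin ≤ vb z j ∧ vb z j ≤ vmax)
    (hdrift : ∀ᶠ r : ℕ in atTop, ∀ i,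
      -(θ₂ / r) ≤ ∑ j, K i j * (rt r (Sum.inl j) / rt r (Sum.inr j) - ρ j) ∧
      ∑ j, K i j * (rt r (Sum.inl j) / rt r (Sum.inr j) - ρ j) ≤ -(θ / r))
    {U : ℕ → ℝ} (hU : Tendsto (fun r : ℕ => U r / r) atTop (𝓝 0)) (hU0 : ∀ r, 0 ≤ U r) :
    ∃ x ε M A N q τ τ₂ dlo dhi σ b : ℝ, 0 < x ∧ 0 < ε ∧ 2 ≤ A ∧ 1 ≤ N ∧ 0 ≤ M ∧ 0 ≤ b ∧
      ∀ᶠ r : ℕ in atTop, ∀ S : Sys J, S.U = U r → S.b0 = b0 → S.chg = chg → S.γ = θ₀ / r →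
      ∀ i, WorkConst.Ok ⟨K i, x / r, 1 / r, ε / r ^ 2, M, A, N⟩ S (rt r) k₀ θ₁ bmin bmax
        (q / r ^ 2) (τ / r) (τ₂ / r) dlo dhi (σ / r ^ 2) (b / r ^ 2) := by
  have hJ : (1 : ℝ) ≤ J := by exact_mod_cast NeZero.one_le
  have hrhi : 0 < rhi := by
    obtain ⟨r, h1, h2⟩ := (hlo.and hhi).exists
    exact hrlo.trans_le ((h1 (Sum.inl 0)).trans (h2 _))
  have hbmax0 : 0 < bmax := hbmin.trans_le ((hbmin' (fun _ => true) 0).trans (hbmax _ 0))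
  -- the constants
  set C := J * (k₀ * (rhi * (1 + bmax))) / rlo ^ 2 with hC
  have hC0 : 0 ≤ C := by positivity
  -- Small enough for the second-order term `x ^ 2 * C` to use at most a quarter of the heavy
  -- traffic drift `x * θ`.
  set x := min 1 (θ / (4 * (C + 1))) with hx
  have hx0 : 0 < x := by positivity
  have hx1 : x ≤ 1 := min_le_left _ _
  have hxC : x * C ≤ θ / 4 := by
    have : x ≤ θ / (4 * (C + 1)) := min_le_right _ _
    rw [le_div_iff₀ (by positivity)] at this
    nlinarith
  clear_value x
  -- A further quarter of `x * θ` is for `ε`, besides the quarter that `hθ₀'` grants to the decay of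
  -- `D`. The bound by `θ₀ / 4` respects the decay rate of the blocking potential.
  set ε := min (θ₀ / 4) (x * θ / 4) with hε
  have hε0 : 0 < ε := by positivity
  have hε1 : ε ≤ θ₀ / 4 := min_le_left _ _
  have hε2 : ε ≤ x * θ / 4 := min_le_right _ _
  clear_value ε
  set dhi := J * vmax with hdhi
  have hdhi0 : 0 ≤ dhi := by positivity
  -- Solves `4 * x * dhi ≤ M * (J * x * bmin / 4)`, using `J ≥ 1`; the summand `1` covers `quad_M`.
  set M := 16 * dhi / bmin + 1 with hM
  have hM1 : 1 ≤ M := by rw [hM]; have : 0 ≤ 16 * dhi / bmin := by positivity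
                         linarith
  have hMb : 16 * dhi ≤ M * bmin := by
    rw [hM, add_mul, div_mul_cancel₀ _ hbmin.ne']; linarith
  clear_value M
  set A := 4 * (rhi / rlo) + 2 with hA
  have hA2 : 2 ≤ A := by rw [hA]; have : 0 ≤ rhi / rlo := by positivity
                         linarith
  set N := 4 * (J * bmax) + 6 with hN
  have hN0 : 0 ≤ J * bmax := by positivity
  set σ := (bmax + 1) * (rhi * k₀ * (J * x) ^ 2) with hσ
  have hσ0 : 0 ≤ σ := by positivity
  -- All contributions to the constant are of order `1 / r ^ 2`; those of order `1 / r` have been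
  -- cancelled in `drift_le`.
  set b := 2 * x * θ₂ + 4 * ε + M * (J * (θ₀ * (J * x) + σ + 2 * ε)) +
    A * (J * (2 * ε + σ)) + N * (J * θ₀) with hb
  have hb0 : 0 ≤ b := by positivity
  refine ⟨x, ε, M, A, N, x ^ 2 * C, θ, θ₂, vmin, dhi, σ, b, hx0, hε0, hA2, by linarith,
    by linarith, hb0, ?_⟩
  have hchg1 : 1 ≤ chg := by
    have : 0 ≤ J * (rhi / rlo) := by positivity
    linarith
  have hU' : ∀ᶠ r : ℕ in atTop, Real.exp (J * (x / rlo * (U r / r))) ≤ 2 := by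
    have h1 := (hU.const_mul (x / rlo)).const_mul (J : ℝ)
    rw [mul_zero, mul_zero] at h1
    have h5 := (Real.continuous_exp.tendsto 0).comp h1
    rw [Real.exp_zero] at h5
    exact (h5.eventually_lt_const one_lt_two).mono fun r hr => hr.le
  filter_upwards [hlo, hhi, hdrift, hU', eventually_ge_atTop 1,
    eventually_le_mul (J * x) hθ₁, eventually_le_mul (x / rlo) hθ₁,
    eventually_le_mul (x * C + J * θ₀ + ε / x) one_pos,
    eventually_le_mul ε (show 0 < x * vmin by positivity),
    eventually_le_mul θ₀ (show 0 < bmin / 2 by positivity),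
    eventually_le_mul (2 * ε) (show 0 < J * x by positivity),
    eventually_le_mul (2 * ε) (show 0 < J * x * bmin / 4 by positivity),
    eventually_le_mul (2 * ε) (show (0 : ℝ) < 1 / 2 by positivity),
    eventually_le_mul (rhi * k₀ * (J * x)) (show (0 : ℝ) < 1 / 4 by positivity),
    eventually_le_mul (2 * ((x / rlo) ^ 2 * k₀ * rhi)) (show 0 < x / 2 by positivity)]
    with r h1 h2 h3 h4 h5 h6 h7 h8 h9 h10 h11 h12 h13 h14 h15 S hSU hSb hSchg hSγ i
  have hr1 : (1 : ℝ) ≤ r := by exact_mod_cast h5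
  have hr : (0 : ℝ) < r := by linarith
  have hrt0 : ∀ k, 0 < rt r k := fun k => hrlo.trans_le (h1 k)
  set w : WorkConst J := ⟨K i, x / r, 1 / r, ε / r ^ 2, M, A, N⟩ with hw
  have hη : w.η = J * x / r := by simp [WorkConst.η, hw, mul_div_assoc]
  have hK0 : ∀ j, 0 ≤ K i j := fun j => by rcases hK i j with h | h <;> simp [h]
  have hK1 : ∀ j, K i j ≤ 1 := fun j => by rcases hK i j with h | h <;> simp [h]
  have hwt0 : ∀ j, 0 ≤ w.wt (rt r) j := fun j =>
    div_nonneg (mul_nonneg (by positivity) (hK0 j)) (hrt0 _).le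
  have hwt : ∀ j, w.wt (rt r) j ≤ x / rlo / r := by
    intro j
    change x / r * K i j / rt r (Sum.inr j) ≤ _
    rw [div_right_comm]
    exact div_le_div₀ (by positivity) (mul_le_of_le_one_right (by positivity) (hK1 j)) hrlo (h1 _)
  have hwt2 : ∀ j, w.wt (rt r) j ^ 2 ≤ (x / rlo) ^ 2 / r ^ 2 := fun j => by
    rw [← div_pow]; exact pow_le_pow_left₀ (hwt0 j) (hwt j) 2
  have hratio : ∀ j, rt r (Sum.inl j) / rt r (Sum.inr j) ≤ rhi / rlo := fun j =>
    div_le_div₀ hrhi.le (h2 _) hrlo (h1 _)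
  have hquad : ∀ k j, 2 * (w.wt (rt r) j ^ 2 * k₀ * rt r k) ≤ x / 2 / r := by
    intro k j
    calc 2 * (w.wt (rt r) j ^ 2 * k₀ * rt r k) ≤ 2 * ((x / rlo) ^ 2 / r ^ 2 * k₀ * rhi) := by
          gcongr
          · exact (hrt0 k).le
          · exact hwt2 j
          · exact h2 k
      _ = 2 * ((x / rlo) ^ 2 * k₀ * rhi) / r ^ 2 := by ring
      _ ≤ x / 2 / r := div_sq_le_of_le_mul hr h15
  have hsplit : ∀ z : Fin J → Bool, ∑ j, K i j * (rt r (Sum.inl j) / rt r (Sum.inr j) - b0 z j) =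
      ∑ j, K i j * (rt r (Sum.inl j) / rt r (Sum.inr j) - ρ j) + ∑ j, K i j * vb z j := by
    intro z
    rw [← hload z i, ← Finset.sum_add_distrib]
    exact Finset.sum_congr rfl fun j _ => by ring
  have hxJ : x / 2 / r ≤ J * x / r / 2 := by
    rw [div_right_comm]
    gcongr
    exact le_mul_of_one_le_left hx0.le hJ
  constructor
  · exact hK i
  · positivity
  · positivity
  · positivity
  · change 0 ≤ M
    linarith
  · change 0 ≤ A
    linarith
  · change 0 ≤ N
    linarith
  · rw [hη]; exact div_le_of_le_mul hr h6
  · intro j; exact (hwt j).trans (div_le_of_le_mul hr h7)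
  · exact hbmin
  · rw [hSb]; exact hbmin'
  · rw [hSb]; exact hbmax
  · -- quad
    calc ∑ j, w.wt (rt r) j ^ 2 * k₀ * (rt r (Sum.inl j) + rt r (Sum.inr j) * bmax)
        ≤ ∑ _j : Fin J, (x / rlo) ^ 2 / r ^ 2 * k₀ * (rhi + rhi * bmax) := by
          gcongr with j
          · exact add_nonneg (hrt0 _).le (mul_nonneg (hrt0 _).le hbmax0.le)
          · exact hwt2 j
          · exact h2 _
          · exact h2 _
      _ = x ^ 2 * C / r ^ 2 := by
          rw [Finset.sum_const, Finset.card_univ, Fintype.card_fin, nsmul_eq_mul, hC]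
          field_simp
  · -- charged
    change x / r * ∑ j, K i j * (rt r (Sum.inl j) / rt r (Sum.inr j)) + x ^ 2 * C / r ^ 2 +
      x / r * J * S.γ + ε / r ^ 2 ≤ x / r * S.chg
    rw [hSγ, hSchg]
    have e1 : ∑ j, K i j * (rt r (Sum.inl j) / rt r (Sum.inr j)) ≤ J * (rhi / rlo) := by
      have : ∑ j, K i j * (rt r (Sum.inl j) / rt r (Sum.inr j)) ≤ ∑ _j : Fin J, rhi / rlo := by
        refine Finset.sum_le_sum fun j _ => le_trans ?_ (hratio j)
        exact mul_le_of_le_one_left (div_nonneg (hrt0 _).le (hrt0 _).le) (hK1 j)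
      simpa using this
    have e2 : x ^ 2 * C / r ^ 2 + x / r * J * (θ₀ / r) + ε / r ^ 2 =
        x / r * ((x * C + J * θ₀ + ε / x) / r) := by field_simp
    have e3 : (x * C + J * θ₀ + ε / x) / r ≤ 1 := div_le_of_le_mul hr h8
    have e4 : 0 ≤ x / r := by positivity
    have e5 := mul_le_mul_of_nonneg_left e1 e4
    have e6 := mul_le_mul_of_nonneg_left e3 e4
    have e7 := mul_le_mul_of_nonneg_left hchg e4
    linarith
  · -- active
    intro z hz
    rw [hSb, hsplit, hvb z i hz, add_zero]
    exact h3 i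
  · -- inactive
    intro z hz
    rw [hSb, hsplit]
    -- The witness `d` is the rate at which capacity is left unused when all queues of the resource
    -- are small. It is at least `vmin` because, by `hloc`, the resource serves at least one type.
    refine ⟨∑ j, K i j * vb z j, ?_, ?_, ?_, ?_⟩
    · obtain ⟨j, hj⟩ := hloc i
      calc vmin ≤ K i j * vb z j := by rw [hj, one_mul]; exact (hvb' z j (hz j hj)).1
        _ ≤ _ := Finset.single_le_sum (f := fun j => K i j * vb z j) (fun k _ => by
          rcases hK i k with h | h
          · simp [h]
          · simpa [h] using hvmin.le.trans (hvb' z k (hz k h)).1) (Finset.mem_univ j)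
    · have : ∑ j, K i j * vb z j ≤ ∑ _j : Fin J, vmax := by
        refine Finset.sum_le_sum fun k _ => ?_
        rcases hK i k with h | h
        · simpa [h] using hvmax
        · simpa [h] using (hvb' z k (hz k h)).2
      simpa [hdhi] using this
    · linarith [(h3 i).1]
    · linarith [(h3 i).2]
  · -- damping
    change x ^ 2 * C / r ^ 2 + x / r * J * S.γ + ε / r ^ 2 ≤ x / r * (θ / r)
    rw [hSγ]
    have e1 : x ^ 2 * C / r ^ 2 + x / r * J * (θ₀ / r) + ε / r ^ 2 =
        (x * (x * C) + x * (J * θ₀) + ε) / r ^ 2 := by field_simp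
    have e2 : x / r * (θ / r) = x * θ / r ^ 2 := by field_simp
    rw [e1, e2]
    have e3 := mul_le_mul_of_nonneg_left hxC hx0.le
    have e4 := mul_le_mul_of_nonneg_left hθ₀' hx0.le
    gcongr
    linarith [mul_pos hx0 hθ]
  · positivity
  · change ε / r ^ 2 ≤ x / r * vmin
    have := div_sq_le_of_le_mul hr h9
    rwa [mul_div_right_comm] at this
  · -- thresholds
    refine le_trans (Real.exp_le_exp.2 ?_) h4
    rw [hSU]
    have : ∑ j, w.wt (rt r) j * U r ≤ ∑ _j : Fin J, x / rlo / r * U r :=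
      Finset.sum_le_sum fun j _ => mul_le_mul_of_nonneg_right (hwt j) (hU0 r)
    refine this.trans (le_of_eq ?_)
    rw [Finset.sum_const, Finset.card_univ, Fintype.card_fin, nsmul_eq_mul]
    ring
  · rw [hη]
    change 4 * (x / r) * dhi ≤ M * (J * x / r * bmin / 4)
    have e1 : M * (J * x / r * bmin / 4) = x / r * (J * (M * bmin)) / 4 := by ring
    rw [e1]
    have e2 : 16 * dhi ≤ J * (M * bmin) := hMb.trans (le_mul_of_one_le_left (by linarith) hJ)
    have e3 := mul_le_mul_of_nonneg_left e2 (show 0 ≤ x / r by positivity)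
    linarith
  · rw [hSγ]; exact div_le_of_le_mul hr h10
  · rw [hη, hSchg]
    change 2 * (ε / r ^ 2) ≤ _
    have e1 := div_sq_le_of_le_mul hr h11
    have e2 : J * x / r ≤ J * x / r * chg := le_mul_of_one_le_right (by positivity) hchg1
    rw [← mul_div_assoc]; linarith
  · rw [hη]
    change 2 * (ε / r ^ 2) ≤ _
    have e1 := div_sq_le_of_le_mul hr h12
    have e2 : J * x * bmin / 4 / r = J * x / r * bmin / 4 := by ring
    rw [← mul_div_assoc]; linarith
  · rw [hη]
    change 2 * (ε / r ^ 2) ≤ _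
    rw [← mul_div_assoc]; exact div_sq_le_of_le_mul hr h11
  · rw [hSγ]
    change 2 * (ε / r ^ 2) ≤ 1 / r * (θ₀ / r) / 2
    have e1 : 1 / r * (θ₀ / r) / 2 = θ₀ / 2 / r ^ 2 := by field_simp
    rw [e1, ← mul_div_assoc]
    gcongr
    linarith
  · change 2 * (ε / r ^ 2) ≤ 1 / r / 2
    rw [← mul_div_assoc, div_right_comm]; exact div_sq_le_of_le_mul hr h13
  · change 2 * (x / r) * (J * bmax) ≤ N * (1 / r / 2)
    have e1 : N * (1 / r / 2) = N / 2 / r := by ring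
    have e2 : 2 * (x / r) * (J * bmax) = 2 * x * (J * bmax) / r := by ring
    rw [e1, e2]
    gcongr
    have := mul_le_mul_of_nonneg_right hx1 hN0
    rw [hN]; linarith
  · change 6 * (x / r) ≤ N * (1 / r)
    rw [← mul_div_assoc, mul_one_div]
    gcongr
    linarith
  · intro j
    rw [hη]
    change 4 * (x / r * K i j / rt r (Sum.inr j) * rt r (Sum.inl j)) ≤ A * (J * x / r)
    have e1 : x / r * K i j / rt r (Sum.inr j) * rt r (Sum.inl j) =
        x / r * (K i j * (rt r (Sum.inl j) / rt r (Sum.inr j))) := by ring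
    have e2 : K i j * (rt r (Sum.inl j) / rt r (Sum.inr j)) ≤ rhi / rlo :=
      (mul_le_of_le_one_left (div_nonneg (hrt0 _).le (hrt0 _).le) (hK1 j)).trans (hratio j)
    have e3 := mul_le_mul_of_nonneg_left e2 (show 0 ≤ x / r by positivity)
    have e4 : x / r * A ≤ A * (J * x / r) := by
      have : A * (J * x / r) = x / r * A * J := by ring
      rw [this]
      exact le_mul_of_one_le_right (mul_nonneg (by positivity) (by linarith)) hJ
    rw [e1]
    have e5 : x / r * A = 4 * (x / r * (rhi / rlo)) + 2 * (x / r) := by rw [hA]; ring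
    have e6 : 0 ≤ x / r := by positivity
    linarith
  · intro k
    rw [hη]
    have e1 : rt r k * k₀ * (J * x / r) ≤ rhi * k₀ * (J * x / r) := by
      have := h2 k
      gcongr
    have e2 : rhi * k₀ * (J * x / r) = rhi * k₀ * (J * x) / r := by ring
    rw [e2] at e1
    exact e1.trans (div_le_of_le_mul hr h14)
  · intro j
    refine (hquad (Sum.inl j) j).trans (hxJ.trans ?_)
    rw [hη]
    change _ ≤ A / 4 * _
    have : 0 ≤ J * x / r := by positivity
    linarith [mul_le_mul_of_nonneg_right hA2 this]
  · intro j
    refine (hquad (Sum.inr j) j).trans (hxJ.trans ?_)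
    rw [hη]
    change _ ≤ M / 2 * _
    have : 0 ≤ J * x / r := by positivity
    linarith [mul_le_mul_of_nonneg_right hM1 this]
  · intro j
    refine (hquad (Sum.inr j) j).trans ?_
    change _ ≤ x / r
    gcongr
    linarith
  · intro j
    rw [hη, hσ]
    calc bmax * (rt r (Sum.inr j) * k₀ * (J * x / r) ^ 2)
        ≤ (bmax + 1) * (rhi * k₀ * (J * x / r) ^ 2) := by
          have := h2 (Sum.inr j)
          have := (hrt0 (Sum.inr j)).le
          gcongr
          linarith
      _ = _ := by rw [div_pow]; ring
  · intro j
    rw [hη, hσ]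
    calc rt r (Sum.inl j) * k₀ * (J * x / r) ^ 2
        ≤ rhi * k₀ * (J * x / r) ^ 2 := by
          have := h2 (Sum.inl j)
          gcongr
      _ ≤ (bmax + 1) * (rhi * k₀ * (J * x / r) ^ 2) :=
          le_mul_of_one_le_left (by positivity) (by linarith)
      _ = _ := by rw [div_pow]; ring
  · rw [hη, hSγ]
    change 2 * (x / r) * (θ₂ / r) + 4 * (ε / r ^ 2) +
      M * (J * (θ₀ / r * (J * x / r) + σ / r ^ 2 + 2 * (ε / r ^ 2))) +
      A * (J * (2 * (ε / r ^ 2) + σ / r ^ 2)) + N * (J * (1 / r * (θ₀ / r))) ≤ b / r ^ 2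
    refine le_of_eq ?_
    rw [hb]
    field_simp

/-! ### The clocks of the network and the heavy traffic limit. -/

namespace Network

variable {I J : ℕ} {Ω : Type*} [MeasurableSpace Ω] {P : Measure Ω} {N : Network I J Ω}

/-- The variables of the clocks. -/
def clocks (N : Network I J Ω) (r : ℕ) (k : Clk J) (l : ℕ) (ω : Ω) : ℝ :=
  Sum.elim (fun j => N.u r j l ω) (fun j => N.v r j l ω) k

/-- The rates of the clocks. -/
def clockRate (N : Network I J Ω) (P : Measure Ω) (r : ℕ) : Clk J → ℝ :=
  Sum.elim (N.rateA P r) (N.rateS P r)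

theorem tendsto_of_mul_sub {f : ℕ → ℝ} {a b : ℝ}
    (h : Tendsto (fun r : ℕ => (r : ℝ) * (f r - a)) atTop (𝓝 b)) : Tendsto f atTop (𝓝 a) := by
  have h1 := h.mul tendsto_one_div_atTop_nhds_zero_nat
  rw [mul_zero] at h1
  have h2 := h1.add_const a
  rw [zero_add] at h2
  refine h2.congr' ?_
  filter_upwards [eventually_ge_atTop 1] with r hr
  have : (r : ℝ) ≠ 0 := by positivity
  field_simp
  ring

theorem HeavyTraffic.tendsto_clockRate (h : N.HeavyTraffic P) (k : Clk J) :
    Tendsto (fun r => N.clockRate P r k) atTop (𝓝 (Sum.elim N.α N.β k : ℝ)) := by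
  cases k with
  | inl j => exact tendsto_of_mul_sub (h.lim_rateA j)
  | inr j => exact tendsto_of_mul_sub (h.lim_rateS j)

theorem HeavyTraffic.lim_pos (h : N.HeavyTraffic P) (k : Clk J) :
    0 < (Sum.elim N.α N.β k : ℝ) := by
  cases k with
  | inl j => exact h.α_pos j
  | inr j => exact h.β_pos j

/-- The drift of the workload of the diffusion-scaled system. -/
theorem HeavyTraffic.tendsto_drift (h : N.HeavyTraffic P) (i : Fin I) :
    Tendsto (fun r : ℕ => (r : ℝ) * ∑ j, N.K i j *
      (N.clockRate P r (Sum.inl j) / N.clockRate P r (Sum.inr j) - N.ρ j)) atTop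
      (𝓝 ((N.K *ᵥ N.η) i)) := by
  have h1 : ∀ j, Tendsto (fun r : ℕ => N.K i j * (((r : ℝ) * (N.rateA P r j - N.α j) * N.β j -
      N.α j * ((r : ℝ) * (N.rateS P r j - N.β j))) / (N.rateS P r j * N.β j))) atTop
      (𝓝 (N.K i j * N.η j)) := by
    intro j
    have hβ := (h.β_pos j).ne'
    have h2 := ((((h.lim_rateA j).mul_const (N.β j)).sub ((h.lim_rateS j).const_mul (N.α j))).div
      ((h.tendsto_clockRate (Sum.inr j)).mul_const (N.β j)) (mul_ne_zero hβ hβ)).const_mul (N.K i j)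
    simp only [Sum.elim_inr] at h2
    rw [← sq] at h2
    exact h2
  have h3 := tendsto_finsetSum Finset.univ fun j (_ : j ∈ Finset.univ) => h1 j
  refine h3.congr' ?_
  have hpos : ∀ᶠ r in atTop, ∀ j, 0 < N.rateS P r j := by
    rw [eventually_all]
    exact fun j => (h.tendsto_clockRate (Sum.inr j)).eventually_const_lt (h.β_pos j)
  filter_upwards [hpos] with r hr
  rw [Finset.mul_sum]
  refine Finset.sum_congr rfl fun j _ => ?_
  have h4 := (hr j).ne'
  have h5 := (h.β_pos j).ne'
  change _ = (r : ℝ) * (N.K i j * (N.rateA P r j / N.rateS P r j - N.α j / N.β j))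
  field_simp
  ring

theorem measurable_clocks (h : N.IsPrimitive P) {r : ℕ} (hr : 0 < r) (k : Clk J) (l : ℕ) :
    Measurable (N.clocks r k l) := by
  cases k with
  | inl j => exact h.measurable_u r j l hr
  | inr j => exact h.measurable_v r j l hr

theorem identDistrib_clocks (h : N.IsPrimitive P) {r : ℕ} (hr : 0 < r) (k : Clk J) (l : ℕ) :
    IdentDistrib (N.clocks r k l) (N.clocks r k 0) P P := by
  cases k with
  | inl j => exact h.ident_u r j l hr
  | inr j => exact h.ident_v r j l hr

theorem clocks_pos (h : N.IsPrimitive P) {r : ℕ} (hr : 0 < r) :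
    ∀ᵐ ω ∂P, ∀ k l, 0 < N.clocks r k l ω := by
  rw [ae_all_iff]; intro k
  rw [ae_all_iff]; intro l
  cases k with
  | inl j => exact h.pos_u r j l hr
  | inr j => exact h.pos_v r j l hr

theorem iIndepFun_clocks (h : N.IsPrimitive P) {r : ℕ} (hr : 0 < r) :
    iIndepFun (fun p : Clk J × ℕ => N.clocks r p.1 p.2) P := by
  let g : Clk J × ℕ → (Fin J × ℕ) ⊕ (Fin J × ℕ) := fun p =>
    Sum.elim (fun j => Sum.inl (j, p.2)) (fun j => Sum.inr (j, p.2)) p.1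
  have hg : Function.Injective g := by
    rintro ⟨a | a, l⟩ ⟨b | b, m⟩ hab <;> simp_all [g]
  have h1 := (h.indep r hr).precomp hg
  have e : (fun p : Clk J × ℕ => N.clocks r p.1 p.2) = fun p => (fun k : (Fin J × ℕ) ⊕ (Fin J × ℕ)
      => (fun ω => Sum.elim (fun p => N.u r p.1 p.2 ω) (fun p => N.v r p.1 p.2 ω) k)) (g p) := by
    funext ⟨k, l⟩ ω
    cases k <;> rfl
  rw [e]
  convert h1 using 2 with p
  obtain ⟨k | k, l⟩ := p <;> rfl

theorem map_clocks (h : N.IsPrimitive P) {r : ℕ} (hr : 0 < r) (k : Clk J) (l : ℕ) :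
    P.map (N.clocks r k l) = P.map (N.clocks r k 0) := (identDistrib_clocks h hr k l).map_eq

theorem mean_clocks (h : N.IsPrimitive P) {r : ℕ} (hr : 0 < r) (k : Clk J) :
    ∫ y, y ∂P.map (N.clocks r k 0) = (N.clockRate P r k)⁻¹ := by
  rw [integral_map (f := fun y : ℝ => y) (measurable_clocks h hr k 0).aemeasurable
    aestronglyMeasurable_id]
  cases k with
  | inl j => exact (inv_inv _).symm
  | inr j => exact (inv_inv _).symm

/-- The exponent `δ / 2` is admissible in the moment assumption, and the suprema over `r` are
finite, so one bound serves all `r` and the finitely many clocks. -/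
theorem exists_tame [IsProbabilityMeasure P] (h : N.IsPrimitive P) (hm : N.ExpMoments P) :
    ∃ y₀ M : ℝ, 0 < y₀ ∧ 0 ≤ M ∧ ∀ r, 0 < r → ∀ k, Tame (P.map (N.clocks r k 0)) y₀ M := by
  obtain ⟨δ, hδ, hmgf⟩ := hm
  have h1 := fun j => hmgf (δ / 2) (by linarith) j
  set B : Clk J → ℝ≥0∞ := Sum.elim
    (fun j => ⨆ r : ℕ, ⨆ _ : 0 < r, ∫⁻ ω, ENNReal.ofReal (Real.exp (δ / 2 * N.u r j 0 ω)) ∂P)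
    (fun j => ⨆ r : ℕ, ⨆ _ : 0 < r, ∫⁻ ω, ENNReal.ofReal (Real.exp (δ / 2 * N.v r j 0 ω)) ∂P)
    with hB
  have hBtop : ∀ k, B k ≠ ∞ := by
    rintro (j | j)
    · exact (h1 j).2.ne
    · exact (h1 j).1.ne
  obtain ⟨M, hM, hBM⟩ := exists_pos_ge fun k => (B k).toReal
  refine ⟨δ / 2, M, by linarith, hM.le, fun r hr k => ⟨?_, ?_, ?_⟩⟩
  · exact Measure.isProbabilityMeasure_map (measurable_clocks h hr k 0).aemeasurable
  · rw [ae_map_iff (measurable_clocks h hr k 0).aemeasurable measurableSet_Ioi]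
    filter_upwards [clocks_pos h hr] with ω hω using hω k 0
  · rw [lintegral_map (by fun_prop) (measurable_clocks h hr k 0)]
    have h2 : ∫⁻ ω, ENNReal.ofReal (Real.exp (δ / 2 * N.clocks r k 0 ω)) ∂P ≤ B k := by
      cases k with
      | inl j =>
        exact le_iSup₂ (f := fun (r : ℕ) (_ : 0 < r) =>
          ∫⁻ ω, ENNReal.ofReal (Real.exp (δ / 2 * N.u r j 0 ω)) ∂P) r hr
      | inr j =>
        exact le_iSup₂ (f := fun (r : ℕ) (_ : 0 < r) =>
          ∫⁻ ω, ENNReal.ofReal (Real.exp (δ / 2 * N.v r j 0 ω)) ∂P) r hr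
    refine h2.trans ?_
    rw [← ENNReal.ofReal_toReal (hBtop k)]
    exact ENNReal.ofReal_le_ofReal (hBM k)

/-- The strong law of large numbers: the averages converge to a positive mean. -/
theorem tendsto_sum_clocks (h : N.IsPrimitive P) {r : ℕ} (hr : 0 < r)
    (hpos : ∀ k, 0 < N.clockRate P r k)
    (hint : ∀ k, Integrable (fun y : ℝ => y) (P.map (N.clocks r k 0))) :
    ∀ᵐ ω ∂P, ∀ k, Tendsto (fun n => ∑ l ∈ Finset.range n, N.clocks r k l ω) atTop atTop := by
  rw [ae_all_iff]; intro k
  have hi : Integrable (N.clocks r k 0) P := (hint k).comp_measurable (measurable_clocks h hr k 0)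
  have hmean : P[N.clocks r k 0] = (N.clockRate P r k)⁻¹ := by
    rw [← mean_clocks h hr k, integral_map (f := fun y : ℝ => y)
      (measurable_clocks h hr k 0).aemeasurable aestronglyMeasurable_id]
  filter_upwards [strong_law_ae_real (N.clocks r k) hi (fun l m hlm =>
    (iIndepFun_clocks h hr).indepFun (i := (k, l)) (j := (k, m)) (by simpa using hlm))
    (identDistrib_clocks h hr k)] with ω hω
  rw [hmean] at hω
  have h1 := hω.pos_mul_atTop (inv_pos.2 (hpos k)) tendsto_natCast_atTop_atTop
  refine h1.congr' ?_
  filter_upwards [eventually_ge_atTop 1] with n hn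
  have : (n : ℝ) ≠ 0 := by positivity
  rw [div_mul_cancel₀ _ this]

end Network

/-! ### Thresholds and allocation rates of the policy. -/

namespace Policy

variable {I J : ℕ} {Ω : Type*} {p : Policy J} {N : Network I J Ω}

/-- The thresholds are negligible on the diffusion scale, so a resource whose queues are all below
them carries almost no workload. -/
theorem tendsto_upper_div (hκ : p.κ < 1) :
    Tendsto (fun r : ℕ => p.upper N r / r) atTop (𝓝 0) := by
  have h1 := (tendsto_rpow_neg_atTop (by linarith : 0 < 1 - p.κ)).comp
    (tendsto_natCast_atTop_atTop (R := ℝ))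
  have h2 := h1.const_mul ((⨅ j, N.β j) * p.c₂)
  rw [mul_zero] at h2
  refine h2.congr' ?_
  filter_upwards [eventually_ge_atTop 1] with r hr
  have hr0 : (0 : ℝ) < r := by positivity
  simp only [Function.comp, upper]
  rw [mul_div_assoc]
  congr 1
  rw [eq_div_iff hr0.ne', ← Real.rpow_add_one hr0.ne']
  ring_nf

/-- The distance of the thresholds grows like `r ^ κ`, and an exponential of a power beats any
polynomial, however small `κ` is. -/
theorem tendsto_sq_mul_exp (hβ : 0 < ⨅ j, N.β j) (hc : p.c₁ < p.c₂) (hκ : 0 < p.κ) {a : ℝ}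
    (ha : 0 < a) : Tendsto (fun r : ℕ => (r : ℝ) ^ 2 *
      Real.exp (-a * (p.upper N r - p.lower N r))) atTop (𝓝 0) := by
  have hb : 0 < a * ((⨅ j, N.β j) * (p.c₂ - p.c₁)) := mul_pos ha (mul_pos hβ (sub_pos.2 hc))
  have h1 := (tendsto_rpow_mul_exp_neg_mul_atTop_nhds_zero (2 / p.κ) _ hb).comp
    ((tendsto_rpow_atTop hκ).comp (tendsto_natCast_atTop_atTop (R := ℝ)))
  refine h1.congr fun r => ?_
  simp only [Function.comp, upper, lower]
  rw [← Real.rpow_mul (Nat.cast_nonneg r), mul_div_cancel₀ _ hκ.ne']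
  rw [show ((2 : ℝ)) = ((2 : ℕ) : ℝ) by norm_num, Real.rpow_natCast]
  congr 2
  ring

theorem eventually_one_le_lower (hβ : 0 < ⨅ j, N.β j) (hc : 0 < p.c₁) (hκ : 0 < p.κ) :
    ∀ᶠ r : ℕ in atTop, 1 ≤ p.lower N r :=
  (((tendsto_rpow_atTop hκ).comp (tendsto_natCast_atTop_atTop (R := ℝ))).const_mul_atTop
    (mul_pos hβ hc)).eventually_ge_atTop 1

open Classical in
/-- The allocation rates of the types that are not blocked. -/
def openRate (p : Policy J) (N : Network I J Ω) (z : Fin J → Bool) (j : Fin J) : ℝ :=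
  N.ρ j - (if z ∈ p.modes N then p.vc z j else 0) - p.vb z j

/-- The system of the policy. -/
def toSys (p : Policy J) (N : Network I J Ω) (chg θ₀ : ℝ) (r : ℕ) (y : InitState J) : Sys J where
  q := y.q
  Υ := Sum.elim (fun j => (y.ΥA j : ℝ)) (fun j => (y.ΥS j : ℝ))
  flag := y.flag
  L := p.lower N r
  U := p.upper N r
  b0 := p.openRate N
  chg := chg
  γ := θ₀ / r

end Policy

theorem le_norm2 {ι : Type*} [Fintype ι] (x : ι → ℝ) (i : ι) : x i ≤ norm2 x :=
  (le_abs_self _).trans (Real.abs_le_sqrt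
    (Finset.single_le_sum (f := fun i => x i ^ 2) (fun _ _ => sq_nonneg _) (Finset.mem_univ i)))

theorem norm2_nonneg {ι : Type*} [Fintype ι] (x : ι → ℝ) : 0 ≤ norm2 x := Real.sqrt_nonneg _

theorem norm2_le_sum {ι : Type*} [Fintype ι] (x : ι → ℝ) (hx : ∀ i, 0 ≤ x i) :
    norm2 x ≤ ∑ i, x i :=
  Real.sqrt_le_iff.2 ⟨Finset.sum_nonneg fun i _ => hx i,
    Finset.sum_sq_le_sq_sum_of_nonneg fun i _ => hx i⟩

namespace Policy

variable {I J : ℕ} {Ω : Type*} {p : Policy J} {N : Network I J Ω}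

theorem ρmin_le (j : Fin J) : N.ρmin ≤ N.ρ j := ciInf_le (Set.finite_range _).bddBelow j

/-- The steering vector `vc` is nonnegative at small queues, so it never adds service to a type
below the threshold. -/
theorem openRate_le (hp : p.IsValid N) {z : Fin J → Bool} {j : Fin J} (hz : z j = true) :
    p.openRate N z j ≤ N.ρ j - p.vb z j := by
  unfold openRate
  split_ifs with h
  · linarith [hp.vc_nonneg z h j hz]
  · linarith

/-- `vc` lies in `ker K` and therefore does not change the load of any resource. -/
theorem sum_openRate (hp : p.IsValid N) (z : Fin J → Bool) (i : Fin I) :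
    ∑ j, N.K i j * (N.ρ j - p.openRate N z j) = ∑ j, N.K i j * p.vb z j := by
  unfold openRate
  split_ifs with h
  · have h1 : ∑ j, N.K i j * p.vc z j = 0 := congrFun (LinearMap.mem_ker.1 (hp.vc_mem z h)) i
    rw [← add_zero (∑ j, N.K i j * p.vb z j), ← h1, ← Finset.sum_add_distrib]
    exact Finset.sum_congr rfl fun j _ => by ring
  · exact Finset.sum_congr rfl fun j _ => by ring

theorem exists_vb_ge (hp : p.IsValid N) :
    ∃ vmin, 0 < vmin ∧ ∀ z j, z j = true → vmin ≤ p.vb z j := by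
  -- The value `1` is a dummy for the pairs with `z j = false`, where `vb` need not be positive.
  obtain ⟨a, ha, h⟩ := exists_pos_le
    (fun k : (Fin J → Bool) × Fin J => if k.1 k.2 = true then p.vb k.1 k.2 else 1) (by
      rintro ⟨z, j⟩
      dsimp only
      split_ifs with hz
      · exact hp.vb_pos z j hz
      · exact one_pos)
  refine ⟨a, ha, fun z j hz => ?_⟩
  have := h (z, j)
  rwa [if_pos hz] at this

variable [MeasurableSpace Ω] {P : Measure Ω}

theorem ρ_pos (hht : N.HeavyTraffic P) (j : Fin J) : 0 < N.ρ j :=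
  div_pos (hht.α_pos j) (hht.β_pos j)

theorem ρmin_pos [NeZero J] (hht : N.HeavyTraffic P) : 0 < N.ρmin := by
  obtain ⟨j, hj⟩ := exists_eq_ciInf_of_finite (f := N.ρ)
  rw [Network.ρmin, ← hj]
  exact ρ_pos hht j

theorem iInf_β_pos [NeZero J] (hht : N.HeavyTraffic P) : 0 < ⨅ j, N.β j := by
  obtain ⟨j, hj⟩ := exists_eq_ciInf_of_finite (f := N.β)
  rw [← hj]
  exact hht.β_pos j

/-- The steering leaves more than `ρmin / 2`, and `vb` takes away at most `ρmin / 4`. -/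
theorem openRate_ge [NeZero J] (hht : N.HeavyTraffic P) (hp : p.IsValid N) (z : Fin J → Bool)
    (j : Fin J) : N.ρmin / 4 ≤ p.openRate N z j := by
  have h1 := (abs_le.1 (hp.vb_bound z j)).2
  have h2 := ρmin_le (N := N) j
  have h3 := ρmin_pos hht
  unfold openRate
  split_ifs with hz
  · linarith [hp.vc_bound z hz j]
  · linarith

theorem lower_lt_upper [NeZero J] (hht : N.HeavyTraffic P) (hp : p.IsValid N) {r : ℕ} (hr : 0 < r) :
    p.lower N r < p.upper N r := by
  have h1 := iInf_β_pos hht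
  have h2 : 0 < (r : ℝ) ^ p.κ := Real.rpow_pos_of_pos (by exact_mod_cast hr) _
  exact mul_lt_mul_of_pos_right (mul_lt_mul_of_pos_left hp.c₁_lt_c₂ h1) h2

theorem upper_nonneg [NeZero J] (hht : N.HeavyTraffic P) (hp : p.IsValid N) (r : ℕ) :
    0 ≤ p.upper N r :=
  mul_nonneg (mul_nonneg (iInf_β_pos hht).le (hp.c₁_pos.trans hp.c₁_lt_c₂).le)
    (Real.rpow_nonneg (Nat.cast_nonneg r) _)

theorem good_toSys [NeZero J] (hht : N.HeavyTraffic P) (hp : p.IsValid N) {chg θ₀ : ℝ}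
    (hchg : 0 ≤ chg) (hθ₀ : 0 ≤ θ₀) {r : ℕ} (hr : 0 < r) (hL : 1 ≤ p.lower N r) (y : InitState J) :
    (p.toSys N chg θ₀ r y).Good where
  Υ_nonneg := by rintro (j | j); exacts [(y.ΥA j).2, (y.ΥS j).2]
  one_le_L := hL
  L_lt_U := lower_lt_upper hht hp hr
  b0_pos := fun z j =>
    (by linarith [ρmin_pos hht] : 0 < N.ρmin / 4).trans_le (openRate_ge hht hp z j)
  chg_nonneg := hchg
  γ_nonneg := div_nonneg hθ₀ (Nat.cast_nonneg r)

/-- The policy has an allocation process. -/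
theorem isAllocation_chainAlloc [NeZero J] (hN : N.IsPrimitive P) {chg θ₀ : ℝ} {r : ℕ}
    (hr : 0 < r) {y : InitState J} (hS : (p.toSys N chg θ₀ r y).Good)
    (hsum : ∀ᵐ ω ∂P, ∀ k, Tendsto (fun n => ∑ l ∈ Finset.range n, N.clocks r k l ω) atTop atTop) :
    p.IsAllocation N P r y fun ω t j =>
      (p.toSys N chg θ₀ r y).chainAlloc (fun k l => N.clocks r k l ω) t j where
  measurable := fun t j _ =>
    Sys.measurable_chainAlloc (fun k l => Network.measurable_clocks hN hr k l) t j
  integral_eq := by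
    filter_upwards [Network.clocks_pos hN hr, hsum] with ω hω hω'
    intro t j ht
    exact Sys.integral_chainAlloc hS hω (Sys.tendsto_T hS hω hω') j ht

/-- The state of the chain determines the queue lengths under every allocation process. -/
theorem IsAllocation.queueProc_eq_chain [NeZero J] {r : ℕ} {y : InitState J}
    {B : Ω → ℝ → Fin J → ℝ} (hB : p.IsAllocation N P r y B) (hN : N.IsPrimitive P) {chg θ₀ : ℝ}
    (hr : 0 < r) (hS : (p.toSys N chg θ₀ r y).Good)
    (hsum : ∀ᵐ ω ∂P, ∀ k, Tendsto (fun n => ∑ l ∈ Finset.range n, N.clocks r k l ω) atTop atTop)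
    {t : ℝ} (ht : 0 ≤ t) :
    ∀ᵐ ω ∂P,
      (∃ m, ((p.toSys N chg θ₀ r y).chain (fun k l => N.clocks r k l ω) m).T ≤ t ∧
        t < ((p.toSys N chg θ₀ r y).chain (fun k l => N.clocks r k l ω) (m + 1)).T) ∧
      ∀ m, ((p.toSys N chg θ₀ r y).chain (fun k l => N.clocks r k l ω) m).T ≤ t →
        t < ((p.toSys N chg θ₀ r y).chain (fun k l => N.clocks r k l ω) (m + 1)).T →
        queueProc N r y B ω t = (p.toSys N chg θ₀ r y).Q
          ((p.toSys N chg θ₀ r y).chain (fun k l => N.clocks r k l ω) m) ∧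
        ∀ j, 0 ≤ queueProc N r y B ω t j := by
  filter_upwards [Network.clocks_pos hN hr, hsum, hB.integral_eq] with ω hω hω' hI
  refine ⟨Sys.exists_interval (Sys.tendsto_T hS hω hω') ht, fun m h1 h2 => ?_⟩
  have h3 : queueProc N r y B ω t = (p.toSys N chg θ₀ r y).Q
      ((p.toSys N chg θ₀ r y).chain (fun k l => N.clocks r k l ω) m) :=
    Sys.pathQueue_of_integral hS hω hI h1 h2
  refine ⟨h3, fun j => ?_⟩
  rw [h3]
  exact (Sys.valid_chain hS hω m).Q_nonneg j

/-- Countably many events locate `t` between successive events of the chain, and on each of them the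
queue length is almost surely a measurable function of the chain. -/
theorem IsAllocation.aemeasurable_queueProc [NeZero J] {r : ℕ} {y : InitState J}
    {B : Ω → ℝ → Fin J → ℝ} (hB : p.IsAllocation N P r y B) (hN : N.IsPrimitive P) {chg θ₀ : ℝ}
    (hr : 0 < r) (hS : (p.toSys N chg θ₀ r y).Good)
    (hsum : ∀ᵐ ω ∂P, ∀ k, Tendsto (fun n => ∑ l ∈ Finset.range n, N.clocks r k l ω) atTop atTop)
    {t : ℝ} (ht : 0 ≤ t) (j : Fin J) : AEMeasurable (fun ω => queueProc N r y B ω t j) P := by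
  set S := p.toSys N chg θ₀ r y
  have hm := S.measurable_chain (x := fun ω k l => N.clocks r k l ω)
    fun k l => Network.measurable_clocks hN hr k l
  set E : ℕ → Set Ω := fun m => {ω | (S.chain (fun k l => N.clocks r k l ω) m).T ≤ t ∧
    t < (S.chain (fun k l => N.clocks r k l ω) (m + 1)).T} with hE
  have hEm : ∀ m, MeasurableSet (E m) := fun m =>
    (measurableSet_le (State.measurable_T.comp (hm m)) measurable_const).inter
      (measurableSet_lt measurable_const (State.measurable_T.comp (hm (m + 1))))
  have key := hB.queueProc_eq_chain hN hr hS hsum ht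
  have hU : P.restrict (⋃ m, E m) = P := by
    rw [Measure.restrict_eq_self_of_ae_mem]
    filter_upwards [key] with ω hω using Set.mem_iUnion.2 hω.1
  rw [← hU, aemeasurable_iUnion_iff]
  intro m
  refine ⟨fun ω => S.Q (S.chain (fun k l => N.clocks r k l ω) m) j,
    (S.measurable_Q j).comp (hm m), ?_⟩
  rw [Filter.EventuallyEq, ae_restrict_iff' (hEm m)]
  filter_upwards [key] with ω hω hωm
  rw [(hω.2 m hωm.1 hωm.2).1]

end Policy

namespace InitState

variable {J : ℕ}

theorem q_div_le (y : InitState J) (r : ℕ) (j : Fin J) : (y.q j : ℝ) / r ≤ y.normQ r :=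
  le_norm2 (fun j => (y.q j : ℝ) / r) j

theorem ΥA_div_le (y : InitState J) (r : ℕ) (j : Fin J) : (y.ΥA j : ℝ) / r ≤ y.normΥ r :=
  le_norm2 (Sum.elim (fun j => (y.ΥA j : ℝ) / r) (fun j => (y.ΥS j : ℝ) / r)) (Sum.inl j)

theorem ΥS_div_le (y : InitState J) (r : ℕ) (j : Fin J) : (y.ΥS j : ℝ) / r ≤ y.normΥ r :=
  le_norm2 (Sum.elim (fun j => (y.ΥA j : ℝ) / r) (fun j => (y.ΥS j : ℝ) / r)) (Sum.inr j)

theorem normQ_nonneg (y : InitState J) (r : ℕ) : 0 ≤ y.normQ r := norm2_nonneg _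

theorem normΥ_nonneg (y : InitState J) (r : ℕ) : 0 ≤ y.normΥ r := norm2_nonneg _

end InitState

/-! ### Moment bounds uniform in `r`. -/

namespace Policy

variable {I J : ℕ} {Ω : Type*} [MeasurableSpace Ω] {P : Measure Ω} {p : Policy J}
  {N : Network I J Ω}

/-- `r` times the drift converges to `(K η) i < 0`; half of this limit and twice this limit serve as
bounds for large `r`. -/
theorem exists_drift_bounds (hht : N.HeavyTraffic P) :
    ∃ θ θ₂ : ℝ, 0 < θ ∧ 0 ≤ θ₂ ∧ ∀ᶠ r : ℕ in atTop, ∀ i,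
      -(θ₂ / r) ≤ ∑ j, N.K i j *
        (N.clockRate P r (Sum.inl j) / N.clockRate P r (Sum.inr j) - N.ρ j) ∧
      ∑ j, N.K i j *
        (N.clockRate P r (Sum.inl j) / N.clockRate P r (Sum.inr j) - N.ρ j) ≤ -(θ / r) := by
  obtain ⟨θ, hθ, hθi⟩ := exists_pos_le (fun i => -(N.K *ᵥ N.η) i / 2) fun i => by
    linarith [hht.drift_neg i]
  obtain ⟨θ₂, hθ₂, hθ₂i⟩ := exists_pos_ge (fun i => -(N.K *ᵥ N.η) i * 2)
  refine ⟨θ, θ₂, hθ, hθ₂.le, ?_⟩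
  rw [eventually_all]
  intro i
  have h1 := hθi i
  have h2 := hθ₂i i
  have h3 := hht.drift_neg i
  filter_upwards [(hht.tendsto_drift i).eventually_lt_const
      (show (N.K *ᵥ N.η) i < -θ by linarith),
    (hht.tendsto_drift i).eventually_const_lt (show -θ₂ < (N.K *ᵥ N.η) i by linarith),
    eventually_gt_atTop 0] with r hr1 hr2 hr
  have hr0 : (0 : ℝ) < r := by exact_mod_cast hr
  rw [← neg_div, ← neg_div, div_le_iff₀' hr0, le_div_iff₀' hr0]
  exact ⟨hr2.le, hr1.le⟩

theorem exists_rate_bounds (hht : N.HeavyTraffic P) :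
    ∃ rlo rhi : ℝ, 0 < rlo ∧ 0 < rhi ∧ (∀ᶠ r in atTop, ∀ k, rlo ≤ N.clockRate P r k) ∧
      ∀ᶠ r in atTop, ∀ k, N.clockRate P r k ≤ rhi := by
  obtain ⟨a, ha, hak⟩ := exists_pos_le (fun k : Clk J => (Sum.elim N.α N.β k : ℝ) / 2) fun k => by
    have := hht.lim_pos k; positivity
  obtain ⟨b, hb, hbk⟩ := exists_pos_ge (fun k : Clk J => (Sum.elim N.α N.β k : ℝ) * 2)
  refine ⟨a, b, ha, hb, ?_, ?_⟩ <;> rw [eventually_all] <;> intro k <;>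
    have h1 := hak k <;> have h2 := hbk k <;> have h3 := hht.lim_pos k
  · filter_upwards [(hht.tendsto_clockRate k).eventually_const_lt
      (show a < Sum.elim N.α N.β k by linarith)] with r hr using hr.le
  · filter_upwards [(hht.tendsto_clockRate k).eventually_lt_const
      (show Sum.elim N.α N.β k < b by linarith)] with r hr using hr.le

set_option maxHeartbeats 800000 in
/-- Exponential moments of the workload of each resource in the scaled system. -/
theorem exists_work_bound [NeZero J] [IsProbabilityMeasure P] (hN : N.IsPrimitive P)
    (hmgf : N.ExpMoments P) (hht : N.HeavyTraffic P) (hloc : N.LocalTraffic) (hp : p.IsValid N) :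
    ∃ x κ ε b C₀ H₀ chg θ₀ : ℝ, 0 < x ∧ 0 < κ ∧ 0 < ε ∧ 0 ≤ b ∧ 0 ≤ C₀ ∧ 0 < H₀ ∧
      ∀ᶠ r : ℕ in atTop, 0 < r ∧ ∀ y : InitState J, (p.toSys N chg θ₀ r y).Good ∧
        (∀ k, 0 < N.clockRate P r k) ∧
        (∀ᵐ ω ∂P, ∀ k, Tendsto (fun n => ∑ l ∈ Finset.range n, N.clocks r k l ω) atTop atTop) ∧
        ∀ i t, 0 ≤ t → ∀ W : Ω → ℝ,
          (∀ᵐ ω ∂P, ∃ m,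
            ((p.toSys N chg θ₀ r y).chain (fun k l => N.clocks r k l ω) m).T ≤ t ∧
            t < ((p.toSys N chg θ₀ r y).chain (fun k l => N.clocks r k l ω) (m + 1)).T ∧
            W ω = ∑ j, x / r * N.K i j / N.clockRate P r (Sum.inr j) *
              (p.toSys N chg θ₀ r y).Q
                ((p.toSys N chg θ₀ r y).chain (fun k l => N.clocks r k l ω) m) j) →
          ∫⁻ ω, ENNReal.ofReal (Real.exp (κ * W ω)) ∂P ≤ ENNReal.ofReal (3 + 2 *
            (C₀ * Real.exp (-(ε / r ^ 2) * t + H₀ * (y.normQ r + y.normΥ r)) + b)) := by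
  have hJ : (1 : ℝ) ≤ J := by exact_mod_cast NeZero.one_le
  obtain ⟨y₀, M₀, hy₀, hM₀, htame⟩ := Network.exists_tame hN hmgf
  obtain ⟨rlo, rhi, hrlo, hrhi, hlo, hhi⟩ := exists_rate_bounds hht
  obtain ⟨k₀, θ₁, hk₀, hθ₁, hexp⟩ := exists_expBounds y₀ M₀ rhi hy₀ hM₀ hrhi
  obtain ⟨θ, θ₂, hθ, hθ₂, hdrift⟩ := exists_drift_bounds hht
  obtain ⟨vmin, hvmin, hvb⟩ := exists_vb_ge hp
  obtain ⟨bmax, hbmax, hb0⟩ := exists_pos_ge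
    (fun k : (Fin J → Bool) × Fin J => p.openRate N k.1 k.2)
  have hρ := ρmin_pos hht
  have hβ := iInf_β_pos hht
  have hκ1 : p.κ < 1 := by linarith [hp.κ_lt]
  -- The workload of a resource grows at most at rate `J * (rhi / rlo)` even without any service;
  -- the summand `1` leaves room for second-order terms.
  set chg := J * (rhi / rlo) + 1 with hchg
  have hchg0 : 0 ≤ chg := by positivity
  -- The decay of the `J` variables `D` may use a quarter of the drift: `J * θ₀ = θ / 4`.
  set θ₀ := θ / (4 * J) with hθ₀
  have hθ₀0 : 0 < θ₀ := by positivity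
  have hU := tendsto_upper_div (N := N) hκ1
  obtain ⟨lam, a₂, A', M', G, d₁, b₁, hblock⟩ := exists_blockConst hht.lim_pos hht.tendsto_clockRate
    hrlo hlo hhi hk₀ hθ₁ hchg0 hθ₀0 hvmin (b0 := p.openRate N)
    (fun z j => (by linarith : 0 < N.ρmin / 4).trans_le (openRate_ge hht hp z j))
    (fun z j => hb0 (z, j)) hbmax.le
    (fun z j hz => (openRate_le hp hz).trans (sub_le_sub_left (hvb z j hz) _))
    (L := p.lower N) (U := p.upper N)
    ((eventually_gt_atTop 0).mono fun r hr => lower_lt_upper hht hp hr) hU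
    fun a ha => tendsto_sq_mul_exp hβ hp.c₁_lt_c₂ hp.κ_pos ha
  obtain ⟨x, ε, M, A, V, q, τ, τ₂, dlo, dhi, σ, b, hx, hε, hA, hV, hM, hb, hwork⟩ :=
    exists_workConst (K := N.K) hN.K_zero_one (fun i => (hloc i).imp fun _ h => h.1) hrlo hlo hhi
      hk₀ hθ₁ (θ₀ := θ₀) hchg.ge hθ hθ₀0 (by rw [hθ₀]; field_simp; norm_num) hθ₂ hvmin
      (by linarith : 0 < N.ρmin / 4) (by linarith : 0 ≤ N.ρmin / 4)
      (b0 := p.openRate N) (openRate_ge hht hp) (fun z j => hb0 (z, j)) (sum_openRate hp)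
      (fun z i hz => hp.vb_active z i hz)
      (fun z j hz => ⟨hvb z j hz, (abs_le.1 (hp.vb_bound z j)).2⟩) hdrift hU (upper_nonneg hht hp)
  set B₀ := 1 + θ₁ / rlo + k₀ * θ₁ ^ 2 with hB₀
  have hB₀1 : 1 ≤ B₀ := by
    have : 0 ≤ θ₁ / rlo + k₀ * θ₁ ^ 2 := by positivity
    linarith
  -- The absolute value saves tracking the sign of the constants.
  set C₀ := |3 + J * B₀ + M * (J * B₀) + 2 * (A * (J * B₀)) +
    V * (J * (G * B₀ + G * Real.exp lam))| with hC₀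
  -- The summands are for the initial workload, the residual times with exponent `η`, and the
  -- residual interarrival times with exponent `e₁`.
  set H₀ := J * (x / rlo) + J * x + (chg + 1) with hH₀
  have hH₀0 : 0 < H₀ := by positivity
  set κ := min (1 / 3) (min (2 / (J * V)) (2 / (3 * J * A))) with hκ
  have hV0 : 0 < V := by linarith
  have hA0 : 0 < A := by linarith
  have hκ0 : 0 < κ := by positivity
  have hκV : κ * J * V ≤ 2 := by
    have : κ ≤ 2 / (J * V) := (min_le_right _ _).trans (min_le_left _ _)
    rw [le_div_iff₀ (by positivity)] at this
    linarith
  have hκA : 3 * κ * J * A ≤ 2 := by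
    have : κ ≤ 2 / (3 * J * A) := (min_le_right _ _).trans (min_le_right _ _)
    rw [le_div_iff₀ (by positivity)] at this
    linarith
  have hκ3 : κ ≤ 1 / 3 := min_le_left _ _
  have hchg1 : 0 ≤ chg + 1 := by linarith
  clear_value chg θ₀ B₀ H₀ κ
  refine ⟨x, κ, ε, b / ε, C₀, H₀, chg, θ₀, hx, hκ0, hε, by positivity, abs_nonneg _, hH₀0, ?_⟩
  filter_upwards [hlo, hhi, hblock, hwork, eventually_gt_atTop 0,
    eventually_one_le_lower hβ hp.c₁_pos hp.κ_pos] with r hlo hhi hblock hwork hr hL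
  refine ⟨hr, fun y => ?_⟩
  have hr0 : (0 : ℝ) < r := by exact_mod_cast hr
  have hS := good_toSys hht hp hchg0 hθ₀0.le hr hL y
  have hrt : ∀ k, 0 < N.clockRate P r k := fun k => hrlo.trans_le (hlo k)
  have hE := hexp (fun k => P.map (N.clocks r k 0)) (N.clockRate P r) (htame r hr) hrt hhi
    (Network.mean_clocks hN hr)
  refine ⟨hS, hrt, Network.tendsto_sum_clocks hN hr hrt hE.integrable_id, ?_⟩
  intro i t ht W hW
  obtain ⟨hc, hdBlock⟩ := hblock (p.toSys N chg θ₀ r y) rfl rfl rfl rfl rfl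
  have hw := hwork (p.toSys N chg θ₀ r y) rfl rfl rfl rfl i
  have hX := Network.measurable_clocks hN hr
  have hμ := Network.map_clocks hN hr
  have hpos := Network.clocks_pos hN hr
  have hnQ := y.normQ_nonneg r
  have hnΥ := y.normΥ_nonneg r
  have hCx : 0 ≤ J * (x / rlo) := by positivity
  have hJx : 0 ≤ J * x := by positivity
  have hmain := hw.lintegral_exp_work_le hE hc hS (hdBlock _ hE hS) (by positivity) (by positivity)
    hX (Network.iIndepFun_clocks hN hr) hμ hpos hκ0.le hκ3 hκV hκA hA hV ht hW
  have hinit := hw.lintegral_lyap_init_le hE hc hS hX hμ hpos hB₀1 (fun k => by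
      have : θ₁ / N.clockRate P r k ≤ θ₁ / rlo := by gcongr; exact hlo k
      linarith) (H := H₀ * (y.normQ r + y.normΥ r)) (by positivity)
    (fun j => ?_) (fun j => ?_) (fun j => ?_)
  · refine hmain.trans ?_
    have e : b / (r : ℝ) ^ 2 / (ε / r ^ 2) = b / ε := by field_simp
    rw [e]
    set D := Real.exp (H₀ * (y.normQ r + y.normΥ r)) with hD
    have h1 : ENNReal.ofReal (Real.exp (-(ε / r ^ 2) * t)) *
        ENNReal.ofReal (C₀ * D) + ENNReal.ofReal (b / ε) =
        ENNReal.ofReal (C₀ * Real.exp (-(ε / r ^ 2) * t + H₀ * (y.normQ r + y.normΥ r)) + b / ε) := by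
      rw [← ENNReal.ofReal_mul (Real.exp_pos _).le, ← ENNReal.ofReal_add (by positivity)
        (by positivity), Real.exp_add]
      congr 1
      ring
    rw [ENNReal.ofReal_add (by norm_num) (by positivity), ENNReal.ofReal_mul (by norm_num), ← h1]
    gcongr
    · simp
    · simp
    · refine hinit.trans (ENNReal.ofReal_le_ofReal ?_)
      gcongr
      exact le_abs_self _
  · have h1 : ∑ i', (WorkConst.mk (N.K i) (x / r) (1 / r) (ε / r ^ 2) M A V).wt
        (N.clockRate P r) i' * (p.toSys N chg θ₀ r y).q i' ≤ ∑ _i' : Fin J, x / rlo * y.normQ r := by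
      refine Finset.sum_le_sum fun j' _ => ?_
      have h2 : x / r * N.K i j' / N.clockRate P r (Sum.inr j') * (y.q j' : ℝ) =
        x / N.clockRate P r (Sum.inr j') * (N.K i j' * ((y.q j' : ℝ) / r)) := by ring
      change x / r * N.K i j' / N.clockRate P r (Sum.inr j') * (y.q j' : ℝ) ≤ _
      rw [h2]
      have h3 : 0 ≤ (y.q j' : ℝ) / r := by positivity
      have h4 : N.K i j' * ((y.q j' : ℝ) / r) ≤ y.normQ r := by
        have := y.q_div_le r j'
        rcases hN.K_zero_one i j' with h | h <;> rw [h] <;> linarith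
      have h5 : 0 ≤ N.K i j' := by rcases hN.K_zero_one i j' with h | h <;> simp [h]
      gcongr
      exact hlo _
    have h2 : (WorkConst.mk (N.K i) (x / r) (1 / r) (ε / r ^ 2) M A V).η *
        (p.toSys N chg θ₀ r y).Υ (Sum.inr j) = J * x * ((y.ΥS j : ℝ) / r) := by
      change J * (x / r) * (y.ΥS j : ℝ) = _
      ring
    have h3 := mul_le_mul_of_nonneg_left (y.ΥS_div_le r j) hJx
    rw [Finset.sum_const, Finset.card_univ, Fintype.card_fin, nsmul_eq_mul] at h1
    rw [h2, hH₀]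
    linarith [mul_nonneg hCx hnΥ, mul_nonneg hJx hnQ, mul_nonneg hchg1 hnQ,
      mul_nonneg hchg1 hnΥ]
  · have h2 : (WorkConst.mk (N.K i) (x / r) (1 / r) (ε / r ^ 2) M A V).η *
        (p.toSys N chg θ₀ r y).Υ (Sum.inl j) = J * x * ((y.ΥA j : ℝ) / r) := by
      change J * (x / r) * (y.ΥA j : ℝ) = _
      ring
    have h3 := mul_le_mul_of_nonneg_left (y.ΥA_div_le r j) hJx
    rw [h2, hH₀]
    linarith [mul_nonneg hCx hnΥ, mul_nonneg hJx hnQ, mul_nonneg hchg1 hnQ,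
      mul_nonneg hchg1 hnΥ, mul_nonneg hCx hnQ]
  · have h2 : (chg + 1) / r * (p.toSys N chg θ₀ r y).Υ (Sum.inl j) =
        (chg + 1) * ((y.ΥA j : ℝ) / r) := by
      change (chg + 1) / r * (y.ΥA j : ℝ) = _
      ring
    have h3 := mul_le_mul_of_nonneg_left (y.ΥA_div_le r j) hchg1
    change (chg + 1) / r * (p.toSys N chg θ₀ r y).Υ (Sum.inl j) ≤ _
    rw [h2, hH₀]
    linarith [mul_nonneg hCx hnΥ, mul_nonneg hJx hnQ, mul_nonneg hchg1 hnQ,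
      mul_nonneg hJx hnΥ, mul_nonneg hCx hnQ]

end Policy

end RSN

/-! ### From single resources to the norm of the scaled workload. -/

open RSN in
theorem proposition3p4 {I J : ℕ} {Ω : Type*} [MeasurableSpace Ω] (P : Measure Ω)
    [IsProbabilityMeasure P] (N : RSN.Network I J Ω) (hN : N.IsPrimitive P)
    (hmgf : N.ExpMoments P) (hht : N.HeavyTraffic P) (hloc : N.LocalTraffic)
    (p : RSN.Policy J) (hp : p.IsValid N) :
    ∃ R B₁ B₂ B₃ δt δ : ℝ, 0 < R ∧ 0 < B₁ ∧ 0 < B₂ ∧ 0 < B₃ ∧ 0 < δt ∧ 0 < δ ∧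
      ∀ r : ℕ, R ≤ (r : ℝ) → ∀ y : RSN.InitState J,
        (∃ B : Ω → ℝ → Fin J → ℝ, p.IsAllocation N P r y B) ∧
        ∀ B : Ω → ℝ → Fin J → ℝ, p.IsAllocation N P r y B →
          ∀ c : ℝ, 0 < c → c ≤ δ → ∀ t : ℝ, 0 ≤ t →
            ∫⁻ ω, ENNReal.ofReal
                (Real.exp (c * RSN.norm2 (RSN.Policy.workloadHat N P r y B ω t))) ∂P ≤
              ENNReal.ofReal
                (B₁ * Real.exp (-δt * t + B₂ * (y.normQ r + y.normΥ r)) + B₃) := by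
  
  -- Without job types there are no resources either, by `hloc`, and the workload is the empty
  -- vector.
  rcases Nat.eq_zero_or_pos J with rfl | hJ
  · have hI : IsEmpty (Fin I) := ⟨fun i => by obtain ⟨j, -⟩ := hloc i; exact j.elim0⟩
    refine ⟨1, 1, 1, 1, 1, 1, one_pos, one_pos, one_pos, one_pos, one_pos, one_pos,
      fun r _ y => ⟨⟨fun _ _ _ => 0, fun _ j => j.elim0, ae_of_all _ fun _ _ j => j.elim0⟩,
        fun B _ c _ _ t _ => ?_⟩⟩
    simp only [norm2, Finset.univ_eq_empty, Finset.sum_empty, Real.sqrt_zero, mul_zero,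
      Real.exp_zero, ENNReal.ofReal_one, lintegral_const, measure_univ, mul_one]
    rw [← ENNReal.ofReal_one]
    refine ENNReal.ofReal_le_ofReal ?_
    have := Real.exp_pos (-1 * t + 1 * (y.normQ r + y.normΥ r))
    linarith
  have : NeZero J := ⟨hJ.ne'⟩
  obtain ⟨x, κ, ε, b, C₀, H₀, chg, θ₀, hx, hκ, hε, hb, hC₀, hH₀, hev⟩ :=
    Policy.exists_work_bound hN hmgf hht hloc hp
  obtain ⟨r₀, hr₀⟩ := eventually_atTop.1 hev
  -- The ones in `R`, in `B₁` and in the denominator of `δ` provide positivity when `r₀` or `I` is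
  -- `0`; the one in `B₃` comes from `exp_sum_le`.
  refine ⟨r₀ + 1, 2 * I * C₀ + 1, H₀, 1 + I * (3 + 2 * b), ε, κ * x / (I + 1), by positivity,
    by positivity, hH₀, by positivity, hε, by positivity, fun r hr y => ?_⟩
  obtain ⟨hr0, hry⟩ := hr₀ r (by exact_mod_cast (le_add_of_nonneg_right zero_le_one).trans hr)
  obtain ⟨hS, hrt, hsum, hbound⟩ := hry y
  refine ⟨⟨_, Policy.isAllocation_chainAlloc hN hr0 hS hsum⟩, fun B hB c hc hcδ t ht => ?_⟩
  have hrR : (0 : ℝ) < r := by exact_mod_cast hr0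
  have ht' : 0 ≤ (r : ℝ) ^ 2 * t := by positivity
  have key := hB.queueProc_eq_chain hN hr0 hS hsum ht'
  set W : Ω → Fin I → ℝ := fun ω i => x * Policy.workloadHat N P r y B ω t i with hW
  have hWeq : ∀ ω i, W ω i = ∑ j, x / r * N.K i j / N.clockRate P r (Sum.inr j) *
      Policy.queueProc N r y B ω ((r : ℝ) ^ 2 * t) j := by
    intro ω i
    simp only [hW, Policy.workloadHat, Matrix.mulVec, dotProduct, Finset.sum_div, Finset.mul_sum]
    refine Finset.sum_congr rfl fun j _ => ?_
    change x * (N.K i j * (_ / N.clockRate P r (Sum.inr j)) / r) = _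
    ring
  have hWm : ∀ i, AEMeasurable (fun ω => ENNReal.ofReal (Real.exp (κ * W ω i))) P := by
    intro i
    simp only [hWeq]
    have h1 := fun j => hB.aemeasurable_queueProc hN hr0 hS hsum ht' j
    refine AEMeasurable.ennreal_ofReal (Real.measurable_exp.comp_aemeasurable ?_)
    exact (Finset.aemeasurable_fun_sum _ fun j _ => (h1 j).const_mul _).const_mul _
  have hWi : ∀ i, ∫⁻ ω, ENNReal.ofReal (Real.exp (κ * W ω i)) ∂P ≤ ENNReal.ofReal (3 + 2 *
      (C₀ * Real.exp (-ε * t + H₀ * (y.normQ r + y.normΥ r)) + b)) := by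
    intro i
    have h1 := hbound i _ ht' (fun ω => W ω i) (by
      filter_upwards [key] with ω hω
      obtain ⟨m, h1, h2⟩ := hω.1
      exact ⟨m, h1, h2, by rw [hWeq, (hω.2 m h1 h2).1]⟩)
    -- Reading the unscaled process at time `r ^ 2 * t` turns the rate `ε / r ^ 2` into `ε`.
    have e : -(ε / (r : ℝ) ^ 2) * ((r : ℝ) ^ 2 * t) = -ε * t := by field_simp
    rwa [e] at h1
  set D := Real.exp (-ε * t + H₀ * (y.normQ r + y.normΥ r)) with hD
  have hD0 : 0 < D := Real.exp_pos _
  calc ∫⁻ ω, ENNReal.ofReal (Real.exp (c * norm2 (Policy.workloadHat N P r y B ω t))) ∂P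
      ≤ ∫⁻ ω, (1 + ∑ i, ENNReal.ofReal (Real.exp (κ * W ω i))) ∂P := by
        refine lintegral_mono_ae ?_
        filter_upwards [key] with ω hω
        obtain ⟨m, h1, h2⟩ := hω.1
        have hQ := (hω.2 m h1 h2).2
        have hW0 : ∀ i, 0 ≤ W ω i := fun i => by
          rw [hWeq]
          refine Finset.sum_nonneg fun j _ => mul_nonneg ?_ (hQ j)
          have h3 : 0 ≤ N.K i j := by rcases hN.K_zero_one i j with h | h <;> simp [h]
          have := (hrt (Sum.inr j)).le
          positivity
        have hŴ : ∀ i, 0 ≤ Policy.workloadHat N P r y B ω t i := fun i =>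
          nonneg_of_mul_nonneg_right (hW0 i) hx
        -- All components are nonnegative, so the norm is at most their sum. Dividing by `I + 1`
        -- makes the loss in `exp_sum_le` restore the exponent `κ`.
        have h3 : c * norm2 (Policy.workloadHat N P r y B ω t) ≤
            ∑ i, κ / (I + 1) * W ω i := by
          calc c * norm2 (Policy.workloadHat N P r y B ω t)
              ≤ κ * x / (I + 1) * ∑ i, Policy.workloadHat N P r y B ω t i :=
                mul_le_mul hcδ (norm2_le_sum _ hŴ) (norm2_nonneg _) (by positivity)
            _ = _ := by
                rw [Finset.mul_sum]
                exact Finset.sum_congr rfl fun i _ => by simp only [hW]; ring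
        have h4 := exp_sum_le Finset.univ (fun i => κ / (I + 1) * W ω i) (n := I + 1)
          (fun i _ => mul_nonneg (by positivity) (hW0 i)) (by simp)
        have h5 : ∀ i, ((I : ℝ) + 1) * (κ / (I + 1) * W ω i) = κ * W ω i := fun i => by
          field_simp
        simp only [h5] at h4
        rw [← ENNReal.ofReal_sum_of_nonneg fun i _ => (Real.exp_pos _).le, ← ENNReal.ofReal_one,
          ← ENNReal.ofReal_add zero_le_one (Finset.sum_nonneg fun i _ => (Real.exp_pos _).le)]
        refine ENNReal.ofReal_le_ofReal ((Real.exp_le_exp.2 h3).trans (h4.trans ?_))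
        gcongr
        linarith
    _ = 1 + ∑ i, ∫⁻ ω, ENNReal.ofReal (Real.exp (κ * W ω i)) ∂P := by
        rw [lintegral_add_left measurable_const, lintegral_finsetSum' _ fun i _ => hWm i]
        simp
    _ ≤ 1 + ∑ _i : Fin I, ENNReal.ofReal (3 + 2 * (C₀ * D + b)) := by
        gcongr with i
        exact hWi i
    _ = ENNReal.ofReal (1 + I * (3 + 2 * (C₀ * D + b))) := by
        rw [Finset.sum_const, Finset.card_univ, Fintype.card_fin, nsmul_eq_mul,
          ENNReal.ofReal_add zero_le_one (by positivity), ENNReal.ofReal_mul (by positivity),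
          ENNReal.ofReal_one, ENNReal.ofReal_natCast]
    _ ≤ ENNReal.ofReal ((2 * I * C₀ + 1) * D + (1 + I * (3 + 2 * b))) := by
        refine ENNReal.ofReal_le_ofReal ?_
        nlinarith

end
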